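/- \textbf{Setting.} Let $a,b,q,h,l,p$ be integers with $1\le a,b\le q$, $h\ge 2$, $0\le l\le p\le 2h-1$, let $s>0$, $u_1,\dots,u_{2h-1}\in\mathbb R$, and put $H(x,y)=\frac{y^2}{2}+U(x)$, $U(x)=\frac{x^{2h}}{2h}+\sum_{i=1}^{2h-1}u_ix^i$, $S(t)=s\,t^{1+b/q}$. Consider $$\frac{dx}{dt}=\partial_yH+t^{-a/q}f(x,y,S(t),t),\qquad \frac{dy}{dt}=-\partial_xH+t^{-a/q}g(x,y,S(t),t),\qquad t>0,\tag{1}$$ where $f,g$ are $C^\infty$ for $(x,y,S)\in\mathbb R^3$, $t>0$, and $2\pi$-periodic in $S$. Assume $f\sim\sum_{k\ge0}t^{-k/q}f_k(x,y,S)$ and $g\sim\sum_{k\ge0}t^{-k/q}g_k(x,y,S)$ as $t\to\infty$, with $$f_k=\sum_{i=0}^{p}\sum_{j=0}^{l-1}A_{k,i,j}(S)x^iy^j,\qquad g_k=\sum_{i=0}^{p}\sum_{j=0}^{l}B_{k,i,j}(S)x^iy^j,$$ where $A_{k,i,j},B_{k,i,j}$ are smooth, $2\pi$-periodic, and vanish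 if $i+j>p$; the expansions mean that for some $m$ and every $n$ the remainder after the terms $k<n$ is, for all large $t$, bounded by $C_n t^{-n/q}(1+|x|+|y|)^m$, uniformly in $(x,y,S)\in\mathbb R^3$. Assume also $$-1\le\sigma<\tfrac bq,\qquad \sigma=\tfrac bq\Big(l-1+\tfrac{p-1}{h-1}\Big)-\tfrac aq .$$ Put $\mu=\frac12(\frac bq-\sigma)$, $\nu=1+2\mu+\sigma=1+\frac bq$, $\tau=t^\nu/\nu$, $\vartheta=s(1+\frac bq)$, and let $M=2\mu q(h-1)$, $N=2\nu q(h-1)$, which are positive integers. Let $\zeta(\tau)=S(t)=\vartheta\tau$, and fix an integer $\varkappa\ge1$. For $E_0>0$ such that all level lines $\{H=E\}$, $E>E_0$, are closed curves without equilibria of $x'=\partial_yH$, $y'=-\partial_xH$, let $x_-(E)<0<x_+(E)$ be the solutions of $U=E$, let $\omega(E)=2\pi/T(E)$, $T(E)=\int_{x_-(E)}^{x_+(E)}\frac{\sqrt2\,dx}{\sqrt{E-U(x)}}$, and let $(X(\phi,E),Y(\phi,E))$ be the solution of $\omega(E)\partial_\phi X=\partial_YH$, $\omega(E)\partial_\phi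 Y=-\partial_XH$ with $X(0,E)=x_+(E)$, $Y(0,E)=0$. Write $\mathcal D(E)=\{(x,y):H(x,y)>E\}$. \textbf{Theorem.} There are such $E_0$, and $E_1\ge E_0$, with $\omega'(E)>0$ for all $E\ge E_1$; and for all such $E_0,E_1$ the following holds. (i) The functions $X,Y$ exist, are smooth for $E>E_0$, $2\pi$-periodic in $\phi$, satisfy $H(X,Y)=E$ and $\det\frac{\partial(X,Y)}{\partial(\phi,E)}=\frac1{\omega(E)}>0$, and map $\{(\phi,E):\phi\in\mathbb R/2\pi\mathbb Z,\ E>E_0\}$ bijectively onto $\mathcal D(E_0)$. In the variables $x=X(\phi,I)$, $y=Y(\phi,I)$, for $I>E_0$ and $t>0$, system (1) is equivalent to $I'=t^{-a/q}F(I,\phi,t)$, $\phi'=\omega(I)+t^{-a/q}G(I,\phi,t)$ with $F=fU'(X)+gY$, $G=\omega(I)(f\,\partial_EY-g\,\partial_EX)$, where $f,g$ are taken at $(X(\phi,I),Y(\phi,I),S(t),t)$. (ii) There are $t_1>0$ and a smooth solution $I_*(t)\ge E_1$, $t\ge t_1$, of $\omega(I_*(t))=\varkappa^{-1}S'(t)$.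 Every solution of (1) on an open interval in $(t_1,\infty)$ that stays in $\mathcal D(E_1)$ can be written as $x=X(\phi,I)$, $y=Y(\phi,I)$ with $$I(t)=I_*(t)\big(1+t^{-\mu}r(\tau)\big)^{2h},\qquad \phi(t)=\theta(\tau)+\varkappa^{-1}S(t),\tag{2}$$ where $r,\theta$ are differentiable and $1+t^{-\mu}r>0$. For differentiable $r,\theta$, at times $t>t_1$ with $1+t^{-\mu}r>0$ and $I>E_1$, system (1) is equivalent to $$\frac{dr}{d\tau}=\tau^{-M/N}\mathcal A(r,\theta,\tau),\qquad \frac{d\theta}{d\tau}=\tau^{-M/N}\mathcal B(r,\theta,\tau),$$ the system obtained from that of (i) by the substitution (2). (iii) There are coefficients $\mathcal A_K,\mathcal B_K,\rho_K,\psi_K$ ($K\ge0$), smooth functions of $(r,\theta,\zeta)$, $2\pi$-periodic in $\theta$ and $2\pi\varkappa$-periodic in $\zeta$, and smooth $\Lambda_K,\Omega_K$ of $(R,\Psi)$, independent of $\zeta$ and $2\pi$-periodic in $\Psi$, such that $\mathcal A\sim\sum_K\tau^{-K/N}\mathcal A_K(r,\theta,\zeta(\tau))$ and $\mathcal B\sim\sum_K\tau^{-K/N}\mathcal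 B_K(r,\theta,\zeta(\tau))$ as $\tau\to\infty$, uniformly in $|r|\le r_0$, $\theta\in\mathbb R$, for every $r_0>0$, and, with $\langle\cdot\rangle$ the mean over a period in $\zeta$, $$\vartheta\,\partial_\zeta\rho_K=\Lambda_K-\mathcal A_K-\mathfrak A_K,\quad \Lambda_K=\langle\mathcal A_K+\mathfrak A_K\rangle,\quad \langle\rho_K\rangle=0,$$ $$\vartheta\,\partial_\zeta\psi_K=\Omega_K-\mathcal B_K-\mathfrak B_K,\quad \Omega_K=\langle\mathcal B_K+\mathfrak B_K\rangle,\quad \langle\psi_K\rangle=0.$$ Here $\mathfrak A_K$ (and likewise $\mathfrak B_K$, with $\psi,\Omega$ in place of $\rho,\Lambda$ in the differentiated terms) is $$\mathfrak A_K=\sum_{i+j=K-M}(\mathcal A_i\partial_r+\mathcal B_i\partial_\theta)\rho_j-\frac{M+K-N}{N}\rho_{K-N}-[\epsilon^K]\sum_{j<K}\epsilon^j\Lambda_j\Big(r+\sum_{k<K}\epsilon^{M+k}\rho_k,\ \theta+\sum_{k<K}\epsilon^{M+k}\psi_k\Big),$$ where $[\epsilon^K]$ is the $K$-th Taylor coefficient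 at $\epsilon=0$ and terms with negative indices are zero. (iv) Let $n\ge0$ be an integer, $0<\varepsilon<r_0$, and $$R_n=r+\sum_{K=0}^n\tau^{-\frac{M+K}N}\rho_K(r,\theta,\zeta(\tau)),\qquad \Psi_n=\theta+\sum_{K=0}^n\tau^{-\frac{M+K}N}\psi_K(r,\theta,\zeta(\tau)).\tag{3}$$ Then there is $t_0\ge t_1$ such that for all $t>t_0$ the following hold. On $\{|r|\le r_0,\ \theta\in\mathbb R\}$ the map $(r,\theta)\mapsto(R_n,\Psi_n)$ and its first derivatives are $\varepsilon$-close to the identity and its derivatives; the map is injective with positive Jacobian, and its image contains $\{|R|\le r_0-\varepsilon,\ \Psi\in\mathbb R\}$. All points given by (2) with $|r|\le r_0$ lie in $\mathcal D(E_1)$. Whenever $|r|\le r_0$, system (1) is equivalent, under the composition of $(x,y)=(X(\phi,I),Y(\phi,I))$, (2) and (3), with $R=R_n$, $\Psi=\Psi_n$, to $$\frac{dR}{d\tau}=\sum_{K=0}^n\tau^{-\frac{M+K}N}\Lambda_K(R,\Psi)+\widetilde\Lambda_n(R,\Psi,\tau),\qquad \frac{d\Psi}{d\tau}=\sum_{K=0}^n\tau^{-\frac{M+K}N}\Omega_K(R,\Psi)+\widetilde\Omega_n(R,\Psi,\tau),$$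 and the remainders $\widetilde\Lambda_n,\widetilde\Omega_n$ are bounded by $C\tau^{-(M+n+1)/N}$ uniformly on the image of $\{|r|\le r_0,\ \theta\in\mathbb R\}$, in particular for all $|R|\le r_0-\varepsilon$, $\Psi\in\mathbb R$. -/

import Mathlib

open scoped ContDiff

noncomputable section

/-- The data of the perturbed system
`x' = ∂_y H + t^(-a/q) f(x, y, S(t), t)`, `y' = -∂_x H + t^(-a/q) g(x, y, S(t), t)`:
the half degree `h` and the coefficients `u` of the potential, the exponents `a`, `b`, `q`, the
chirp rate `s`, the perturbations `f`, `g` (arguments `x y S t`), and the coefficients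
`A k i j`, `B k i j` (functions of `S`) of the monomials `x^i y^j` in the `k`-th terms of their
asymptotic expansions. The laws are in `Standing`, `PowerLaw` and `Resonance` below. -/
structure ChirpedSystem where
  (h q a b l p : ℕ)
  s : ℝ
  u : ℕ → ℝ
  (f g : ℝ → ℝ → ℝ → ℝ → ℝ)
  (A B : ℕ → ℕ → ℕ → ℝ → ℝ)

namespace ChirpedSystem

variable (P : ChirpedSystem)

/-! ### The limiting Hamiltonian system -/

def U (x : ℝ) : ℝ :=
  x ^ (2 * P.h) / (2 * P.h) + ∑ i ∈ Finset.Icc 1 (2 * P.h - 1), P.u i * x ^ i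

def H (x y : ℝ) : ℝ := y ^ 2 / 2 + P.U x

/-- `∂_x H`. -/
def Hx (x y : ℝ) : ℝ := deriv (fun x' => P.H x' y) x

/-- `∂_y H`. -/
def Hy (x y : ℝ) : ℝ := deriv (fun y' => P.H x y') y

/-- `x₋(E)`, the left solution of `U(x) = E`. -/
def xMinus (E : ℝ) : ℝ := sInf {x | P.U x = E}

/-- `x₊(E)`, the right solution of `U(x) = E`. -/
def xPlus (E : ℝ) : ℝ := sSup {x | P.U x = E}

/-- The period of the motion on the level line `H = E`. -/
def T (E : ℝ) : ℝ :=
  ∫ x in (P.xMinus E)..(P.xPlus E), Real.sqrt 2 / Real.sqrt (E - P.U x)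

/-- The frequency of the motion on the level line `H = E`. -/
def omega (E : ℝ) : ℝ := 2 * Real.pi / P.T E

/-- `E₀ > 0`, and each level line `H = E` with `E > E₀` is a closed curve without fixed points
of the limiting system. -/
def RegularAbove (E₀ : ℝ) : Prop :=
  0 < E₀ ∧ ∀ E, E₀ < E →
    Nonempty (Circle ≃ₜ {z : ℝ × ℝ // P.H z.1 z.2 = E}) ∧
    ∀ x y, P.H x y = E → ¬ (P.Hy x y = 0 ∧ -P.Hx x y = 0)

/-- The energy levels `E₀ ≤ E₁`: regular motion above `E₀`, and `ω' > 0` from `E₁` on. -/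
def EnergyLevels (E₀ E₁ : ℝ) : Prop :=
  P.RegularAbove E₀ ∧ E₀ ≤ E₁ ∧ ∀ E, E₁ ≤ E → 0 < deriv P.omega E

/-- `D(E) = {(x, y) : H(x, y) > E}`. -/
def D (E : ℝ) : Set (ℝ × ℝ) := {z | E < P.H z.1 z.2}

/-! ### The perturbation and the assumptions on it -/

/-- The phase `S(t)` of the perturbation. -/
def S (t : ℝ) : ℝ := P.s * t ^ (1 + (P.b : ℝ) / P.q)

/-- The coefficient `f_k(x, y, S)`; the sum over `j` runs from `0` to `l - 1`. -/
def fk (k : ℕ) (x y σ : ℝ) : ℝ :=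
  ∑ i ∈ Finset.range (P.p + 1), ∑ j ∈ Finset.range P.l, P.A k i j σ * x ^ i * y ^ j

/-- The coefficient `g_k(x, y, S)`; the sum over `j` runs from `0` to `l`. -/
def gk (k : ℕ) (x y σ : ℝ) : ℝ :=
  ∑ i ∈ Finset.range (P.p + 1), ∑ j ∈ Finset.range (P.l + 1), P.B k i j σ * x ^ i * y ^ j

/-- Ranges of the parameters, and smoothness and periodicity of the perturbations. -/
structure Standing : Prop where
  two_le_h : 2 ≤ P.h
  one_le_a : 1 ≤ P.a
  a_le_q : P.a ≤ P.q
  one_le_b : 1 ≤ P.b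
  b_le_q : P.b ≤ P.q
  s_pos : 0 < P.s
  f_smooth : ContDiffOn ℝ ∞
    (fun z : ℝ × ℝ × ℝ × ℝ => P.f z.1 z.2.1 z.2.2.1 z.2.2.2) {z | 0 < z.2.2.2}
  g_smooth : ContDiffOn ℝ ∞
    (fun z : ℝ × ℝ × ℝ × ℝ => P.g z.1 z.2.1 z.2.2.1 z.2.2.2) {z | 0 < z.2.2.2}
  f_periodic : ∀ x y σ t, 0 < t → P.f x y (σ + 2 * Real.pi) t = P.f x y σ t
  g_periodic : ∀ x y σ t, 0 < t → P.g x y (σ + 2 * Real.pi) t = P.g x y σ t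

/-- The perturbations have the power-law expansions `f ~ ∑ t^(-k/q) f_k`, `g ~ ∑ t^(-k/q) g_k`
as `t → ∞`, with polynomials `f_k`, `g_k` in `(x, y)` of the prescribed form. The remainders are
uniform in `S` and have at most polynomial growth in `(x, y)`, of a degree that does not depend
on the order of the remainder. -/
structure PowerLaw : Prop where
  l_le_p : P.l ≤ P.p
  p_le : P.p ≤ 2 * P.h - 1
  A_smooth : ∀ k i j, ContDiff ℝ ∞ (P.A k i j)
  B_smooth : ∀ k i j, ContDiff ℝ ∞ (P.B k i j)
  A_periodic : ∀ k i j, Function.Periodic (P.A k i j) (2 * Real.pi)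
  B_periodic : ∀ k i j, Function.Periodic (P.B k i j) (2 * Real.pi)
  A_zero : ∀ k i j, P.p < i + j → P.A k i j = 0
  B_zero : ∀ k i j, P.p < i + j → P.B k i j = 0
  expansion : ∃ m : ℕ, ∀ n : ℕ, ∃ C t' : ℝ, 0 < t' ∧ ∀ t, t' ≤ t → ∀ x y σ : ℝ,
    |P.f x y σ t - ∑ k ∈ Finset.range n, t ^ (-(k : ℝ) / P.q) * P.fk k x y σ|
      ≤ C * t ^ (-(n : ℝ) / P.q) * (1 + |x| + |y|) ^ m ∧
    |P.g x y σ t - ∑ k ∈ Finset.range n, t ^ (-(k : ℝ) / P.q) * P.gk k x y σ|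
      ≤ C * t ^ (-(n : ℝ) / P.q) * (1 + |x| + |y|) ^ m

/-- The exponent `σ`. -/
def sigma : ℝ :=
  (P.b : ℝ) / P.q * ((P.l : ℝ) - 1 + ((P.p : ℝ) - 1) / ((P.h : ℝ) - 1)) - (P.a : ℝ) / P.q

def Resonance : Prop := -1 ≤ P.sigma ∧ P.sigma < (P.b : ℝ) / P.q

def mu : ℝ := ((P.b : ℝ) / P.q - P.sigma) / 2

def nu : ℝ := 1 + 2 * P.mu + P.sigma

/-- `M = 2 μ q (h - 1)`, which is a positive integer (see `M_eq`). -/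
def M : ℕ := ⌊2 * P.mu * P.q * ((P.h : ℝ) - 1)⌋₊

/-- `N = 2 ν q (h - 1)`, which is a positive integer (see `N_eq`). -/
def N : ℕ := ⌊2 * P.nu * P.q * ((P.h : ℝ) - 1)⌋₊

theorem M_eq (hP : P.Standing) (hr : P.Resonance) :
    0 < P.M ∧ (P.M : ℝ) = 2 * P.mu * P.q * ((P.h : ℝ) - 1) := by
  have hq : (0 : ℝ) < P.q := by
    exact_mod_cast lt_of_lt_of_le (Nat.lt_of_lt_of_le Nat.zero_lt_one hP.one_le_a) hP.a_le_q
  have hh : (0 : ℝ) < (P.h : ℝ) - 1 := by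
    have : (2 : ℝ) ≤ P.h := by exact_mod_cast hP.two_le_h
    linarith
  have hmu : 0 < P.mu := by
    have := hr.2
    unfold mu
    linarith
  have hpos : 0 < 2 * P.mu * P.q * ((P.h : ℝ) - 1) := by positivity
  have hint : 2 * P.mu * P.q * ((P.h : ℝ) - 1) =
      (((P.b + P.a) * ((P.h : ℤ) - 1) - P.b * (((P.l : ℤ) - 1) * ((P.h : ℤ) - 1) + (P.p - 1)) : ℤ)
        : ℝ) := by
    unfold mu sigma
    push_cast
    field_simp
    ring
  rw [hint] at hpos
  have hz : (0 : ℤ) < (P.b + P.a) * ((P.h : ℤ) - 1)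
      - P.b * (((P.l : ℤ) - 1) * ((P.h : ℤ) - 1) + (P.p - 1)) := by exact_mod_cast hpos
  obtain ⟨k, hk⟩ := Int.eq_ofNat_of_zero_le hz.le
  have hM : P.M = k := by
    unfold M
    rw [hint, hk]
    simp
  refine ⟨by rw [hM]; omega, ?_⟩
  rw [hM, hint, hk]
  simp

theorem N_eq (hP : P.Standing) :
    0 < P.N ∧ (P.N : ℝ) = 2 * P.nu * P.q * ((P.h : ℝ) - 1) := by
  have hq : (0 : ℝ) < P.q := by
    exact_mod_cast lt_of_lt_of_le (Nat.lt_of_lt_of_le Nat.zero_lt_one hP.one_le_a) hP.a_le_q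
  obtain ⟨k, hk⟩ : ∃ k, P.h = k + 2 := ⟨P.h - 2, by have := hP.two_le_h; omega⟩
  have hint : 2 * P.nu * P.q * ((P.h : ℝ) - 1) = ((2 * (P.q + P.b) * (k + 1) : ℕ) : ℝ) := by
    unfold nu mu
    rw [hk]
    push_cast
    field_simp
    ring
  have hN : P.N = 2 * (P.q + P.b) * (k + 1) := by
    unfold N
    rw [hint]
    exact Nat.floor_natCast _
  refine ⟨?_, by rw [hN, hint]⟩
  rw [hN]
  have := hP.one_le_b
  positivity

/-- `ϑ = s (1 + b/q)`, the constant speed of `ζ(τ) = S(t)`. -/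
def vartheta : ℝ := P.s * (1 + (P.b : ℝ) / P.q)

/-- The slow time `τ = t^ν / ν`. -/
def tau (t : ℝ) : ℝ := t ^ P.nu / P.nu

/-- The original time `t = (ν τ)^(1/ν)`. -/
def time (τ : ℝ) : ℝ := (P.nu * τ) ^ (1 / P.nu)

/-- `ζ(τ) = S(t)`. -/
def zeta (τ : ℝ) : ℝ := P.S (P.time τ)

/-! ### The full system and the energy-angle variables -/

/-- The curve `(x, y)` satisfies the full system at the time `t`. -/
def SolvesFull (x y : ℝ → ℝ) (t : ℝ) : Prop :=
  HasDerivAt x (P.Hy (x t) (y t)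
    + t ^ (-(P.a : ℝ) / P.q) * P.f (x t) (y t) (P.S t) t) t ∧
  HasDerivAt y (-P.Hx (x t) (y t)
    + t ^ (-(P.a : ℝ) / P.q) * P.g (x t) (y t) (P.S t) t) t

/-- `φ ↦ (X(φ, E), Y(φ, E))`, `E > E₀`, is the periodic solution of the limiting system with the
energy `E` in the time `φ / ω(E)`. The phase `φ = 0` is at the right turning point. -/
def IsEnergyAngle (E₀ : ℝ) (X Y : ℝ → ℝ → ℝ) : Prop :=
  ∀ E, E₀ < E → X 0 E = P.xPlus E ∧ Y 0 E = 0 ∧ ∀ φ,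
    HasDerivAt (fun φ' => X φ' E) (P.Hy (X φ E) (Y φ E) / P.omega E) φ ∧
    HasDerivAt (fun φ' => Y φ' E) (-P.Hx (X φ E) (Y φ E) / P.omega E) φ

/-- `(φ, E) ↦ (X, Y)` is a smooth change of variables from `{E > E₀}` onto `D(E₀)`, with `φ`
an angle. -/
structure EnergyAngleChange (E₀ : ℝ) (X Y : ℝ → ℝ → ℝ) : Prop where
  omega_pos : ∀ E, E₀ < E → 0 < P.omega E
  periodic : ∀ φ E, E₀ < E → X (φ + 2 * Real.pi) E = X φ E ∧ Y (φ + 2 * Real.pi) E = Y φ E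
  energy : ∀ φ E, E₀ < E → P.H (X φ E) (Y φ E) = E
  smooth_X : ContDiffOn ℝ ∞ (fun z : ℝ × ℝ => X z.1 z.2) {z | E₀ < z.2}
  smooth_Y : ContDiffOn ℝ ∞ (fun z : ℝ × ℝ => Y z.1 z.2) {z | E₀ < z.2}
  jacobian : ∀ φ E, E₀ < E →
    deriv (fun φ' => X φ' E) φ * deriv (fun E' => Y φ E') E
      - deriv (fun E' => X φ E') E * deriv (fun φ' => Y φ' E) φ = 1 / P.omega E
  onto : ∀ x y, (x, y) ∈ P.D E₀ → ∃ φ, X φ (P.H x y) = x ∧ Y φ (P.H x y) = y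
  inj : ∀ φ φ' E E', E₀ < E → E₀ < E' → X φ E = X φ' E' → Y φ E = Y φ' E' →
    E = E' ∧ ∃ k : ℤ, φ' = φ + k * (2 * Real.pi)

def F (X Y : ℝ → ℝ → ℝ) (I φ t : ℝ) : ℝ :=
  P.f (X φ I) (Y φ I) (P.S t) t * deriv P.U (X φ I)
    + P.g (X φ I) (Y φ I) (P.S t) t * Y φ I

def G (X Y : ℝ → ℝ → ℝ) (I φ t : ℝ) : ℝ :=
  P.omega I * (P.f (X φ I) (Y φ I) (P.S t) t * deriv (fun E => Y φ E) I
    - P.g (X φ I) (Y φ I) (P.S t) t * deriv (fun E => X φ E) I)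

/-- `(I, φ)` satisfies the system in the energy-angle variables at the time `t`. -/
def SolvesEnergyAngle (X Y : ℝ → ℝ → ℝ) (I φ : ℝ → ℝ) (t : ℝ) : Prop :=
  HasDerivAt I (t ^ (-(P.a : ℝ) / P.q) * P.F X Y (I t) (φ t) t) t ∧
  HasDerivAt φ (P.omega (I t) + t ^ (-(P.a : ℝ) / P.q) * P.G X Y (I t) (φ t) t) t

/-! ### Amplitude and phase difference -/

/-- `I⋆` is a smooth solution of `ω(I⋆(t)) = S'(t) / ϰ` on `[t₁, ∞)` with values `≥ E₁`. -/
def IsResonantEnergy (ϰ : ℕ) (E₁ t₁ : ℝ) (Istar : ℝ → ℝ) : Prop :=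
  ContDiffOn ℝ ∞ Istar (Set.Ici t₁) ∧
  ∀ t, t₁ ≤ t → E₁ ≤ Istar t ∧ P.omega (Istar t) = deriv P.S t / ϰ

/-- The energy `I(t) = I⋆(t) (1 + t^(-μ) r(τ))^(2h)`. -/
def energyOf (Istar r : ℝ → ℝ) (t : ℝ) : ℝ :=
  Istar t * (1 + t ^ (-P.mu) * r (P.tau t)) ^ (2 * P.h)

/-- The angle `φ(t) = θ(τ) + S(t) / ϰ`. -/
def angleOf (ϰ : ℕ) (θ : ℝ → ℝ) (t : ℝ) : ℝ := θ (P.tau t) + P.S t / ϰ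

/-- `x` or `y` as a function of `t`, for given amplitude `r(τ)` and phase difference `θ(τ)`: the
composition of the two changes of variables (`Z` is `X` or `Y`). -/
def original (ϰ : ℕ) (Z : ℝ → ℝ → ℝ) (Istar r θ : ℝ → ℝ) (t : ℝ) : ℝ :=
  Z (P.angleOf ϰ θ t) (P.energyOf Istar r t)

/-- The right-hand side `𝒜(r, θ, τ)` of `dr/dτ = τ^(-M/N) 𝒜`. -/
def calA (ϰ : ℕ) (X Y : ℝ → ℝ → ℝ) (Istar : ℝ → ℝ) (r θ τ : ℝ) : ℝ :=
  let t := P.time τ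
  let w := 1 + t ^ (-P.mu) * r
  let I := Istar t * w ^ (2 * P.h)
  τ ^ ((P.M : ℝ) / P.N) * t ^ (1 - P.nu) *
    (t ^ P.mu * (w / (2 * P.h)) *
        (t ^ (-(P.a : ℝ) / P.q) * P.F X Y I (θ + P.zeta τ / ϰ) t / I - deriv Istar t / Istar t)
      + P.mu * r / t)

/-- The right-hand side `ℬ(r, θ, τ)` of `dθ/dτ = τ^(-M/N) ℬ`. -/
def calB (ϰ : ℕ) (X Y : ℝ → ℝ → ℝ) (Istar : ℝ → ℝ) (r θ τ : ℝ) : ℝ :=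
  let t := P.time τ
  let w := 1 + t ^ (-P.mu) * r
  let I := Istar t * w ^ (2 * P.h)
  τ ^ ((P.M : ℝ) / P.N) * t ^ (1 - P.nu) *
    (P.omega I - P.omega (Istar t)
      + t ^ (-(P.a : ℝ) / P.q) * P.G X Y I (θ + P.zeta τ / ϰ) t)

/-- `(r, θ)` satisfies the system for amplitude and phase difference at `τ`. -/
def SolvesAmplitude (ϰ : ℕ) (X Y : ℝ → ℝ → ℝ) (Istar r θ : ℝ → ℝ) (τ : ℝ) : Prop :=
  HasDerivAt r (τ ^ (-(P.M : ℝ) / P.N) * P.calA ϰ X Y Istar (r τ) (θ τ) τ) τ ∧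
  HasDerivAt θ (τ ^ (-(P.M : ℝ) / P.N) * P.calB ϰ X Y Istar (r τ) (θ τ) τ) τ

/-- `c(r, θ, τ) ~ ∑ τ^(-K/N) c_K(r, θ, ζ(τ))` as `τ → ∞`, uniformly in `|r| ≤ r₀`, `θ ∈ ℝ` for
each `r₀`. -/
def Expands (c : ℝ → ℝ → ℝ → ℝ) (cK : ℕ → ℝ → ℝ → ℝ → ℝ) : Prop :=
  ∀ (n : ℕ) (r₀ : ℝ), 0 < r₀ → ∃ C τ' : ℝ, 0 < τ' ∧ ∀ τ, τ' ≤ τ → ∀ r θ : ℝ, |r| ≤ r₀ →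
    |c r θ τ - ∑ K ∈ Finset.range (n + 1), τ ^ (-(K : ℝ) / P.N) * cK K r θ (P.zeta τ)|
      ≤ C * τ ^ (-((n : ℝ) + 1) / P.N)

/-! ### Averaging -/

/-- `c(r, θ, ζ)` is smooth, `2π`-periodic in `θ` and `2πϰ`-periodic in `ζ`. -/
def SmoothPeriodic (ϰ : ℕ) (c : ℝ → ℝ → ℝ → ℝ) : Prop :=
  ContDiff ℝ ∞ (fun z : ℝ × ℝ × ℝ => c z.1 z.2.1 z.2.2) ∧
  ∀ r θ ζ, c r (θ + 2 * Real.pi) ζ = c r θ ζ ∧ c r θ (ζ + 2 * Real.pi * ϰ) = c r θ ζ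

/-- The mean over a period `2πϰ` of `ζ`. -/
def mean (ϰ : ℕ) (c : ℝ → ℝ) : ℝ :=
  (1 / (2 * Real.pi * ϰ)) * ∫ ζ in (0 : ℝ)..(2 * Real.pi * ϰ), c ζ

/-- The near-identity transformation: with base point `v = r`, `γ = ρ` it is `R_n(r, θ, τ)`, and
with `v = θ`, `γ = ψ` it is `Ψ_n(r, θ, τ)`. -/
def nearId (n : ℕ) (γ : ℕ → ℝ → ℝ → ℝ → ℝ) (v r θ τ : ℝ) : ℝ :=
  v + ∑ K ∈ Finset.range (n + 1), τ ^ (-((P.M : ℝ) + K) / P.N) * γ K r θ (P.zeta τ)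

/-- `R_n(r, θ, τ)`. -/
def Rn (n : ℕ) (ρ : ℕ → ℝ → ℝ → ℝ → ℝ) (r θ τ : ℝ) : ℝ := P.nearId n ρ r r θ τ

/-- `Ψ_n(r, θ, τ)`. -/
def Psin (n : ℕ) (ψ : ℕ → ℝ → ℝ → ℝ → ℝ) (r θ τ : ℝ) : ℝ := P.nearId n ψ θ r θ τ

/-- The term `𝔄_K` (for `γ = ρ`, `Γ = Λ`) or `𝔅_K` (for `γ = ψ`, `Γ = Ω`) of the chain of
equations: what the coefficients with indices below `K` contribute at the order `τ^(-(M+K)/N)` when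
the total derivative of `(R_n, Ψ_n)` is matched with the averaged right-hand side at `(R_n, Ψ_n)`.
The three lines come from the derivatives of `γ_j` along `(𝒜, ℬ)`, from the derivatives of the
powers of `τ`, and from the Taylor expansion of `Γ_j(R_n, Ψ_n)` in powers of `ε = τ^(-1/N)`. -/
def correction (cA cB ρ ψ : ℕ → ℝ → ℝ → ℝ → ℝ) (γ : ℕ → ℝ → ℝ → ℝ → ℝ) (Γ : ℕ → ℝ → ℝ → ℝ)
    (K : ℕ) (r θ ζ : ℝ) : ℝ :=
  (∑ i ∈ Finset.range (K + 1), ∑ j ∈ Finset.range (K + 1), if i + j + P.M = K then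
      cA i r θ ζ * deriv (fun r' => γ j r' θ ζ) r + cB i r θ ζ * deriv (fun θ' => γ j r θ' ζ) θ
    else 0)
  - (if P.N ≤ K then ((P.M : ℝ) + K - P.N) / P.N * γ (K - P.N) r θ ζ else 0)
  - iteratedDeriv K (fun ε : ℝ => ∑ j ∈ Finset.range K, ε ^ j *
        Γ j (r + ∑ k ∈ Finset.range K, ε ^ (P.M + k) * ρ k r θ ζ)
            (θ + ∑ k ∈ Finset.range K, ε ^ (P.M + k) * ψ k r θ ζ)) 0 / (Nat.factorial K : ℝ)

/-- `γ_K`, `Γ_K` solve the chain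
`ϑ ∂_ζ γ_K = Γ_K - c_K - 𝔠_K`, `Γ_K = ⟨c_K + 𝔠_K⟩`, `⟨γ_K⟩ = 0`, where `c_K` is `𝒜_K` or `ℬ_K` and
`𝔠_K` is the corresponding correction. -/
structure AveragingChain (ϰ : ℕ) (cA cB ρ ψ : ℕ → ℝ → ℝ → ℝ → ℝ)
    (c γ : ℕ → ℝ → ℝ → ℝ → ℝ) (Γ : ℕ → ℝ → ℝ → ℝ) : Prop where
  smoothPeriodic : ∀ K, SmoothPeriodic ϰ (γ K)
  smooth_avg : ∀ K, ContDiff ℝ ∞ (fun z : ℝ × ℝ => Γ K z.1 z.2)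
  periodic_avg : ∀ K R Ψ, Γ K R (Ψ + 2 * Real.pi) = Γ K R Ψ
  average : ∀ K r θ, Γ K r θ =
    mean ϰ (fun ζ => c K r θ ζ + P.correction cA cB ρ ψ γ Γ K r θ ζ)
  equation : ∀ K r θ ζ, P.vartheta * deriv (fun ζ' => γ K r θ ζ') ζ =
    Γ K r θ - c K r θ ζ - P.correction cA cB ρ ψ γ Γ K r θ ζ
  zero_mean : ∀ K r θ, mean ϰ (fun ζ => γ K r θ ζ) = 0

/-- `(R, Ψ)` satisfies at `τ` the averaged system with the remainders `Λt`, `Ωt`. -/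
def SolvesAveraged (n : ℕ) (Λ Ω : ℕ → ℝ → ℝ → ℝ) (Λt Ωt : ℝ → ℝ → ℝ → ℝ)
    (R Ψ : ℝ → ℝ) (τ : ℝ) : Prop :=
  HasDerivAt R (∑ K ∈ Finset.range (n + 1), τ ^ (-((P.M : ℝ) + K) / P.N) * Λ K (R τ) (Ψ τ)
    + Λt (R τ) (Ψ τ) τ) τ ∧
  HasDerivAt Ψ (∑ K ∈ Finset.range (n + 1), τ ^ (-((P.M : ℝ) + K) / P.N) * Ω K (R τ) (Ψ τ)
    + Ωt (R τ) (Ψ τ) τ) τ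

/-- For `τ > τ₀` the near-identity transformation is `ε`-close to the identity, together with its
first derivatives, on `|r| ≤ r₀`; it is invertible there, and its image contains
`|R| ≤ r₀ - ε`, `Ψ ∈ ℝ`. -/
structure NearIdentity (n : ℕ) (ρ ψ : ℕ → ℝ → ℝ → ℝ → ℝ) (r₀ ε τ₀ : ℝ) : Prop where
  close : ∀ τ, τ₀ < τ → ∀ r θ : ℝ, |r| ≤ r₀ →
    |P.Rn n ρ r θ τ - r| ≤ ε ∧ |P.Psin n ψ r θ τ - θ| ≤ ε ∧
    |deriv (fun r' => P.Rn n ρ r' θ τ) r - 1| ≤ ε ∧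
    |deriv (fun θ' => P.Rn n ρ r θ' τ) θ| ≤ ε ∧
    |deriv (fun r' => P.Psin n ψ r' θ τ) r| ≤ ε ∧
    |deriv (fun θ' => P.Psin n ψ r θ' τ) θ - 1| ≤ ε
  jacobian : ∀ τ, τ₀ < τ → ∀ r θ : ℝ, |r| ≤ r₀ →
    0 < deriv (fun r' => P.Rn n ρ r' θ τ) r * deriv (fun θ' => P.Psin n ψ r θ' τ) θ
      - deriv (fun θ' => P.Rn n ρ r θ' τ) θ * deriv (fun r' => P.Psin n ψ r' θ τ) r
  inj : ∀ τ, τ₀ < τ → Set.InjOn (fun z : ℝ × ℝ => (P.Rn n ρ z.1 z.2 τ, P.Psin n ψ z.1 z.2 τ))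
    {z | |z.1| ≤ r₀}
  onto : ∀ τ, τ₀ < τ → ∀ R Ψ : ℝ, |R| ≤ r₀ - ε →
    ∃ r θ : ℝ, |r| ≤ r₀ ∧ P.Rn n ρ r θ τ = R ∧ P.Psin n ψ r θ τ = Ψ

end ChirpedSystem

end

noncomputable section

open Filter Topology

/-! ### Smooth functions: parameter integrals, division, Taylor coefficients -/

/-! High energies become an ordinary smooth limit after scaling. With δ = E^(-1/(2h)) one has U(x) =
δ^(-2h) V(δ, δx), where V is polynomial in both arguments and V(0, x) = x^(2h)/(2h). The level E of
H turns into the level 1 of a family of wells that is smooth through δ = 0. Dividing 1 - V by its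
two roots gives 1 - V = (d² - (x - c)²) Q with Q > 0 on the well (`exists_wellFamily`), so x = c + d
cos α removes the square-root singularities at the turning points: α moves with the smooth positive
speed √(2Q). Hence the angle variable and the scaled frequency are smooth in δ up to and including
0, and ω(E) = freq(δ) δ^(1-h) (`omega_eq`). Positivity of ω' at high energies, the bijection onto
D(E₀) and the Jacobian follow from this picture.

At resonance, with η = t^(-b/(q(h-1))) and δ = η e, the equation ω = S'/ϰ becomes freq(η e) = const
· e^(h-1), which the implicit function theorem solves smoothly near η = 0
(`WellFamily.exists_resonant_scale`). All powers of t that occur are then natural powers of κε with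
ε = τ^(-1/N): η = (κε)^(2b), t^(-μ) = (κε)^M. The exponent σ is chosen so that no monomial x^i y^j
of the perturbation leaves a negative power of η (`monomial_rescale`), and -1 ≤ σ does the same for
the drift of the resonant energy (`two_mul_M_le`). The difference of frequencies loses its growing
factor to a divided difference in t^(-μ) r (`exists_frequency_difference`). Thus 𝒜 and ℬ are, to any
order, smooth functions of (ε, r, θ, ζ), periodic in θ and ζ, and Taylor's formula with a bound
uniform by periodicity gives their expansions (`HasSeries.exists_expands`).

Averaging is the elimination of ζ order by order. The correction at order K involves lower indices
only, so each order is an equation ϑ ∂_ζ γ = ⟨c⟩ - c, solvable by periodic functions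
(`exists_averagingChain`). If ε is regarded as an independent variable, the difference between the
derivative of (R_n, Ψ_n) along the truncated system and the averaged right-hand side at (R_n, Ψ_n)
is a smooth function whose Taylor coefficients up to order n vanish by these very equations
(`taylorCoeff_defect`); hence the remainder is O(ε^(M+n+1)). The transformation differs from the
identity by O(ε^M) in C¹, so it is injective by a Lipschitz estimate and reaches the smaller strip
by the contraction principle (`exists_nearIdentity`).

The equivalences of the systems are chain rules made reversible by non-zero Jacobians. That every
solution can be written in the form (2) rests on lifting a C¹ curve on the unit circle to an angle
(`exists_angle_lift`). -/

theorem hasFDerivAt_integral_param {E G : Type} [NormedAddCommGroup E] [NormedSpace ℝ E]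
    [NormedAddCommGroup G] [NormedSpace ℝ G] {F : E × ℝ → G} (hF : ContDiff ℝ 1 F) (p : E) :
    HasFDerivAt (fun p => ∫ s in (0 : ℝ)..1, F (p, s))
      (∫ s in (0 : ℝ)..1, (fderiv ℝ F (p, s)).comp (ContinuousLinearMap.inl ℝ E ℝ)) p := by
  have hc : Continuous fun z : E × ℝ =>
      (fderiv ℝ F z).comp (ContinuousLinearMap.inl ℝ E ℝ) :=
    (hF.continuous_fderiv (by norm_num)).clm_comp continuous_const
  obtain ⟨C, hC⟩ : ∃ C, ∀ s ∈ Set.Icc (0 : ℝ) 1,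
      ‖(fderiv ℝ F (p, s)).comp (ContinuousLinearMap.inl ℝ E ℝ)‖ ≤ C := by
    have hk : Continuous fun s : ℝ => (fderiv ℝ F (p, s)).comp (ContinuousLinearMap.inl ℝ E ℝ) :=
      hc.comp (by fun_prop)
    exact isCompact_Icc.exists_bound_of_continuousOn hk.continuousOn
  -- Compactness of [0, 1]: a strict bound at p for every s persists for all s at once in a
  -- neighbourhood of p, which supplies a constant dominating function.
  have hnear : ∀ᶠ p' in 𝓝 p, ∀ s ∈ Set.Icc (0 : ℝ) 1,
      ‖(fderiv ℝ F (p', s)).comp (ContinuousLinearMap.inl ℝ E ℝ)‖ ≤ C + 1 := by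
    have := (isCompact_Icc (a := (0 : ℝ)) (b := 1)).eventually_forall_of_forall_eventually
      (x₀ := p) (P := fun p' s =>
        ‖(fderiv ℝ F (p', s)).comp (ContinuousLinearMap.inl ℝ E ℝ)‖ < C + 1) ?_
    · exact this.mono fun p' h s hs => (h s hs).le
    · intro s hs
      have h1 : Tendsto (fun z : E × ℝ =>
          ‖(fderiv ℝ F z).comp (ContinuousLinearMap.inl ℝ E ℝ)‖) (𝓝 (p, s))
          (𝓝 ‖(fderiv ℝ F (p, s)).comp (ContinuousLinearMap.inl ℝ E ℝ)‖) :=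
        hc.norm.continuousAt
      exact h1.eventually (gt_mem_nhds (lt_of_le_of_lt (hC s hs) (lt_add_one C)))
  obtain ⟨U, hU, hUs⟩ := hnear.exists_mem
  refine intervalIntegral.hasFDerivAt_integral_of_dominated_of_fderiv_le
    (F := fun p s => F (p, s))
    (F' := fun p s => (fderiv ℝ F (p, s)).comp (ContinuousLinearMap.inl ℝ E ℝ))
    (bound := fun _ => C + 1) hU ?_ ?_ ?_ ?_ ?_ ?_
  · exact Eventually.of_forall fun q =>
      (hF.continuous.comp (by fun_prop : Continuous fun s : ℝ => (q, s))).aestronglyMeasurable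
  · exact (hF.continuous.comp
      (by fun_prop : Continuous fun s : ℝ => (p, s))).intervalIntegrable _ _
  · exact (hc.comp (by fun_prop : Continuous fun s : ℝ => (p, s))).aestronglyMeasurable
  · refine Eventually.of_forall fun s hs q hq => hUs q hq s ?_
    rw [Set.uIoc_of_le zero_le_one] at hs
    exact ⟨hs.1.le, hs.2⟩
  · exact intervalIntegrable_const
  · refine Eventually.of_forall fun s _ q _ => ?_
    have h1 : HasFDerivAt F (fderiv ℝ F (q, s)) (q, s) :=
      (hF.differentiable (by norm_num) _).hasFDerivAt
    exact h1.comp q (hasFDerivAt_prodMk_left q s)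

/-- Induction on the order over all target spaces at once: the derivative is again a parameter
integral, with values in a space of linear maps. -/
theorem contDiff_integral_param {E : Type} [NormedAddCommGroup E] [NormedSpace ℝ E]
    {G : Type} [NormedAddCommGroup G] [NormedSpace ℝ G] {F : E × ℝ → G} (hF : ContDiff ℝ ∞ F) :
    ContDiff ℝ ∞ fun p => ∫ s in (0 : ℝ)..1, F (p, s) := by
  rw [contDiff_infty]
  intro n
  induction n generalizing G with
  | zero =>
    have : Continuous fun p => ∫ s in (0 : ℝ)..1, F (p, s) :=
      continuous_iff_continuousAt.2 fun p =>
        (hasFDerivAt_integral_param (hF.of_le (by norm_cast)) p).continuousAt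
    exact_mod_cast contDiff_zero.2 this
  | succ n ih =>
    have h1 := fun p => hasFDerivAt_integral_param (hF.of_le (by norm_cast)) p
    push_cast
    rw [contDiff_succ_iff_hasFDerivAt]
    refine ⟨_, ?_, h1⟩
    refine ih (F := fun z : E × ℝ => (fderiv ℝ F z).comp (ContinuousLinearMap.inl ℝ E ℝ)) ?_
    exact (hF.fderiv_right (m := ∞) (by norm_num)).clm_comp contDiff_const

/-- The divided difference of a smooth function is smooth. -/
theorem exists_contDiff_dividedDifference {E : Type} [NormedAddCommGroup E] [NormedSpace ℝ E]
    {F : E × ℝ → ℝ} (hF : ContDiff ℝ ∞ F) :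
    ∃ K : E × ℝ × ℝ → ℝ, ContDiff ℝ ∞ K ∧
      ∀ p x y, F (p, x) - F (p, y) = (x - y) * K (p, x, y) := by
  have hd : ContDiff ℝ ∞ fun z : E × ℝ => fderiv ℝ F z (0, 1) :=
    (hF.fderiv_right (m := ∞) (by norm_num)).clm_apply contDiff_const
  have hder : ∀ (p : E) (x : ℝ), HasDerivAt (fun x => F (p, x)) (fderiv ℝ F (p, x) (0, 1)) x := by
    intro p x
    have h1 : HasFDerivAt F (fderiv ℝ F (p, x)) (p, x) :=
      (hF.differentiable (by norm_num) _).hasFDerivAt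
    have h2 : HasDerivAt (fun x : ℝ => (p, x)) ((0 : E), (1 : ℝ)) x :=
      (hasDerivAt_const x p).prodMk (hasDerivAt_id x)
    exact h1.comp_hasDerivAt x h2
  -- The quotient is the mean of the derivative over the segment from y to x, which makes sense on
  -- the diagonal too.
  refine ⟨fun z => ∫ s in (0 : ℝ)..1, fderiv ℝ F (z.1, z.2.2 + s * (z.2.1 - z.2.2)) (0, 1),
    ?_, ?_⟩
  · refine contDiff_integral_param
      (F := fun w : (E × ℝ × ℝ) × ℝ =>
        fderiv ℝ F (w.1.1, w.1.2.2 + w.2 * (w.1.2.1 - w.1.2.2)) (0, 1)) ?_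
    exact hd.comp (by fun_prop)
  · intro p x y
    have hint := intervalIntegral.integral_eq_sub_of_hasDerivAt (a := 0) (b := 1)
      (f := fun s : ℝ => F (p, y + s * (x - y)))
      (f' := fun s : ℝ => fderiv ℝ F (p, y + s * (x - y)) (0, 1) * (x - y)) ?_ ?_
    · rw [intervalIntegral.integral_mul_const] at hint
      simp only [one_mul, zero_mul, add_zero, add_sub_cancel] at hint
      dsimp only
      rw [← hint, mul_comm]
    · intro s _
      have h2 : HasDerivAt (fun s : ℝ => y + s * (x - y)) (x - y) s := by
        simpa using ((hasDerivAt_id s).mul_const (x - y)).const_add y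
      exact (hder p _).comp s h2
    · refine Continuous.intervalIntegrable ?_ _ _
      exact (hd.continuous.comp (by fun_prop : Continuous fun s : ℝ => (p, y + s * (x - y)))).mul
        continuous_const

/-- Hadamard's lemma iterated: the remainder minus its value at ε = 0 is divisible by ε with a
smooth quotient. -/
theorem exists_contDiff_taylor {E : Type} [NormedAddCommGroup E] [NormedSpace ℝ E]
    {g : ℝ × E → ℝ} (hg : ContDiff ℝ ∞ g) (n : ℕ) :
    ∃ (c : ℕ → E → ℝ) (R : ℝ × E → ℝ), (∀ k, ContDiff ℝ ∞ (c k)) ∧ ContDiff ℝ ∞ R ∧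
      ∀ ε p, g (ε, p) = (∑ k ∈ Finset.range n, ε ^ k * c k p) + ε ^ n * R (ε, p) := by
  induction n with
  | zero => exact ⟨fun _ _ => 0, g, fun _ => contDiff_const, hg, by simp⟩
  | succ n ih =>
    obtain ⟨c, R, hc, hR, h⟩ := ih
    obtain ⟨K, hK, hKe⟩ := exists_contDiff_dividedDifference
      (F := fun z : E × ℝ => R (z.2, z.1)) (hR.comp (by fun_prop))
    refine ⟨fun k => if k = n then fun p => R (0, p) else c k, fun z => K (z.2, z.1, 0), ?_, ?_, ?_⟩
    · intro k
      dsimp only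
      split_ifs
      · exact hR.comp (by fun_prop)
      · exact hc k
    · exact hK.comp (by fun_prop)
    · intro ε p
      rw [h, Finset.sum_range_succ]
      have h1 : ∀ k ∈ Finset.range n,
          ε ^ k * (if k = n then fun p => R (0, p) else c k) p = ε ^ k * c k p := by
        intro k hk
        rw [if_neg (by simp at hk; omega)]
      have h3 : (fun k => if k = n then fun p => R (0, p) else c k) n p = R (0, p) := by simp
      rw [Finset.sum_congr rfl h1, h3]
      have h2 := hKe p ε 0
      simp only [sub_zero] at h2
      rw [pow_succ]
      linear_combination ε ^ n * h2

/-- The `K`-th Taylor coefficient at `0`. -/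
def taylorCoeff (K : ℕ) (f : ℝ → ℝ) : ℝ := iteratedDeriv K f 0 / (Nat.factorial K : ℝ)

/-- Each derivative costs one power of ε only: the derivative of ε^(m+1) f is ε^m times a smooth
function. -/
theorem iteratedDeriv_pow_mul_zero {K n : ℕ} (hK : K < n) {f : ℝ → ℝ} (hf : ContDiff ℝ ∞ f) :
    iteratedDeriv K (fun ε => ε ^ n * f ε) 0 = 0 := by
  induction K generalizing n f with
  | zero => simp [iteratedDeriv_zero, show n ≠ 0 by omega]
  | succ K ih =>
    obtain ⟨m, rfl⟩ : ∃ m, n = m + 1 := ⟨n - 1, by omega⟩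
    have hd : deriv (fun ε => ε ^ (m + 1) * f ε) =
        fun ε => ε ^ m * ((m + 1) * f ε + ε * deriv f ε) := by
      ext ε
      have h1 := (hasDerivAt_pow (m + 1) ε).mul
        ((hf.differentiable (by norm_num)) ε).hasDerivAt
      have h2 := h1.deriv
      refine h2.trans ?_
      push_cast
      ring
    rw [iteratedDeriv_succ', hd]
    have hf' : ContDiff ℝ ∞ (deriv f) := (contDiff_infty_iff_deriv.1 hf).2
    exact ih (by omega) (by fun_prop)

/-- Allows Taylor coefficients to be computed modulo a higher power of ε, without differentiating
anything. -/
theorem taylorCoeff_congr_pow {K n : ℕ} (hK : K < n) {f g R : ℝ → ℝ} (hg : ContDiff ℝ ∞ g)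
    (hR : ContDiff ℝ ∞ R) (h : ∀ ε, f ε = g ε + ε ^ n * R ε) :
    taylorCoeff K f = taylorCoeff K g := by
  have hf : f = fun ε => g ε + ε ^ n * R ε := funext h
  have hle : (K : WithTop ℕ∞) ≤ ∞ := by exact_mod_cast le_top
  unfold taylorCoeff
  rw [hf, iteratedDeriv_fun_add (hg.contDiffAt.of_le hle)
    ((by fun_prop : ContDiff ℝ ∞ fun ε => ε ^ n * R ε).contDiffAt.of_le hle), iteratedDeriv_pow_mul_zero hK hR, add_zero]

theorem taylorCoeff_add {K : ℕ} {f g : ℝ → ℝ} (hf : ContDiff ℝ ∞ f) (hg : ContDiff ℝ ∞ g) :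
    taylorCoeff K (fun ε => f ε + g ε) = taylorCoeff K f + taylorCoeff K g := by
  have hle : (K : WithTop ℕ∞) ≤ ∞ := by exact_mod_cast le_top
  unfold taylorCoeff
  rw [iteratedDeriv_fun_add (hf.contDiffAt.of_le hle) (hg.contDiffAt.of_le hle), add_div]

theorem taylorCoeff_sub {K : ℕ} {f g : ℝ → ℝ} (hf : ContDiff ℝ ∞ f) (hg : ContDiff ℝ ∞ g) :
    taylorCoeff K (fun ε => f ε - g ε) = taylorCoeff K f - taylorCoeff K g := by
  have hle : (K : WithTop ℕ∞) ≤ ∞ := by exact_mod_cast le_top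
  unfold taylorCoeff
  rw [iteratedDeriv_fun_sub (hf.contDiffAt.of_le hle) (hg.contDiffAt.of_le hle), sub_div]

theorem taylorCoeff_sum {ι : Type*} {K : ℕ} {f : ι → ℝ → ℝ} {s : Finset ι}
    (hf : ∀ i ∈ s, ContDiff ℝ ∞ (f i)) :
    taylorCoeff K (fun ε => ∑ i ∈ s, f i ε) = ∑ i ∈ s, taylorCoeff K (f i) := by
  classical
  induction s using Finset.induction_on with
  | empty => simp [taylorCoeff]
  | insert a s ha ih =>
    simp only [Finset.sum_insert ha]
    rw [taylorCoeff_add (hf a (by simp)) (ContDiff.sum fun i hi => hf i (by simp [hi])),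
      ih fun i hi => hf i (by simp [hi])]

theorem taylorCoeff_mul_const {K : ℕ} (f : ℝ → ℝ) (c : ℝ) :
    taylorCoeff K (fun ε => f ε * c) = taylorCoeff K f * c := by
  unfold taylorCoeff
  rw [iteratedDeriv_mul_const_field]
  ring

theorem taylorCoeff_pow (K m : ℕ) : taylorCoeff K (fun ε => ε ^ m) = if m = K then 1 else 0 := by
  unfold taylorCoeff
  rw [iteratedDeriv_fun_pow_zero]
  rcases eq_or_ne m K with rfl | h
  · simp [Nat.factorial_ne_zero]
  · simp [h, h.symm]

theorem taylorCoeff_monomial (K m : ℕ) (c : ℝ) :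
    taylorCoeff K (fun ε => ε ^ m * c) = if m = K then c else 0 := by
  rw [taylorCoeff_mul_const, taylorCoeff_pow]
  split_ifs <;> simp

theorem taylorCoeff_pow_mul_self {K : ℕ} {f : ℝ → ℝ} (hf : ContDiff ℝ ∞ f) :
    taylorCoeff K (fun ε => ε ^ K * f ε) = f 0 := by
  obtain ⟨c, R, -, hR, h⟩ := exists_contDiff_taylor (E := ℝ) (g := fun z => f z.1)
    (hf.comp contDiff_fst) 1
  simp only [Finset.range_one, Finset.sum_singleton, pow_zero, one_mul, pow_one] at h
  have h0 := h 0 0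
  rw [zero_mul, add_zero] at h0
  rw [taylorCoeff_congr_pow (K := K) (n := K + 1) (g := fun ε => ε ^ K * f 0)
    (R := fun ε => R (ε, 0)) (by omega) (by fun_prop) (hR.comp (by fun_prop)) ?_]
  · rw [taylorCoeff_monomial, if_pos rfl]
  · intro ε
    rw [h ε 0, ← h0]
    ring

theorem taylorCoeff_pow_mul_of_lt {K n : ℕ} (hK : K < n) {f : ℝ → ℝ} (hf : ContDiff ℝ ∞ f) :
    taylorCoeff K (fun ε => ε ^ n * f ε) = 0 := by
  unfold taylorCoeff
  rw [iteratedDeriv_pow_mul_zero hK hf, zero_div]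

/-- Taylor's formula with a parameter. -/
theorem exists_taylor_remainder {E : Type} [NormedAddCommGroup E] [NormedSpace ℝ E]
    {g : ℝ × E → ℝ} (hg : ContDiff ℝ ∞ g) (n : ℕ) :
    ∃ R : ℝ × E → ℝ, ContDiff ℝ ∞ R ∧ (∀ k < n, ContDiff ℝ ∞ fun p =>
        taylorCoeff k fun ε => g (ε, p)) ∧
      ∀ ε p, g (ε, p) = (∑ k ∈ Finset.range n, ε ^ k * taylorCoeff k fun ε' => g (ε', p))
        + ε ^ n * R (ε, p) := by
  obtain ⟨c, R, hc, hR, h⟩ := exists_contDiff_taylor hg n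
  have hk : ∀ k < n, ∀ p, taylorCoeff k (fun ε => g (ε, p)) = c k p := by
    intro k hk p
    rw [taylorCoeff_congr_pow hk (g := fun ε => ∑ k ∈ Finset.range n, ε ^ k * c k p)
      (R := fun ε => R (ε, p)) (ContDiff.sum fun i _ => by fun_prop) (hR.comp (by fun_prop))
      fun ε => h ε p]
    rw [taylorCoeff_sum fun i _ => by fun_prop]
    simp only [taylorCoeff_monomial]
    simp [hk]
  refine ⟨R, hR, ?_, ?_⟩
  · intro k hkn
    rw [funext (hk k hkn)]
    exact hc k
  · intro ε p
    rw [h, Finset.sum_congr rfl]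
    intro k hkn
    rw [hk k (Finset.mem_range.1 hkn)]

theorem contDiff_taylorCoeff {E : Type} [NormedAddCommGroup E] [NormedSpace ℝ E]
    {g : ℝ × E → ℝ} (hg : ContDiff ℝ ∞ g) (k : ℕ) :
    ContDiff ℝ ∞ fun p => taylorCoeff k fun ε => g (ε, p) := by
  obtain ⟨R, -, h, -⟩ := exists_taylor_remainder hg (k + 1)
  exact h k (by omega)

/-! ### Cut-offs, implicit functions, periodic functions -/

/-- A smooth map of the line into a ball about c that is the identity near c. Composition with it
turns a function smooth on the ball into one smooth everywhere, unchanged near c. -/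
theorem exists_cutoff (c : ℝ) {R : ℝ} (hR : 0 < R) :
    ∃ χ : ℝ → ℝ, ContDiff ℝ ∞ χ ∧ (∀ x, |χ x - c| < R) ∧
      ∃ r > 0, ∀ x, |x - c| ≤ r → χ x = x := by
  let b : ContDiffBump c := ⟨R / 4, R / 2, by positivity, by linarith⟩
  refine ⟨fun x => c + b x * (x - c), ?_, ?_, R / 4, by positivity, ?_⟩
  · exact contDiff_const.add (b.contDiff.mul (by fun_prop))
  · intro x
    dsimp only
    rw [add_sub_cancel_left, abs_mul]
    by_cases hx : |x - c| < R / 2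
    · have h1 : |b x| ≤ 1 := by rw [abs_of_nonneg b.nonneg]; exact b.le_one
      calc |b x| * |x - c| ≤ 1 * |x - c| := by gcongr
        _ < R := by linarith
    · have : b x = 0 := b.zero_of_le_dist (by rw [Real.dist_eq]; exact not_lt.1 hx)
      rw [this]
      simpa using hR
  · intro x hx
    have : b x = 1 := b.one_of_mem_closedBall (by rw [Metric.mem_closedBall, Real.dist_eq]; exact hx)
    dsimp only
    rw [this]
    ring

theorem isInvertible_fderiv_comp_inr {E : Type} [NormedAddCommGroup E] [NormedSpace ℝ E]
    {f : E × ℝ → ℝ} {u : E × ℝ} (hf : DifferentiableAt ℝ f u) {m : ℝ}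
    (hm : HasDerivAt (fun y => f (u.1, y)) m u.2) (hm0 : m ≠ 0) :
    (fderiv ℝ f u ∘L .inr ℝ E ℝ).IsInvertible := by
  have h1 : HasDerivAt (fun y => f (u.1, y)) (fderiv ℝ f u (0, 1)) u.2 :=
    hf.hasFDerivAt.comp_hasDerivAt (x := u.2) (f := fun y => (u.1, y))
      ((hasDerivAt_const _ _).prodMk (hasDerivAt_id _))
  have h2 := h1.unique hm
  refine ⟨ContinuousLinearEquiv.unitsEquivAut ℝ (Units.mk0 m hm0), ?_⟩
  ext
  simp [h2]

/-- By local uniqueness, a continuous solution of the implicit equation coincides with the smooth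
implicit function. -/
theorem contDiffAt_of_implicit {E : Type} [NormedAddCommGroup E] [NormedSpace ℝ E]
    [CompleteSpace E] {f : E × ℝ → ℝ} {p : E} {g : E → ℝ} (hf : ContDiffAt ℝ ∞ f (p, g p))
    {m : ℝ} (hm : HasDerivAt (fun y => f (p, y)) m (g p)) (hm0 : m ≠ 0) (hg : ContinuousAt g p)
    (h : ∀ᶠ q in 𝓝 p, f (q, g q) = f (p, g p)) : ContDiffAt ℝ ∞ g p := by
  have hi := isInvertible_fderiv_comp_inr (hf.differentiableAt (by norm_num)) hm hm0
  have hs := hf.contDiffAt_implicitFunction (by norm_num) hi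
  refine hs.congr_of_eventuallyEq ?_
  have he := hf.eventually_apply_eq_iff_implicitFunction (by norm_num) hi
  have ht : Tendsto (fun q => (q, g q)) (𝓝 p) (𝓝 (p, g p)) :=
    (continuousAt_id.prodMk hg).tendsto
  filter_upwards [ht.eventually he, h] with q h1 h2
  exact (h1.1 h2).symm

theorem exists_implicit {E : Type} [NormedAddCommGroup E] [NormedSpace ℝ E]
    [CompleteSpace E] {f : E × ℝ → ℝ} {p : E} {y : ℝ} (hf : ContDiffAt ℝ ∞ f (p, y))
    {m : ℝ} (hm : HasDerivAt (fun y => f (p, y)) m y) (hm0 : m ≠ 0) :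
    ∃ g : E → ℝ, ContDiffAt ℝ ∞ g p ∧ g p = y ∧ ∀ᶠ q in 𝓝 p, f (q, g q) = f (p, y) := by
  have hi := isInvertible_fderiv_comp_inr (hf.differentiableAt (by norm_num)) hm hm0
  exact ⟨_, hf.contDiffAt_implicitFunction (by norm_num) hi,
    hf.implicitFunction_apply_self (by norm_num) hi,
    hf.eventually_apply_implicitFunction (by norm_num) hi⟩

/-- The periods move θ and ζ into a compact box, so the bound is uniform over all real θ and ζ. -/
theorem exists_bound_of_periodic {g : ℝ × ℝ × ℝ × ℝ → ℝ} (hg : Continuous g) {T T' : ℝ}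
    (hT : 0 < T) (hT' : 0 < T')
    (hp : ∀ ε r θ ζ, g (ε, r, θ + T, ζ) = g (ε, r, θ, ζ))
    (hp' : ∀ ε r θ ζ, g (ε, r, θ, ζ + T') = g (ε, r, θ, ζ)) (r₀ : ℝ) :
    ∃ C, 0 < C ∧ ∀ ε r θ ζ, |ε| ≤ 1 → |r| ≤ r₀ → |g (ε, r, θ, ζ)| ≤ C := by
  have hK : IsCompact (Set.Icc (-1 : ℝ) 1 ×ˢ Set.Icc (-r₀) r₀ ×ˢ Set.Icc 0 T ×ˢ Set.Icc 0 T') :=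
    isCompact_Icc.prod (isCompact_Icc.prod (isCompact_Icc.prod isCompact_Icc))
  obtain ⟨C, hC⟩ := hK.exists_bound_of_continuousOn hg.continuousOn
  refine ⟨max C 1, by positivity, fun ε r θ ζ hε hr => ?_⟩
  obtain ⟨θ', hθ', h1⟩ := (show Function.Periodic (fun θ => g (ε, r, θ, ζ)) T from
    fun θ => hp ε r θ ζ).exists_mem_Ico₀ hT θ
  obtain ⟨ζ', hζ', h2⟩ := (show Function.Periodic (fun ζ => g (ε, r, θ', ζ)) T' from
    fun ζ => hp' ε r θ' ζ).exists_mem_Ico₀ hT' ζ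
  rw [h1, h2]
  refine (hC _ ⟨abs_le.1 hε, abs_le.1 hr, ⟨hθ'.1, hθ'.2.le⟩, ⟨hζ'.1, hζ'.2.le⟩⟩).trans
    (le_max_left _ _)

/-- Taylor's formula for a function periodic in the last two variables. -/
theorem exists_taylor_bound {g : ℝ × ℝ × ℝ × ℝ → ℝ} (hg : ContDiff ℝ ∞ g) {T T' : ℝ}
    (hT : 0 < T) (hT' : 0 < T')
    (hp : ∀ ε r θ ζ, g (ε, r, θ + T, ζ) = g (ε, r, θ, ζ))
    (hp' : ∀ ε r θ ζ, g (ε, r, θ, ζ + T') = g (ε, r, θ, ζ)) (n : ℕ) (r₀ : ℝ) :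
    ∃ C, 0 < C ∧ ∀ ε r θ ζ, |ε| ≤ 1 → |r| ≤ r₀ →
      |g (ε, r, θ, ζ) - ∑ k ∈ Finset.range n, ε ^ k * taylorCoeff k fun ε' => g (ε', r, θ, ζ)|
        ≤ C * |ε| ^ n := by
  obtain ⟨R, hR, -, h⟩ := exists_taylor_remainder hg n
  have hK : IsCompact (Set.Icc (-1 : ℝ) 1 ×ˢ Set.Icc (-r₀) r₀ ×ˢ Set.Icc 0 T ×ˢ Set.Icc 0 T') :=
    isCompact_Icc.prod (isCompact_Icc.prod (isCompact_Icc.prod isCompact_Icc))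
  obtain ⟨C, hC⟩ := hK.exists_bound_of_continuousOn hR.continuous.continuousOn
  refine ⟨max C 1, by positivity, fun ε r θ ζ hε hr => ?_⟩
  -- Periodicity is applied to the whole function of ε, so that the Taylor coefficients are carried
  -- along with the value.
  obtain ⟨θ', hθ', h1⟩ := (show Function.Periodic (fun θ => fun ε => g (ε, r, θ, ζ)) T from
    fun θ => funext fun ε => hp ε r θ ζ).exists_mem_Ico₀ hT θ
  obtain ⟨ζ', hζ', h2⟩ := (show Function.Periodic (fun ζ => fun ε => g (ε, r, θ', ζ)) T' from
    fun ζ => funext fun ε => hp' ε r θ' ζ).exists_mem_Ico₀ hT' ζ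
  rw [h2] at h1
  rw [h1, congrFun h1 ε, h, add_sub_cancel_left, abs_mul, abs_pow, mul_comm]
  gcongr
  exact (hC (ε, r, θ', ζ') ⟨abs_le.1 hε, abs_le.1 hr, ⟨hθ'.1, hθ'.2.le⟩, ⟨hζ'.1, hζ'.2.le⟩⟩).trans
    (le_max_left _ _)

/-! ### Families of potential wells -/

/-- The level v(a) ≥ 1 is a barrier: wherever v returns to it the derivative is positive, so v never
falls below it and stays where its derivative is positive. -/
theorem strictMonoOn_Ici_of_deriv_pos {v : ℝ → ℝ} (hv : Differentiable ℝ v)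
    (hpos : ∀ x, 0 < x → 1 ≤ v x → 0 < deriv v x) {a : ℝ} (ha : 0 < a) (hva : 1 ≤ v a) :
    StrictMonoOn v (Set.Ici a) := by
  have hge : ∀ x, a ≤ x → v a ≤ v x := by
    intro x hx
    have := image_le_of_deriv_right_lt_deriv_boundary (f := fun _ => v a) (f' := fun _ => 0)
      (a := a) (b := x) continuousOn_const (fun y _ => hasDerivWithinAt_const _ _ _) (B := v)
      (B' := deriv v) le_rfl (fun y => (hv y).hasDerivAt) ?_
    · exact this ⟨hx, le_rfl⟩
    · intro y hy h
      exact hpos y (ha.trans_le hy.1) (h ▸ hva)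
  refine strictMonoOn_of_deriv_pos (convex_Ici a) hv.continuous.continuousOn ?_
  intro x hx
  rw [interior_Ici] at hx
  exact hpos x (ha.trans hx) (hva.trans (hge x (le_of_lt hx)))

/-- The level 1 is crossed only once: a height of at least 1 before a would force v(a) > 1 by
monotonicity from there on. -/
theorem exists_root_of_deriv_pos {v : ℝ → ℝ} (hv : Differentiable ℝ v) (h0 : v 0 < 1)
    (hpos : ∀ x, 0 < x → 1 ≤ v x → 0 < deriv v x) (hlarge : ∃ x, 0 < x ∧ 1 ≤ v x) :
    ∃ a, 0 < a ∧ v a = 1 ∧ (∀ x, 0 < x → x < a → v x < 1) ∧ ∀ x, a < x → 1 < v x := by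
  obtain ⟨b, hb, hvb⟩ := hlarge
  obtain ⟨a, ha, hva⟩ := intermediate_value_Icc hb.le hv.continuous.continuousOn
    (show (1 : ℝ) ∈ Set.Icc (v 0) (v b) from ⟨h0.le, hvb⟩)
  have ha0 : 0 < a := lt_of_le_of_ne ha.1 (by rintro rfl; linarith)
  refine ⟨a, ha0, hva, fun x hx hxa => ?_, fun x hx => ?_⟩
  · by_contra hcon
    have := strictMonoOn_Ici_of_deriv_pos hv hpos hx (not_lt.1 hcon) (Set.mem_Ici.2 le_rfl)
      (Set.mem_Ici.2 hxa.le) hxa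
    linarith [not_lt.1 hcon]
  · have := strictMonoOn_Ici_of_deriv_pos hv hpos ha0 hva.ge (Set.mem_Ici.2 le_rfl)
      (Set.mem_Ici.2 hx.le) hx
    linarith

/-- The implicit function theorem gives a smooth root near each δ; as a positive root is unique, it
is the chosen one. -/
theorem exists_smooth_root {V : ℝ → ℝ → ℝ} {d₀ : ℝ}
    (hV : ContDiff ℝ ∞ fun z : ℝ × ℝ => V z.1 z.2) (h0 : ∀ δ, V δ 0 < 1)
    (hpos : ∀ δ, |δ| < d₀ → ∀ x, 0 < x → 1 ≤ V δ x → 0 < deriv (V δ) x)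
    (hlarge : ∀ δ, ∃ x, 0 < x ∧ 1 ≤ V δ x) :
    ∃ a : ℝ → ℝ, ∀ δ, |δ| < d₀ → ContDiffAt ℝ ∞ a δ ∧ 0 < a δ ∧ V δ (a δ) = 1 ∧
      (∀ x, 0 < x → x < a δ → V δ x < 1) ∧ ∀ x, a δ < x → 1 < V δ x := by
  have hVd : ∀ δ, Differentiable ℝ (V δ) := fun δ =>
    (hV.comp (by fun_prop : ContDiff ℝ ∞ fun x : ℝ => (δ, x))).differentiable (by norm_num)
  have hex : ∀ δ, ∃ a, |δ| < d₀ → 0 < a ∧ V δ a = 1 ∧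
      (∀ x, 0 < x → x < a → V δ x < 1) ∧ ∀ x, a < x → 1 < V δ x := by
    intro δ
    by_cases hδ : |δ| < d₀
    · obtain ⟨a, ha⟩ := exists_root_of_deriv_pos (hVd δ) (h0 δ) (hpos δ hδ) (hlarge δ)
      exact ⟨a, fun _ => ha⟩
    · exact ⟨0, fun h => absurd h hδ⟩
  choose a ha using hex
  refine ⟨a, fun δ hδ => ⟨?_, ha δ hδ⟩⟩
  obtain ⟨h1, h2, -, -⟩ := ha δ hδ
  obtain ⟨g, hg, hg0, hge⟩ := exists_implicit (f := fun z : ℝ × ℝ => V z.1 z.2) (p := δ) (y := a δ)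
    hV.contDiffAt (hVd δ (a δ)).hasDerivAt (hpos δ hδ _ h1 h2.ge).ne'
  refine hg.congr_of_eventuallyEq ?_
  have hgpos : ∀ᶠ q in 𝓝 δ, 0 < g q := hg.continuousAt.eventually_const_lt (by rw [hg0]; exact h1)
  have hnear : ∀ᶠ q in 𝓝 δ, |q| < d₀ := (continuous_abs.continuousAt).eventually_lt_const hδ
  filter_upwards [hgpos, hnear, hge] with q hq1 hq2 hq3
  obtain ⟨h3, h4, h5, h6⟩ := ha q hq2
  rw [h2] at hq3
  rcases lt_trichotomy (a q) (g q) with h | h | h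
  · linarith [h6 _ h]
  · exact h
  · linarith [h5 _ hq1 h]

/-- A smooth family of potential wells `V δ`, `|δ| < d₀`, at the energy level `1`: the well is the
interval with the center `c δ` and the half width `d δ`. -/
structure WellFamily (V : ℝ → ℝ → ℝ) (d₀ : ℝ) where
  (c d : ℝ → ℝ)
  Q : ℝ → ℝ → ℝ
  smooth_V : ContDiff ℝ ∞ fun z : ℝ × ℝ => V z.1 z.2
  smooth_c : ∀ δ, |δ| < d₀ → ContDiffAt ℝ ∞ c δ
  smooth_d : ∀ δ, |δ| < d₀ → ContDiffAt ℝ ∞ d δ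
  smooth_Q : ∀ δ x, |δ| < d₀ → ContDiffAt ℝ ∞ (fun z : ℝ × ℝ => Q z.1 z.2) (δ, x)
  d_pos : ∀ δ, |δ| < d₀ → 0 < d δ
  factor : ∀ δ x, |δ| < d₀ → 1 - V δ x = (d δ ^ 2 - (x - c δ) ^ 2) * Q δ x
  Q_pos : ∀ δ x, |δ| < d₀ → |x - c δ| ≤ d δ → 0 < Q δ x
  one_lt : ∀ δ x, |δ| < d₀ → d δ < |x - c δ| → 1 < V δ x
  neg : ∀ δ, |δ| < d₀ → c δ - d δ < 0
  pos : ∀ δ, |δ| < d₀ → 0 < c δ + d δ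

/-- Let a and -b be the right and left roots of V = 1. Taking divided differences at both gives 1 -
V = (a - x)(x + b) L with L smooth. Inside the well L > 0 because V < 1; at the two ends L > 0
because the derivative of V is non-zero with the right sign. -/
theorem exists_wellFamily {V : ℝ → ℝ → ℝ} {d₀ : ℝ}
    (hV : ContDiff ℝ ∞ fun z : ℝ × ℝ => V z.1 z.2) (h0 : ∀ δ, V δ 0 < 1)
    (hpos : ∀ δ, |δ| < d₀ → ∀ x, 0 < x → 1 ≤ V δ x → 0 < deriv (V δ) x)
    (hneg : ∀ δ, |δ| < d₀ → ∀ x, x < 0 → 1 ≤ V δ x → deriv (V δ) x < 0)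
    (hlarge : ∀ δ, ∃ x, 0 < x ∧ 1 ≤ V δ x) (hlarge' : ∀ δ, ∃ x, x < 0 ∧ 1 ≤ V δ x) :
    Nonempty (WellFamily V d₀) := by
  have hVd : ∀ δ, Differentiable ℝ (V δ) := fun δ =>
    (hV.comp (by fun_prop : ContDiff ℝ ∞ fun x : ℝ => (δ, x))).differentiable (by norm_num)
  obtain ⟨a, ha⟩ := exists_smooth_root hV h0 hpos hlarge
  obtain ⟨b, hb⟩ := exists_smooth_root (V := fun δ x => V δ (-x)) (d₀ := d₀)
    (hV.comp (by fun_prop : ContDiff ℝ ∞ fun z : ℝ × ℝ => (z.1, -z.2))) (by simpa using h0)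
    (by
      intro δ hδ x hx h1
      rw [deriv_comp_neg]
      linarith [hneg δ hδ (-x) (by linarith) h1])
    (by
      intro δ
      obtain ⟨x, hx, h1⟩ := hlarge' δ
      exact ⟨-x, by linarith, by simpa using h1⟩)
  obtain ⟨K, hK, hKe⟩ := exists_contDiff_dividedDifference hV
  obtain ⟨L, hL, hLe⟩ := exists_contDiff_dividedDifference
    (F := fun w : (ℝ × ℝ) × ℝ => K (w.1.1, w.2, w.1.2)) (hK.comp (by fun_prop))
  have hfac : ∀ δ x, |δ| < d₀ →
      1 - V δ x = (a δ - x) * (x + b δ) * L ((δ, a δ), x, -b δ) := by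
    intro δ x hδ
    obtain ⟨-, ha0, ha1, -⟩ := ha δ hδ
    obtain ⟨-, hb0, hb1, -⟩ := hb δ hδ
    have e1 := hKe δ x (a δ)
    have e2 := hKe δ (-b δ) (a δ)
    have e3 := hLe (δ, a δ) x (-b δ)
    dsimp only at e1 e2 e3
    rw [hb1, ha1, sub_self] at e2
    -- The first quotient K(·, a) vanishes at the second root, so it can itself be divided by x + b.
    have e4 : K (δ, -b δ, a δ) = 0 := by
      rcases mul_eq_zero.1 e2.symm with h | h
      · linarith
      · exact h
    rw [e4] at e3
    rw [ha1] at e1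
    linear_combination -e1 + (a δ - x) * e3
  have hder : ∀ δ x, |δ| < d₀ → HasDerivAt (fun x => L ((δ, a δ), x, -b δ))
      (deriv (fun x => L ((δ, a δ), x, -b δ)) x) x := by
    intro δ x hδ
    exact ((hL.comp (by fun_prop : ContDiff ℝ ∞ fun x : ℝ => ((δ, a δ), x, -b δ))).differentiable
      (by norm_num) x).hasDerivAt
  have hderV : ∀ δ x, |δ| < d₀ → -deriv (V δ) x =
      (a δ - x - (x + b δ)) * L ((δ, a δ), x, -b δ) +
      (a δ - x) * (x + b δ) * deriv (fun x => L ((δ, a δ), x, -b δ)) x := by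
    intro δ x hδ
    have h1 : HasDerivAt (fun x => 1 - V δ x) (-deriv (V δ) x) x := by
      simpa using (hVd δ x).hasDerivAt.const_sub 1
    have h2 := ((((hasDerivAt_id x).const_sub (a δ)).mul
      ((hasDerivAt_id x).add_const (b δ))).mul (hder δ x hδ))
    have h3 : (fun x => 1 - V δ x) = (fun x => (a δ - x) * (x + b δ) * L ((δ, a δ), x, -b δ)) :=
      funext fun x => hfac δ x hδ
    rw [h3] at h1
    have := h1.unique h2
    rw [this]
    simp only [Pi.mul_apply, id]
    ring
  refine ⟨{
    c := fun δ => (a δ - b δ) / 2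
    d := fun δ => (a δ + b δ) / 2
    Q := fun δ x => L ((δ, a δ), x, -b δ)
    smooth_V := hV
    smooth_c := ?_, smooth_d := ?_, smooth_Q := ?_, d_pos := ?_, factor := ?_, Q_pos := ?_
    one_lt := ?_, neg := ?_, pos := ?_ }⟩
  · exact fun δ hδ => ((ha δ hδ).1.sub (hb δ hδ).1).div_const 2
  · exact fun δ hδ => ((ha δ hδ).1.add (hb δ hδ).1).div_const 2
  · intro δ x hδ
    have h1 : ContDiffAt ℝ ∞ (fun z : ℝ × ℝ => a z.1) (δ, x) :=
      ContDiffAt.comp (δ, x) (g := a) (ha δ hδ).1 contDiffAt_fst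
    have h2 : ContDiffAt ℝ ∞ (fun z : ℝ × ℝ => b z.1) (δ, x) :=
      ContDiffAt.comp (δ, x) (g := b) (hb δ hδ).1 contDiffAt_fst
    exact hL.contDiffAt.comp (δ, x)
      ((contDiffAt_fst.prodMk h1).prodMk (contDiffAt_snd.prodMk h2.neg))
  · intro δ hδ
    linarith [(ha δ hδ).2.1, (hb δ hδ).2.1]
  · intro δ x hδ
    rw [hfac δ x hδ]
    ring
  · intro δ x hδ hx
    obtain ⟨-, ha0, ha1, ha2, -⟩ := ha δ hδ
    obtain ⟨-, hb0, hb1, hb2, -⟩ := hb δ hδ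
    rw [abs_le] at hx
    have hxa : x ≤ a δ := by linarith [hx.2]
    have hxb : -b δ ≤ x := by linarith [hx.1]
    -- At an end point the factorization only says 0 = 0; its derivative there is, up to sign, (a +
    -- b) L and decides the sign of L.
    rcases hxa.eq_or_lt with h | h
    · have h1 := hderV δ x hδ
      have h2 := hpos δ hδ x (by linarith) (by rw [h, ha1])
      rw [h] at h1 h2 ⊢
      rw [sub_self, zero_mul, zero_mul, add_zero, zero_sub, neg_mul, neg_inj] at h1
      rw [h1] at h2
      exact pos_of_mul_pos_right h2 (by linarith)
    rcases hxb.eq_or_lt with h' | h'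
    · have h1 := hderV δ x hδ
      have h2 := hneg δ hδ x (by linarith) (by rw [← h', hb1])
      have h3 : x + b δ = 0 := by linarith
      rw [h3, mul_zero, zero_mul, add_zero, sub_zero] at h1
      have h4 : 0 < (a δ - x) * L ((δ, a δ), x, -b δ) := by linarith
      exact pos_of_mul_pos_right h4 (by linarith)
    have hlt : V δ x < 1 := by
      rcases lt_trichotomy x 0 with h3 | h3 | h3
      · have := hb2 (-x) (by linarith) (by linarith)
        simpa using this
      · rw [h3]; exact h0 δ
      · exact ha2 x h3 h
    have h4 := hfac δ x hδ
    have h5 : 0 < (a δ - x) * (x + b δ) * L ((δ, a δ), x, -b δ) := by linarith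
    exact pos_of_mul_pos_right h5 (mul_nonneg (by linarith) (by linarith))
  · intro δ x hδ hx
    obtain ⟨-, ha0, -, -, ha3⟩ := ha δ hδ
    obtain ⟨-, hb0, -, -, hb3⟩ := hb δ hδ
    rw [lt_abs] at hx
    rcases hx with h | h
    · exact ha3 x (by linarith)
    · have := hb3 (-x) (by linarith)
      simpa using this
  · intro δ hδ
    linarith [(hb δ hδ).2.1]
  · intro δ hδ
    linarith [(ha δ hδ).2.1]

/-! ### The angle variable of a potential well -/

namespace WellFamily

variable {V : ℝ → ℝ → ℝ} {d₀ : ℝ} (W : WellFamily V d₀)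

/-- The speed of the auxiliary angle `α`, where `x = c + d cos α`. -/
def speed (δ α : ℝ) : ℝ := Real.sqrt (2 * W.Q δ (W.c δ + W.d δ * Real.cos α))

/-- With x = c + d cos α and y = -d sin α · `speed`, the equation x' = y reads α' = `speed`; the
integral is therefore the time elapsed from the right turning point. -/
def phase (δ α : ℝ) : ℝ := ∫ s in (0 : ℝ)..α, 1 / W.speed δ s

def period (δ : ℝ) : ℝ := W.phase δ (2 * Real.pi)

def freq (δ : ℝ) : ℝ := 2 * Real.pi / W.period δ

/-- The angle variable as a function of the auxiliary angle. -/
def Theta (δ α : ℝ) : ℝ := W.freq δ * W.phase δ α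

/-- The auxiliary angle as a function of the angle variable. -/
def aux (δ φ : ℝ) : ℝ := Function.invFun (W.Theta δ) φ

def X (δ φ : ℝ) : ℝ := W.c δ + W.d δ * Real.cos (W.aux δ φ)

def Y (δ φ : ℝ) : ℝ := -(W.d δ * Real.sin (W.aux δ φ) * W.speed δ (W.aux δ φ))

variable {W} {δ : ℝ}

theorem abs_cos_le (hδ : |δ| < d₀) (α : ℝ) :
    |W.c δ + W.d δ * Real.cos α - W.c δ| ≤ W.d δ := by
  rw [add_sub_cancel_left, abs_mul, abs_of_pos (W.d_pos δ hδ)]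
  exact mul_le_of_le_one_right (W.d_pos δ hδ).le (Real.abs_cos_le_one α)

theorem Q_cos_pos (hδ : |δ| < d₀) (α : ℝ) : 0 < W.Q δ (W.c δ + W.d δ * Real.cos α) :=
  W.Q_pos δ _ hδ (abs_cos_le hδ α)

theorem speed_pos (hδ : |δ| < d₀) (α : ℝ) : 0 < W.speed δ α :=
  Real.sqrt_pos.2 (mul_pos two_pos (Q_cos_pos hδ α))

theorem speed_sq (hδ : |δ| < d₀) (α : ℝ) :
    W.speed δ α ^ 2 = 2 * W.Q δ (W.c δ + W.d δ * Real.cos α) :=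
  Real.sq_sqrt (mul_pos two_pos (Q_cos_pos hδ α)).le

theorem speed_periodic (δ : ℝ) : Function.Periodic (W.speed δ) (2 * Real.pi) := by
  intro α
  simp [speed]

theorem smooth_c_fst (hδ : |δ| < d₀) (α : ℝ) :
    ContDiffAt ℝ ∞ (fun z : ℝ × ℝ => W.c z.1) (δ, α) :=
  ContDiffAt.comp (δ, α) (g := W.c) (W.smooth_c δ hδ) contDiffAt_fst

theorem smooth_d_fst (hδ : |δ| < d₀) (α : ℝ) :
    ContDiffAt ℝ ∞ (fun z : ℝ × ℝ => W.d z.1) (δ, α) :=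
  ContDiffAt.comp (δ, α) (g := W.d) (W.smooth_d δ hδ) contDiffAt_fst

theorem smooth_speed (hδ : |δ| < d₀) (α : ℝ) :
    ContDiffAt ℝ ∞ (fun z : ℝ × ℝ => W.speed z.1 z.2) (δ, α) := by
  have h1 : ContDiffAt ℝ ∞ (fun z : ℝ × ℝ => (z.1, W.c z.1 + W.d z.1 * Real.cos z.2)) (δ, α) :=
    contDiffAt_fst.prodMk ((smooth_c_fst hδ α).add ((smooth_d_fst hδ α).mul contDiffAt_snd.cos))
  have h2 : ContDiffAt ℝ ∞ (fun z : ℝ × ℝ => W.Q z.1 (W.c z.1 + W.d z.1 * Real.cos z.2)) (δ, α) :=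
    ContDiffAt.comp (δ, α) (g := fun z : ℝ × ℝ => W.Q z.1 z.2) (W.smooth_Q δ _ hδ) h1
  exact (contDiffAt_const.mul h2).sqrt (mul_pos two_pos (Q_cos_pos hδ α)).ne'

theorem contDiff_speed (hδ : |δ| < d₀) : ContDiff ℝ ∞ (W.speed δ) :=
  contDiff_iff_contDiffAt.2 fun α =>
    (smooth_speed hδ α).comp α (contDiffAt_const.prodMk contDiffAt_id)

theorem hasDerivAt_phase (hδ : |δ| < d₀) (α : ℝ) :
    HasDerivAt (W.phase δ) (1 / W.speed δ α) α := by
  have hc : Continuous fun s => 1 / W.speed δ s :=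
    continuous_const.div (contDiff_speed hδ).continuous fun s => (speed_pos hδ s).ne'
  exact intervalIntegral.integral_hasDerivAt_right (hc.intervalIntegrable _ _)
    (hc.stronglyMeasurableAtFilter _ _) hc.continuousAt

/-- The integrand is smooth only for scales below d₀ and the upper limit varies. A cut-off in δ
removes the first obstacle, rescaling to [0, 1] the second. -/
theorem smooth_phase (hδ : |δ| < d₀) (α : ℝ) :
    ContDiffAt ℝ ∞ (fun z : ℝ × ℝ => W.phase z.1 z.2) (δ, α) := by
  obtain ⟨χ, hχ, hχd, r, hr, hχr⟩ := exists_cutoff δ (sub_pos.2 hδ)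
  have hχ0 : ∀ x, |χ x| < d₀ := by
    intro x
    have := abs_sub_abs_le_abs_sub (χ x) δ
    linarith [hχd x]
  have hF : ContDiff ℝ ∞ fun w : (ℝ × ℝ) × ℝ => 1 / W.speed (χ w.1.1) (w.1.2 * w.2) := by
    rw [contDiff_iff_contDiffAt]
    intro w
    refine contDiffAt_const.div ?_ (speed_pos (hχ0 _) _).ne'
    exact ContDiffAt.comp w (g := fun z : ℝ × ℝ => W.speed z.1 z.2)
      (f := fun w : (ℝ × ℝ) × ℝ => (χ w.1.1, w.1.2 * w.2)) (smooth_speed (hχ0 _) _)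
      (by fun_prop)
  have h1 : ContDiff ℝ ∞ fun z : ℝ × ℝ => z.2 * ∫ s in (0 : ℝ)..1, 1 / W.speed (χ z.1) (z.2 * s) :=
    contDiff_snd.mul (contDiff_integral_param hF)
  refine h1.contDiffAt.congr_of_eventuallyEq ?_
  have hn : ∀ᶠ z : ℝ × ℝ in 𝓝 (δ, α), |z.1 - δ| < r :=
    (by fun_prop : Continuous fun z : ℝ × ℝ => |z.1 - δ|).continuousAt.eventually_lt_const
      (by simpa using hr)
  filter_upwards [hn] with z hz
  rw [hχr _ hz.le, intervalIntegral.mul_integral_comp_mul_left (f := fun s => 1 / W.speed z.1 s)]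
  simp [phase]

theorem phase_zero (δ : ℝ) : W.phase δ 0 = 0 := by simp [phase]

theorem strictMono_phase (hδ : |δ| < d₀) : StrictMono (W.phase δ) :=
  strictMono_of_deriv_pos fun α => by
    rw [(hasDerivAt_phase hδ α).deriv]
    exact one_div_pos.2 (speed_pos hδ α)

theorem period_pos (hδ : |δ| < d₀) : 0 < W.period δ := by
  have := strictMono_phase (W := W) hδ Real.two_pi_pos
  rwa [phase_zero] at this

theorem freq_pos (hδ : |δ| < d₀) : 0 < W.freq δ := div_pos Real.two_pi_pos (period_pos hδ)

theorem smooth_period (hδ : |δ| < d₀) : ContDiffAt ℝ ∞ W.period δ :=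
  ContDiffAt.comp δ (g := fun z : ℝ × ℝ => W.phase z.1 z.2) (f := fun δ => (δ, 2 * Real.pi))
    (smooth_phase hδ _) (contDiffAt_id.prodMk contDiffAt_const)

theorem smooth_freq (hδ : |δ| < d₀) : ContDiffAt ℝ ∞ W.freq δ :=
  contDiffAt_const.div (smooth_period hδ) (period_pos hδ).ne'

theorem phase_add_two_pi (hδ : |δ| < d₀) (α : ℝ) :
    W.phase δ (α + 2 * Real.pi) = W.phase δ α + W.period δ := by
  have hc : Continuous fun s => 1 / W.speed δ s :=
    continuous_const.div (contDiff_speed hδ).continuous fun s => (speed_pos hδ s).ne'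
  have hp : Function.Periodic (fun s => 1 / W.speed δ s) (2 * Real.pi) := fun s => by
    dsimp only
    rw [speed_periodic δ s]
  unfold period phase
  rw [← intervalIntegral.integral_add_adjacent_intervals (hc.intervalIntegrable 0 α)
    (hc.intervalIntegrable α _), hp.intervalIntegral_add_eq α 0, zero_add]

theorem smooth_Theta (hδ : |δ| < d₀) (α : ℝ) :
    ContDiffAt ℝ ∞ (fun z : ℝ × ℝ => W.Theta z.1 z.2) (δ, α) :=
  (ContDiffAt.comp (δ, α) (g := W.freq) (smooth_freq hδ) contDiffAt_fst).mul (smooth_phase hδ α)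

theorem hasDerivAt_Theta (hδ : |δ| < d₀) (α : ℝ) :
    HasDerivAt (W.Theta δ) (W.freq δ / W.speed δ α) α := by
  have := (hasDerivAt_phase (W := W) hδ α).const_mul (W.freq δ)
  rwa [mul_one_div] at this

theorem Theta_zero (δ : ℝ) : W.Theta δ 0 = 0 := by simp [Theta, phase_zero]

theorem strictMono_Theta (hδ : |δ| < d₀) : StrictMono (W.Theta δ) :=
  (strictMono_phase hδ).const_mul (freq_pos hδ)

theorem Theta_add_two_pi (hδ : |δ| < d₀) (α : ℝ) :
    W.Theta δ (α + 2 * Real.pi) = W.Theta δ α + 2 * Real.pi := by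
  unfold Theta
  rw [phase_add_two_pi hδ, mul_add]
  congr 1
  unfold freq
  have := (period_pos (W := W) hδ).ne'
  field_simp

theorem Theta_add_int_mul (hδ : |δ| < d₀) (α : ℝ) (k : ℤ) :
    W.Theta δ (α + k * (2 * Real.pi)) = W.Theta δ α + k * (2 * Real.pi) := by
  have hp : Function.Periodic (fun α => W.Theta δ α - α) (2 * Real.pi) := fun α => by
    dsimp only
    rw [Theta_add_two_pi hδ]
    ring
  have := hp.int_mul k α
  linarith

theorem Theta_surjective (hδ : |δ| < d₀) : Function.Surjective (W.Theta δ) := by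
  intro y
  have hc : Continuous (W.Theta δ) :=
    continuous_iff_continuousAt.2 fun α => (hasDerivAt_Theta hδ α).continuousAt
  have hT : ∀ k : ℤ, W.Theta δ (k * (2 * Real.pi)) = k * (2 * Real.pi) := fun k => by
    have := Theta_add_int_mul (W := W) hδ 0 k
    simpa only [Theta_zero, zero_add] using this
  set k := ⌊y / (2 * Real.pi)⌋
  have h1 : (k : ℝ) * (2 * Real.pi) ≤ y := by
    have := Int.floor_le (y / (2 * Real.pi))
    rwa [le_div_iff₀ Real.two_pi_pos] at this
  have h2 : y ≤ ((k + 1 : ℤ) : ℝ) * (2 * Real.pi) := by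
    have := Int.lt_floor_add_one (y / (2 * Real.pi))
    rw [div_lt_iff₀ Real.two_pi_pos] at this
    push_cast
    exact this.le
  obtain ⟨x, -, hx⟩ := intermediate_value_Icc (h1.trans h2) hc.continuousOn
    (show y ∈ Set.Icc _ _ by rw [hT, hT]; exact ⟨h1, h2⟩)
  exact ⟨x, hx⟩

theorem Theta_aux (hδ : |δ| < d₀) (φ : ℝ) : W.Theta δ (W.aux δ φ) = φ :=
  Function.invFun_eq (Theta_surjective hδ φ)

theorem aux_Theta (hδ : |δ| < d₀) (α : ℝ) : W.aux δ (W.Theta δ α) = α :=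
  (strictMono_Theta hδ).injective (Theta_aux hδ _)

theorem aux_add_two_pi (hδ : |δ| < d₀) (φ : ℝ) :
    W.aux δ (φ + 2 * Real.pi) = W.aux δ φ + 2 * Real.pi := by
  apply (strictMono_Theta (W := W) hδ).injective
  rw [Theta_aux hδ, Theta_add_two_pi hδ, Theta_aux hδ]

theorem aux_zero (hδ : |δ| < d₀) : W.aux δ 0 = 0 := by
  have := aux_Theta (W := W) hδ 0
  rwa [Theta_zero] at this

/-- The implicit function for Θ(δ, α) = φ agrees with the inverse because Θ(δ, ·) is injective. -/
theorem smooth_aux (hδ : |δ| < d₀) (φ : ℝ) :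
    ContDiffAt ℝ ∞ (fun z : ℝ × ℝ => W.aux z.1 z.2) (δ, φ) := by
  have hf : ContDiffAt ℝ ∞ (fun w : (ℝ × ℝ) × ℝ => W.Theta w.1.1 w.2 - w.1.2)
      ((δ, φ), W.aux δ φ) := by
    refine ContDiffAt.sub ?_ (by fun_prop)
    exact ContDiffAt.comp ((δ, φ), W.aux δ φ) (g := fun z : ℝ × ℝ => W.Theta z.1 z.2)
      (f := fun w : (ℝ × ℝ) × ℝ => (w.1.1, w.2)) (smooth_Theta hδ _) (by fun_prop)
  obtain ⟨g, hg, -, hge⟩ := exists_implicit hf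
    ((hasDerivAt_Theta hδ (W.aux δ φ)).sub_const φ)
    (div_pos (freq_pos hδ) (speed_pos hδ _)).ne'
  refine hg.congr_of_eventuallyEq ?_
  have hn : ∀ᶠ z : ℝ × ℝ in 𝓝 (δ, φ), |z.1| < d₀ :=
    (by fun_prop : Continuous fun z : ℝ × ℝ => |z.1|).continuousAt.eventually_lt_const hδ
  filter_upwards [hn, hge] with z hz hz2
  apply (strictMono_Theta (W := W) hz).injective
  rw [Theta_aux hδ, sub_self] at hz2
  rw [Theta_aux hz]
  linarith

theorem hasDerivAt_aux (hδ : |δ| < d₀) (φ : ℝ) :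
    HasDerivAt (W.aux δ) (W.speed δ (W.aux δ φ) / W.freq δ) φ := by
  have hc : ContinuousAt (W.aux δ) φ :=
    ((smooth_aux hδ φ).continuousAt).comp (f := fun φ => (δ, φ)) (by fun_prop)
  have := HasDerivAt.of_local_left_inverse (f := W.Theta δ) (g := W.aux δ) hc
    (hasDerivAt_Theta hδ _) (div_pos (freq_pos hδ) (speed_pos hδ _)).ne'
    (Eventually.of_forall (Theta_aux hδ))
  rwa [inv_div] at this

theorem smooth_X (hδ : |δ| < d₀) (φ : ℝ) :
    ContDiffAt ℝ ∞ (fun z : ℝ × ℝ => W.X z.1 z.2) (δ, φ) :=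
  (smooth_c_fst hδ φ).add ((smooth_d_fst hδ φ).mul (smooth_aux hδ φ).cos)

theorem smooth_Y (hδ : |δ| < d₀) (φ : ℝ) :
    ContDiffAt ℝ ∞ (fun z : ℝ × ℝ => W.Y z.1 z.2) (δ, φ) := by
  refine (((smooth_d_fst hδ φ).mul (smooth_aux hδ φ).sin).mul ?_).neg
  exact ContDiffAt.comp (δ, φ) (g := fun z : ℝ × ℝ => W.speed z.1 z.2) (smooth_speed hδ _)
    (contDiffAt_fst.prodMk (smooth_aux hδ φ))

theorem X_periodic (hδ : |δ| < d₀) (φ : ℝ) : W.X δ (φ + 2 * Real.pi) = W.X δ φ := by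
  simp [X, aux_add_two_pi hδ]

theorem Y_periodic (hδ : |δ| < d₀) (φ : ℝ) : W.Y δ (φ + 2 * Real.pi) = W.Y δ φ := by
  simp [Y, aux_add_two_pi hδ, speed_periodic δ _]

theorem X_zero (hδ : |δ| < d₀) : W.X δ 0 = W.c δ + W.d δ := by simp [X, aux_zero hδ]

theorem Y_zero (hδ : |δ| < d₀) : W.Y δ 0 = 0 := by simp [Y, aux_zero hδ]

theorem energy (hδ : |δ| < d₀) (φ : ℝ) : W.Y δ φ ^ 2 / 2 + V δ (W.X δ φ) = 1 := by
  have h1 := W.factor δ (W.X δ φ) hδ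
  have h2 := speed_sq (W := W) hδ (W.aux δ φ)
  have h3 := Real.sin_sq_add_cos_sq (W.aux δ φ)
  have h4 : W.Y δ φ ^ 2 = W.d δ ^ 2 * Real.sin (W.aux δ φ) ^ 2 * W.speed δ (W.aux δ φ) ^ 2 := by
    unfold Y; ring
  rw [h2] at h4
  unfold X at h1 ⊢
  linear_combination h4 / 2 - h1 + W.d δ ^ 2 * W.Q δ (W.c δ + W.d δ * Real.cos (W.aux δ φ)) * h3

theorem hasDerivAt_X (hδ : |δ| < d₀) (φ : ℝ) :
    HasDerivAt (W.X δ) (W.Y δ φ / W.freq δ) φ := by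
  have := ((hasDerivAt_aux (W := W) hδ φ).cos.const_mul (W.d δ)).const_add (W.c δ)
  convert! this using 1
  unfold Y
  ring

/-- Differentiating `speed` brings in the derivative of Q. The same term appears when V is
differentiated through its factorization, and the two match because d² - (x - c)² = d² sin² α. -/
theorem hasDerivAt_Y (hδ : |δ| < d₀) (φ : ℝ) :
    HasDerivAt (W.Y δ) (-deriv (V δ) (W.X δ φ) / W.freq δ) φ := by
  set α := W.aux δ φ with hα
  set x := W.c δ + W.d δ * Real.cos α with hx
  have hQ : ContDiff ℝ ∞ (W.Q δ) := contDiff_iff_contDiffAt.2 fun x =>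
    (W.smooth_Q δ x hδ).comp x (contDiffAt_const.prodMk contDiffAt_id)
  have hQd : HasDerivAt (W.Q δ) (deriv (W.Q δ) x) x :=
    ((hQ.differentiable (by norm_num)) x).hasDerivAt
  have hV : HasDerivAt (V δ) (-(-(2 * (x - W.c δ)) * W.Q δ x
      + (W.d δ ^ 2 - (x - W.c δ) ^ 2) * deriv (W.Q δ) x)) x := by
    have h1 := ((((hasDerivAt_id x).sub_const (W.c δ)).pow 2).const_sub (W.d δ ^ 2)).mul hQd
    have h2 : V δ = fun x => 1 - (W.d δ ^ 2 - (x - W.c δ) ^ 2) * W.Q δ x := funext fun x => by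
      rw [← W.factor δ x hδ]; ring
    rw [h2]
    convert! h1.const_sub 1 using 1
    simp
  have hxd : HasDerivAt (fun α => W.c δ + W.d δ * Real.cos α) (W.d δ * -Real.sin α) α :=
    ((Real.hasDerivAt_cos α).const_mul _).const_add _
  have hs : HasDerivAt (W.speed δ)
      (2 * (deriv (W.Q δ) x * (W.d δ * -Real.sin α)) / (2 * W.speed δ α)) α :=
    ((hQd.comp α hxd).const_mul 2).sqrt (mul_pos two_pos (Q_cos_pos hδ α)).ne'
  have h3 := (((Real.hasDerivAt_sin α).const_mul (W.d δ)).mul hs).neg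
  have h4 := h3.comp φ (hasDerivAt_aux hδ φ)
  convert! h4 using 1
  rw [show W.X δ φ = x from rfl, hV.deriv, ← hα]
  have hsp := (speed_pos (W := W) hδ α).ne'
  have hf := (freq_pos (W := W) hδ).ne'
  have h5 : W.Q δ x = W.speed δ α ^ 2 / 2 := by rw [speed_sq hδ]; ring
  have h6 : W.d δ ^ 2 - (x - W.c δ) ^ 2 = W.d δ ^ 2 * Real.sin α ^ 2 := by
    have := Real.sin_sq_add_cos_sq α
    rw [hx]
    linear_combination -W.d δ ^ 2 * this
  rw [h5, h6, hx]
  field_simp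
  ring

/-- The two quantities whose squares sum to 1 are the cosine and sine of the auxiliary angle of (x,
y). They serve both for surjectivity and for lifting whole solutions. -/
theorem of_energy (hδ : |δ| < d₀) {x y : ℝ} (h : y ^ 2 / 2 + V δ x = 1) :
    0 < W.Q δ x ∧
      ((x - W.c δ) / W.d δ) ^ 2 + (-y / (W.d δ * Real.sqrt (2 * W.Q δ x))) ^ 2 = 1 := by
  have hx : |x - W.c δ| ≤ W.d δ := by
    by_contra hcon
    have := W.one_lt δ x hδ (not_le.1 hcon)
    nlinarith [sq_nonneg y]
  have hQ := W.Q_pos δ x hδ hx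
  refine ⟨hQ, ?_⟩
  have hd := (W.d_pos δ hδ).ne'
  have h1 := W.factor δ x hδ
  rw [div_pow, div_pow, mul_pow, Real.sq_sqrt (by positivity)]
  field_simp
  linear_combination 2 * h + 2 * h1

theorem of_cos_sin (hδ : |δ| < d₀) {x y α : ℝ} (hQ : 0 < W.Q δ x)
    (hc : Real.cos α = (x - W.c δ) / W.d δ)
    (hs : Real.sin α = -y / (W.d δ * Real.sqrt (2 * W.Q δ x))) :
    W.X δ (W.Theta δ α) = x ∧ W.Y δ (W.Theta δ α) = y := by
  have hd := (W.d_pos δ hδ).ne'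
  have hX : W.c δ + W.d δ * Real.cos α = x := by
    rw [hc]
    field_simp
    ring
  have hq : Real.sqrt (2 * W.Q δ x) ≠ 0 := (Real.sqrt_pos.2 (by positivity)).ne'
  unfold X Y
  rw [aux_Theta hδ]
  refine ⟨hX, ?_⟩
  unfold speed
  rw [hX, hs]
  field_simp

/-- Equal x gives equal cosines, hence equal speeds, since `speed` sees α only through cos α; then
equal y gives equal sines. -/
theorem inj (hδ : |δ| < d₀) {φ φ' : ℝ} (hX : W.X δ φ = W.X δ φ') (hY : W.Y δ φ = W.Y δ φ') :
    ∃ k : ℤ, φ' = φ + k * (2 * Real.pi) := by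
  have hd := (W.d_pos δ hδ).ne'
  have hc : Real.cos (W.aux δ φ) = Real.cos (W.aux δ φ') := by
    unfold X at hX
    exact mul_left_cancel₀ hd (add_left_cancel hX)
  have hs : Real.sin (W.aux δ φ) = Real.sin (W.aux δ φ') := by
    have h1 : W.speed δ (W.aux δ φ) = W.speed δ (W.aux δ φ') := by unfold speed; rw [hc]
    unfold Y at hY
    rw [h1, neg_inj] at hY
    exact mul_left_cancel₀ hd (mul_right_cancel₀ (speed_pos hδ _).ne' hY)
  have h2 : ((W.aux δ φ' : ℝ) : Real.Angle) = (W.aux δ φ : ℝ) :=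
    Real.Angle.cos_sin_inj hc.symm hs.symm
  rw [Real.Angle.angle_eq_iff_two_pi_dvd_sub] at h2
  obtain ⟨k, hk⟩ := h2
  refine ⟨k, ?_⟩
  rw [← Theta_aux (W := W) hδ φ', ← Theta_aux (W := W) hδ φ, ← Theta_add_int_mul hδ]
  congr 1
  linarith

/-- The period as an integral over the well. -/
theorem integral_well (hδ : |δ| < d₀) :
    ∫ x in (W.c δ - W.d δ)..(W.c δ + W.d δ), Real.sqrt 2 / Real.sqrt (1 - V δ x) = W.period δ := by
  have hd := W.d_pos δ hδ
  have himage : (fun α => W.c δ + W.d δ * Real.cos α) '' Set.Ioo 0 Real.pi =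
      Set.Ioo (W.c δ - W.d δ) (W.c δ + W.d δ) := by
    ext x
    constructor
    · rintro ⟨α, hα, rfl⟩
      have h1 : Real.cos α < 1 := by
        rw [← Real.cos_zero]
        exact Real.strictAntiOn_cos ⟨le_rfl, Real.pi_pos.le⟩ ⟨hα.1.le, hα.2.le⟩ hα.1
      have h2 : -1 < Real.cos α := by
        rw [← Real.cos_pi]
        exact Real.strictAntiOn_cos ⟨hα.1.le, hα.2.le⟩ ⟨Real.pi_pos.le, le_rfl⟩ hα.2
      constructor <;> dsimp only <;> nlinarith
    · rintro ⟨h1, h2⟩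
      have h3 : -1 < (x - W.c δ) / W.d δ := by rw [lt_div_iff₀ hd]; linarith
      have h4 : (x - W.c δ) / W.d δ < 1 := by rw [div_lt_iff₀ hd]; linarith
      refine ⟨Real.arccos ((x - W.c δ) / W.d δ), ⟨Real.arccos_pos.2 h4, ?_⟩, ?_⟩
      · refine lt_of_le_of_ne (Real.arccos_le_pi _) fun h => ?_
        rw [Real.arccos_eq_pi] at h
        linarith
      · dsimp only
        rw [Real.cos_arccos h3.le h4.le]
        field_simp
        ring
  have hderiv : ∀ α ∈ Set.Ioo 0 Real.pi, HasDerivWithinAt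
      (fun α => W.c δ + W.d δ * Real.cos α) (W.d δ * -Real.sin α) (Set.Ioo 0 Real.pi) α :=
    fun α _ => (((Real.hasDerivAt_cos α).const_mul _).const_add _).hasDerivWithinAt
  have hinj : Set.InjOn (fun α => W.c δ + W.d δ * Real.cos α) (Set.Ioo 0 Real.pi) := by
    intro α hα β hβ h
    exact Real.injOn_cos ⟨hα.1.le, hα.2.le⟩ ⟨hβ.1.le, hβ.2.le⟩
      (mul_left_cancel₀ hd.ne' (add_left_cancel h))
  rw [intervalIntegral.integral_of_le (by linarith), MeasureTheory.integral_Ioc_eq_integral_Ioo,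
    ← himage, MeasureTheory.integral_image_eq_integral_abs_deriv_smul measurableSet_Ioo hderiv hinj]
  -- The Jacobian d sin α cancels the vanishing square root, since 1 - V = (d sin α)² Q along the
  -- substitution.
  have hcongr : ∀ α ∈ Set.Ioo 0 Real.pi, |W.d δ * -Real.sin α| •
      (Real.sqrt 2 / Real.sqrt (1 - V δ (W.c δ + W.d δ * Real.cos α))) =
      2 * (1 / W.speed δ α) := by
    intro α hα
    have hsin := Real.sin_pos_of_pos_of_lt_pi hα.1 hα.2
    have hQ := Q_cos_pos (W := W) hδ α
    have h6 : 1 - V δ (W.c δ + W.d δ * Real.cos α) =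
        (W.d δ * Real.sin α) ^ 2 * W.Q δ (W.c δ + W.d δ * Real.cos α) := by
      rw [W.factor δ _ hδ]
      have := Real.sin_sq_add_cos_sq α
      linear_combination -W.d δ ^ 2 * W.Q δ (W.c δ + W.d δ * Real.cos α) * this
    rw [h6, Real.sqrt_mul (sq_nonneg _), Real.sqrt_sq (by positivity), smul_eq_mul, mul_neg,
      abs_neg, abs_of_pos (by positivity)]
    unfold speed
    rw [Real.sqrt_mul zero_le_two]
    have h2 := Real.sq_sqrt (zero_le_two (α := ℝ))
    have h3 := (Real.sqrt_pos.2 hQ).ne'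
    field_simp
    exact h2
  rw [MeasureTheory.setIntegral_congr_fun measurableSet_Ioo hcongr,
    ← MeasureTheory.integral_Ioc_eq_integral_Ioo,
    ← intervalIntegral.integral_of_le Real.pi_pos.le, intervalIntegral.integral_const_mul]
  have hc : Continuous fun s => 1 / W.speed δ s :=
    continuous_const.div (contDiff_speed hδ).continuous fun s => (speed_pos hδ s).ne'
  have hp : Function.Periodic (fun s => 1 / W.speed δ s) (2 * Real.pi) := fun s => by
    dsimp only
    rw [speed_periodic δ s]
  -- The well is traversed for α in (0, π), half a turn; as `speed` is even, twice this integral is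
  -- the full period.
  have h1 := hp.intervalIntegral_add_eq 0 (-Real.pi)
  rw [zero_add, show -Real.pi + 2 * Real.pi = Real.pi by ring,
    ← intervalIntegral.integral_add_adjacent_intervals (hc.intervalIntegrable (-Real.pi) 0)
    (hc.intervalIntegrable 0 Real.pi)] at h1
  have h2 := intervalIntegral.integral_comp_neg (a := -Real.pi) (b := 0)
    (fun s => 1 / W.speed δ s)
  have h3 : ∀ s, W.speed δ (-s) = W.speed δ s := fun s => by simp [speed]
  simp only [h3, neg_neg, neg_zero] at h2
  rw [h2] at h1
  unfold period phase
  rw [h1]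
  ring

end WellFamily

namespace ChirpedSystem

variable (P : ChirpedSystem)

/-! ### The rescaled potential -/

/-- The potential in the scaled variable: `V δ x = δ^(2h) U(x / δ)` for `δ ≠ 0`. -/
def V (δ x : ℝ) : ℝ :=
  x ^ (2 * P.h) / (2 * P.h) +
    ∑ i ∈ Finset.Icc 1 (2 * P.h - 1), P.u i * δ ^ (2 * P.h - i) * x ^ i

theorem contDiff_U : ContDiff ℝ ∞ P.U := by
  unfold U
  fun_prop

theorem contDiff_V : ContDiff ℝ ∞ fun z : ℝ × ℝ => P.V z.1 z.2 := by
  unfold V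
  fun_prop

theorem differentiable_U : Differentiable ℝ P.U := P.contDiff_U.differentiable (by norm_num)

theorem Hy_eq (x y : ℝ) : P.Hy x y = y := by
  have h : HasDerivAt (fun y' => P.H x y') (2 * y / 2) y := by
    simpa [H] using ((hasDerivAt_pow 2 y).div_const 2).add_const (P.U x)
  rw [Hy, h.deriv]
  ring

theorem Hx_eq (x y : ℝ) : P.Hx x y = deriv P.U x := by
  simp [Hx, H]

variable {P}

theorem V_eq {δ : ℝ} (hδ : δ ≠ 0) (x : ℝ) : P.V δ x = δ ^ (2 * P.h) * P.U (x / δ) := by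
  unfold V U
  rw [mul_add, Finset.mul_sum]
  congr 1
  · rw [div_pow]
    field_simp
  · refine Finset.sum_congr rfl fun i hi => ?_
    rw [Finset.mem_Icc] at hi
    have : δ ^ (2 * P.h) = δ ^ (2 * P.h - i) * δ ^ i := by rw [← pow_add]; congr 1; omega
    rw [this, div_pow]
    field_simp

theorem V_zero_left (x : ℝ) : P.V 0 x = x ^ (2 * P.h) / (2 * P.h) := by
  unfold V
  rw [Finset.sum_eq_zero, add_zero]
  intro i hi
  rw [Finset.mem_Icc] at hi
  rw [zero_pow (by omega)]
  simp

theorem V_zero_right (hh : 2 ≤ P.h) (δ : ℝ) : P.V δ 0 = 0 := by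
  unfold V
  rw [zero_pow (by omega), zero_div, zero_add]
  refine Finset.sum_eq_zero fun i hi => ?_
  rw [Finset.mem_Icc] at hi
  rw [zero_pow (by omega), mul_zero]

theorem U_zero (hh : 2 ≤ P.h) : P.U 0 = 0 := by
  have := V_zero_right hh (1 : ℝ)
  rw [V_eq one_ne_zero] at this
  simpa using this

theorem hasDerivAt_V {δ : ℝ} (hδ : δ ≠ 0) (hh : 2 ≤ P.h) (x : ℝ) :
    HasDerivAt (P.V δ) (δ ^ (2 * P.h - 1) * deriv P.U (x / δ)) x := by
  have h1 : P.V δ = fun x => δ ^ (2 * P.h) * P.U (x / δ) := funext (V_eq hδ)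
  have h2 := ((P.differentiable_U (x / δ)).hasDerivAt.comp x
    ((hasDerivAt_id x).div_const δ)).const_mul (δ ^ (2 * P.h))
  rw [h1]
  convert! h2 using 1
  have : δ ^ (2 * P.h) = δ ^ (2 * P.h - 1) * δ := by rw [← pow_succ]; congr 1; omega
  rw [this]
  field_simp

theorem exists_large (hh : 2 ≤ P.h) (δ : ℝ) : ∃ R, 0 < R ∧ ∀ x, R ≤ |x| → 1 ≤ P.V δ x := by
  set C := ∑ i ∈ Finset.Icc 1 (2 * P.h - 1), |P.u i * δ ^ (2 * P.h - i)| with hC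
  have hC0 : 0 ≤ C := Finset.sum_nonneg fun i _ => abs_nonneg _
  have hh' : (2 : ℝ) ≤ P.h := by exact_mod_cast hh
  -- Beyond this radius the leading term is at least (C + 1)|x|^(2h-1), while the lower terms can
  -- take away no more than C|x|^(2h-1).
  refine ⟨2 * P.h * (C + 1), by positivity, fun x hx => ?_⟩
  have hx1 : 1 ≤ |x| := by nlinarith
  have h1 : -(C * |x| ^ (2 * P.h - 1)) ≤
      ∑ i ∈ Finset.Icc 1 (2 * P.h - 1), P.u i * δ ^ (2 * P.h - i) * x ^ i := by
    rw [hC, Finset.sum_mul, ← Finset.sum_neg_distrib]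
    refine Finset.sum_le_sum fun i hi => ?_
    rw [Finset.mem_Icc] at hi
    refine (neg_le_neg ?_).trans (neg_abs_le _)
    rw [abs_mul _ (x ^ i), abs_pow]
    gcongr
    exact hi.2
  have h2 : x ^ (2 * P.h) = |x| ^ (2 * P.h - 1) * |x| := by
    rw [← pow_succ, show 2 * P.h - 1 + 1 = 2 * P.h by omega, pow_mul, pow_mul, sq_abs]
  have h4 : 1 ≤ |x| ^ (2 * P.h - 1) := one_le_pow₀ hx1
  have h3 : |x| ^ (2 * P.h - 1) * (C + 1) ≤ x ^ (2 * P.h) / (2 * P.h) := by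
    rw [h2, mul_div_assoc]
    gcongr
    rw [le_div_iff₀ (by positivity)]
    linarith
  unfold V
  nlinarith

/-- If U decreased outwards at z, its maximum on the segment from 0 to z would lie strictly inside:
not at 0, where U = 0 < E₀, nor at z. That would be a critical point above E₀. -/
theorem deriv_U_pos {E₀ z : ℝ} (hh : 2 ≤ P.h) (hE : 0 < E₀) (hc : ∀ x, E₀ < P.U x → deriv P.U x ≠ 0)
    (hz : E₀ < P.U z) : 0 < z * deriv P.U z := by
  have hz0 : z ≠ 0 := by
    rintro rfl
    rw [U_zero hh] at hz
    linarith
  by_contra hcon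
  have hneg : z * deriv P.U z < 0 :=
    lt_of_le_of_ne (not_lt.1 hcon) (mul_ne_zero hz0 (hc z hz))
  let v : ℝ → ℝ := fun s => P.U (s * z)
  have hv : ∀ s, HasDerivAt v (deriv P.U (s * z) * z) s := fun s =>
    (P.differentiable_U _).hasDerivAt.comp s (by simpa using (hasDerivAt_id s).mul_const z)
  obtain ⟨m, hm, hmax⟩ := isCompact_Icc.exists_isMaxOn (s := Set.Icc (0 : ℝ) 1)
    ⟨0, by simp⟩ (fun s _ => (hv s).continuousAt.continuousWithinAt)
  have h1 : P.U z ≤ v m := by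
    have := hmax (show (1 : ℝ) ∈ Set.Icc (0 : ℝ) 1 by simp)
    simpa [v] using this
  have hm0 : m ≠ 0 := by
    rintro rfl
    simp only [v, zero_mul, U_zero hh] at h1
    linarith
  have hm1 : m ≠ 1 := by
    rintro rfl
    have h2 := hv 1
    rw [one_mul] at h2
    have hlt : deriv P.U z * z < 0 := by linarith [mul_comm z (deriv P.U z)]
    have h3 : ∀ᶠ s in 𝓝[<] (1 : ℝ), v 1 < v s := by
      have h4 := (hasDerivAt_iff_tendsto_slope_left_right.1 h2).1
      have h5 := h4.eventually (gt_mem_nhds hlt)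
      filter_upwards [h5, self_mem_nhdsWithin] with s hs hs1
      rw [slope_def_field] at hs
      have hs1' : s - 1 < 0 := sub_neg.2 hs1
      have := (div_neg_iff.1 hs)
      rcases this with h | h <;> linarith [h.1, h.2]
    have h6 : ∀ᶠ s in 𝓝[<] (1 : ℝ), s ∈ Set.Icc (0 : ℝ) 1 :=
      Filter.mem_of_superset (Ioo_mem_nhdsLT zero_lt_one) fun s hs => ⟨hs.1.le, hs.2.le⟩
    obtain ⟨s, hs1, hs2⟩ := (h3.and h6).exists
    exact absurd (hmax hs2) (not_le.2 hs1)
  have hloc : IsLocalMax v m := hmax.isLocalMax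
    (Icc_mem_nhds (lt_of_le_of_ne hm.1 (Ne.symm hm0)) (lt_of_le_of_ne hm.2 hm1))
  have h7 := hloc.hasDerivAt_eq_zero (hv m)
  exact hc (m * z) (hz.trans_le h1) ((mul_eq_zero.1 h7).resolve_right hz0)

/-! ### The scale of an energy -/

variable (P) in
/-- `δ = E^(-1/(2h))`. -/
def scale (E : ℝ) : ℝ := E ^ (-(1 / (2 * P.h : ℝ)))

theorem scale_pos {E : ℝ} (hE : 0 < E) : 0 < P.scale E := Real.rpow_pos_of_pos hE _

theorem scale_pow (hh : 2 ≤ P.h) {E : ℝ} (hE : 0 < E) : P.scale E ^ (2 * P.h) = E⁻¹ := by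
  have hh' : (2 : ℝ) ≤ P.h := by exact_mod_cast hh
  unfold scale
  rw [← Real.rpow_natCast, ← Real.rpow_mul hE.le, ← Real.rpow_neg_one]
  congr 1
  push_cast
  field_simp

theorem scale_lt (hh : 2 ≤ P.h) {E E' : ℝ} (hE : 0 < E) (hEE : E < E') :
    P.scale E' < P.scale E := by
  have hh' : (2 : ℝ) ≤ P.h := by exact_mod_cast hh
  exact Real.rpow_lt_rpow_of_neg hE hEE (by rw [neg_lt_zero]; positivity)

theorem scale_pow_inv (hh : 2 ≤ P.h) {δ : ℝ} (hδ : 0 < δ) : P.scale ((δ ^ (2 * P.h))⁻¹) = δ := by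
  have h1 := scale_pow hh (E := (δ ^ (2 * P.h))⁻¹) (by positivity)
  rw [inv_inv] at h1
  exact (pow_left_inj₀ (scale_pos (by positivity)).le hδ.le (by omega)).1 h1

theorem abs_scale_lt (hh : 2 ≤ P.h) {E E₀ : ℝ} (hE₀ : 0 < E₀) (hE : E₀ < E) :
    |P.scale E| < P.scale E₀ := by
  rw [abs_of_pos (scale_pos (hE₀.trans hE))]
  exact scale_lt hh hE₀ hE

/-- The factor δ^(2h) stands for 1/E, so that all later computations are algebraic in δ. -/
theorem hasDerivAt_scale (hh : 2 ≤ P.h) {E : ℝ} (hE : 0 < E) :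
    HasDerivAt P.scale (-(1 / (2 * P.h)) * P.scale E * P.scale E ^ (2 * P.h)) E := by
  have h := Real.hasDerivAt_rpow_const (x := E) (p := -(1 / (2 * P.h : ℝ))) (Or.inl hE.ne')
  rw [scale_pow hh hE]
  convert! h using 1
  unfold scale
  rw [Real.rpow_sub_one hE.ne']
  ring

theorem contDiffAt_scale {E : ℝ} (hE : 0 < E) : ContDiffAt ℝ ∞ P.scale E :=
  Real.contDiffAt_rpow_const_of_ne hE.ne'

theorem lt_inv_of_abs_lt_scale (hh : 2 ≤ P.h) {E₀ δ : ℝ} (hE : 0 < E₀) (h : |δ| < P.scale E₀)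
    (hδ : δ ≠ 0) : E₀ < (δ ^ (2 * P.h))⁻¹ := by
  have h1 : |δ| ^ (2 * P.h) < P.scale E₀ ^ (2 * P.h) :=
    pow_lt_pow_left₀ h (abs_nonneg δ) (by omega)
  rw [scale_pow hh hE, pow_mul, sq_abs, ← pow_mul] at h1
  rw [lt_inv_comm₀ hE (by rw [pow_mul]; positivity)]
  exact h1

/-- For δ ≠ 0 the region V ≥ 1 corresponds to energies δ^(-2h) > E₀ of the original potential, where
U grows outwards; for δ = 0 the potential is a pure even power. So V grows outwards at and above
level 1 for every admissible δ, which is all that the well construction needs. -/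
theorem nonempty_wellFamily {E₀ : ℝ} (hh : 2 ≤ P.h) (hE : 0 < E₀)
    (hc : ∀ x, E₀ < P.U x → deriv P.U x ≠ 0) : Nonempty (WellFamily P.V (P.scale E₀)) := by
  have hh' : (2 : ℝ) ≤ P.h := by exact_mod_cast hh
  have key : ∀ δ, |δ| < P.scale E₀ → ∀ x, 1 ≤ P.V δ x → 0 < x * deriv (P.V δ) x := by
    intro δ hδ x hx
    by_cases h0 : δ = 0
    · subst h0
      have h1 : P.V 0 = fun x : ℝ => x ^ (2 * P.h) / (2 * P.h : ℝ) := funext V_zero_left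
      have h2 : HasDerivAt (P.V 0) (x ^ (2 * P.h - 1)) x := by
        rw [h1]
        convert! (hasDerivAt_pow (2 * P.h) x).div_const (2 * P.h : ℝ) using 1
        push_cast
        field_simp
      rw [h2.deriv, ← pow_succ', show 2 * P.h - 1 + 1 = 2 * P.h by omega, pow_mul]
      rw [V_zero_left] at hx
      have hx0 : x ≠ 0 := by
        rintro rfl
        rw [zero_pow (by omega), zero_div] at hx
        linarith
      positivity
    · rw [(hasDerivAt_V h0 hh x).deriv]
      have hlt := lt_inv_of_abs_lt_scale hh hE hδ h0
      have hpos : 0 < δ ^ (2 * P.h) := by rw [pow_mul]; positivity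
      have h1 : E₀ < P.U (x / δ) := by
        refine hlt.trans_le ?_
        rw [V_eq h0] at hx
        rw [inv_le_iff_one_le_mul₀' hpos]
        exact hx
      have h2 := deriv_U_pos hh hE hc h1
      have h3 : x * (δ ^ (2 * P.h - 1) * deriv P.U (x / δ)) =
          δ ^ (2 * P.h) * (x / δ * deriv P.U (x / δ)) := by
        have : δ ^ (2 * P.h) = δ ^ (2 * P.h - 1) * δ := by rw [← pow_succ]; congr 1; omega
        rw [this]
        field_simp
      rw [h3]
      exact mul_pos hpos h2
  refine exists_wellFamily P.contDiff_V (fun δ => by rw [V_zero_right hh]; exact zero_lt_one)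
    ?_ ?_ ?_ ?_
  · intro δ hδ x hx h1
    exact pos_of_mul_pos_right (key δ hδ x h1) hx.le
  · intro δ hδ x hx h1
    have := key δ hδ x h1
    by_contra hcon
    nlinarith [not_lt.1 hcon]
  · intro δ
    obtain ⟨R, hR, h⟩ := exists_large hh δ
    exact ⟨R, hR, h R (le_abs_self R)⟩
  · intro δ
    obtain ⟨R, hR, h⟩ := exists_large hh δ
    exact ⟨-R, by linarith, h (-R) (by rw [abs_neg]; exact le_abs_self R)⟩

theorem U_eq {δ : ℝ} (hδ : δ ≠ 0) (x : ℝ) : P.U x = (δ ^ (2 * P.h))⁻¹ * P.V δ (δ * x) := by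
  rw [V_eq hδ, mul_div_cancel_left₀ _ hδ, inv_mul_cancel_left₀ (pow_ne_zero _ hδ)]

theorem U_scale_eq (hh : 2 ≤ P.h) {E : ℝ} (hE : 0 < E) (x : ℝ) :
    P.U x = E * P.V (P.scale E) (P.scale E * x) := by
  rw [U_eq (scale_pos hE).ne', scale_pow hh hE, inv_inv]

/-! ### The energy-angle variables -/

section EnergyAngle

variable {E₀ : ℝ} (W : WellFamily P.V (P.scale E₀))

/-- At energy E = δ^(-2h), x has the size E^(1/(2h)) = δ^(-1) and y the size E^(1/2) = δ^(-h); the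
scaled solution is blown up accordingly. -/
def eaX (φ E : ℝ) : ℝ := W.X (P.scale E) φ / P.scale E

def eaY (φ E : ℝ) : ℝ := W.Y (P.scale E) φ / P.scale E ^ P.h

theorem setOf_U_eq (hh : 2 ≤ P.h) (hE₀ : 0 < E₀) {E : ℝ} (hE : E₀ < E) : {x | P.U x = E} =
    {(W.c (P.scale E) - W.d (P.scale E)) / P.scale E,
      (W.c (P.scale E) + W.d (P.scale E)) / P.scale E} := by
  have hE' := hE₀.trans hE
  have hδ := scale_pos (P := P) hE'
  have hδ' := abs_scale_lt hh hE₀ hE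
  set δ := P.scale E
  ext x
  have h1 : P.U x = E ↔ P.V δ (δ * x) = 1 := by
    rw [U_scale_eq hh hE']
    constructor
    · intro h
      exact mul_left_cancel₀ hE'.ne' (by rw [h, mul_one])
    · intro h
      rw [h, mul_one]
  simp only [Set.mem_ofPred_eq, Set.mem_insert_iff, Set.mem_singleton_iff, h1]
  have hf := W.factor δ (δ * x) hδ'
  rw [eq_div_iff hδ.ne', eq_div_iff hδ.ne', mul_comm x δ]
  constructor
  · intro h
    rw [h, sub_self] at hf
    have hle : |δ * x - W.c δ| ≤ W.d δ := by
      by_contra hcon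
      linarith [W.one_lt δ (δ * x) hδ' (not_le.1 hcon)]
    have h2 := (mul_eq_zero.1 hf.symm).resolve_right (W.Q_pos δ _ hδ' hle).ne'
    have h3 : (δ * x - (W.c δ - W.d δ)) * (δ * x - (W.c δ + W.d δ)) = 0 := by linarith
    rcases mul_eq_zero.1 h3 with h | h
    · left; linarith
    · right; linarith
  · rintro (h | h) <;> rw [h] at hf ⊢ <;> ring_nf at hf ⊢ <;> linarith

theorem xPlus_eq (hh : 2 ≤ P.h) (hE₀ : 0 < E₀) {E : ℝ} (hE : E₀ < E) : P.xPlus E =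
    (W.c (P.scale E) + W.d (P.scale E)) / P.scale E := by
  have hd := W.d_pos _ (abs_scale_lt hh hE₀ hE)
  have hδ := scale_pos (P := P) (hE₀.trans hE)
  rw [xPlus, setOf_U_eq W hh hE₀ hE, csSup_pair]
  exact max_eq_right (by gcongr; linarith)

theorem xMinus_eq (hh : 2 ≤ P.h) (hE₀ : 0 < E₀) {E : ℝ} (hE : E₀ < E) : P.xMinus E =
    (W.c (P.scale E) - W.d (P.scale E)) / P.scale E := by
  have hd := W.d_pos _ (abs_scale_lt hh hE₀ hE)
  have hδ := scale_pos (P := P) (hE₀.trans hE)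
  rw [xMinus, setOf_U_eq W hh hE₀ hE, csInf_pair]
  exact min_eq_left (by gcongr; linarith)

/-- Lengths scale as δ^(-1) and velocities as δ^(-h), hence times as δ^(h-1). -/
theorem T_eq (hh : 2 ≤ P.h) (hE₀ : 0 < E₀) {E : ℝ} (hE : E₀ < E) :
    P.T E = P.scale E ^ (P.h - 1) * W.period (P.scale E) := by
  have hE' := hE₀.trans hE
  have hδ := scale_pos (P := P) hE'
  have hδ' := abs_scale_lt hh hE₀ hE
  rw [T, xMinus_eq W hh hE₀ hE, xPlus_eq W hh hE₀ hE, ← WellFamily.integral_well hδ']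
  set δ := P.scale E with hδdef
  have h1 : ∀ x, Real.sqrt 2 / Real.sqrt (E - P.U x) =
      δ ^ P.h * (Real.sqrt 2 / Real.sqrt (1 - P.V δ (δ * x))) := by
    intro x
    have h2 : E - P.U x = (1 - P.V δ (δ * x)) / (δ ^ P.h) ^ 2 := by
      rw [U_scale_eq hh hE', ← pow_mul, mul_comm P.h 2, scale_pow hh hE', ← hδdef]
      field_simp
    rw [h2, Real.sqrt_div' _ (by positivity), Real.sqrt_sq (by positivity), div_div_eq_mul_div]
    ring
  simp only [h1]
  rw [intervalIntegral.integral_const_mul,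
    intervalIntegral.integral_comp_mul_left
      (f := fun y => Real.sqrt 2 / Real.sqrt (1 - P.V δ y)) hδ.ne', mul_div_cancel₀ _ hδ.ne',
    mul_div_cancel₀ _ hδ.ne', smul_eq_mul, ← mul_assoc]
  congr 1
  obtain ⟨k, hk⟩ : ∃ k, P.h = k + 1 := ⟨P.h - 1, by omega⟩
  rw [hk, Nat.add_sub_cancel, pow_succ, mul_assoc, mul_inv_cancel₀ hδ.ne', mul_one]

/-- All growth of the frequency with the energy sits in the explicit power of δ; the other factor is
smooth and positive at δ = 0. -/
theorem omega_eq (hh : 2 ≤ P.h) (hE₀ : 0 < E₀) {E : ℝ} (hE : E₀ < E) :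
    P.omega E = W.freq (P.scale E) / P.scale E ^ (P.h - 1) := by
  rw [omega, T_eq W hh hE₀ hE, WellFamily.freq]
  rw [div_div, mul_comm (W.period _)]

theorem deriv_U_eaX (hh : 2 ≤ P.h) {E : ℝ} (hE : 0 < E) (φ : ℝ) : deriv P.U (eaX W φ E) =
    deriv (P.V (P.scale E)) (W.X (P.scale E) φ) / P.scale E ^ (2 * P.h - 1) := by
  have hδ := scale_pos (P := P) hE
  rw [(hasDerivAt_V hδ.ne' hh _).deriv, eaX]
  field_simp

theorem isEnergyAngle_ea (hh : 2 ≤ P.h) (hE₀ : 0 < E₀) : P.IsEnergyAngle E₀ (eaX W) (eaY W) := by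
  intro E hE
  have hE' := hE₀.trans hE
  have hδ := scale_pos (P := P) hE'
  have hδ' := abs_scale_lt hh hE₀ hE
  have hf := (WellFamily.freq_pos (W := W) hδ').ne'
  obtain ⟨k, hk⟩ : ∃ k, P.h = k + 2 := ⟨P.h - 2, by omega⟩
  refine ⟨?_, ?_, fun φ => ⟨?_, ?_⟩⟩
  · rw [eaX, WellFamily.X_zero hδ', xPlus_eq W hh hE₀ hE]
  · rw [eaY, WellFamily.Y_zero hδ', zero_div]
  · have h := (WellFamily.hasDerivAt_X (W := W) hδ' φ).div_const (P.scale E)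
    convert! h using 1
    rw [Hy_eq, omega_eq W hh hE₀ hE, eaY, show P.h - 1 = k + 1 by omega, hk]
    field_simp
    ring
  · have h := (WellFamily.hasDerivAt_Y (W := W) hδ' φ).div_const (P.scale E ^ P.h)
    convert! h using 1
    rw [Hx_eq, omega_eq W hh hE₀ hE, deriv_U_eaX W hh hE', show P.h - 1 = k + 1 by omega,
      show 2 * P.h - 1 = (k + 1) + (k + 2) by omega, hk, pow_add]
    field_simp

theorem energy_ea (hh : 2 ≤ P.h) (hE₀ : 0 < E₀) {E : ℝ} (hE : E₀ < E) (φ : ℝ) :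
    P.H (eaX W φ E) (eaY W φ E) = E := by
  have hE' := hE₀.trans hE
  have hδ := scale_pos (P := P) hE'
  have h := WellFamily.energy (W := W) (abs_scale_lt hh hE₀ hE) φ
  rw [H, U_scale_eq hh hE', eaX, eaY, mul_div_cancel₀ _ hδ.ne', div_pow, ← pow_mul, mul_comm P.h 2,
    scale_pow hh hE']
  field_simp
  field_simp at h
  linarith

theorem smooth_scale_snd {E : ℝ} (hE : 0 < E) (φ : ℝ) :
    ContDiffAt ℝ ∞ (fun z : ℝ × ℝ => P.scale z.2) (φ, E) :=
  ContDiffAt.comp (φ, E) (g := P.scale) (contDiffAt_scale hE) contDiffAt_snd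

theorem smooth_eaX (hh : 2 ≤ P.h) (hE₀ : 0 < E₀) {E : ℝ} (hE : E₀ < E) (φ : ℝ) :
    ContDiffAt ℝ ∞ (fun z : ℝ × ℝ => eaX W z.1 z.2) (φ, E) := by
  have hE' := hE₀.trans hE
  have h1 := smooth_scale_snd (P := P) hE' φ
  refine ContDiffAt.div ?_ h1 (scale_pos hE').ne'
  exact ContDiffAt.comp (φ, E) (g := fun z : ℝ × ℝ => W.X z.1 z.2)
    (WellFamily.smooth_X (abs_scale_lt hh hE₀ hE) φ) (h1.prodMk contDiffAt_fst)

theorem smooth_eaY (hh : 2 ≤ P.h) (hE₀ : 0 < E₀) {E : ℝ} (hE : E₀ < E) (φ : ℝ) :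
    ContDiffAt ℝ ∞ (fun z : ℝ × ℝ => eaY W z.1 z.2) (φ, E) := by
  have hE' := hE₀.trans hE
  have h1 := smooth_scale_snd (P := P) hE' φ
  refine ContDiffAt.div ?_ (h1.pow _) (pow_pos (scale_pos hE') _).ne'
  exact ContDiffAt.comp (φ, E) (g := fun z : ℝ × ℝ => W.Y z.1 z.2)
    (WellFamily.smooth_Y (abs_scale_lt hh hE₀ hE) φ) (h1.prodMk contDiffAt_fst)

theorem hasDerivAt_eaX_energy (hh : 2 ≤ P.h) (hE₀ : 0 < E₀) {E : ℝ} (hE : E₀ < E) (φ : ℝ) :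
    HasDerivAt (fun E => eaX W φ E) (-(1 / (2 * P.h)) * P.scale E ^ (2 * P.h - 1) *
      (P.scale E * deriv (fun δ => W.X δ φ) (P.scale E) - W.X (P.scale E) φ)) E := by
  have hE' := hE₀.trans hE
  have hδ := (scale_pos (P := P) hE').ne'
  have hs := hasDerivAt_scale hh hE'
  have hX : HasDerivAt (fun δ => W.X δ φ) (deriv (fun δ => W.X δ φ) (P.scale E)) (P.scale E) :=
    (((WellFamily.smooth_X (abs_scale_lt hh hE₀ hE) φ).comp (P.scale E)
      (f := fun δ : ℝ => (δ, φ)) (by fun_prop)).differentiableAt (by norm_num)).hasDerivAt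
  have h := (hX.comp E hs).div hs hδ
  convert! h using 1
  obtain ⟨k, hk⟩ : ∃ k, P.h = k + 1 := ⟨P.h - 1, by omega⟩
  rw [show 2 * P.h - 1 = 2 * k + 1 by omega, show 2 * P.h = 2 * k + 2 by omega]
  simp only [Function.comp]
  field_simp
  ring

theorem hasDerivAt_eaY_energy (hh : 2 ≤ P.h) (hE₀ : 0 < E₀) {E : ℝ} (hE : E₀ < E) (φ : ℝ) :
    HasDerivAt (fun E => eaY W φ E) (-(1 / (2 * P.h)) * P.scale E ^ P.h *
      (P.scale E * deriv (fun δ => W.Y δ φ) (P.scale E) - P.h * W.Y (P.scale E) φ)) E := by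
  have hE' := hE₀.trans hE
  have hδ := (scale_pos (P := P) hE').ne'
  have hs := hasDerivAt_scale hh hE'
  have hY : HasDerivAt (fun δ => W.Y δ φ) (deriv (fun δ => W.Y δ φ) (P.scale E)) (P.scale E) :=
    (((WellFamily.smooth_Y (abs_scale_lt hh hE₀ hE) φ).comp (P.scale E)
      (f := fun δ : ℝ => (δ, φ)) (by fun_prop)).differentiableAt (by norm_num)).hasDerivAt
  have h := (hY.comp E hs).div (hs.pow P.h) (pow_ne_zero P.h hδ)
  convert! h using 1
  obtain ⟨k, hk⟩ : ∃ k, P.h = k + 1 := ⟨P.h - 1, by omega⟩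
  rw [show P.h - 1 = k by omega, show 2 * P.h = 2 * k + 2 by omega]
  simp only [Function.comp, Pi.pow_apply]
  rw [hk]
  push_cast
  field_simp
  ring

end EnergyAngle

end ChirpedSystem

/-! ### The energy-angle change of variables and its equations -/

theorem hasDerivAt_comp_two {f : ℝ → ℝ → ℝ} {a b : ℝ → ℝ} {a' b' t : ℝ}
    (hf : DifferentiableAt ℝ (fun z : ℝ × ℝ => f z.1 z.2) (a t, b t))
    (ha : HasDerivAt a a' t) (hb : HasDerivAt b b' t) :
    HasDerivAt (fun t => f (a t) (b t))
      (deriv (fun x => f x (b t)) (a t) * a' + deriv (fun y => f (a t) y) (b t) * b') t := by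
  set L := fderiv ℝ (fun z : ℝ × ℝ => f z.1 z.2) (a t, b t)
  have hL : HasFDerivAt (fun z : ℝ × ℝ => f z.1 z.2) L (a t, b t) := hf.hasFDerivAt
  have h1 : HasDerivAt (fun x => f x (b t)) (L (1, 0)) (a t) :=
    hL.comp_hasDerivAt (a t) (f := fun x => (x, b t))
      ((hasDerivAt_id _).prodMk (hasDerivAt_const _ _))
  have h2 : HasDerivAt (fun y => f (a t) y) (L (0, 1)) (b t) :=
    hL.comp_hasDerivAt (b t) (f := fun y => (a t, y))
      ((hasDerivAt_const _ _).prodMk (hasDerivAt_id _))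
  have h3 : HasDerivAt (fun t => f (a t) (b t)) (L (a', b')) t :=
    hL.comp_hasDerivAt t (f := fun t => (a t, b t)) (ha.prodMk hb)
  convert! h3 using 1
  rw [h1.deriv, h2.deriv, show ((a', b') : ℝ × ℝ) = a' • (1, 0) + b' • (0, 1) by simp,
    map_add, map_smul, map_smul, smul_eq_mul, smul_eq_mul]
  ring

theorem exists_cos_sin {a b : ℝ} (h : a ^ 2 + b ^ 2 = 1) :
    ∃ α, Real.cos α = a ∧ Real.sin α = b := by
  have h2 : ‖(⟨a, b⟩ : ℂ)‖ = 1 := by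
    rw [Complex.norm_eq_sqrt_sq_add_sq]
    rw [h, Real.sqrt_one]
  refine ⟨Complex.arg ⟨a, b⟩, ?_, ?_⟩
  · rw [Complex.cos_arg (norm_ne_zero_iff.1 (by rw [h2]; exact one_ne_zero)), h2, div_one]
  · rw [Complex.sin_arg, h2, div_one]

namespace ChirpedSystem

variable {P : ChirpedSystem}

theorem RegularAbove.deriv_U_ne {E₀ : ℝ} (h : P.RegularAbove E₀) {x : ℝ} (hx : E₀ < P.U x) :
    deriv P.U x ≠ 0 := by
  intro h0
  refine (h.2 _ hx).2 x 0 (by simp [H]) ⟨P.Hy_eq x 0, ?_⟩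
  rw [Hx_eq, h0, neg_zero]

section EnergyAngle

variable {E₀ : ℝ} (W : WellFamily P.V (P.scale E₀))

theorem hasDerivAt_H {x y : ℝ → ℝ} {x' y' t : ℝ} (hx : HasDerivAt x x' t) (hy : HasDerivAt y y' t) :
    HasDerivAt (fun t => P.H (x t) (y t)) (y t * y' + deriv P.U (x t) * x') t := by
  have h := ((hy.pow 2).div_const 2).add ((P.differentiable_U (x t)).hasDerivAt.comp t hx)
  convert! h using 1
  push_cast
  ring

theorem omega_pos_of_lt (W : WellFamily P.V (P.scale E₀)) (hh : 2 ≤ P.h) (hE₀ : 0 < E₀) {E : ℝ} (hE : E₀ < E) : 0 < P.omega E := by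
  rw [omega_eq W hh hE₀ hE]
  exact div_pos (WellFamily.freq_pos (abs_scale_lt hh hE₀ hE))
    (pow_pos (scale_pos (hE₀.trans hE)) _)

theorem scaled_energy (hh : 2 ≤ P.h) {E x y : ℝ} (hE : 0 < E) (h : P.H x y = E) :
    (P.scale E ^ P.h * y) ^ 2 / 2 + P.V (P.scale E) (P.scale E * x) = 1 := by
  have h1 : (P.scale E ^ P.h) ^ 2 = E⁻¹ := by rw [← pow_mul, mul_comm P.h 2, scale_pow hh hE]
  rw [mul_pow, h1]
  rw [H, U_scale_eq hh hE] at h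
  field_simp at h ⊢
  linarith

theorem ea_of_cos_sin (hh : 2 ≤ P.h) (hE₀ : 0 < E₀) {E : ℝ} (hE : E₀ < E) {x y α : ℝ}
    (hQ : 0 < W.Q (P.scale E) (P.scale E * x))
    (hc : Real.cos α = (P.scale E * x - W.c (P.scale E)) / W.d (P.scale E))
    (hs : Real.sin α = -(P.scale E ^ P.h * y) /
      (W.d (P.scale E) * Real.sqrt (2 * W.Q (P.scale E) (P.scale E * x)))) :
    eaX W (W.Theta (P.scale E) α) E = x ∧ eaY W (W.Theta (P.scale E) α) E = y := by
  have hδ := scale_pos (P := P) (hE₀.trans hE)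
  obtain ⟨h1, h2⟩ := WellFamily.of_cos_sin (abs_scale_lt hh hE₀ hE) hQ hc hs
  rw [eaX, eaY, h1, h2]
  constructor <;> field_simp

theorem energyAngleChange_ea (hh : 2 ≤ P.h) (hE₀ : 0 < E₀) :
    P.EnergyAngleChange E₀ (eaX W) (eaY W) where
  omega_pos E hE := omega_pos_of_lt W hh hE₀ hE
  periodic φ E hE := by
    have hδ' := abs_scale_lt hh hE₀ hE
    simp [eaX, eaY, WellFamily.X_periodic hδ', WellFamily.Y_periodic hδ']
  energy φ E hE := energy_ea W hh hE₀ hE φ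
  smooth_X := fun z hz => (smooth_eaX W hh hE₀ hz z.1).contDiffWithinAt
  smooth_Y := fun z hz => (smooth_eaY W hh hE₀ hz z.1).contDiffWithinAt
  -- The φ-derivatives are (Y, -U'(X))/ω, so the determinant is (Y ∂_E Y + U'(X) ∂_E X)/ω; the
  -- bracket is the E-derivative of H(X, Y) = E.
  jacobian φ E hE := by
    obtain ⟨-, -, h⟩ := isEnergyAngle_ea W hh hE₀ E hE
    rw [(h φ).1.deriv, (h φ).2.deriv, Hx_eq, Hy_eq]
    have hX := (hasDerivAt_eaX_energy W hh hE₀ hE φ).differentiableAt.hasDerivAt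
    have hY := (hasDerivAt_eaY_energy W hh hE₀ hE φ).differentiableAt.hasDerivAt
    have h1 := hasDerivAt_H (P := P) hX hY
    have h2 : HasDerivAt (fun E => P.H (eaX W φ E) (eaY W φ E)) 1 E := by
      refine (hasDerivAt_id E).congr_of_eventuallyEq ?_
      filter_upwards [lt_mem_nhds hE] with E' hE'
      exact energy_ea W hh hE₀ hE' φ
    have h3 := h1.unique h2
    have := (omega_pos_of_lt W hh hE₀ hE).ne'
    field_simp
    linarith
  onto x y hxy := by
    have hE : E₀ < P.H x y := hxy
    obtain ⟨hQ, h1⟩ := WellFamily.of_energy (W := W) (abs_scale_lt hh hE₀ hE)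
      (scaled_energy hh (hE₀.trans hE) rfl)
    obtain ⟨α, hα1, hα2⟩ := exists_cos_sin h1
    exact ⟨_, ea_of_cos_sin W hh hE₀ hE hQ hα1 hα2⟩
  inj φ φ' E E' hE hE' hX hY := by
    have h1 : E = E' := by
      rw [← energy_ea W hh hE₀ hE φ, ← energy_ea W hh hE₀ hE' φ', hX, hY]
    subst h1
    refine ⟨rfl, ?_⟩
    have hδ := scale_pos (P := P) (hE₀.trans hE)
    refine WellFamily.inj (W := W) (abs_scale_lt hh hE₀ hE) ?_ ?_
    · exact (div_left_inj' hδ.ne').1 hX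
    · exact (div_left_inj' (pow_ne_zero _ hδ.ne')).1 hY

/-- The angle induces a continuous bijection from a compact circle to a Hausdorff space. This
verifies the closed-curve condition when admissible energies are produced. -/
theorem nonempty_circle_homeomorph {X Y : ℝ → ℝ → ℝ} (h : P.EnergyAngleChange E₀ X Y) {E : ℝ}
    (hE : E₀ < E) : Nonempty (Circle ≃ₜ {z : ℝ × ℝ // P.H z.1 z.2 = E}) := by
  let f : ℝ → {z : ℝ × ℝ // P.H z.1 z.2 = E} := fun φ => ⟨(X φ E, Y φ E), h.energy φ E hE⟩
  have hf : Function.Periodic f (2 * Real.pi) := fun φ => by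
    apply Subtype.ext
    exact Prod.ext (h.periodic φ E hE).1 (h.periodic φ E hE).2
  have hmem : ∀ φ : ℝ, (φ, E) ∈ {z : ℝ × ℝ | E₀ < z.2} := fun φ => hE
  have hXc : Continuous fun φ => X φ E := h.smooth_X.continuousOn.comp_continuous
    (f := fun φ : ℝ => (φ, E)) (by fun_prop) hmem
  have hYc : Continuous fun φ => Y φ E := h.smooth_Y.continuousOn.comp_continuous
    (f := fun φ : ℝ => (φ, E)) (by fun_prop) hmem
  have hfc : Continuous f := (hXc.prodMk hYc).subtype_mk _
  let g : AddCircle (2 * Real.pi) → {z : ℝ × ℝ // P.H z.1 z.2 = E} := hf.lift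
  have hg : Continuous g := continuous_coinduced_dom.2 hfc
  have : Fact (0 < 2 * Real.pi) := ⟨Real.two_pi_pos⟩
  have hbij : Function.Bijective g := by
    constructor
    · intro u v
      induction u using QuotientAddGroup.induction_on with | H φ => ?_
      induction v using QuotientAddGroup.induction_on with | H φ' => ?_
      intro huv
      have h1 : f φ = f φ' := huv
      have h2 := congrArg Subtype.val h1
      obtain ⟨-, k, hk⟩ := h.inj φ φ' E E hE hE (congrArg Prod.fst h2) (congrArg Prod.snd h2)
      rw [hk]
      exact (Real.Angle.angle_eq_iff_two_pi_dvd_sub.2 ⟨-k, by push_cast; ring⟩)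
    · rintro ⟨⟨x, y⟩, hxy⟩
      dsimp only at hxy
      obtain ⟨φ, h1, h2⟩ := h.onto x y (show E₀ < P.H x y by rw [hxy]; exact hE)
      rw [hxy] at h1 h2
      exact ⟨(φ : AddCircle (2 * Real.pi)), Subtype.ext (Prod.ext h1 h2)⟩
  exact ⟨(AddCircle.homeomorphCircle (T := 2 * Real.pi) Real.two_pi_pos.ne').symm.trans
    (Continuous.homeoOfEquivCompactToT2 (f := Equiv.ofBijective g hbij) hg)⟩

/-- Critical points of U are confined to a bounded interval, on which U is bounded; any energy above
that bound will do. -/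
theorem exists_deriv_U_ne (hh : 2 ≤ P.h) : ∃ E₀, 0 < E₀ ∧ ∀ x, E₀ < P.U x → deriv P.U x ≠ 0 := by
  have hh' : (2 : ℝ) ≤ P.h := by exact_mod_cast hh
  -- With these coefficients x U'(x) is 2h times a potential of the same form, so the growth
  -- estimate for potentials excludes zeros for large |x|.
  let P' : ChirpedSystem := { P with u := fun i => i * P.u i / (2 * P.h) }
  obtain ⟨R, -, hR⟩ := exists_large (P := P') hh 1
  have hxU : ∀ x, x * deriv P.U x = 2 * P.h * P'.V 1 x := by
    intro x
    have h1 : HasDerivAt P.U (((2 * P.h : ℕ) : ℝ) * x ^ (2 * P.h - 1) / (2 * P.h) +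
        ∑ i ∈ Finset.Icc 1 (2 * P.h - 1), P.u i * (i * x ^ (i - 1))) x :=
      ((hasDerivAt_pow _ x).div_const _).add
        (HasDerivAt.fun_sum fun i _ => (hasDerivAt_pow i x).const_mul (P.u i))
    rw [h1.deriv]
    simp only [V, P', one_pow, mul_one, mul_add, Finset.mul_sum]
    congr 1
    · push_cast
      rw [show 2 * P.h = 2 * P.h - 1 + 1 by omega, pow_succ]
      simp only [Nat.add_sub_cancel]
      field_simp
    · refine Finset.sum_congr rfl fun i hi => ?_
      rw [Finset.mem_Icc] at hi
      obtain ⟨k, rfl⟩ : ∃ k, i = k + 1 := ⟨i - 1, by omega⟩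
      rw [Nat.add_sub_cancel, pow_succ]
      field_simp
  obtain ⟨C, hC⟩ := (isCompact_Icc (a := -R) (b := R)).exists_bound_of_continuousOn
    P.contDiff_U.continuous.continuousOn
  refine ⟨max C 1, by positivity, fun x hx h0 => ?_⟩
  have h1 := hxU x
  rw [h0, mul_zero] at h1
  rcases le_total R |x| with h | h
  · nlinarith [hR x h]
  · have h2 := hC x (abs_le.1 h)
    rw [Real.norm_eq_abs] at h2
    linarith [le_abs_self (P.U x), le_max_left C 1]

theorem tendsto_scale (hh : 2 ≤ P.h) : Tendsto P.scale atTop (𝓝 0) := by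
  have hh' : (2 : ℝ) ≤ P.h := by exact_mod_cast hh
  exact tendsto_rpow_neg_atTop (by positivity)

/-- From ω = freq(δ) δ^(1-h), dω/dδ has the sign of δ freq'(δ) - (h - 1) freq(δ), which is negative
at δ = 0 and hence nearby. As δ decreases with E, ω increases. -/
theorem exists_deriv_omega_pos (W : WellFamily P.V (P.scale E₀)) (hh : 2 ≤ P.h) (hE₀ : 0 < E₀) :
    ∃ E₁, E₀ ≤ E₁ ∧ ∀ E, E₁ ≤ E → 0 < deriv P.omega E := by
  have hh' : (2 : ℝ) ≤ P.h := by exact_mod_cast hh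
  have h0 : |(0 : ℝ)| < P.scale E₀ := by rw [abs_zero]; exact scale_pos hE₀
  have hdf : ContinuousAt (deriv W.freq) 0 := by
    exact ((WellFamily.smooth_freq (W := W) h0).derivWithin (m := 0) (by norm_num)).continuousAt
  have hneg : ∀ᶠ δ in 𝓝 (0 : ℝ), δ * deriv W.freq δ - (P.h - 1) * W.freq δ < 0 := by
    have hc : ContinuousAt (fun δ => δ * deriv W.freq δ - (P.h - 1) * W.freq δ) 0 :=
      (continuousAt_id.mul hdf).sub
        (continuousAt_const.mul (WellFamily.smooth_freq (W := W) h0).continuousAt)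
    refine hc.eventually_lt_const ?_
    have := WellFamily.freq_pos (W := W) h0
    dsimp only
    rw [zero_mul, zero_sub, neg_lt_zero]
    exact mul_pos (by linarith) this
  have hev := ((tendsto_scale hh).eventually hneg).and (eventually_gt_atTop E₀)
  obtain ⟨E₁, hE₁⟩ := eventually_atTop.1 hev
  refine ⟨max E₀ E₁, le_max_left _ _, fun E hE => ?_⟩
  obtain ⟨h1, h2⟩ := hE₁ E ((le_max_right _ _).trans hE)
  have hE' := hE₀.trans h2
  have hδ := scale_pos (P := P) hE'
  have hδ' := abs_scale_lt hh hE₀ h2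
  have hs := hasDerivAt_scale hh hE'
  have hf : HasDerivAt W.freq (deriv W.freq (P.scale E)) (P.scale E) :=
    ((WellFamily.smooth_freq hδ').differentiableAt (by norm_num)).hasDerivAt
  have h3 := (hf.comp E hs).div (hs.pow (P.h - 1)) (pow_ne_zero (P.h - 1) hδ.ne')
  have h4 : P.omega =ᶠ[𝓝 E] fun E => W.freq (P.scale E) / P.scale E ^ (P.h - 1) := by
    filter_upwards [lt_mem_nhds h2] with E' hE'
    exact omega_eq W hh hE₀ hE'
  have h5 := (h3.congr_of_eventuallyEq h4).deriv
  rw [h5]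
  have h6 : 0 < -(1 / (2 * P.h)) * (P.scale E * deriv W.freq (P.scale E)
      - (P.h - 1) * W.freq (P.scale E)) * P.scale E ^ (2 * P.h) / P.scale E ^ (P.h - 1) := by
    refine div_pos (mul_pos ?_ (by positivity)) (by positivity)
    exact mul_pos_of_neg_of_neg (by rw [neg_lt_zero]; positivity) h1
  convert! h6 using 1
  obtain ⟨k, hk⟩ : ∃ k, P.h = k + 2 := ⟨P.h - 2, by omega⟩
  simp only [Function.comp, Pi.pow_apply]
  rw [show P.h - 1 = k + 1 by omega, Nat.add_sub_cancel, hk]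
  push_cast
  field_simp
  ring

end EnergyAngle

theorem exists_energyLevels (hh : 2 ≤ P.h) : ∃ E₀ E₁ : ℝ, P.EnergyLevels E₀ E₁ := by
  obtain ⟨E₀, hE₀, hc⟩ := exists_deriv_U_ne hh
  obtain ⟨W⟩ := nonempty_wellFamily hh hE₀ hc
  obtain ⟨E₁, hE₁, h⟩ := exists_deriv_omega_pos W hh hE₀
  refine ⟨E₀, E₁, ⟨hE₀, fun E hE =>
    ⟨nonempty_circle_homeomorph (energyAngleChange_ea W hh hE₀) hE, fun x y hxy hcon => ?_⟩⟩,
    hE₁, h⟩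
  rw [Hy_eq, Hx_eq, neg_eq_zero] at hcon
  refine hc x ?_ hcon.2
  rw [H, hcon.1] at hxy
  have : P.U x = E := by simpa using hxy
  rwa [this]

/-- The chain rule expresses (x', y') linearly through (I', φ'). The normalized determinant relation
`hj` inverts this linear system, so both directions are Cramer's rule. -/
theorem solvesFull_iff_solvesEnergyAngle {E₀ : ℝ} {X Y : ℝ → ℝ → ℝ}
    (hX : P.IsEnergyAngle E₀ X Y) (hXY : P.EnergyAngleChange E₀ X Y) (I φ : ℝ → ℝ) (t : ℝ)
    (hI : E₀ < I t) (hId : DifferentiableAt ℝ I t) (hφd : DifferentiableAt ℝ φ t) :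
    P.SolvesFull (fun t' => X (φ t') (I t')) (fun t' => Y (φ t') (I t')) t ↔
      P.SolvesEnergyAngle X Y I φ t := by
  have hopen : IsOpen {z : ℝ × ℝ | E₀ < z.2} := isOpen_lt continuous_const continuous_snd
  have hmem : {z : ℝ × ℝ | E₀ < z.2} ∈ 𝓝 (φ t, I t) := hopen.mem_nhds hI
  have hx := hasDerivAt_comp_two ((hXY.smooth_X.contDiffAt hmem).differentiableAt (by norm_num))
    hφd.hasDerivAt hId.hasDerivAt
  have hy := hasDerivAt_comp_two ((hXY.smooth_Y.contDiffAt hmem).differentiableAt (by norm_num))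
    hφd.hasDerivAt hId.hasDerivAt
  obtain ⟨-, -, h⟩ := hX (I t) hI
  have hjac := hXY.jacobian (φ t) (I t) hI
  have hw := (hXY.omega_pos (I t) hI).ne'
  rw [(h (φ t)).1.deriv, Hy_eq] at hx hjac
  rw [(h (φ t)).2.deriv, Hx_eq] at hy hjac
  unfold SolvesFull SolvesEnergyAngle F G
  simp only [Hx_eq, Hy_eq]
  set a := deriv (fun E => X (φ t) E) (I t)
  set b := deriv (fun E => Y (φ t) E) (I t)
  set u := deriv P.U (X (φ t) (I t))
  set y := Y (φ t) (I t)
  set f := P.f (X (φ t) (I t)) y (P.S t) t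
  set g := P.g (X (φ t) (I t)) y (P.S t) t
  set w := P.omega (I t)
  set k := t ^ (-(P.a : ℝ) / P.q)
  have hj : y * b + u * a = 1 := by
    field_simp at hjac
    linarith
  constructor
  · rintro ⟨h1, h2⟩
    have e1 := hx.unique h1
    have e2 := hy.unique h2
    field_simp at e1 e2
    have hI' : deriv I t = k * (f * u + g * y) := by
      apply mul_left_cancel₀ hw
      linear_combination (-(w * deriv I t)) * hj + u * e1 + y * e2
    have hφ' : deriv φ t = w + k * (w * (f * b - g * a)) := by
      linear_combination (w - deriv φ t) * hj + b * e1 - a * e2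
    exact ⟨hI' ▸ hId.hasDerivAt, hφ' ▸ hφd.hasDerivAt⟩
  · rintro ⟨h1, h2⟩
    have e1 := hId.hasDerivAt.unique h1
    have e2 := hφd.hasDerivAt.unique h2
    rw [e1, e2] at hx hy
    constructor
    · convert! hx using 1
      field_simp
      linear_combination (-(k * f)) * hj
    · convert! hy using 1
      field_simp
      linear_combination (-(k * g)) * hj

end ChirpedSystem

/-- A `C^1` curve on the unit circle has a differentiable angle. -/
theorem exists_angle_lift {J : Set ℝ} (hJ : IsOpen J) (hJc : J.OrdConnected) {C S : ℝ → ℝ}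
    (hC : ContDiffOn ℝ 1 C J) (hS : ContDiffOn ℝ 1 S J) (h : ∀ t ∈ J, C t ^ 2 + S t ^ 2 = 1) :
    ∃ α : ℝ → ℝ, ∀ t ∈ J, DifferentiableAt ℝ α t ∧ Real.cos (α t) = C t ∧
      Real.sin (α t) = S t := by
  rcases J.eq_empty_or_nonempty with rfl | ⟨t₀, ht₀⟩
  · exact ⟨fun _ => 0, fun t ht => absurd ht (Set.notMem_empty t)⟩
  obtain ⟨α₀, hα1, hα2⟩ := exists_cos_sin (h t₀ ht₀)
  -- The angular velocity of the curve; its primitive is the candidate for the angle.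
  set g : ℝ → ℝ := fun t => C t * deriv S t - S t * deriv C t with hg
  have hgc : ContinuousOn g J :=
    (hC.continuousOn.mul (hS.continuousOn_deriv_of_isOpen hJ le_rfl)).sub
      (hS.continuousOn.mul (hC.continuousOn_deriv_of_isOpen hJ le_rfl))
  have hCd : ∀ t ∈ J, HasDerivAt C (deriv C t) t := fun t ht =>
    ((hC.contDiffAt (hJ.mem_nhds ht)).differentiableAt one_ne_zero).hasDerivAt
  have hSd : ∀ t ∈ J, HasDerivAt S (deriv S t) t := fun t ht =>
    ((hS.contDiffAt (hJ.mem_nhds ht)).differentiableAt one_ne_zero).hasDerivAt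
  set α : ℝ → ℝ := fun t => α₀ + ∫ s in t₀..t, g s
  have hα : ∀ t ∈ J, HasDerivAt α (g t) t := by
    intro t ht
    refine (intervalIntegral.integral_hasDerivAt_right ?_ ?_ ?_).const_add α₀
    · exact (hgc.mono (hJc.uIcc_subset ht₀ ht)).intervalIntegrable
    · exact hgc.stronglyMeasurableAtFilter hJ t ht
    · exact hgc.continuousAt (hJ.mem_nhds ht)
  have hzero : ∀ t ∈ J, C t * deriv C t + S t * deriv S t = 0 := by
    intro t ht
    have h1 := ((hCd t ht).pow 2).add ((hSd t ht).pow 2)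
    have h2 : HasDerivAt (fun t => C t ^ 2 + S t ^ 2) 0 t := by
      refine (hasDerivAt_const t (1 : ℝ)).congr_of_eventuallyEq ?_
      filter_upwards [hJ.mem_nhds ht] with s hs
      exact h s hs
    have h3 := h1.unique h2
    norm_num at h3
    linarith
  -- In the frame rotating with the candidate angle the curve stands still: the component along (cos
  -- α, sin α) and the one across it are constant, with initial values 1 and 0.
  have hp : ∀ t ∈ J, HasDerivAt (fun t => C t * Real.cos (α t) + S t * Real.sin (α t)) 0 t := by
    intro t ht
    have h1 := ((hCd t ht).mul (hα t ht).cos).add ((hSd t ht).mul (hα t ht).sin)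
    convert! h1 using 1
    have h2 := h t ht
    have h3 := hzero t ht
    simp only [hg]
    linear_combination (-Real.cos (α t) * C t - Real.sin (α t) * S t) * h3 +
      (Real.cos (α t) * deriv C t + Real.sin (α t) * deriv S t) * h2
  have hr : ∀ t ∈ J, HasDerivAt (fun t => S t * Real.cos (α t) - C t * Real.sin (α t)) 0 t := by
    intro t ht
    have h1 := ((hSd t ht).mul (hα t ht).cos).sub ((hCd t ht).mul (hα t ht).sin)
    convert! h1 using 1
    have h2 := h t ht
    have h3 := hzero t ht
    simp only [hg]
    linear_combination (-Real.cos (α t) * S t + Real.sin (α t) * C t) * h3 +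
      (Real.cos (α t) * deriv S t - Real.sin (α t) * deriv C t) * h2
  have hconst : ∀ p : ℝ → ℝ, (∀ t ∈ J, HasDerivAt p 0 t) → ∀ t ∈ J, p t = p t₀ := by
    intro p hp t ht
    refine hJ.is_const_of_deriv_eq_zero hJc.isPreconnected
      (fun s hs => (hp s hs).differentiableAt.differentiableWithinAt)
      (fun s hs => (hp s hs).deriv) ht ht₀
  have hα0 : α t₀ = α₀ := by simp [α]
  refine ⟨α, fun t ht => ⟨(hα t ht).differentiableAt, ?_⟩⟩
  have e1 := hconst _ hp t ht
  have e2 := hconst _ hr t ht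
  rw [hα0, hα1, hα2] at e1 e2
  have e3 := h t₀ ht₀
  have e4 := Real.sin_sq_add_cos_sq (α t)
  constructor
  · linear_combination (-Real.cos (α t)) * e1 + Real.sin (α t) * e2 - Real.cos (α t) * e3 + C t * e4
  · linear_combination (-Real.sin (α t)) * e1 - Real.cos (α t) * e2 - Real.sin (α t) * e3 + S t * e4

namespace ChirpedSystem

variable {P : ChirpedSystem}

/-! ### The slow time -/

theorem Standing.q_pos (hP : P.Standing) : (0 : ℝ) < P.q := by
  have := hP.one_le_a.trans hP.a_le_q
  exact_mod_cast this

theorem Standing.b_pos (hP : P.Standing) : (0 : ℝ) < P.b := by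
  exact_mod_cast hP.one_le_b

theorem Standing.two_le (hP : P.Standing) : (2 : ℝ) ≤ P.h := by exact_mod_cast hP.two_le_h

theorem nu_eq : P.nu = 1 + (P.b : ℝ) / P.q := by
  unfold nu mu
  ring

theorem Standing.nu_pos (hP : P.Standing) : 0 < P.nu := by
  rw [nu_eq]
  have := hP.q_pos
  positivity

theorem Resonance.mu_pos (hr : P.Resonance) : 0 < P.mu := by
  have := hr.2
  unfold mu
  linarith

theorem Standing.vartheta_pos (hP : P.Standing) : 0 < P.vartheta := by
  have := hP.q_pos
  have := hP.s_pos
  unfold vartheta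
  positivity

theorem tau_pos (hP : P.Standing) {t : ℝ} (ht : 0 < t) : 0 < P.tau t :=
  div_pos (Real.rpow_pos_of_pos ht _) hP.nu_pos

theorem time_pos (hP : P.Standing) {τ : ℝ} (hτ : 0 < τ) : 0 < P.time τ :=
  Real.rpow_pos_of_pos (mul_pos hP.nu_pos hτ) _

theorem time_tau (hP : P.Standing) {t : ℝ} (ht : 0 < t) : P.time (P.tau t) = t := by
  have := hP.nu_pos.ne'
  unfold time tau
  rw [mul_div_cancel₀ _ this, ← Real.rpow_mul ht.le, mul_one_div_cancel this, Real.rpow_one]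

theorem tau_time (hP : P.Standing) {τ : ℝ} (hτ : 0 < τ) : P.tau (P.time τ) = τ := by
  have h := hP.nu_pos
  unfold time tau
  rw [← Real.rpow_mul (mul_pos h hτ).le, one_div_mul_cancel h.ne', Real.rpow_one,
    mul_div_cancel_left₀ _ h.ne']

theorem S_eq (t : ℝ) : P.S t = P.s * t ^ P.nu := by rw [S, nu_eq]

theorem zeta_eq (hP : P.Standing) {τ : ℝ} (hτ : 0 < τ) : P.zeta τ = P.vartheta * τ := by
  have h := hP.nu_pos
  unfold zeta time
  rw [S_eq, ← Real.rpow_mul (mul_pos h hτ).le, one_div_mul_cancel h.ne', Real.rpow_one, vartheta,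
    ← nu_eq]
  ring

theorem tau_lt_tau (hP : P.Standing) {t t' : ℝ} (ht : 0 ≤ t) (h : t < t') : P.tau t < P.tau t' :=
  div_lt_div_of_pos_right (Real.rpow_lt_rpow ht h hP.nu_pos) hP.nu_pos

theorem hasDerivAt_tau (hP : P.Standing) {t : ℝ} (ht : 0 < t) :
    HasDerivAt P.tau (t ^ (P.nu - 1)) t := by
  have h := (Real.hasDerivAt_rpow_const (x := t) (p := P.nu) (Or.inl ht.ne')).div_const P.nu
  rwa [mul_div_cancel_left₀ _ hP.nu_pos.ne'] at h

theorem differentiableAt_time (hP : P.Standing) {τ : ℝ} (hτ : 0 < τ) :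
    DifferentiableAt ℝ P.time τ :=
  ((differentiableAt_id.const_mul P.nu).rpow_const
    (Or.inl (mul_pos hP.nu_pos hτ).ne') : DifferentiableAt ℝ (fun τ => (P.nu * τ) ^ (1 / P.nu)) τ)

theorem hasDerivAt_S {t : ℝ} (ht : 0 < t) :
    HasDerivAt P.S (P.vartheta * t ^ ((P.b : ℝ) / P.q)) t := by
  have h := (Real.hasDerivAt_rpow_const (x := t) (p := 1 + (P.b : ℝ) / P.q)
    (Or.inl ht.ne')).const_mul P.s
  rw [add_sub_cancel_left, ← mul_assoc] at h
  exact h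

/-! ### The amplitude and the phase difference -/

section Amplitude

variable {E₀ E₁ t₁ : ℝ} {ϰ : ℕ} {Istar : ℝ → ℝ}

theorem IsResonantEnergy.differentiableAt (h : P.IsResonantEnergy ϰ E₁ t₁ Istar) {t : ℝ}
    (ht : t₁ < t) : DifferentiableAt ℝ Istar t :=
  (h.1.contDiffAt (Ici_mem_nhds ht)).differentiableAt (by norm_num)

/-- The energy-angle system followed by the chain rule with dτ/dt = t^(ν-1); the term S'(t)/ϰ from
the angle is ω(I⋆), which produces the frequency difference in ℬ. -/
theorem solvesFull_iff_solvesAmplitude (hP : P.Standing) {X Y : ℝ → ℝ → ℝ}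
    (hX : P.IsEnergyAngle E₀ X Y) (hXY : P.EnergyAngleChange E₀ X Y) (hE₀ : 0 < E₀)
    (hE : E₀ ≤ E₁) (ht₁ : 0 < t₁) (hI : P.IsResonantEnergy ϰ E₁ t₁ Istar) (r θ : ℝ → ℝ) (t : ℝ)
    (ht : t₁ < t) (hw : 0 < 1 + t ^ (-P.mu) * r (P.tau t)) (hE₁ : E₁ < P.energyOf Istar r t)
    (hr : DifferentiableAt ℝ r (P.tau t)) (hθ : DifferentiableAt ℝ θ (P.tau t)) :
    P.SolvesFull (P.original ϰ X Istar r θ) (P.original ϰ Y Istar r θ) t ↔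
      P.SolvesAmplitude ϰ X Y Istar r θ (P.tau t) := by
  have ht0 := ht₁.trans ht
  have hJ : 0 < Istar t := hE₀.trans_le (hE.trans (hI.2 t ht.le).1)
  have hh := hP.two_le
  have hτ := hasDerivAt_tau hP ht0
  have hτ0 := tau_pos hP ht0
  have hJd := (hI.differentiableAt ht).hasDerivAt
  have hrd := hr.hasDerivAt.comp t hτ
  have hθd := hθ.hasDerivAt.comp t hτ
  have hm := Real.hasDerivAt_rpow_const (x := t) (p := -P.mu) (Or.inl ht0.ne')
  have hwd := (hm.mul hrd).const_add 1
  have hId := hJd.mul (hwd.pow (2 * P.h))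
  have hφd := hθd.add ((hasDerivAt_S (P := P) ht0).div_const ϰ)
  have hId' : HasDerivAt (P.energyOf Istar r) _ t := hId
  have hφd' : HasDerivAt (P.angleOf ϰ θ) _ t := hφd
  have hiff := solvesFull_iff_solvesEnergyAngle hX hXY (P.energyOf Istar r) (P.angleOf ϰ θ) t
    (hE.trans_lt hE₁) hId'.differentiableAt hφd'.differentiableAt
  refine hiff.trans ?_
  unfold SolvesEnergyAngle SolvesAmplitude
  have hom := (hI.2 t ht.le).2
  rw [(hasDerivAt_S ht0).deriv] at hom
  have hζ : P.zeta (P.tau t) = P.S t := by rw [zeta, time_tau hP ht0]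
  have hT : t ^ (1 - P.nu) = (t ^ (P.nu - 1))⁻¹ := by rw [← Real.rpow_neg ht0.le]; congr 1; ring
  have hmu : t ^ P.mu = (t ^ (-P.mu))⁻¹ := by rw [← Real.rpow_neg ht0.le, neg_neg]
  have hmu1 : t ^ (-P.mu - 1) = t ^ (-P.mu) / t := Real.rpow_sub_one ht0.ne' _
  have hMN : P.tau t ^ (-(P.M : ℝ) / P.N) * P.tau t ^ ((P.M : ℝ) / P.N) = 1 := by
    rw [← Real.rpow_add hτ0, neg_div, neg_add_cancel, Real.rpow_zero]
  have hTpos : t ^ (P.nu - 1) ≠ 0 := (Real.rpow_pos_of_pos ht0 _).ne'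
  have hmpos : t ^ (-P.mu) ≠ 0 := (Real.rpow_pos_of_pos ht0 _).ne'
  -- Differentiating w^(2h) leaves w^(2h-1), which has to be cancelled; the remaining factor w is
  -- the one that appears in 𝒜.
  have hpow : (1 + t ^ (-P.mu) * r (P.tau t)) ^ (2 * P.h) =
      (1 + t ^ (-P.mu) * r (P.tau t)) ^ (2 * P.h - 1) * (1 + t ^ (-P.mu) * r (P.tau t)) := by
    have := hP.two_le_h
    rw [← pow_succ]; congr 1; omega
  have hA : P.tau t ^ (-(P.M : ℝ) / P.N) * P.calA ϰ X Y Istar (r (P.tau t)) (θ (P.tau t)) (P.tau t)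
      = t ^ (1 - P.nu) * (t ^ P.mu * ((1 + t ^ (-P.mu) * r (P.tau t)) / (2 * P.h)) *
        (t ^ (-(P.a : ℝ) / P.q) * P.F X Y (P.energyOf Istar r t) (P.angleOf ϰ θ t) t /
          P.energyOf Istar r t - deriv Istar t / Istar t) + P.mu * r (P.tau t) / t) := by
    unfold calA
    simp only [time_tau hP ht0, hζ]
    rw [← mul_assoc, ← mul_assoc, hMN, one_mul]
    rfl
  have hB : P.tau t ^ (-(P.M : ℝ) / P.N) * P.calB ϰ X Y Istar (r (P.tau t)) (θ (P.tau t)) (P.tau t)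
      = t ^ (1 - P.nu) * (P.omega (P.energyOf Istar r t) - P.omega (Istar t) +
        t ^ (-(P.a : ℝ) / P.q) * P.G X Y (P.energyOf Istar r t) (P.angleOf ϰ θ t) t) := by
    unfold calB
    simp only [time_tau hP ht0, hζ]
    rw [← mul_assoc, ← mul_assoc, hMN, one_mul]
    rfl
  rw [hA, hB, hT, hmu, hom]
  set FF := P.F X Y (P.energyOf Istar r t) (P.angleOf ϰ θ t) t
  set GG := P.G X Y (P.energyOf Istar r t) (P.angleOf ϰ θ t) t
  have hEn : P.energyOf Istar r t = Istar t * ((1 + t ^ (-P.mu) * r (P.tau t)) ^ (2 * P.h - 1) *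
      (1 + t ^ (-P.mu) * r (P.tau t))) := by rw [energyOf, hpow]
  set om := P.omega (P.energyOf Istar r t)
  have hwp := pow_pos hw (2 * P.h - 1)
  rw [hEn]
  simp only [Pi.mul_apply, Pi.pow_apply, Function.comp_apply, hmu1, hpow] at hId'
  set w := 1 + t ^ (-P.mu) * r (P.tau t) with hwdef
  set T := t ^ (P.nu - 1)
  set m := t ^ (-P.mu)
  set k := t ^ (-(P.a : ℝ) / P.q)
  set W := w ^ (2 * P.h - 1)
  refine and_congr ⟨fun h => ?_, fun h => ?_⟩ ⟨fun h => ?_, fun h => ?_⟩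
  · have e := hId'.unique h
    have : deriv r (P.tau t) = T⁻¹ * (m⁻¹ * (w / (2 * P.h)) * (k * FF / (Istar t * (W * w)) -
        deriv Istar t / Istar t) + P.mu * r (P.tau t) / t) := by
      rw [← e]
      push_cast
      field_simp
      ring
    rw [← this]
    exact hr.hasDerivAt
  · have e := hr.hasDerivAt.unique h
    convert! hId' using 1
    rw [e]
    push_cast
    field_simp
    ring
  · have e := hφd'.unique h
    have : deriv θ (P.tau t) = T⁻¹ * (om - P.vartheta * t ^ ((P.b : ℝ) / P.q) / ϰ + k * GG) := by
      field_simp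
      linear_combination e
    rw [← this]
    exact hθ.hasDerivAt
  · have e := hθ.hasDerivAt.unique h
    convert! hφd' using 1
    rw [e]
    field_simp
    ring

end Amplitude

end ChirpedSystem

/-- Smoothness of infinite order at a point does not provide one neighbourhood that serves all
orders. Since the partial derivative stays non-zero nearby, the implicit function theorem is applied
afresh at each nearby point. -/
theorem exists_implicit_nhds {E : Type} [NormedAddCommGroup E] [NormedSpace ℝ E]
    [CompleteSpace E] {f : E × ℝ → ℝ} {p : E} {y m : ℝ} (hf : ContDiff ℝ ∞ f)
    (hm : HasDerivAt (fun y => f (p, y)) m y) (hm0 : m ≠ 0) :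
    ∃ g : E → ℝ, g p = y ∧ ∀ᶠ q in 𝓝 p, ContDiffAt ℝ ∞ g q ∧ f (q, g q) = f (p, y) := by
  obtain ⟨g, hg, hgp, hge⟩ := exists_implicit hf.contDiffAt hm hm0
  refine ⟨g, hgp, ?_⟩
  have hder : ∀ z : E × ℝ, HasDerivAt (fun y => f (z.1, y)) (fderiv ℝ f z (0, 1)) z.2 := fun z =>
    (hf.differentiable (by norm_num) z).hasFDerivAt.comp_hasDerivAt (x := z.2)
      (f := fun y => (z.1, y)) ((hasDerivAt_const _ _).prodMk (hasDerivAt_id _))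
  have hc : ContinuousAt (fun q => fderiv ℝ f (q, g q) (0, 1)) p := by
    have h1 : Continuous fun z => fderiv ℝ f z (0, 1) :=
      (hf.continuous_fderiv (by norm_num)).clm_apply continuous_const
    exact h1.continuousAt.comp (f := fun q => (q, g q)) (continuousAt_id.prodMk hg.continuousAt)
  have hne : ∀ᶠ q in 𝓝 p, fderiv ℝ f (q, g q) (0, 1) ≠ 0 := by
    refine hc.eventually_ne ?_
    rw [hgp, (hder (p, y)).unique hm]
    exact hm0
  have hcg : ∀ᶠ q in 𝓝 p, ContDiffAt ℝ 1 g q :=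
    (hg.of_le (by norm_cast)).eventually (by norm_cast)
  filter_upwards [hne, hcg, hge.eventually_nhds] with q h1 h2 h3
  refine ⟨contDiffAt_of_implicit hf.contDiffAt (hder (q, g q)) h1 h2.continuousAt ?_,
    h3.self_of_nhds⟩
  filter_upwards [h3] with q' h4
  rw [h4, h3.self_of_nhds]

/-- At η = 0 the equation is freq(0) = c e^m, with a positive root at which the derivative in e is
non-zero; so the root continues smoothly to small η. -/
theorem WellFamily.exists_resonant_scale {V : ℝ → ℝ → ℝ} {d₀ : ℝ} (W : WellFamily V d₀)
    (hd : 0 < d₀) {m : ℕ} (hm : 1 ≤ m) {c : ℝ} (hc : 0 < c) :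
    ∃ e : ℝ → ℝ, ContDiff ℝ ∞ e ∧ (∀ η, 0 < e η) ∧
      ∃ r > 0, ∀ η, |η| ≤ r → |η * e η| < d₀ ∧ W.freq (η * e η) = c * e η ^ m := by
  obtain ⟨χ, hχ, hχd, r₁, hr₁, hχr⟩ := exists_cutoff 0 hd
  simp only [sub_zero] at hχd hχr
  have hχ0 : χ 0 = 0 := hχr 0 (by rw [abs_zero]; exact hr₁.le)
  have hfreq : ContDiff ℝ ∞ fun x => W.freq (χ x) := contDiff_iff_contDiffAt.2 fun x =>
    (WellFamily.smooth_freq (hχd x)).comp x hχ.contDiffAt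
  have h0 : |(0 : ℝ)| < d₀ := by rwa [abs_zero]
  have hf0 := WellFamily.freq_pos (W := W) h0
  set e₀ := (W.freq 0 / c) ^ (1 / (m : ℝ)) with he₀
  have he₀pos : 0 < e₀ := Real.rpow_pos_of_pos (div_pos hf0 hc) _
  have he₀m : e₀ ^ m = W.freq 0 / c := by
    rw [he₀, ← Real.rpow_natCast, ← Real.rpow_mul (div_pos hf0 hc).le, one_div_mul_cancel,
      Real.rpow_one]
    exact_mod_cast (by omega : m ≠ 0)
  have hf : ContDiff ℝ ∞ fun z : ℝ × ℝ => W.freq (χ (z.1 * z.2)) - c * z.2 ^ m :=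
    (hfreq.comp (by fun_prop : ContDiff ℝ ∞ fun z : ℝ × ℝ => z.1 * z.2)).sub (by fun_prop)
  have hder : HasDerivAt (fun y => W.freq (χ ((0 : ℝ) * y)) - c * y ^ m)
      (-(c * (m * e₀ ^ (m - 1)))) e₀ := by
    simp only [zero_mul]
    exact ((hasDerivAt_pow m e₀).const_mul c).const_sub _
  obtain ⟨g, hg0, hg⟩ := exists_implicit_nhds hf hder (by
    have : (0 : ℝ) < m := by exact_mod_cast hm
    have := pow_pos he₀pos (m - 1)
    rw [neg_ne_zero]
    positivity)
  have hgc : ContinuousAt g 0 := hg.self_of_nhds.1.continuousAt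
  have h1 : ∀ᶠ q in 𝓝 (0 : ℝ), 0 < g q := hgc.eventually_const_lt (by rw [hg0]; exact he₀pos)
  have h2 : ∀ᶠ q in 𝓝 (0 : ℝ), |q * g q| < min r₁ d₀ :=
    ((continuousAt_id.mul hgc).abs).eventually_lt_const (by simp [hr₁, hd])
  obtain ⟨R, hR, hRe⟩ := Metric.eventually_nhds_iff.1 (hg.and (h1.and h2))
  -- A second cut-off, in η, makes the solution smooth and positive on the whole line while leaving
  -- it unchanged near 0.
  obtain ⟨κ, hκ, hκd, r, hr, hκr⟩ := exists_cutoff 0 hR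
  have hκR : ∀ η, dist (κ η) 0 < R := fun η => by rw [Real.dist_eq]; exact hκd η
  simp only [sub_zero] at hκr
  refine ⟨fun η => g (κ η), ?_, fun η => (hRe (hκR η)).2.1, r, hr, fun η hη => ?_⟩
  · exact contDiff_iff_contDiffAt.2 fun η => (hRe (hκR η)).1.1.comp η hκ.contDiffAt
  · have h3 := hRe (hκR η)
    dsimp only
    rw [hκr η hη] at h3 ⊢
    obtain ⟨⟨-, h4⟩, -, h5⟩ := h3
    refine ⟨h5.trans_le (min_le_right _ _), ?_⟩
    rw [hχr _ (h5.le.trans (min_le_left _ _)), zero_mul, hχ0, he₀m] at h4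
    field_simp at h4
    linarith

namespace ChirpedSystem

variable {P : ChirpedSystem}

/-! ### Every solution at high energies has an amplitude and a phase difference -/

theorem contDiffOn_one_of_hasDerivAt {J : Set ℝ} (hJ : IsOpen J) {x x' : ℝ → ℝ}
    (h : ∀ t ∈ J, HasDerivAt x (x' t) t) (hc : ContinuousOn x' J) : ContDiffOn ℝ 1 x J := by
  rw [contDiffOn_one_iff_derivWithin hJ.uniqueDiffOn]
  refine ⟨fun t ht => (h t ht).differentiableAt.differentiableWithinAt, hc.congr fun t ht => ?_⟩
  rw [derivWithin_of_isOpen hJ ht, (h t ht).deriv]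

/-- The equations themselves make the derivatives continuous; this C¹ regularity is what the angle
lift requires. -/
theorem contDiffOn_of_solvesFull (hP : P.Standing) {J : Set ℝ} (hJ : IsOpen J)
    (hJ0 : J ⊆ Set.Ioi 0) {x y : ℝ → ℝ} (h : ∀ t ∈ J, P.SolvesFull x y t) :
    ContDiffOn ℝ 1 x J ∧ ContDiffOn ℝ 1 y J := by
  have hx : ContinuousOn x J := fun t ht => (h t ht).1.continuousAt.continuousWithinAt
  have hy : ContinuousOn y J := fun t ht => (h t ht).2.continuousAt.continuousWithinAt
  have hS : ContinuousOn P.S J := fun t ht =>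
    (hasDerivAt_S (hJ0 ht)).continuousAt.continuousWithinAt
  have ht' : ∀ a : ℝ, ContinuousOn (fun t : ℝ => t ^ a) J := fun a t ht =>
    (Real.continuousAt_rpow_const t a (Or.inl (ne_of_gt (hJ0 ht)))).continuousWithinAt
  have hz : ContinuousOn (fun t => (x t, y t, P.S t, t)) J :=
    hx.prodMk (hy.prodMk (hS.prodMk continuousOn_id))
  have hf := hP.f_smooth.continuousOn.comp hz fun t ht => hJ0 ht
  have hg := hP.g_smooth.continuousOn.comp hz fun t ht => hJ0 ht
  have hU : Continuous (deriv P.U) := P.contDiff_U.continuous_deriv (by norm_cast)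
  constructor
  · refine contDiffOn_one_of_hasDerivAt hJ (fun t ht => (h t ht).1) ?_
    simp only [Hy_eq]
    exact hy.add ((ht' _).mul hf)
  · refine contDiffOn_one_of_hasDerivAt hJ (fun t ht => (h t ht).2) ?_
    simp only [Hx_eq]
    exact (hU.comp_continuousOn hx).neg.add ((ht' _).mul hg)

/-- The energy of the solution is explicit and determines the scale; the only choice to be made
along the interval is that of the angle. The auxiliary angle is lifted from the unit circle, and Θ
turns it into a differentiable φ. -/
theorem exists_amplitude {E₀ E₁ t₁ : ℝ} (W : WellFamily P.V (P.scale E₀)) {ϰ : ℕ} {Istar : ℝ → ℝ}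
    (hP : P.Standing) (hE₀ : 0 < E₀) (hE : E₀ ≤ E₁) (ht₁ : 0 < t₁)
    (hI : P.IsResonantEnergy ϰ E₁ t₁ Istar) {J : Set ℝ} (hJ : IsOpen J) (hJc : J.OrdConnected)
    (hJt : J ⊆ Set.Ioi t₁) {x y : ℝ → ℝ}
    (h : ∀ t ∈ J, P.SolvesFull x y t ∧ (x t, y t) ∈ P.D E₁) :
    ∃ r θ : ℝ → ℝ, ∀ t ∈ J, 0 < 1 + t ^ (-P.mu) * r (P.tau t) ∧
      DifferentiableAt ℝ r (P.tau t) ∧ DifferentiableAt ℝ θ (P.tau t) ∧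
      x t = P.original ϰ (eaX W) Istar r θ t ∧ y t = P.original ϰ (eaY W) Istar r θ t := by
  have hh := hP.two_le_h
  have hh' := hP.two_le
  obtain ⟨hx, hy⟩ := contDiffOn_of_solvesFull hP hJ (fun t ht => ht₁.trans (hJt ht))
    fun t ht => (h t ht).1
  set I : ℝ → ℝ := fun t => P.H (x t) (y t) with hIdef
  have hI0 : ∀ t ∈ J, E₀ < I t := fun t ht => hE.trans_lt (h t ht).2
  have hIpos : ∀ t ∈ J, 0 < I t := fun t ht => hE₀.trans (hI0 t ht)
  have hIs : ContDiffOn ℝ 1 I J :=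
    ((hy.pow 2).div_const 2).add ((P.contDiff_U.of_le (by norm_cast)).comp_contDiffOn hx)
  set δ : ℝ → ℝ := fun t => P.scale (I t) with hδdef
  have hδ : ∀ t ∈ J, |δ t| < P.scale E₀ := fun t ht => abs_scale_lt hh hE₀ (hI0 t ht)
  have hδpos : ∀ t ∈ J, 0 < δ t := fun t ht => scale_pos (hIpos t ht)
  have hδs : ∀ t ∈ J, ContDiffAt ℝ 1 δ t := fun t ht =>
    ((contDiffAt_scale (hIpos t ht)).of_le (by norm_cast)).comp t (hIs.contDiffAt (hJ.mem_nhds ht))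
  have hxs : ∀ t ∈ J, ContDiffAt ℝ 1 x t := fun t ht => hx.contDiffAt (hJ.mem_nhds ht)
  have hys : ∀ t ∈ J, ContDiffAt ℝ 1 y t := fun t ht => hy.contDiffAt (hJ.mem_nhds ht)
  have hcs : ∀ t ∈ J, ContDiffAt ℝ 1 (fun t => W.c (δ t)) t := fun t ht =>
    ((W.smooth_c _ (hδ t ht)).of_le (by norm_cast)).comp t (hδs t ht)
  have hds : ∀ t ∈ J, ContDiffAt ℝ 1 (fun t => W.d (δ t)) t := fun t ht =>
    ((W.smooth_d _ (hδ t ht)).of_le (by norm_cast)).comp t (hδs t ht)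
  have hQs : ∀ t ∈ J, ContDiffAt ℝ 1 (fun t => W.Q (δ t) (δ t * x t)) t := fun t ht =>
    ContDiffAt.comp t (g := fun z : ℝ × ℝ => W.Q z.1 z.2) (f := fun t => (δ t, δ t * x t))
      ((W.smooth_Q _ _ (hδ t ht)).of_le (by norm_cast))
      ((hδs t ht).prodMk ((hδs t ht).mul (hxs t ht)))
  have hen := fun t (ht : t ∈ J) => WellFamily.of_energy (W := W) (hδ t ht)
    (scaled_energy hh (hIpos t ht) rfl)
  obtain ⟨α, hα⟩ := exists_angle_lift hJ hJc
    (C := fun t => (δ t * x t - W.c (δ t)) / W.d (δ t))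
    (S := fun t => -(δ t ^ P.h * y t) / (W.d (δ t) * Real.sqrt (2 * W.Q (δ t) (δ t * x t))))
    (fun t ht => (((((hδs t ht).mul (hxs t ht)).sub (hcs t ht)).div (hds t ht)
      (W.d_pos _ (hδ t ht)).ne')).contDiffWithinAt)
    (fun t ht => by
      have h2Q : 0 < 2 * W.Q (δ t) (δ t * x t) := mul_pos two_pos (hen t ht).1
      refine (((((hδs t ht).pow P.h).mul (hys t ht)).neg).div ((hds t ht).mul
        ((contDiffAt_const.mul (hQs t ht)).sqrt h2Q.ne')) ?_).contDiffWithinAt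
      exact (mul_pos (W.d_pos _ (hδ t ht)) (Real.sqrt_pos.2 h2Q)).ne')
    (fun t ht => (hen t ht).2)
  set φ : ℝ → ℝ := fun t => W.Theta (δ t) (α t) with hφdef
  have hφd : ∀ t ∈ J, DifferentiableAt ℝ φ t := fun t ht =>
    DifferentiableAt.comp t (g := fun z : ℝ × ℝ => W.Theta z.1 z.2) (f := fun t => (δ t, α t))
      ((WellFamily.smooth_Theta (hδ t ht) _).differentiableAt (by norm_num))
      (((hδs t ht).differentiableAt one_ne_zero).prodMk (hα t ht).1)
  -- Formula (2) solved for r and θ: the 2h-th root of I/I⋆ gives 1 + t^(-μ) r, and θ = φ - S/ϰ.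
  refine ⟨fun τ => P.time τ ^ P.mu *
      ((I (P.time τ) / Istar (P.time τ)) ^ (1 / (2 * P.h : ℝ)) - 1),
    fun τ => φ (P.time τ) - P.S (P.time τ) / ϰ, fun t ht => ?_⟩
  have ht0 : 0 < t := ht₁.trans (hJt ht)
  have hJs : 0 < Istar t := hE₀.trans_le (hE.trans (hI.2 t (le_of_lt (hJt ht))).1)
  have htd := differentiableAt_time hP (tau_pos hP ht0)
  have htt := time_tau hP ht0
  have hq : 0 < I t / Istar t := div_pos (hIpos t ht) hJs
  have hw : 1 + t ^ (-P.mu) * (t ^ P.mu * ((I t / Istar t) ^ (1 / (2 * P.h : ℝ)) - 1)) =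
      (I t / Istar t) ^ (1 / (2 * P.h : ℝ)) := by
    rw [← mul_assoc, ← Real.rpow_add ht0, neg_add_cancel, Real.rpow_zero]
    ring
  have hId : DifferentiableAt ℝ I t := (hIs.contDiffAt (hJ.mem_nhds ht)).differentiableAt
    one_ne_zero
  refine ⟨?_, ?_, ?_, ?_⟩
  · dsimp only
    rw [htt, hw]
    exact Real.rpow_pos_of_pos hq _
  · have hd1 : DifferentiableAt ℝ (fun t => t ^ P.mu *
        ((I t / Istar t) ^ (1 / (2 * P.h : ℝ)) - 1)) (P.time (P.tau t)) := by
      rw [htt]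
      exact (differentiableAt_id.rpow_const (Or.inl ht0.ne')).mul
        (((hId.div (hI.differentiableAt (hJt ht)) hJs.ne').rpow_const (Or.inl hq.ne')).sub_const 1)
    exact hd1.comp _ htd
  · have hd1 : DifferentiableAt ℝ (fun t => φ t - P.S t / ϰ) (P.time (P.tau t)) := by
      rw [htt]
      exact (hφd t ht).sub ((hasDerivAt_S ht0).differentiableAt.div_const _)
    exact hd1.comp _ htd
  · have hEn : P.energyOf Istar (fun τ => P.time τ ^ P.mu *
        ((I (P.time τ) / Istar (P.time τ)) ^ (1 / (2 * P.h : ℝ)) - 1)) t = I t := by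
      unfold energyOf
      dsimp only
      rw [htt, hw, ← Real.rpow_natCast, ← Real.rpow_mul hq.le]
      push_cast
      rw [one_div_mul_cancel (by positivity), Real.rpow_one, mul_div_cancel₀ _ hJs.ne']
    have hAn : P.angleOf ϰ (fun τ => φ (P.time τ) - P.S (P.time τ) / ϰ) t = φ t := by
      unfold angleOf
      dsimp only
      rw [htt]
      ring
    unfold original
    rw [hEn, hAn]
    obtain ⟨e1, e2⟩ := ea_of_cos_sin W hh hE₀ (hI0 t ht) (hen t ht).1 (hα t ht).2.1 (hα t ht).2.2
    exact ⟨e1.symm, e2.symm⟩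

end ChirpedSystem

/-! ### Recursion on all previous terms, and smoothness of partial derivatives -/

/-- The step expects a full sequence but reads only entries below K, so the unknown ones are filled
with the default d. The default must itself be `good`, because the invariant of a step is granted
only for sequences that are good throughout. -/
theorem exists_strongRec {T : Type} (d : T) (step : (ℕ → T) → ℕ → T)
    (hcongr : ∀ K p p', (∀ j < K, p j = p' j) → step p K = step p' K) (good : T → Prop)
    (hdef : good d) (hgood : ∀ p K, (∀ j, good (p j)) → good (step p K)) :
    ∃ s : ℕ → T, ∀ K, s K = step s K ∧ good (s K) := by
  let trunc : ∀ K : ℕ, (∀ j, j < K → T) → ℕ → T := fun K f j => if h : j < K then f j h else d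
  let s : ℕ → T := WellFounded.fix (measure id).wf fun K f => step (trunc K f) K
  have hs : ∀ K, s K = step (trunc K fun j _ => s j) K := fun K =>
    WellFounded.fix_eq (measure id).wf (fun K f => step (trunc K f) K) K
  refine ⟨s, fun K => ⟨?_, ?_⟩⟩
  · rw [hs K]
    refine hcongr K _ _ fun j hj => ?_
    simp [trunc, hj]
  · induction K using Nat.strong_induction_on with
    | _ K ih =>
      rw [hs K]
      refine hgood _ K fun j => ?_
      by_cases hj : j < K
      · simpa [trunc, hj] using ih j hj
      · simpa [trunc, hj] using hdef

theorem contDiff_deriv_one_three {c : ℝ → ℝ → ℝ → ℝ}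
    (hc : ContDiff ℝ ∞ fun z : ℝ × ℝ × ℝ => c z.1 z.2.1 z.2.2) :
    ContDiff ℝ ∞ fun z : ℝ × ℝ × ℝ => deriv (fun r => c r z.2.1 z.2.2) z.1 := by
  have h : ∀ z : ℝ × ℝ × ℝ, deriv (fun r => c r z.2.1 z.2.2) z.1 =
      fderiv ℝ (fun z : ℝ × ℝ × ℝ => c z.1 z.2.1 z.2.2) z (1, 0, 0) := fun z =>
    ((hc.differentiable (by norm_num) z).hasFDerivAt.comp_hasDerivAt z.1
      (f := fun r => (r, z.2.1, z.2.2))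
      ((hasDerivAt_id _).prodMk ((hasDerivAt_const _ _).prodMk (hasDerivAt_const _ _)))).deriv
  rw [funext h]
  exact (hc.fderiv_right (m := ∞) (by norm_num)).clm_apply contDiff_const

theorem contDiff_deriv_two_three {c : ℝ → ℝ → ℝ → ℝ}
    (hc : ContDiff ℝ ∞ fun z : ℝ × ℝ × ℝ => c z.1 z.2.1 z.2.2) :
    ContDiff ℝ ∞ fun z : ℝ × ℝ × ℝ => deriv (fun θ => c z.1 θ z.2.2) z.2.1 := by
  have h : ∀ z : ℝ × ℝ × ℝ, deriv (fun θ => c z.1 θ z.2.2) z.2.1 =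
      fderiv ℝ (fun z : ℝ × ℝ × ℝ => c z.1 z.2.1 z.2.2) z (0, 1, 0) := fun z =>
    ((hc.differentiable (by norm_num) z).hasFDerivAt.comp_hasDerivAt z.2.1
      (f := fun θ => (z.1, θ, z.2.2))
      ((hasDerivAt_const _ _).prodMk ((hasDerivAt_id _).prodMk (hasDerivAt_const _ _)))).deriv
  rw [funext h]
  exact (hc.fderiv_right (m := ∞) (by norm_num)).clm_apply contDiff_const

theorem contDiff_deriv_three_three {c : ℝ → ℝ → ℝ → ℝ}
    (hc : ContDiff ℝ ∞ fun z : ℝ × ℝ × ℝ => c z.1 z.2.1 z.2.2) :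
    ContDiff ℝ ∞ fun z : ℝ × ℝ × ℝ => deriv (fun ζ => c z.1 z.2.1 ζ) z.2.2 := by
  have h : ∀ z : ℝ × ℝ × ℝ, deriv (fun ζ => c z.1 z.2.1 ζ) z.2.2 =
      fderiv ℝ (fun z : ℝ × ℝ × ℝ => c z.1 z.2.1 z.2.2) z (0, 0, 1) := fun z =>
    ((hc.differentiable (by norm_num) z).hasFDerivAt.comp_hasDerivAt z.2.2
      (f := fun ζ => (z.1, z.2.1, ζ))
      ((hasDerivAt_const _ _).prodMk ((hasDerivAt_const _ _).prodMk (hasDerivAt_id _)))).deriv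
  rw [funext h]
  exact (hc.fderiv_right (m := ∞) (by norm_num)).clm_apply contDiff_const

namespace ChirpedSystem

/-! ### The averaging chain -/

section Homological

variable {ϰ : ℕ} {c : ℝ → ℝ → ℝ → ℝ}

theorem mean_eq (hϰ : 0 < ϰ) (f : ℝ → ℝ) :
    mean ϰ f = ∫ s in (0 : ℝ)..1, f (2 * Real.pi * ϰ * s) := by
  have hT : 2 * Real.pi * ϰ ≠ 0 := by positivity
  rw [intervalIntegral.integral_comp_mul_left (f := f) hT, mul_zero, mul_one, mean, one_div,
    smul_eq_mul]

theorem mean_const (hϰ : 0 < ϰ) (a : ℝ) : mean ϰ (fun _ => a) = a := by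
  rw [mean_eq hϰ]
  simp

theorem contDiff_mean (hϰ : 0 < ϰ)
    (hc : ContDiff ℝ ∞ fun z : ℝ × ℝ × ℝ => c z.1 z.2.1 z.2.2) :
    ContDiff ℝ ∞ fun z : ℝ × ℝ => mean ϰ (fun ζ => c z.1 z.2 ζ) := by
  simp only [mean_eq hϰ]
  exact contDiff_integral_param (F := fun w : (ℝ × ℝ) × ℝ => c w.1.1 w.1.2 (2 * Real.pi * ϰ * w.2))
    (hc.comp (by fun_prop : ContDiff ℝ ∞ fun w : (ℝ × ℝ) × ℝ =>
      (w.1.1, w.1.2, 2 * Real.pi * ϰ * w.2)))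

/-- The solution with the initial value `0` of `κ ∂_ζ γ = ⟨c⟩ - c`. -/
def homologicalPrimitive (ϰ : ℕ) (κ : ℝ) (c : ℝ → ℝ → ℝ → ℝ) (r θ ζ : ℝ) : ℝ :=
  (∫ s in (0 : ℝ)..ζ, (mean ϰ (c r θ) - c r θ s)) / κ

/-- The solution with zero mean of `κ ∂_ζ γ = ⟨c⟩ - c`. -/
def homological (ϰ : ℕ) (κ : ℝ) (c : ℝ → ℝ → ℝ → ℝ) (r θ ζ : ℝ) : ℝ :=
  homologicalPrimitive ϰ κ c r θ ζ - mean ϰ (homologicalPrimitive ϰ κ c r θ)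

theorem contDiff_primitive
    (hc : ContDiff ℝ ∞ fun z : ℝ × ℝ × ℝ => c z.1 z.2.1 z.2.2) :
    ContDiff ℝ ∞ fun z : ℝ × ℝ × ℝ => ∫ s in (0 : ℝ)..z.2.2, c z.1 z.2.1 s := by
  have h1 : ∀ z : ℝ × ℝ × ℝ, ∫ s in (0 : ℝ)..z.2.2, c z.1 z.2.1 s =
      z.2.2 * ∫ s in (0 : ℝ)..1, c z.1 z.2.1 (z.2.2 * s) := fun z => by
    rw [intervalIntegral.mul_integral_comp_mul_left (f := fun s => c z.1 z.2.1 s), mul_zero,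
      mul_one]
  rw [funext h1]
  refine (by fun_prop : ContDiff ℝ ∞ fun z : ℝ × ℝ × ℝ => z.2.2).mul ?_
  exact contDiff_integral_param (F := fun w : (ℝ × ℝ × ℝ) × ℝ => c w.1.1 w.1.2.1 (w.1.2.2 * w.2))
    (hc.comp (by fun_prop : ContDiff ℝ ∞ fun w : (ℝ × ℝ × ℝ) × ℝ =>
      (w.1.1, w.1.2.1, w.1.2.2 * w.2)))

theorem continuous_third (hc : ContDiff ℝ ∞ fun z : ℝ × ℝ × ℝ => c z.1 z.2.1 z.2.2) (r θ : ℝ) :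
    Continuous (c r θ) :=
  hc.continuous.comp (by fun_prop : Continuous fun ζ : ℝ => (r, θ, ζ))

theorem contDiff_homologicalPrimitive (hϰ : 0 < ϰ) (κ : ℝ) (hc : SmoothPeriodic ϰ c) :
    ContDiff ℝ ∞ fun z : ℝ × ℝ × ℝ => homologicalPrimitive ϰ κ c z.1 z.2.1 z.2.2 := by
  refine (contDiff_primitive (c := fun r θ s => mean ϰ (c r θ) - c r θ s) ?_).div_const κ
  exact ((contDiff_mean hϰ hc.1).comp
    (by fun_prop : ContDiff ℝ ∞ fun z : ℝ × ℝ × ℝ => (z.1, z.2.1))).sub hc.1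

/-- Periodicity in ζ is the solvability condition: the integrand ⟨c⟩ - c has integral zero over a
period. -/
theorem smoothPeriodic_homological (hϰ : 0 < ϰ) (κ : ℝ) (hc : SmoothPeriodic ϰ c) :
    SmoothPeriodic ϰ (homological ϰ κ c) := by
  have hp := contDiff_homologicalPrimitive hϰ κ hc
  refine ⟨?_, fun r θ ζ => ⟨?_, ?_⟩⟩
  · have hm := (contDiff_mean hϰ hp).comp
      (by fun_prop : ContDiff ℝ ∞ fun z : ℝ × ℝ × ℝ => (z.1, z.2.1))
    exact hp.sub hm
  · have h1 : c r (θ + 2 * Real.pi) = c r θ := funext fun ζ => (hc.2 r θ ζ).1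
    unfold homological homologicalPrimitive
    rw [h1]
  · have hper : Function.Periodic (fun s => mean ϰ (c r θ) - c r θ s) (2 * Real.pi * ϰ) := fun s => by
      dsimp only
      rw [(hc.2 r θ s).2]
    have hcont := continuous_third hc.1 r θ
    have hi : Continuous fun s => mean ϰ (c r θ) - c r θ s := continuous_const.sub hcont
    have hzero : ∫ s in (0 : ℝ)..(2 * Real.pi * ϰ), (mean ϰ (c r θ) - c r θ s) = 0 := by
      rw [intervalIntegral.integral_sub intervalIntegrable_const (hcont.intervalIntegrable _ _),
        intervalIntegral.integral_const, mean, smul_eq_mul]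
      field_simp
      ring
    unfold homological homologicalPrimitive
    rw [← intervalIntegral.integral_add_adjacent_intervals (hi.intervalIntegrable 0 ζ)
      (hi.intervalIntegrable ζ _), hper.intervalIntegral_add_eq ζ 0, zero_add, hzero, add_zero]

theorem deriv_homological (κ : ℝ) (hκ : κ ≠ 0) (hc : SmoothPeriodic ϰ c) (r θ ζ : ℝ) :
    κ * deriv (fun ζ => homological ϰ κ c r θ ζ) ζ = mean ϰ (c r θ) - c r θ ζ := by
  have hi : Continuous fun s => mean ϰ (c r θ) - c r θ s :=
    continuous_const.sub (continuous_third hc.1 r θ)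
  have h : HasDerivAt (fun ζ => homological ϰ κ c r θ ζ) ((mean ϰ (c r θ) - c r θ ζ) / κ) ζ :=
    ((intervalIntegral.integral_hasDerivAt_right (hi.intervalIntegrable _ _)
      (hi.stronglyMeasurableAtFilter _ _) hi.continuousAt).div_const κ).sub_const _
  rw [h.deriv]
  field_simp

theorem mean_sub {f g : ℝ → ℝ} (hf : Continuous f) (hg : Continuous g) :
    mean ϰ (fun ζ => f ζ - g ζ) = mean ϰ f - mean ϰ g := by
  unfold mean
  rw [intervalIntegral.integral_sub (hf.intervalIntegrable _ _) (hg.intervalIntegrable _ _),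
    mul_sub]

theorem mean_homological (hϰ : 0 < ϰ) (κ : ℝ) (hc : SmoothPeriodic ϰ c) (r θ : ℝ) :
    mean ϰ (fun ζ => homological ϰ κ c r θ ζ) = 0 := by
  have hp := continuous_third (contDiff_homologicalPrimitive hϰ κ hc) r θ
  unfold homological
  rw [mean_sub hp continuous_const, mean_const hϰ, sub_self]

end Homological

variable {P : ChirpedSystem} {ϰ : ℕ}

/-- The chain is a genuine recursion: M > 0 forces j < K in the convolution, and N > 0 gives K - N <
K. -/
theorem correction_congr (hM : 0 < P.M) (hN : 0 < P.N) {cA cB ρ ψ γ ρ' ψ' γ' : ℕ → ℝ → ℝ → ℝ → ℝ}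
    {Γ Γ' : ℕ → ℝ → ℝ → ℝ} {K : ℕ} (hρ : ∀ j < K, ρ j = ρ' j) (hψ : ∀ j < K, ψ j = ψ' j)
    (hγ : ∀ j < K, γ j = γ' j) (hΓ : ∀ j < K, Γ j = Γ' j) :
    P.correction cA cB ρ ψ γ Γ K = P.correction cA cB ρ' ψ' γ' Γ' K := by
  funext r θ ζ
  unfold correction
  congr 1
  · congr 1
    · refine Finset.sum_congr rfl fun i _ => Finset.sum_congr rfl fun j _ => ?_
      by_cases h : i + j + P.M = K
      · rw [hγ j (by omega)]
      · rw [if_neg h, if_neg h]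
    · by_cases h : P.N ≤ K
      · rw [hγ (K - P.N) (by omega)]
      · rw [if_neg h, if_neg h]
  · congr 2
    funext ε
    have h1 : ∑ k ∈ Finset.range K, ε ^ (P.M + k) * ρ k r θ ζ =
        ∑ k ∈ Finset.range K, ε ^ (P.M + k) * ρ' k r θ ζ :=
      Finset.sum_congr rfl fun k hk => by rw [hρ k (Finset.mem_range.1 hk)]
    have h2 : ∑ k ∈ Finset.range K, ε ^ (P.M + k) * ψ k r θ ζ =
        ∑ k ∈ Finset.range K, ε ^ (P.M + k) * ψ' k r θ ζ :=
      Finset.sum_congr rfl fun k hk => by rw [hψ k (Finset.mem_range.1 hk)]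
    rw [h1, h2]
    exact Finset.sum_congr rfl fun j hj => by rw [hΓ j (Finset.mem_range.1 hj)]

/-- Smooth, and periodic in the second variable. -/
def SmoothPeriodicAvg (Γ : ℝ → ℝ → ℝ) : Prop :=
  ContDiff ℝ ∞ (fun z : ℝ × ℝ => Γ z.1 z.2) ∧ ∀ R Ψ, Γ R (Ψ + 2 * Real.pi) = Γ R Ψ

theorem SmoothPeriodic.contDiff_comp {c : ℝ → ℝ → ℝ → ℝ} (hc : SmoothPeriodic ϰ c) {E : Type}
    [NormedAddCommGroup E] [NormedSpace ℝ E] {f g k : E → ℝ} (hf : ContDiff ℝ ∞ f)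
    (hg : ContDiff ℝ ∞ g) (hk : ContDiff ℝ ∞ k) : ContDiff ℝ ∞ fun z => c (f z) (g z) (k z) :=
  hc.1.comp (hf.prodMk (hg.prodMk hk))

theorem SmoothPeriodicAvg.contDiff_comp {Γ : ℝ → ℝ → ℝ} (hΓ : SmoothPeriodicAvg Γ) {E : Type}
    [NormedAddCommGroup E] [NormedSpace ℝ E] {f g : E → ℝ} (hf : ContDiff ℝ ∞ f)
    (hg : ContDiff ℝ ∞ g) : ContDiff ℝ ∞ fun z => Γ (f z) (g z) :=
  hΓ.1.comp (hf.prodMk hg)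

theorem SmoothPeriodic.deriv_one {c : ℝ → ℝ → ℝ → ℝ} (hc : SmoothPeriodic ϰ c) :
    SmoothPeriodic ϰ fun r θ ζ => deriv (fun r' => c r' θ ζ) r := by
  refine ⟨contDiff_deriv_one_three hc.1, fun r θ ζ => ⟨?_, ?_⟩⟩
  · dsimp only
    congr 1
    funext r'
    exact (hc.2 r' θ ζ).1
  · dsimp only
    congr 1
    funext r'
    exact (hc.2 r' θ ζ).2

theorem SmoothPeriodic.deriv_two {c : ℝ → ℝ → ℝ → ℝ} (hc : SmoothPeriodic ϰ c) :
    SmoothPeriodic ϰ fun r θ ζ => deriv (fun θ' => c r θ' ζ) θ := by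
  refine ⟨contDiff_deriv_two_three hc.1, fun r θ ζ => ⟨?_, ?_⟩⟩
  · dsimp only
    rw [← deriv_comp_add_const]
    congr 1
    funext θ'
    exact (hc.2 r θ' ζ).1
  · dsimp only
    congr 1
    funext θ'
    exact (hc.2 r θ' ζ).2

theorem SmoothPeriodic.deriv_three {c : ℝ → ℝ → ℝ → ℝ} (hc : SmoothPeriodic ϰ c) :
    SmoothPeriodic ϰ fun r θ ζ => deriv (fun ζ' => c r θ ζ') ζ := by
  refine ⟨contDiff_deriv_three_three hc.1, fun r θ ζ => ⟨?_, ?_⟩⟩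
  · dsimp only
    congr 1
    funext ζ'
    exact (hc.2 r θ ζ').1
  · dsimp only
    rw [← deriv_comp_add_const]
    congr 1
    funext ζ'
    exact (hc.2 r θ ζ').2

theorem SmoothPeriodic.add {c c' : ℝ → ℝ → ℝ → ℝ} (hc : SmoothPeriodic ϰ c)
    (hc' : SmoothPeriodic ϰ c') : SmoothPeriodic ϰ fun r θ ζ => c r θ ζ + c' r θ ζ :=
  ⟨hc.1.add hc'.1, fun r θ ζ => by simp only [hc.2 r θ ζ, hc'.2 r θ ζ, and_self]⟩

theorem SmoothPeriodic.sub {c c' : ℝ → ℝ → ℝ → ℝ} (hc : SmoothPeriodic ϰ c)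
    (hc' : SmoothPeriodic ϰ c') : SmoothPeriodic ϰ fun r θ ζ => c r θ ζ - c' r θ ζ :=
  ⟨hc.1.sub hc'.1, fun r θ ζ => by simp only [hc.2 r θ ζ, hc'.2 r θ ζ, and_self]⟩

theorem SmoothPeriodic.mul {c c' : ℝ → ℝ → ℝ → ℝ} (hc : SmoothPeriodic ϰ c)
    (hc' : SmoothPeriodic ϰ c') : SmoothPeriodic ϰ fun r θ ζ => c r θ ζ * c' r θ ζ :=
  ⟨hc.1.mul hc'.1, fun r θ ζ => by simp only [hc.2 r θ ζ, hc'.2 r θ ζ, and_self]⟩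

theorem smoothPeriodic_const (a : ℝ) : SmoothPeriodic ϰ fun _ _ _ => a :=
  ⟨contDiff_const, fun _ _ _ => ⟨rfl, rfl⟩⟩

theorem SmoothPeriodic.sum {ι : Type*} {s : Finset ι} {c : ι → ℝ → ℝ → ℝ → ℝ}
    (hc : ∀ i ∈ s, SmoothPeriodic ϰ (c i)) : SmoothPeriodic ϰ fun r θ ζ => ∑ i ∈ s, c i r θ ζ :=
  ⟨ContDiff.sum fun i hi => (hc i hi).1, fun r θ ζ =>
    ⟨Finset.sum_congr rfl fun i hi => ((hc i hi).2 r θ ζ).1,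
      Finset.sum_congr rfl fun i hi => ((hc i hi).2 r θ ζ).2⟩⟩

theorem smoothPeriodic_correction {cA cB ρ ψ γ : ℕ → ℝ → ℝ → ℝ → ℝ} {Γ : ℕ → ℝ → ℝ → ℝ}
    (hA : ∀ j, SmoothPeriodic ϰ (cA j)) (hB : ∀ j, SmoothPeriodic ϰ (cB j))
    (hρ : ∀ j, SmoothPeriodic ϰ (ρ j)) (hψ : ∀ j, SmoothPeriodic ϰ (ψ j))
    (hγ : ∀ j, SmoothPeriodic ϰ (γ j)) (hΓ : ∀ j, SmoothPeriodicAvg (Γ j)) (K : ℕ) :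
    SmoothPeriodic ϰ (P.correction cA cB ρ ψ γ Γ K) := by
  have h1 : SmoothPeriodic ϰ fun r θ ζ =>
      ∑ i ∈ Finset.range (K + 1), ∑ j ∈ Finset.range (K + 1), if i + j + P.M = K then
      cA i r θ ζ * deriv (fun r' => γ j r' θ ζ) r + cB i r θ ζ * deriv (fun θ' => γ j r θ' ζ) θ
      else 0 := by
    refine SmoothPeriodic.sum fun i _ => SmoothPeriodic.sum fun j _ => ?_
    by_cases h : i + j + P.M = K
    · simp only [h, if_true]
      exact ((hA i).mul (hγ j).deriv_one).add ((hB i).mul (hγ j).deriv_two)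
    · simp only [h, if_false]
      exact smoothPeriodic_const 0
  have h2 : SmoothPeriodic ϰ fun r θ ζ =>
      if P.N ≤ K then ((P.M : ℝ) + K - P.N) / P.N * γ (K - P.N) r θ ζ else 0 := by
    by_cases h : P.N ≤ K
    · simp only [h, if_true]
      exact (smoothPeriodic_const _).mul (hγ _)
    · simp only [h, if_false]
      exact smoothPeriodic_const 0
  have h3 : SmoothPeriodic ϰ fun r θ ζ => taylorCoeff K fun ε : ℝ => ∑ j ∈ Finset.range K, ε ^ j *
        Γ j (r + ∑ k ∈ Finset.range K, ε ^ (P.M + k) * ρ k r θ ζ)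
            (θ + ∑ k ∈ Finset.range K, ε ^ (P.M + k) * ψ k r θ ζ) := by
    refine ⟨contDiff_taylorCoeff (E := ℝ × ℝ × ℝ) (g := fun w => ∑ j ∈ Finset.range K, w.1 ^ j *
        Γ j (w.2.1 + ∑ k ∈ Finset.range K, w.1 ^ (P.M + k) * ρ k w.2.1 w.2.2.1 w.2.2.2)
            (w.2.2.1 + ∑ k ∈ Finset.range K, w.1 ^ (P.M + k) * ψ k w.2.1 w.2.2.1 w.2.2.2)) ?_ K,
      fun r θ ζ => ⟨?_, ?_⟩⟩
    · refine ContDiff.sum fun j _ => ContDiff.mul (by fun_prop) ((hΓ j).contDiff_comp ?_ ?_)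
      · exact ContDiff.add (by fun_prop) (ContDiff.sum fun k _ => ContDiff.mul (by fun_prop)
          ((hρ k).contDiff_comp (by fun_prop) (by fun_prop) (by fun_prop)))
      · exact ContDiff.add (by fun_prop) (ContDiff.sum fun k _ => ContDiff.mul (by fun_prop)
          ((hψ k).contDiff_comp (by fun_prop) (by fun_prop) (by fun_prop)))
    · simp only [fun k => ((hρ k).2 r θ ζ).1, fun k => ((hψ k).2 r θ ζ).1,
        add_right_comm θ (2 * Real.pi), fun j => (hΓ j).2]
    · simp only [fun k => ((hρ k).2 r θ ζ).2, fun k => ((hψ k).2 r θ ζ).2]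
  exact (h1.sub h2).sub h3

/-- At order K the correction is already known, and `homological` solves the remaining equation with
zero mean. The four sequences are built simultaneously because each correction involves both ρ and
ψ. -/
theorem exists_averagingChain (hP : P.Standing) (hr : P.Resonance) (hϰ : 0 < ϰ)
    {cA cB : ℕ → ℝ → ℝ → ℝ → ℝ} (hA : ∀ j, SmoothPeriodic ϰ (cA j))
    (hB : ∀ j, SmoothPeriodic ϰ (cB j)) :
    ∃ ρ ψ : ℕ → ℝ → ℝ → ℝ → ℝ, ∃ Λ Ω : ℕ → ℝ → ℝ → ℝ,
      P.AveragingChain ϰ cA cB ρ ψ cA ρ Λ ∧ P.AveragingChain ϰ cA cB ρ ψ cB ψ Ω := by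
  have hM := (P.M_eq hP hr).1
  have hN := (P.N_eq hP).1
  let rhs : (ℕ → ℝ → ℝ → ℝ → ℝ) → (ℕ → ℝ → ℝ → ℝ → ℝ) → (ℕ → ℝ → ℝ → ℝ → ℝ) →
      (ℕ → ℝ → ℝ → ℝ → ℝ) → (ℕ → ℝ → ℝ → ℝ) → ℕ → ℝ → ℝ → ℝ → ℝ := fun c ρ ψ γ Γ K r θ ζ =>
    c K r θ ζ + P.correction cA cB ρ ψ γ Γ K r θ ζ
  let T := (ℝ → ℝ → ℝ → ℝ) × (ℝ → ℝ → ℝ → ℝ) × (ℝ → ℝ → ℝ) × (ℝ → ℝ → ℝ)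
  let a : (ℕ → T) → ℕ → ℝ → ℝ → ℝ → ℝ := fun p =>
    rhs cA (fun j => (p j).1) (fun j => (p j).2.1) (fun j => (p j).1) (fun j => (p j).2.2.1)
  let b : (ℕ → T) → ℕ → ℝ → ℝ → ℝ → ℝ := fun p =>
    rhs cB (fun j => (p j).1) (fun j => (p j).2.1) (fun j => (p j).2.1) (fun j => (p j).2.2.2)
  let step : (ℕ → T) → ℕ → T := fun p K => (homological ϰ P.vartheta (a p K),
    homological ϰ P.vartheta (b p K), fun r θ => mean ϰ (a p K r θ), fun r θ => mean ϰ (b p K r θ))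
  let good : T → Prop := fun p => SmoothPeriodic ϰ p.1 ∧ SmoothPeriodic ϰ p.2.1 ∧
    SmoothPeriodicAvg p.2.2.1 ∧ SmoothPeriodicAvg p.2.2.2
  have hab : ∀ p : ℕ → T, (∀ j, good (p j)) → ∀ K,
      SmoothPeriodic ϰ (a p K) ∧ SmoothPeriodic ϰ (b p K) := fun p hp K =>
    ⟨(hA K).add (smoothPeriodic_correction hA hB (fun j => (hp j).1) (fun j => (hp j).2.1)
      (fun j => (hp j).1) (fun j => (hp j).2.2.1) K),
    (hB K).add (smoothPeriodic_correction hA hB (fun j => (hp j).1) (fun j => (hp j).2.1)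
      (fun j => (hp j).2.1) (fun j => (hp j).2.2.2) K)⟩
  have havg : ∀ c : ℝ → ℝ → ℝ → ℝ, SmoothPeriodic ϰ c →
      SmoothPeriodicAvg fun r θ => mean ϰ (c r θ) := fun c hc =>
    ⟨contDiff_mean hϰ hc.1, fun R Ψ => by
      dsimp only
      rw [show c R (Ψ + 2 * Real.pi) = c R Ψ from funext fun ζ => (hc.2 R Ψ ζ).1]⟩
  let d : T := (fun _ _ _ => 0, fun _ _ _ => 0, fun _ _ => 0, fun _ _ => 0)
  obtain ⟨s, hs⟩ := exists_strongRec d step (fun K p p' hpp => by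
      have h1 : a p K = a p' K := by
        funext r θ ζ
        simp only [a, rhs]
        rw [correction_congr hM hN (fun j hj => by rw [hpp j hj]) (fun j hj => by rw [hpp j hj])
          (fun j hj => by rw [hpp j hj]) (fun j hj => by rw [hpp j hj])]
      have h2 : b p K = b p' K := by
        funext r θ ζ
        simp only [b, rhs]
        rw [correction_congr hM hN (fun j hj => by rw [hpp j hj]) (fun j hj => by rw [hpp j hj])
          (fun j hj => by rw [hpp j hj]) (fun j hj => by rw [hpp j hj])]
      simp only [step, h1, h2])
    good
    ⟨smoothPeriodic_const 0, smoothPeriodic_const 0, ⟨contDiff_const, fun _ _ => rfl⟩,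
      ⟨contDiff_const, fun _ _ => rfl⟩⟩
    (fun p K hp => ⟨smoothPeriodic_homological hϰ _ (hab p hp K).1,
      smoothPeriodic_homological hϰ _ (hab p hp K).2, havg _ (hab p hp K).1, havg _ (hab p hp K).2⟩)
  have hgood := fun K => (hs K).2
  have e1 : ∀ K, (s K).1 = homological ϰ P.vartheta (a s K) := fun K => congrArg (·.1) (hs K).1
  have e2 : ∀ K, (s K).2.1 = homological ϰ P.vartheta (b s K) := fun K => congrArg (·.2.1) (hs K).1
  have e3 : ∀ K, (s K).2.2.1 = fun r θ => mean ϰ (a s K r θ) := fun K =>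
    congrArg (·.2.2.1) (hs K).1
  have e4 : ∀ K, (s K).2.2.2 = fun r θ => mean ϰ (b s K r θ) := fun K =>
    congrArg (·.2.2.2) (hs K).1
  refine ⟨fun j => (s j).1, fun j => (s j).2.1, fun j => (s j).2.2.1, fun j => (s j).2.2.2,
    ⟨fun K => (hgood K).1, fun K => (hgood K).2.2.1.1, fun K => (hgood K).2.2.1.2,
      fun K r θ => ?_, fun K r θ ζ => ?_, fun K r θ => ?_⟩,
    ⟨fun K => (hgood K).2.1, fun K => (hgood K).2.2.2.1, fun K => (hgood K).2.2.2.2,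
      fun K r θ => ?_, fun K r θ ζ => ?_, fun K r θ => ?_⟩⟩
  · rw [e3 K]
  · have h := deriv_homological P.vartheta hP.vartheta_pos.ne' (hab s hgood K).1 r θ ζ
    rw [← e1 K] at h
    rw [h, e3 K, sub_sub]
  · rw [e1 K]
    exact mean_homological hϰ _ (hab s hgood K).1 r θ
  · rw [e4 K]
  · have h := deriv_homological P.vartheta hP.vartheta_pos.ne' (hab s hgood K).2 r θ ζ
    rw [← e2 K] at h
    rw [h, e4 K, sub_sub]
  · rw [e2 K]
    exact mean_homological hϰ _ (hab s hgood K).2 r θ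

end ChirpedSystem

namespace ChirpedSystem

/-! ### Series in powers of `ε = τ^(-1/N)` -/

variable {P : ChirpedSystem} {ϰ : ℕ}

/-- Smooth functions of `(ε, r, θ, ζ)`, periodic in `θ` and `ζ`. -/
def ParamPeriodic (ϰ : ℕ) (g : ℝ × ℝ × ℝ × ℝ → ℝ) : Prop :=
  ContDiff ℝ ∞ g ∧ ∀ ε r θ ζ, g (ε, r, θ + 2 * Real.pi, ζ) = g (ε, r, θ, ζ) ∧
    g (ε, r, θ, ζ + 2 * Real.pi * ϰ) = g (ε, r, θ, ζ)

namespace ParamPeriodic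

variable {g k : ℝ × ℝ × ℝ × ℝ → ℝ}

theorem comp {f : ℝ → ℝ} (hf : ContDiff ℝ ∞ f) (hg : ParamPeriodic ϰ g) :
    ParamPeriodic ϰ fun z => f (g z) :=
  ⟨hf.comp hg.1, fun ε r θ ζ => by simp only [(hg.2 ε r θ ζ).1, (hg.2 ε r θ ζ).2, and_self]⟩

theorem add (hg : ParamPeriodic ϰ g) (hk : ParamPeriodic ϰ k) :
    ParamPeriodic ϰ fun z => g z + k z :=
  ⟨hg.1.add hk.1, fun ε r θ ζ => by simp only [hg.2 ε r θ ζ, hk.2 ε r θ ζ, and_self]⟩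

theorem sub (hg : ParamPeriodic ϰ g) (hk : ParamPeriodic ϰ k) :
    ParamPeriodic ϰ fun z => g z - k z :=
  ⟨hg.1.sub hk.1, fun ε r θ ζ => by simp only [hg.2 ε r θ ζ, hk.2 ε r θ ζ, and_self]⟩

theorem mul (hg : ParamPeriodic ϰ g) (hk : ParamPeriodic ϰ k) :
    ParamPeriodic ϰ fun z => g z * k z :=
  ⟨hg.1.mul hk.1, fun ε r θ ζ => by simp only [hg.2 ε r θ ζ, hk.2 ε r θ ζ, and_self]⟩

theorem pow (hg : ParamPeriodic ϰ g) (n : ℕ) : ParamPeriodic ϰ fun z => g z ^ n :=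
  hg.comp (f := fun x => x ^ n) (by fun_prop)

theorem inv (hg : ParamPeriodic ϰ g) (h : ∀ z, g z ≠ 0) : ParamPeriodic ϰ fun z => (g z)⁻¹ :=
  ⟨hg.1.inv h, fun ε r θ ζ => by simp only [hg.2 ε r θ ζ, and_self]⟩

theorem sum {ι : Type*} {s : Finset ι} {g : ι → ℝ × ℝ × ℝ × ℝ → ℝ}
    (hg : ∀ i ∈ s, ParamPeriodic ϰ (g i)) : ParamPeriodic ϰ fun z => ∑ i ∈ s, g i z :=
  ⟨ContDiff.sum fun i hi => (hg i hi).1, fun ε r θ ζ =>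
    ⟨Finset.sum_congr rfl fun i hi => ((hg i hi).2 ε r θ ζ).1,
      Finset.sum_congr rfl fun i hi => ((hg i hi).2 ε r θ ζ).2⟩⟩

/-- A smooth function of `(ε, r)` alone. -/
theorem of_fst_snd {f : ℝ → ℝ → ℝ} (hf : ContDiff ℝ ∞ fun z : ℝ × ℝ => f z.1 z.2) :
    ParamPeriodic ϰ fun z => f z.1 z.2.1 :=
  ⟨hf.comp (by fun_prop : ContDiff ℝ ∞ fun z : ℝ × ℝ × ℝ × ℝ => (z.1, z.2.1)),
    fun _ _ _ _ => ⟨rfl, rfl⟩⟩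

theorem const (a : ℝ) : ParamPeriodic ϰ fun _ => a := ⟨contDiff_const, fun _ _ _ _ => ⟨rfl, rfl⟩⟩

theorem epsilon : ParamPeriodic ϰ fun z => z.1 := of_fst_snd (f := fun ε _ => ε) contDiff_fst

theorem of_smoothPeriodic {c : ℝ → ℝ → ℝ → ℝ} (hc : SmoothPeriodic ϰ c) :
    ParamPeriodic ϰ fun z => c z.2.1 z.2.2.1 z.2.2.2 :=
  ⟨hc.contDiff_comp (by fun_prop) (by fun_prop) (by fun_prop), fun _ r θ ζ => hc.2 r θ ζ⟩

/-- A `2π`-periodic function of `ζ`. -/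
theorem of_zeta {A : ℝ → ℝ} (hA : ContDiff ℝ ∞ A) (hp : Function.Periodic A (2 * Real.pi)) :
    ParamPeriodic ϰ fun z => A z.2.2.2 :=
  ⟨hA.comp (by fun_prop), fun _ _ _ ζ => ⟨rfl, by
    have := hp.nat_mul ϰ ζ
    dsimp only
    rwa [mul_comm]⟩⟩

theorem bound (hϰ : 0 < ϰ) (hg : ParamPeriodic ϰ g) (r₀ : ℝ) :
    ∃ C, 0 < C ∧ ∀ ε r θ ζ, |ε| ≤ 1 → |r| ≤ r₀ → |g (ε, r, θ, ζ)| ≤ C :=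
  exists_bound_of_periodic hg.1.continuous Real.two_pi_pos (by positivity)
    (fun ε r θ ζ => (hg.2 ε r θ ζ).1) (fun ε r θ ζ => (hg.2 ε r θ ζ).2) r₀

theorem taylor_bound (hϰ : 0 < ϰ) (hg : ParamPeriodic ϰ g) (n : ℕ) (r₀ : ℝ) :
    ∃ C, 0 < C ∧ ∀ ε r θ ζ, |ε| ≤ 1 → |r| ≤ r₀ →
      |g (ε, r, θ, ζ) - ∑ k ∈ Finset.range n, ε ^ k * taylorCoeff k fun ε' => g (ε', r, θ, ζ)|
        ≤ C * |ε| ^ n :=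
  exists_taylor_bound hg.1 Real.two_pi_pos (by positivity)
    (fun ε r θ ζ => (hg.2 ε r θ ζ).1) (fun ε r θ ζ => (hg.2 ε r θ ζ).2) n r₀

theorem contDiff_epsilon (hg : ParamPeriodic ϰ g) (r θ ζ : ℝ) :
    ContDiff ℝ ∞ fun ε => g (ε, r, θ, ζ) :=
  hg.1.comp (by fun_prop : ContDiff ℝ ∞ fun ε : ℝ => (ε, r, θ, ζ))

theorem taylorCoeff (hg : ParamPeriodic ϰ g) (K : ℕ) :
    SmoothPeriodic ϰ fun r θ ζ => taylorCoeff K fun ε => g (ε, r, θ, ζ) :=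
  ⟨contDiff_taylorCoeff (E := ℝ × ℝ × ℝ) hg.1 K, fun r θ ζ => by
    simp only [hg.2 _ r θ ζ, and_self]⟩

end ParamPeriodic

/-- `ε = τ^(-1/N)`. -/
def epsOf (P : ChirpedSystem) (τ : ℝ) : ℝ := τ ^ (-(1 : ℝ) / P.N)

theorem epsOf_pos {τ : ℝ} (hτ : 0 < τ) : 0 < P.epsOf τ := Real.rpow_pos_of_pos hτ _

theorem epsOf_le_one {τ : ℝ} (hτ : 1 ≤ τ) : P.epsOf τ ≤ 1 :=
  Real.rpow_le_one_of_one_le_of_nonpos hτ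
    (div_nonpos_of_nonpos_of_nonneg (by norm_num) (Nat.cast_nonneg _))

theorem epsOf_pow {τ : ℝ} (hτ : 0 < τ) (n : ℕ) : P.epsOf τ ^ n = τ ^ (-(n : ℝ) / P.N) := by
  unfold epsOf
  rw [← Real.rpow_natCast, ← Real.rpow_mul hτ.le]
  congr 1
  ring

/-- The point `(ε, r, θ, ζ)` at the slow time `τ`. -/
def paramPoint (P : ChirpedSystem) (r θ τ : ℝ) : ℝ × ℝ × ℝ × ℝ := (P.epsOf τ, r, θ, P.zeta τ)

/-- `c(r, θ, τ) ~ ∑ ε^k G_k(ε, r, θ, ζ)` as `τ → ∞`, uniformly in `|r| ≤ r₀` and `θ`. -/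
def HasSeries (P : ChirpedSystem) (ϰ : ℕ) (c : ℝ → ℝ → ℝ → ℝ) : Prop :=
  ∃ G : ℕ → ℝ × ℝ × ℝ × ℝ → ℝ, (∀ k, ParamPeriodic ϰ (G k)) ∧
    ∀ (n : ℕ) (r₀ : ℝ), ∃ n₀, ∀ n' ≥ n₀, ∃ C τ' : ℝ, 0 < τ' ∧ ∀ τ, τ' ≤ τ → ∀ r θ : ℝ,
      |r| ≤ r₀ → |c r θ τ - ∑ k ∈ Finset.range n', P.epsOf τ ^ k * G k (P.paramPoint r θ τ)|
        ≤ C * P.epsOf τ ^ n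

namespace HasSeries

variable {c c' : ℝ → ℝ → ℝ → ℝ} {g : ℝ × ℝ × ℝ × ℝ → ℝ}

/-- The coefficients of a `HasSeries` may depend on ε themselves, so a smooth function of ε is a
series with one term. Taylor expansion in ε is postponed to `exists_expands`. -/
theorem of_param (hg : ParamPeriodic ϰ g) : P.HasSeries ϰ fun r θ τ => g (P.paramPoint r θ τ) := by
  refine ⟨fun k => if k = 0 then g else fun _ => 0, fun k => ?_, fun n r₀ => ⟨1, fun n' hn' =>
    ⟨0, 1, one_pos, fun τ hτ r θ _ => ?_⟩⟩⟩
  · by_cases h : k = 0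
    · simpa only [if_pos h] using hg
    · simp only [if_neg h]
      exact ParamPeriodic.const 0
  · rw [Finset.sum_eq_single_of_mem 0 (Finset.mem_range.2 hn') fun k _ hk => by
      simp only [if_neg hk, mul_zero]]
    simp

theorem add (hc : P.HasSeries ϰ c) (hc' : P.HasSeries ϰ c') :
    P.HasSeries ϰ fun r θ τ => c r θ τ + c' r θ τ := by
  obtain ⟨G, hG, h⟩ := hc
  obtain ⟨G', hG', h'⟩ := hc'
  refine ⟨fun k z => G k z + G' k z, fun k => (hG k).add (hG' k), fun n r₀ => ?_⟩
  obtain ⟨n₁, h1⟩ := h n r₀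
  obtain ⟨n₂, h2⟩ := h' n r₀
  refine ⟨max n₁ n₂, fun n' hn' => ?_⟩
  obtain ⟨C, τ₁, hτ₁, h1⟩ := h1 n' (le_of_max_le_left hn')
  obtain ⟨C', τ₂, -, h2⟩ := h2 n' (le_of_max_le_right hn')
  refine ⟨C + C', max τ₁ τ₂, lt_max_of_lt_left hτ₁, fun τ hτ r θ hr => ?_⟩
  have e1 := h1 τ (le_of_max_le_left hτ) r θ hr
  have e2 := h2 τ (le_of_max_le_right hτ) r θ hr
  simp only [mul_add, Finset.sum_add_distrib]
  rw [add_sub_add_comm, add_mul]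
  exact (abs_add_le _ _).trans (add_le_add e1 e2)

theorem param_mul (hϰ : 0 < ϰ) (hg : ParamPeriodic ϰ g) (hc : P.HasSeries ϰ c) :
    P.HasSeries ϰ fun r θ τ => g (P.paramPoint r θ τ) * c r θ τ := by
  obtain ⟨G, hG, h⟩ := hc
  refine ⟨fun k z => g z * G k z, fun k => hg.mul (hG k), fun n r₀ => ?_⟩
  obtain ⟨n₁, h1⟩ := h n r₀
  obtain ⟨B, hB, hgB⟩ := hg.bound hϰ r₀
  refine ⟨n₁, fun n' hn' => ?_⟩
  obtain ⟨C, τ₁, hτ₁, h1⟩ := h1 n' hn'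
  refine ⟨B * C, max τ₁ 1, lt_max_of_lt_left hτ₁, fun τ hτ r θ hr => ?_⟩
  have e1 := h1 τ (le_of_max_le_left hτ) r θ hr
  have hτ1 := le_of_max_le_right hτ
  have e2 : |g (P.paramPoint r θ τ)| ≤ B := hgB _ _ _ _ (by
    rw [abs_of_pos (epsOf_pos (by linarith))]; exact epsOf_le_one hτ1) hr
  simp only [mul_left_comm _ (g _)]
  rw [← Finset.mul_sum, ← mul_sub, abs_mul, mul_assoc]
  exact mul_le_mul e2 e1 (abs_nonneg _) hB.le

/-- Agreement is needed only for large τ depending on r₀, which is where cut-offs are inactive. -/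
theorem congr (hc : P.HasSeries ϰ c) (h : ∀ r₀ : ℝ, ∃ τ', ∀ τ, τ' ≤ τ → ∀ r θ : ℝ, |r| ≤ r₀ →
    c' r θ τ = c r θ τ) : P.HasSeries ϰ c' := by
  obtain ⟨G, hG, h1⟩ := hc
  refine ⟨G, hG, fun n r₀ => ?_⟩
  obtain ⟨n₁, h1⟩ := h1 n r₀
  obtain ⟨τ₂, h2⟩ := h r₀
  refine ⟨n₁, fun n' hn' => ?_⟩
  obtain ⟨C, τ₁, hτ₁, h1⟩ := h1 n' hn'
  refine ⟨C, max τ₁ τ₂, lt_max_of_lt_left hτ₁, fun τ hτ r θ hr => ?_⟩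
  rw [h2 τ (le_of_max_le_right hτ) r θ hr]
  exact h1 τ (le_of_max_le_left hτ) r θ hr

/-- Terms with k > K carry too many powers of ε to contribute, so the K-th coefficient does not
depend on the length of the partial sum. -/
theorem taylorCoeff_partial {G : ℕ → ℝ × ℝ × ℝ × ℝ → ℝ} (hG : ∀ k, ParamPeriodic ϰ (G k))
    {K n : ℕ} (h : K < n) (r θ ζ : ℝ) :
    taylorCoeff K (fun ε => ∑ k ∈ Finset.range n, ε ^ k * G k (ε, r, θ, ζ)) =
      taylorCoeff K (fun ε => ∑ k ∈ Finset.range (K + 1), ε ^ k * G k (ε, r, θ, ζ)) := by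
  have hs : ∀ k, ContDiff ℝ ∞ fun ε => ε ^ k * G k (ε, r, θ, ζ) := fun k =>
    (contDiff_id.pow k).mul ((hG k).contDiff_epsilon r θ ζ)
  rw [taylorCoeff_sum fun k _ => hs k, taylorCoeff_sum fun k _ => hs k]
  refine (Finset.sum_subset (Finset.range_mono h) fun k _ hk => ?_).symm
  exact taylorCoeff_pow_mul_of_lt (by simpa using hk) ((hG k).contDiff_epsilon r θ ζ)

/-- The partial sums are smooth and periodic, and regrouping their Taylor expansions by powers of ε
gives true coefficients independent of ε. The error is the series remainder plus the Taylor
remainder. -/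
theorem exists_expands (hϰ : 0 < ϰ) (hc : P.HasSeries ϰ c) :
    ∃ cK : ℕ → ℝ → ℝ → ℝ → ℝ, (∀ K, SmoothPeriodic ϰ (cK K)) ∧ P.Expands c cK := by
  obtain ⟨G, hG, h⟩ := hc
  have hS : ∀ n, ParamPeriodic ϰ fun z => ∑ k ∈ Finset.range n, z.1 ^ k * G k z := fun n =>
    ParamPeriodic.sum fun k _ => (ParamPeriodic.epsilon.pow k).mul (hG k)
  refine ⟨fun K r θ ζ => taylorCoeff K fun ε =>
    ∑ k ∈ Finset.range (K + 1), ε ^ k * G k (ε, r, θ, ζ), fun K => (hS (K + 1)).taylorCoeff K,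
    fun n r₀ _ => ?_⟩
  obtain ⟨n₀, h1⟩ := h (n + 1) r₀
  have hn : n < max n₀ (n + 1) := lt_max_of_lt_right (by omega)
  obtain ⟨C, τ₁, hτ₁, h1⟩ := h1 (max n₀ (n + 1)) (le_max_left _ _)
  obtain ⟨C', -, h2⟩ := (hS (max n₀ (n + 1))).taylor_bound hϰ (n + 1) r₀
  refine ⟨C + C', max τ₁ 1, lt_max_of_lt_left hτ₁, fun τ hτ r θ hr => ?_⟩
  have hτ1 := le_of_max_le_right hτ
  have hτ0 : 0 < τ := by linarith
  have e1 := h1 τ (le_of_max_le_left hτ) r θ hr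
  have hε : |P.epsOf τ| = P.epsOf τ := abs_of_pos (epsOf_pos hτ0)
  have e2 := h2 (P.epsOf τ) r θ (P.zeta τ) (by rw [hε]; exact epsOf_le_one hτ1) hr
  rw [hε] at e2
  have e3 : ∑ K ∈ Finset.range (n + 1), τ ^ (-(K : ℝ) / P.N) * taylorCoeff K (fun ε =>
        ∑ k ∈ Finset.range (K + 1), ε ^ k * G k (ε, r, θ, P.zeta τ)) =
      ∑ K ∈ Finset.range (n + 1), P.epsOf τ ^ K * taylorCoeff K fun ε =>
        ∑ k ∈ Finset.range (max n₀ (n + 1)), ε ^ k * G k (ε, r, θ, P.zeta τ) := by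
    refine Finset.sum_congr rfl fun K hK => ?_
    rw [epsOf_pow hτ0, taylorCoeff_partial hG ((Finset.mem_range.1 hK).trans_le (le_max_right _ _))]
  have e4 : τ ^ (-((n : ℝ) + 1) / P.N) = P.epsOf τ ^ (n + 1) := by
    rw [epsOf_pow hτ0]
    push_cast
    rfl
  rw [e3, e4, add_mul]
  refine (abs_sub_le _ _ _).trans (add_le_add e1 e2)

end HasSeries

end ChirpedSystem

/-! ### The perturbations in rescaled variables -/

namespace ChirpedSystem

variable {P : ChirpedSystem} {ϰ : ℕ}

/-- `ν^(-1/N)`. -/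
def kappa (P : ChirpedSystem) : ℝ := P.nu ^ (-(1 : ℝ) / P.N)

theorem kappa_pos (hP : P.Standing) : 0 < P.kappa := Real.rpow_pos_of_pos hP.nu_pos _

/-- `t^(-1/(2q(h-1)))` as a function of `τ`. -/
def smallScale (P : ChirpedSystem) (τ : ℝ) : ℝ := P.kappa * P.epsOf τ

theorem smallScale_pos (hP : P.Standing) {τ : ℝ} (hτ : 0 < τ) : 0 < P.smallScale τ :=
  mul_pos (kappa_pos hP) (epsOf_pos hτ)

/-- Since N = 2νq(h-1) and t = (ντ)^(1/ν), the quantity κε equals t^(-1/(2q(h-1))). Every power of t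
used later has an exponent that is a multiple of this one. -/
theorem time_rpow_eq (hP : P.Standing) {τ : ℝ} (hτ : 0 < τ) {x : ℝ} {n : ℕ}
    (h : 2 * P.q * ((P.h : ℝ) - 1) * x = -n) : P.time τ ^ x = P.smallScale τ ^ n := by
  obtain ⟨hN, hNe⟩ := P.N_eq hP
  have hν := hP.nu_pos
  have hN' : (P.N : ℝ) ≠ 0 := by exact_mod_cast hN.ne'
  have hντ := mul_pos hν hτ
  unfold smallScale kappa epsOf time
  rw [← Real.mul_rpow hν.le hτ.le, ← Real.rpow_natCast, ← Real.rpow_mul hντ.le,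
    ← Real.rpow_mul hντ.le]
  congr 1
  rw [show (n : ℝ) = -(2 * P.q * ((P.h : ℝ) - 1) * x) by rw [h, neg_neg], one_div_mul_eq_div,
    div_eq_iff hν.ne', div_mul_eq_mul_div, div_mul_eq_mul_div, eq_div_iff hN', hNe]
  ring

theorem smallScale_le_one (hP : P.Standing) {τ : ℝ} (hτ : P.tau 1 ≤ τ) : P.smallScale τ ≤ 1 := by
  have hτ0 := (tau_pos hP one_pos).trans_le hτ
  have hh := hP.two_le
  have hq := hP.q_pos
  have h1 := time_rpow_eq hP hτ0 (x := -1 / (2 * P.q * ((P.h : ℝ) - 1))) (n := 1) (by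
    have : (2 * P.q * ((P.h : ℝ) - 1)) ≠ 0 := by
      have : (0 : ℝ) < (P.h : ℝ) - 1 := by linarith
      positivity
    rw [mul_div_cancel₀ _ this, Nat.cast_one])
  rw [pow_one] at h1
  rw [← h1]
  refine Real.rpow_le_one_of_one_le_of_nonpos ?_ ?_
  · have h2 : P.time (P.tau 1) = 1 := time_tau hP one_pos
    rw [← h2]
    exact Real.rpow_le_rpow (mul_pos hP.nu_pos (tau_pos hP one_pos)).le
      (mul_le_mul_of_nonneg_left hτ hP.nu_pos.le) (one_div_pos.2 hP.nu_pos).le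
  · refine div_nonpos_of_nonpos_of_nonneg (by norm_num) ?_
    have : (0 : ℝ) < (P.h : ℝ) - 1 := by linarith
    positivity

theorem tendsto_smallScale (hP : P.Standing) : Tendsto P.smallScale atTop (𝓝 0) := by
  have hN : (0 : ℝ) < 1 / P.N := one_div_pos.2 (by exact_mod_cast (P.N_eq hP).1)
  have h := (tendsto_rpow_neg_atTop hN).const_mul P.kappa
  rw [mul_zero] at h
  refine h.congr fun τ => ?_
  unfold smallScale epsOf
  rw [neg_div]

theorem tendsto_epsOf (hP : P.Standing) : Tendsto P.epsOf atTop (𝓝 0) := by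
  have hN : (0 : ℝ) < 1 / P.N := one_div_pos.2 (by exact_mod_cast (P.N_eq hP).1)
  refine (tendsto_rpow_neg_atTop hN).congr fun τ => ?_
  unfold epsOf
  rw [neg_div]

/-- The monomial contributes η^(-(i+hj)), which the prefactor η^(L+e) compensates. Thus only a
natural power of η is left and the expression extends smoothly through η = 0. -/
theorem monomial_rescale {η u x y : ℝ} (hη : 0 < η) (hu : 0 < u) {e i j h : ℕ} {L : ℤ}
    (hL : (i : ℤ) + h * j ≤ L + e) :
    η ^ L * (η * u) ^ e * ((x / (η * u)) ^ i * (y / (η * u) ^ h) ^ j) =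
      x ^ i * y ^ j * u ^ e * u⁻¹ ^ (i + h * j) * η ^ (L + e - (i + h * j)).toNat := by
  have h1 : η ^ (L + e - (i + h * j)).toNat = η ^ L * η ^ e / (η ^ i * η ^ (h * j)) := by
    rw [← zpow_natCast η (L + e - (i + h * j)).toNat, Int.toNat_of_nonneg (by omega),
      zpow_sub₀ hη.ne', zpow_add₀ hη.ne', zpow_add₀ hη.ne', zpow_natCast, zpow_natCast]
    congr 2
  rw [h1, pow_add, div_pow, div_pow, mul_pow, mul_pow, ← pow_mul, mul_pow, inv_pow, inv_pow]
  field_simp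

/-- Used for the remainder of the expansion, where only polynomial growth in the unscaled variables
is known: each power of it costs at most η^(-h). -/
theorem growth_rescale {η u x y X Y B : ℝ} (hη : 0 < η) (hη1 : η ≤ 1) (hu : 0 < u)
    (hB : u⁻¹ ≤ B) (hx : |x| ≤ X) (hy : |y| ≤ Y) {h : ℕ} (hh : 1 ≤ h) :
    1 + |x / (η * u)| + |y / (η * u) ^ h| ≤ η⁻¹ ^ h * (1 + X * B + Y * B ^ h) := by
  have hη' : 1 ≤ η⁻¹ := (one_le_inv₀ hη).2 hη1
  have h1 : (1 : ℝ) ≤ η⁻¹ ^ h := one_le_pow₀ hη'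
  have h2 : η⁻¹ ≤ η⁻¹ ^ h := le_self_pow₀ hη' (by omega)
  have hX : 0 ≤ X := (abs_nonneg _).trans hx
  have hY : 0 ≤ Y := (abs_nonneg _).trans hy
  have hu' : 0 < u⁻¹ := inv_pos.2 hu
  have e1 : |x / (η * u)| ≤ η⁻¹ ^ h * (X * B) := by
    rw [abs_div, abs_of_pos (mul_pos hη hu), div_eq_mul_inv, mul_inv]
    calc |x| * (η⁻¹ * u⁻¹) = η⁻¹ * (|x| * u⁻¹) := by ring
      _ ≤ η⁻¹ ^ h * (X * B) := by gcongr
  have e2 : |y / (η * u) ^ h| ≤ η⁻¹ ^ h * (Y * B ^ h) := by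
    rw [abs_div, abs_of_pos (pow_pos (mul_pos hη hu) _), div_eq_mul_inv, ← inv_pow, mul_inv, mul_pow]
    calc |y| * (η⁻¹ ^ h * u⁻¹ ^ h) = η⁻¹ ^ h * (|y| * u⁻¹ ^ h) := by ring
      _ ≤ η⁻¹ ^ h * (Y * B ^ h) := by gcongr
  nlinarith

/-- The small parameter `η = t^(-b/(q(h-1)))`, in terms of `ε`. -/
def etaOf (P : ChirpedSystem) (ε : ℝ) : ℝ := (P.kappa * ε) ^ (2 * P.b)

theorem paramPeriodic_etaOf : ParamPeriodic ϰ fun z => P.etaOf z.1 :=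
  ParamPeriodic.epsilon.comp (f := P.etaOf)
    (by unfold etaOf; fun_prop)

theorem etaOf_pos (hP : P.Standing) {τ : ℝ} (hτ : 0 < τ) : 0 < P.etaOf (P.epsOf τ) :=
  pow_pos (smallScale_pos hP hτ) _

theorem etaOf_le_one (hP : P.Standing) {τ : ℝ} (hτ : P.tau 1 ≤ τ) : P.etaOf (P.epsOf τ) ≤ 1 :=
  pow_le_one₀ (smallScale_pos hP ((tau_pos hP one_pos).trans_le hτ)).le (smallScale_le_one hP hτ)

section Perturbation

variable {F : ℝ → ℝ → ℝ → ℝ → ℝ} {A : ℕ → ℕ → ℕ → ℝ → ℝ} {J e m : ℕ} {L : ℤ}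
  {u x y a : ℝ × ℝ × ℝ × ℝ → ℝ}

/-- Each term of the expansion becomes a smooth function of ε by `monomial_rescale`. The remainder
loses a fixed negative power of η, fixed because the growth degree m does not depend on the order,
and enough additional terms outweigh this loss. -/
theorem hasSeries_perturbation (hP : P.Standing) (hϰ : 0 < ϰ)
    (hA : ∀ k i j, ContDiff ℝ ∞ (A k i j))
    (hAp : ∀ k i j, Function.Periodic (A k i j) (2 * Real.pi))
    (hA0 : ∀ k i j, P.p < i + j → A k i j = 0)
    (hF : ∀ n : ℕ, ∃ C t' : ℝ, 0 < t' ∧ ∀ t, t' ≤ t → ∀ x y σ : ℝ,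
      |F x y σ t - ∑ k ∈ Finset.range n, t ^ (-(k : ℝ) / P.q) *
        ∑ i ∈ Finset.range (P.p + 1), ∑ j ∈ Finset.range J, A k i j σ * x ^ i * y ^ j|
      ≤ C * t ^ (-(n : ℝ) / P.q) * (1 + |x| + |y|) ^ m)
    (hL : ∀ i j, i + j ≤ P.p → j < J → (i : ℤ) + P.h * j ≤ L + e)
    (hu : ParamPeriodic ϰ u) (hu0 : ∀ z, 0 < u z) (hx : ParamPeriodic ϰ x)
    (hy : ParamPeriodic ϰ y) (ha : ParamPeriodic ϰ a) :
    P.HasSeries ϰ fun r θ τ =>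
      P.etaOf (P.epsOf τ) ^ L * (P.etaOf (P.epsOf τ) * u (P.paramPoint r θ τ)) ^ e *
        F (x (P.paramPoint r θ τ) / (P.etaOf (P.epsOf τ) * u (P.paramPoint r θ τ)))
          (y (P.paramPoint r θ τ) / (P.etaOf (P.epsOf τ) * u (P.paramPoint r θ τ)) ^ P.h)
          (P.zeta τ) (P.time τ) * a (P.paramPoint r θ τ) := by
  have hh := hP.two_le_h
  have hui : ParamPeriodic ϰ fun z => (u z)⁻¹ := hu.inv fun z => (hu0 z).ne'
  let T : ℕ → ℝ × ℝ × ℝ × ℝ → ℝ := fun k z =>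
    (∑ i ∈ Finset.range (P.p + 1), ∑ j ∈ Finset.range J, A k i j z.2.2.2 *
      (x z ^ i * y z ^ j * u z ^ e * (u z)⁻¹ ^ (i + P.h * j) *
        P.etaOf z.1 ^ (L + e - (i + P.h * j)).toNat)) * a z
  have hT : ∀ k, ParamPeriodic ϰ (T k) := fun k =>
    (ParamPeriodic.sum fun i _ => ParamPeriodic.sum fun j _ =>
      (ParamPeriodic.of_zeta (hA k i j) (hAp k i j)).mul
        (((((hx.pow i).mul (hy.pow j)).mul (hu.pow e)).mul (hui.pow _)).mul
          (paramPeriodic_etaOf.pow _))).mul ha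
  obtain ⟨d, hd⟩ : ∃ d, P.h = d + 2 := ⟨P.h - 2, by omega⟩
  -- Here t^(-k/q) = (κε)^(2(h-1)k); one factor ε^k stays outside as the series requires, and the
  -- rest goes into the k-th coefficient.
  have hexp : ∀ {τ : ℝ}, 0 < τ → ∀ k : ℕ, P.time τ ^ (-(k : ℝ) / P.q) =
      P.epsOf τ ^ k * (P.kappa ^ (2 * (d + 1) * k) * P.epsOf τ ^ ((2 * d + 1) * k)) := by
    intro τ hτ k
    rw [time_rpow_eq hP hτ (n := 2 * (d + 1) * k), smallScale, mul_pow, mul_left_comm, ← pow_add]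
    · congr 2
      ring
    · have := hP.q_pos.ne'
      rw [hd]
      push_cast
      field_simp
      ring
  refine ⟨fun k z => P.kappa ^ (2 * (d + 1) * k) * z.1 ^ ((2 * d + 1) * k) * T k z, fun k =>
    ((ParamPeriodic.const _).mul (ParamPeriodic.epsilon.pow _)).mul (hT k), fun n r₀ => ?_⟩
  -- D bounds the negative power of η caused by the prefactor and the growth of the remainder
  -- together.
  obtain ⟨D, hD⟩ : ∃ D : ℕ, -(D : ℤ) ≤ L + e - P.h * m :=
    ⟨(-(L + e - P.h * m)).toNat, by have := Int.self_le_toNat (-(L + e - P.h * m)); omega⟩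
  obtain ⟨X, hX, hxX⟩ := hx.bound hϰ r₀
  obtain ⟨Y, hY, hyY⟩ := hy.bound hϰ r₀
  obtain ⟨B, hB, hB'⟩ := hu.bound hϰ r₀
  obtain ⟨B₁, hB₁, hB₁'⟩ := hui.bound hϰ r₀
  obtain ⟨B₂, hB₂, hB₂'⟩ := ha.bound hϰ r₀
  -- As η^D = (κε)^(2bD), this many terms repay the loss and leave (κε)^n.
  refine ⟨2 * P.b * D + n, fun n' hn' => ?_⟩
  obtain ⟨C, t', ht', hC⟩ := hF n'
  let Q := 1 + X * B₁ + Y * B₁ ^ P.h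
  refine ⟨B ^ e * (|C| * Q ^ m) * B₂ * P.kappa ^ n, max (max (P.tau t') (P.tau 1)) 1,
    lt_max_of_lt_right one_pos, fun τ hτ r θ hr => ?_⟩
  have hτ1 : 1 ≤ τ := le_of_max_le_right hτ
  have hτt : P.tau t' ≤ τ := le_of_max_le_left (le_of_max_le_left hτ)
  have hτt1 : P.tau 1 ≤ τ := le_of_max_le_right (le_of_max_le_left hτ)
  have hτ0 : 0 < τ := by linarith
  have htime : t' ≤ P.time τ := by
    have h2 : P.time (P.tau t') = t' := time_tau hP ht'
    rw [← h2]
    exact Real.rpow_le_rpow (mul_pos hP.nu_pos (tau_pos hP ht')).le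
      (mul_le_mul_of_nonneg_left hτt hP.nu_pos.le) (one_div_pos.2 hP.nu_pos).le
  have hε : |P.epsOf τ| ≤ 1 := by rw [abs_of_pos (epsOf_pos hτ0)]; exact epsOf_le_one hτ1
  have hη := etaOf_pos hP hτ0
  have hη1 := etaOf_le_one hP hτt1
  have hs := smallScale_pos hP hτ0
  have hs1 := smallScale_le_one hP hτt1
  have b1 := hxX _ r θ (P.zeta τ) hε hr
  have b2 := hyY _ r θ (P.zeta τ) hε hr
  have b3 := hB' _ r θ (P.zeta τ) hε hr
  have b4 := hB₁' _ r θ (P.zeta τ) hε hr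
  have b5 := hB₂' _ r θ (P.zeta τ) hε hr
  change |x (P.paramPoint r θ τ)| ≤ X at b1
  change |y (P.paramPoint r θ τ)| ≤ Y at b2
  change |u (P.paramPoint r θ τ)| ≤ B at b3
  change |(u (P.paramPoint r θ τ))⁻¹| ≤ B₁ at b4
  change |a (P.paramPoint r θ τ)| ≤ B₂ at b5
  have hT' : ∀ k, P.epsOf τ ^ k * (P.kappa ^ (2 * (d + 1) * k) *
      (P.paramPoint r θ τ).1 ^ ((2 * d + 1) * k) * T k (P.paramPoint r θ τ)) =
      P.time τ ^ (-(k : ℝ) / P.q) * T k (P.paramPoint r θ τ) := fun k => by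
    rw [hexp hτ0]
    exact (mul_assoc _ _ _).symm
  simp only [hT']
  have hu0' := hu0 (P.paramPoint r θ τ)
  have hTk : ∀ k, T k (P.paramPoint r θ τ) =
      P.etaOf (P.epsOf τ) ^ L * (P.etaOf (P.epsOf τ) * u (P.paramPoint r θ τ)) ^ e *
      (∑ i ∈ Finset.range (P.p + 1), ∑ j ∈ Finset.range J, A k i j (P.zeta τ) *
        (x (P.paramPoint r θ τ) / (P.etaOf (P.epsOf τ) * u (P.paramPoint r θ τ))) ^ i *
        (y (P.paramPoint r θ τ) / (P.etaOf (P.epsOf τ) * u (P.paramPoint r θ τ)) ^ P.h) ^ j) *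
      a (P.paramPoint r θ τ) := fun k => by
    simp only [T]
    congr 1
    rw [Finset.mul_sum]
    refine Finset.sum_congr rfl fun i _ => ?_
    rw [Finset.mul_sum]
    refine Finset.sum_congr rfl fun j hj => ?_
    -- The double sum runs over a rectangle; the exponent inequality is available only for i + j ≤
    -- p, and the other coefficients vanish.
    by_cases hij : P.p < i + j
    · rw [hA0 k i j hij]
      simp
    · refine (congrArg (A k i j (P.zeta τ) * ·)
        (monomial_rescale hη hu0' (hL i j (not_lt.1 hij) (Finset.mem_range.1 hj))).symm).trans ?_
      ring
  simp only [hTk]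
  clear_value T
  set η := P.etaOf (P.epsOf τ) with hηdef
  set w := P.paramPoint r θ τ
  have hgrow := growth_rescale (x := x w) (y := y w) hη hη1 hu0'
    ((le_abs_self _).trans b4) b1 b2
    (h := P.h) (by omega)
  have hrem := hC (P.time τ) htime (x w / (η * u w)) (y w / (η * u w) ^ P.h) (P.zeta τ)
  set Sm : ℕ → ℝ := fun k => ∑ i ∈ Finset.range (P.p + 1), ∑ j ∈ Finset.range J,
    A k i j (P.zeta τ) * (x w / (η * u w)) ^ i * (y w / (η * u w) ^ P.h) ^ j
  set F' := F (x w / (η * u w)) (y w / (η * u w) ^ P.h) (P.zeta τ) (P.time τ)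
  have hsplit : η ^ L * (η * u w) ^ e * F' * a w -
      ∑ k ∈ Finset.range n', P.time τ ^ (-(k : ℝ) / P.q) * (η ^ L * (η * u w) ^ e * Sm k * a w) =
      η ^ L * (η * u w) ^ e * (F' - ∑ k ∈ Finset.range n', P.time τ ^ (-(k : ℝ) / P.q) * Sm k)
        * a w := by
    rw [mul_sub, sub_mul, Finset.mul_sum, Finset.sum_mul]
    congr 1
    refine Finset.sum_congr rfl fun k _ => by ring
  rw [hsplit, abs_mul, abs_mul, abs_mul, abs_of_pos (zpow_pos hη L),
    abs_of_pos (pow_pos (mul_pos hη hu0') e), mul_pow]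
  have hη' : η ^ L * η ^ e * η⁻¹ ^ (P.h * m) ≤ η⁻¹ ^ D := by
    have e1 : η ^ L * η ^ e * η⁻¹ ^ (P.h * m) = η ^ (L + e - P.h * m) := by
      rw [zpow_sub₀ hη.ne', zpow_add₀ hη.ne', zpow_natCast, inv_pow, div_eq_mul_inv]
      congr 2
    have e2 : η⁻¹ ^ D = η ^ (-(D : ℤ)) := by rw [zpow_neg, zpow_natCast, inv_pow]
    rw [e1, e2]
    exact zpow_le_zpow_right_of_le_one₀ hη hη1 hD
  have htime' : P.time τ ^ (-(n' : ℝ) / P.q) ≤ η ^ D * P.smallScale τ ^ n := by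
    rw [time_rpow_eq hP hτ0 (n := 2 * (d + 1) * n'), hηdef, etaOf]
    · change _ ≤ (P.smallScale τ ^ (2 * P.b)) ^ D * _
      rw [← pow_mul, ← pow_add]
      exact pow_le_pow_of_le_one hs.le hs1 (by nlinarith)
    · have := hP.q_pos.ne'
      rw [hd]
      push_cast
      field_simp
      ring
  have hQ : 0 ≤ Q := by positivity
  have hts : 0 ≤ P.time τ ^ (-(n' : ℝ) / P.q) := Real.rpow_nonneg (time_pos hP hτ0).le _
  have hrem' : |F' - ∑ k ∈ Finset.range n', P.time τ ^ (-(k : ℝ) / P.q) * Sm k| ≤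
      |C| * (η ^ D * P.smallScale τ ^ n) * (η⁻¹ ^ P.h * Q) ^ m := by
    refine hrem.trans ?_
    gcongr
    exact le_abs_self C
  have hub : u w ≤ B := (le_abs_self _).trans b3
  calc η ^ L * (η ^ e * u w ^ e) * |F' - ∑ k ∈ Finset.range n',
          P.time τ ^ (-(k : ℝ) / P.q) * Sm k| * |a w|
      ≤ η ^ L * (η ^ e * B ^ e) * (|C| * (η ^ D * P.smallScale τ ^ n) * (η⁻¹ ^ P.h * Q) ^ m)
          * B₂ := by gcongr
    _ = (η ^ L * η ^ e * η⁻¹ ^ (P.h * m)) * η ^ D * (B ^ e * (|C| * Q ^ m) * B₂ *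
          P.smallScale τ ^ n) := by rw [mul_pow, ← pow_mul]; ring
    _ ≤ η⁻¹ ^ D * η ^ D * (B ^ e * (|C| * Q ^ m) * B₂ * P.smallScale τ ^ n) := by
        have := pow_pos hs n
        gcongr
    _ = B ^ e * (|C| * Q ^ m) * B₂ * P.kappa ^ n * P.epsOf τ ^ n := by
        rw [← mul_pow, inv_mul_cancel₀ hη.ne', one_pow, one_mul, smallScale, mul_pow]
        ring

end Perturbation

end ChirpedSystem

namespace ChirpedSystem

variable {P : ChirpedSystem} {ϰ : ℕ}

/-! ### Exponents -/

/-- Because M/N = μ/ν. -/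
theorem rpow_mu_eq (hP : P.Standing) (hr : P.Resonance) {τ : ℝ} (hτ : 0 < τ) :
    τ ^ ((P.M : ℝ) / P.N) = P.kappa ^ P.M * P.time τ ^ P.mu := by
  obtain ⟨hN, hNe⟩ := P.N_eq hP
  obtain ⟨-, hMe⟩ := P.M_eq hP hr
  have hν := hP.nu_pos
  have hq := hP.q_pos
  have hh : (0 : ℝ) < (P.h : ℝ) - 1 := by linarith [hP.two_le]
  have hN' : (P.N : ℝ) ≠ 0 := by exact_mod_cast hN.ne'
  have h1 : P.mu / P.nu = P.M / P.N := by
    rw [hNe, hMe]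
    field_simp
  unfold kappa time
  rw [← Real.rpow_natCast, ← Real.rpow_mul hν.le, ← Real.rpow_mul (mul_pos hν hτ).le,
    one_div_mul_eq_div, h1, Real.mul_rpow hν.le hτ.le, ← mul_assoc, ← Real.rpow_add hν]
  rw [show -(1 : ℝ) / P.N * P.M + P.M / P.N = 0 by ring, Real.rpow_zero, one_mul]

theorem prefactor_eq (hP : P.Standing) (hr : P.Resonance) {τ : ℝ} (hτ : 0 < τ) :
    τ ^ ((P.M : ℝ) / P.N) * P.time τ ^ (1 - P.nu) =
      P.kappa ^ P.M * P.time τ ^ (-P.mu - P.sigma) := by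
  rw [rpow_mu_eq hP hr hτ, mul_assoc, ← Real.rpow_add (time_pos hP hτ)]
  congr 2
  unfold nu
  ring

theorem time_rpow_neg_mu (hP : P.Standing) (hr : P.Resonance) {τ : ℝ} (hτ : 0 < τ) :
    P.time τ ^ (-P.mu) = P.smallScale τ ^ P.M :=
  time_rpow_eq hP hτ (by rw [(P.M_eq hP hr).2]; ring)

/-- N - 2M = 2q(h-1)(1 + σ), so the lower bound -1 ≤ σ enters here. It makes t^(-1-σ), the size of
the drift of I⋆ in 𝒜, a natural power of κε. -/
theorem two_mul_M_le (hP : P.Standing) (hr : P.Resonance) : 2 * P.M ≤ P.N := by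
  have hq := hP.q_pos
  have hh : (0 : ℝ) < (P.h : ℝ) - 1 := by linarith [hP.two_le]
  have h : (0 : ℝ) ≤ 2 * P.q * ((P.h : ℝ) - 1) * (1 + P.sigma) :=
    mul_nonneg (by positivity) (by linarith [hr.1])
  have h2 : ((2 * P.M : ℕ) : ℝ) ≤ (P.N : ℕ) := by
    push_cast
    rw [(P.M_eq hP hr).2, (P.N_eq hP).2]
    unfold nu
    nlinarith
  exact_mod_cast h2

theorem time_rpow_sub_sigma (hP : P.Standing) (hr : P.Resonance) {τ : ℝ} (hτ : 0 < τ) :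
    P.time τ ^ (-1 - P.sigma) = P.smallScale τ ^ (P.N - 2 * P.M) :=
  time_rpow_eq hP hτ (by
    rw [Nat.cast_sub (two_mul_M_le hP hr)]
    push_cast
    rw [(P.M_eq hP hr).2, (P.N_eq hP).2]
    unfold nu
    ring)

theorem time_rpow_sub_mu_sigma (hP : P.Standing) (hr : P.Resonance) {τ : ℝ} (hτ : 0 < τ) :
    P.time τ ^ (-1 - P.mu - P.sigma) = P.smallScale τ ^ (P.N - P.M) :=
  time_rpow_eq hP hτ (by
    rw [Nat.cast_sub (by have := two_mul_M_le hP hr; omega), (P.M_eq hP hr).2, (P.N_eq hP).2]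
    unfold nu
    ring)

/-- The exponent of `η` in `t^(-σ-a/q)`. -/
def etaExponent (P : ChirpedSystem) : ℤ := ((P.l : ℤ) - 1) * ((P.h : ℤ) - 1) + P.p - 1

/-- `η` as a function of `t`. -/
def etaTime (P : ChirpedSystem) (t : ℝ) : ℝ := t ^ (-((P.b : ℝ) / (P.q * ((P.h : ℝ) - 1))))

theorem etaTime_time (hP : P.Standing) {τ : ℝ} (hτ : 0 < τ) :
    P.etaTime (P.time τ) = P.etaOf (P.epsOf τ) :=
  time_rpow_eq hP hτ (by
    have hq := hP.q_pos
    have hh : (0 : ℝ) < (P.h : ℝ) - 1 := by linarith [hP.two_le]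
    push_cast
    field_simp)

theorem time_rpow_sub_sigma_a (hP : P.Standing) {t : ℝ} (ht : 0 < t) :
    t ^ (-P.sigma - (P.a : ℝ) / P.q) = P.etaTime t ^ P.etaExponent := by
  have hq := hP.q_pos
  have hh : (0 : ℝ) < (P.h : ℝ) - 1 := by linarith [hP.two_le]
  unfold etaTime
  rw [← Real.rpow_intCast, ← Real.rpow_mul ht.le]
  congr 1
  unfold sigma etaExponent
  push_cast
  field_simp
  ring

theorem etaTime_pow (hP : P.Standing) {t : ℝ} (ht : 0 < t) :
    P.etaTime t ^ (P.h - 1) = (t ^ ((P.b : ℝ) / P.q))⁻¹ := by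
  have hq := hP.q_pos
  have hh : (0 : ℝ) < (P.h : ℝ) - 1 := by linarith [hP.two_le]
  unfold etaTime
  rw [← Real.rpow_natCast, ← Real.rpow_mul ht.le, ← Real.rpow_neg ht.le, Nat.cast_sub
    (by have := hP.two_le_h; omega), Nat.cast_one]
  congr 1
  field_simp

theorem etaTime_pos {t : ℝ} (ht : 0 < t) : 0 < P.etaTime t := Real.rpow_pos_of_pos ht _

theorem tendsto_etaTime (hP : P.Standing) : Tendsto P.etaTime atTop (𝓝 0) := by
  have hq := hP.q_pos
  have hb := hP.b_pos
  have hh : (0 : ℝ) < (P.h : ℝ) - 1 := by linarith [hP.two_le]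
  exact tendsto_rpow_neg_atTop (by positivity)

/-! ### The resonant energy -/

variable {E₀ : ℝ} {W : WellFamily P.V (P.scale E₀)} {e : ℝ → ℝ} {ρ : ℝ}

/-- The scale of the resonant energy is `η e(η)`. -/
structure ResonantScale (W : WellFamily P.V (P.scale E₀)) (ϰ : ℕ) (e : ℝ → ℝ) (ρ : ℝ) : Prop where
  smooth : ContDiff ℝ ∞ e
  pos : ∀ η, 0 < e η
  radius_pos : 0 < ρ
  lt : ∀ η, |η| ≤ ρ → |η * e η| < P.scale E₀
  freq_eq : ∀ η, |η| ≤ ρ → W.freq (η * e η) = P.vartheta / ϰ * e η ^ (P.h - 1)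

theorem exists_resonantScale (hP : P.Standing) (W : WellFamily P.V (P.scale E₀)) (hE₀ : 0 < E₀)
    (hϰ : 0 < ϰ) : ∃ e ρ, ResonantScale W ϰ e ρ := by
  have hϰ' : (0 : ℝ) < ϰ := by exact_mod_cast hϰ
  obtain ⟨e, h1, h2, ρ, h3, h4⟩ := W.exists_resonant_scale (scale_pos hE₀) (m := P.h - 1)
    (by have := hP.two_le_h; omega) (div_pos hP.vartheta_pos hϰ')
  exact ⟨e, ρ, h1, h2, h3, fun η hη => (h4 η hη).1, fun η hη => (h4 η hη).2⟩

/-- `I⋆(t) = (η e(η))^(-2h)`. -/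
def resonantEnergy (P : ChirpedSystem) (e : ℝ → ℝ) (t : ℝ) : ℝ :=
  ((P.etaTime t * e (P.etaTime t)) ^ (2 * P.h))⁻¹

namespace ResonantScale

theorem omega_energy (h : ResonantScale W ϰ e ρ) (hP : P.Standing) (hE₀ : 0 < E₀) {t : ℝ}
    (ht : 0 < t) (hη : P.etaTime t ≤ ρ) :
    P.omega (P.resonantEnergy e t) = P.vartheta / ϰ * t ^ ((P.b : ℝ) / P.q) := by
  have hη0 := etaTime_pos (P := P) ht
  have hη' : |P.etaTime t| ≤ ρ := by rwa [abs_of_pos hη0]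
  have hh := hP.two_le_h
  have hpos := mul_pos hη0 (h.pos (P.etaTime t))
  have hlt : E₀ < P.resonantEnergy e t := lt_inv_of_abs_lt_scale hh hE₀ (h.lt _ hη') hpos.ne'
  rw [omega_eq W hh hE₀ hlt, resonantEnergy, scale_pow_inv hh hpos, h.freq_eq _ hη', mul_pow,
    etaTime_pow hP ht]
  have := pow_pos (h.pos (P.etaTime t)) (P.h - 1)
  have := Real.rpow_pos_of_pos ht ((P.b : ℝ) / P.q)
  field_simp

theorem tendsto_energy (h : ResonantScale W ϰ e ρ) (hP : P.Standing) :
    Tendsto (P.resonantEnergy e) atTop atTop := by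
  have hh := hP.two_le_h
  have h1 : Tendsto (fun t => (P.etaTime t * e (P.etaTime t)) ^ (2 * P.h)) atTop (𝓝 0) := by
    have h2 : ContinuousAt (fun η => (η * e η) ^ (2 * P.h)) 0 :=
      ((continuous_id.mul h.smooth.continuous).pow _).continuousAt
    have h3 := h2.tendsto.comp (tendsto_etaTime hP)
    rw [zero_mul, zero_pow (by omega)] at h3
    exact h3
  refine Tendsto.inv_tendsto_nhdsGT_zero (tendsto_nhdsWithin_iff.2 ⟨h1, ?_⟩)
  filter_upwards [eventually_gt_atTop 0] with t ht
  exact pow_pos (mul_pos (etaTime_pos ht) (h.pos _)) _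

theorem contDiffAt_etaTime {t : ℝ} (ht : 0 < t) : ContDiffAt ℝ ∞ P.etaTime t :=
  Real.contDiffAt_rpow_const_of_ne ht.ne'

theorem exists_isResonantEnergy (h : ResonantScale W ϰ e ρ) (hP : P.Standing) (hE₀ : 0 < E₀)
    (E₁ : ℝ) : ∃ t₁, 0 < t₁ ∧ P.IsResonantEnergy ϰ E₁ t₁ (P.resonantEnergy e) := by
  obtain ⟨t₁, h1⟩ := eventually_atTop.1
    ((((tendsto_energy h hP).eventually_ge_atTop E₁).and
      ((tendsto_etaTime hP).eventually (ge_mem_nhds h.radius_pos))).and (eventually_gt_atTop 0))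
  refine ⟨t₁, (h1 t₁ le_rfl).2, fun t ht => ?_, fun t ht => ?_⟩
  · have ht0 := (h1 t ht).2
    have h2 := contDiffAt_etaTime (P := P) ht0
    exact (((h2.mul (h.smooth.contDiffAt.comp t h2)).pow _).inv
      (pow_pos (mul_pos (etaTime_pos ht0) (h.pos _)) _).ne').contDiffWithinAt
  · obtain ⟨⟨h2, h3⟩, ht0⟩ := h1 t ht
    refine ⟨h2, ?_⟩
    rw [omega_energy h hP hE₀ ht0 h3, (hasDerivAt_S ht0).deriv]
    ring

/-- Logarithmic derivative of (η e(η))^(-2h), where η is a power of t; the result is 1/t times a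
smooth function of η. -/
theorem deriv_energy (h : ResonantScale W ϰ e ρ) (hP : P.Standing) {t : ℝ} (ht : 0 < t) :
    deriv (P.resonantEnergy e) t / P.resonantEnergy e t =
      2 * P.h * (P.b / (P.q * ((P.h : ℝ) - 1))) * t⁻¹ *
        (1 + P.etaTime t * deriv e (P.etaTime t) * (e (P.etaTime t))⁻¹) := by
  set c : ℝ := P.b / (P.q * ((P.h : ℝ) - 1)) with hc
  have h1 : HasDerivAt P.etaTime (-c * (P.etaTime t * t⁻¹)) t := by
    have h2 := Real.hasDerivAt_rpow_const (x := t) (p := -c) (Or.inl ht.ne')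
    rw [Real.rpow_sub_one ht.ne', div_eq_mul_inv] at h2
    exact h2
  have he := (h.smooth.differentiable (by norm_num) (P.etaTime t)).hasDerivAt
  have h3 := h1.mul (he.comp t h1)
  have hη := etaTime_pos (P := P) ht
  have hep := h.pos (P.etaTime t)
  have hpos : P.etaTime t * e (P.etaTime t) ≠ 0 := (mul_pos hη hep).ne'
  have h4 := (h3.pow (2 * P.h)).inv (pow_ne_zero _ hpos)
  have h5 := h4.deriv
  have h6 : deriv (P.resonantEnergy e) t = _ := h5
  rw [h6, resonantEnergy]
  obtain ⟨k, hk⟩ : ∃ k, 2 * P.h = k + 1 := ⟨2 * P.h - 1, by have := hP.two_le_h; omega⟩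
  have hk' : (2 * P.h : ℝ) = k + 1 := by exact_mod_cast hk
  simp only [Pi.mul_apply, Function.comp_apply, Pi.pow_apply, hk, Nat.add_sub_cancel, hk',
    Nat.cast_add, Nat.cast_one]
  field_simp
  ring

end ResonantScale

end ChirpedSystem

/-! ### The right-hand sides as functions of the scale and the angle -/

theorem contDiffAt_deriv_fst_two {a : ℝ → ℝ → ℝ} {z : ℝ × ℝ}
    (h : ContDiffAt ℝ ∞ (fun z : ℝ × ℝ => a z.1 z.2) z) :
    ContDiffAt ℝ ∞ (fun z : ℝ × ℝ => deriv (fun x => a x z.2) z.1) z := by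
  have h1 : ContDiffAt ℝ ∞ (fun z' => fderiv ℝ (fun z : ℝ × ℝ => a z.1 z.2) z' (1, 0)) z :=
    (h.fderiv_right (m := ∞) (by norm_num)).clm_apply contDiffAt_const
  refine h1.congr_of_eventuallyEq ?_
  filter_upwards [(h.of_le (by exact_mod_cast le_top : (1 : WithTop ℕ∞) ≤ ∞)).eventually
    (by norm_num)] with w hw
  exact ((hw.differentiableAt (by norm_num)).hasFDerivAt.comp_hasDerivAt w.1 (f := fun x => (x, w.2))
    ((hasDerivAt_id _).prodMk (hasDerivAt_const _ _))).deriv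

theorem contDiffAt_deriv_snd_two {a : ℝ → ℝ → ℝ} {z : ℝ × ℝ}
    (h : ContDiffAt ℝ ∞ (fun z : ℝ × ℝ => a z.1 z.2) z) :
    ContDiffAt ℝ ∞ (fun z : ℝ × ℝ => deriv (fun y => a z.1 y) z.2) z := by
  have h1 : ContDiffAt ℝ ∞ (fun z' => fderiv ℝ (fun z : ℝ × ℝ => a z.1 z.2) z' (0, 1)) z :=
    (h.fderiv_right (m := ∞) (by norm_num)).clm_apply contDiffAt_const
  refine h1.congr_of_eventuallyEq ?_
  filter_upwards [(h.of_le (by exact_mod_cast le_top : (1 : WithTop ℕ∞) ≤ ∞)).eventually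
    (by norm_num)] with w hw
  exact ((hw.differentiableAt (by norm_num)).hasFDerivAt.comp_hasDerivAt w.2 (f := fun y => (w.1, y))
    ((hasDerivAt_const _ _).prodMk (hasDerivAt_id _))).deriv

namespace ChirpedSystem

variable {P : ChirpedSystem} {ϰ : ℕ}

/-- A function of the scale and the angle that is smooth for scales below `d₀` and `2π`-periodic in
the angle. -/
structure AngleFunction (d₀ : ℝ) (a : ℝ → ℝ → ℝ) : Prop where
  smooth : ∀ {δ φ}, |δ| < d₀ → ContDiffAt ℝ ∞ (fun z : ℝ × ℝ => a z.1 z.2) (δ, φ)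
  periodic : ∀ {δ φ}, |δ| < d₀ → a δ (φ + 2 * Real.pi) = a δ φ

/-- The angle enters as θ + ζ/ϰ, which is why the period in ζ is 2πϰ rather than 2π. -/
theorem AngleFunction.paramPeriodic {d₀ : ℝ} {a : ℝ → ℝ → ℝ} (ha : AngleFunction d₀ a) (hϰ : 0 < ϰ)
    {d : ℝ × ℝ × ℝ × ℝ → ℝ} (hd : ParamPeriodic ϰ d) (hd₀ : ∀ z, |d z| < d₀) :
    ParamPeriodic ϰ fun z => a (d z) (z.2.2.1 + z.2.2.2 / ϰ) := by
  have hϰ' : (ϰ : ℝ) ≠ 0 := by exact_mod_cast hϰ.ne'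
  refine ⟨contDiff_iff_contDiffAt.2 fun z => ?_, fun ε r θ ζ => ⟨?_, ?_⟩⟩
  · have h1 : ContDiff ℝ ∞ fun z : ℝ × ℝ × ℝ × ℝ => (d z, z.2.2.1 + z.2.2.2 / ϰ) :=
      hd.1.prodMk (by fun_prop)
    exact (ha.smooth (hd₀ z)).comp z h1.contDiffAt
  · dsimp only
    rw [(hd.2 ε r θ ζ).1, add_right_comm, ha.periodic (hd₀ _)]
  · dsimp only
    rw [(hd.2 ε r θ ζ).2, add_div, mul_div_assoc, div_self hϰ', mul_one, ← add_assoc,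
      ha.periodic (hd₀ _)]

section AngleFunctions

variable {E₀ : ℝ} (W : WellFamily P.V (P.scale E₀))

theorem angleFunction_X : AngleFunction (P.scale E₀) W.X :=
  ⟨fun h => WellFamily.smooth_X h _, fun h => WellFamily.X_periodic h _⟩

theorem angleFunction_Y : AngleFunction (P.scale E₀) W.Y :=
  ⟨fun h => WellFamily.smooth_Y h _, fun h => WellFamily.Y_periodic h _⟩

theorem AngleFunction.deriv_scale {d₀ : ℝ} {a : ℝ → ℝ → ℝ} (ha : AngleFunction d₀ a) :
    AngleFunction d₀ fun δ φ => deriv (fun δ' => a δ' φ) δ := by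
  refine ⟨fun h => contDiffAt_deriv_fst_two (ha.smooth h), fun {δ φ} h => ?_⟩
  refine Filter.EventuallyEq.deriv_eq ?_
  filter_upwards [(continuous_abs.tendsto δ).eventually (gt_mem_nhds h)] with δ' h'
  exact ha.periodic h'

theorem angleFunction_force : AngleFunction (P.scale E₀) fun δ φ => deriv (P.V δ) (W.X δ φ) := by
  refine ⟨fun {δ φ} h => ?_, fun h => by rw [WellFamily.X_periodic h]⟩
  exact (contDiffAt_deriv_snd_two (a := P.V) (z := (δ, W.X δ φ)) P.contDiff_V.contDiffAt).comp
    (δ, φ) (contDiffAt_fst.prodMk (WellFamily.smooth_X h φ))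

/-- The coefficient with which g enters the equation for φ, from the E-derivative of X rewritten in
δ. In this form it is smooth at δ = 0; the next function plays the same role for f. -/
theorem angleFunction_phaseX : AngleFunction (P.scale E₀) fun δ φ =>
    W.freq δ / (2 * P.h) * (δ * deriv (fun δ' => W.X δ' φ) δ - W.X δ φ) := by
  refine ⟨fun {δ φ} h => ?_, fun h => ?_⟩
  · exact (((WellFamily.smooth_freq h).comp (δ, φ) contDiffAt_fst).div_const _).mul
      ((contDiffAt_fst.mul ((angleFunction_X W).deriv_scale.smooth h)).sub
        (WellFamily.smooth_X h φ))
  · rw [WellFamily.X_periodic h, (angleFunction_X W).deriv_scale.periodic h]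

theorem angleFunction_phaseY : AngleFunction (P.scale E₀) fun δ φ =>
    -(W.freq δ / (2 * P.h)) * (δ * deriv (fun δ' => W.Y δ' φ) δ - P.h * W.Y δ φ) := by
  refine ⟨fun {δ φ} h => ?_, fun h => ?_⟩
  · exact (((WellFamily.smooth_freq h).comp (δ, φ) contDiffAt_fst).div_const _).neg.mul
      ((contDiffAt_fst.mul ((angleFunction_Y W).deriv_scale.smooth h)).sub
        (contDiffAt_const.mul (WellFamily.smooth_Y h φ)))
  · rw [WellFamily.Y_periodic h, (angleFunction_Y W).deriv_scale.periodic h]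

/-- `δ f a + δ^h g b` at the point with scale `δ` and angle `φ`. -/
def forcing (a b : ℝ → ℝ → ℝ) (δ φ ζ t : ℝ) : ℝ :=
  δ * P.f (W.X δ φ / δ) (W.Y δ φ / δ ^ P.h) ζ t * a δ φ +
    δ ^ P.h * P.g (W.X δ φ / δ) (W.Y δ φ / δ ^ P.h) ζ t * b δ φ

variable {W}

/-- U'(X) = δ^(1-2h) V' and Y grows as δ^(-h), so division by I = δ^(-2h) leaves the factors δ and
δ^h and no negative power outside f and g. -/
theorem F_div_eq (hh : 2 ≤ P.h) {δ : ℝ} (hδ : 0 < δ) (φ t : ℝ) :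
    P.F (eaX W) (eaY W) ((δ ^ (2 * P.h))⁻¹) φ t / (δ ^ (2 * P.h))⁻¹ =
      forcing W (fun δ φ => deriv (P.V δ) (W.X δ φ)) W.Y δ φ (P.S t) t := by
  have hE : 0 < (δ ^ (2 * P.h))⁻¹ := inv_pos.2 (pow_pos hδ _)
  unfold F forcing
  rw [deriv_U_eaX W hh hE]
  unfold eaX eaY
  rw [scale_pow_inv hh hδ]
  obtain ⟨k, hk⟩ : ∃ k, P.h = k + 2 := ⟨P.h - 2, by omega⟩
  rw [hk, show 2 * (k + 2) - 1 = 2 * k + 3 by omega]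
  field_simp
  ring

/-- The E-derivatives of Y and X carry δ^h and δ^(2h-1), and ω carries δ^(1-h): the same factors δ
for f and δ^h for g as in the energy equation, so one expansion lemma serves both. -/
theorem G_eq (hh : 2 ≤ P.h) (hE₀ : 0 < E₀) {δ : ℝ} (hδ : 0 < δ) (hδ' : δ < P.scale E₀) (φ t : ℝ) :
    P.G (eaX W) (eaY W) ((δ ^ (2 * P.h))⁻¹) φ t =
      forcing W (fun δ φ =>
        -(W.freq δ / (2 * P.h)) * (δ * deriv (fun δ' => W.Y δ' φ) δ - P.h * W.Y δ φ))
      (fun δ φ => W.freq δ / (2 * P.h) * (δ * deriv (fun δ' => W.X δ' φ) δ - W.X δ φ))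
      δ φ (P.S t) t := by
  have hE := lt_inv_of_abs_lt_scale hh hE₀ (by rwa [abs_of_pos hδ]) hδ.ne'
  unfold G forcing
  rw [(hasDerivAt_eaX_energy W hh hE₀ hE φ).deriv, (hasDerivAt_eaY_energy W hh hE₀ hE φ).deriv,
    omega_eq W hh hE₀ hE]
  unfold eaX eaY
  rw [scale_pow_inv hh hδ]
  obtain ⟨k, hk⟩ : ∃ k, P.h = k + 2 := ⟨P.h - 2, by omega⟩
  rw [hk, show 2 * (k + 2) - 1 = 2 * k + 3 by omega, show k + 2 - 1 = k + 1 by omega]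
  field_simp
  ring

end AngleFunctions

/-! ### Extension through ε = 0 and expansion of the forcing and the frequency -/

section Series

variable {E₀ : ℝ} {W : WellFamily P.V (P.scale E₀)} {e : ℝ → ℝ} {ρ : ℝ}

/-- The factor `1 + t^(-μ) r`. -/
def widthOf (P : ChirpedSystem) (r τ : ℝ) : ℝ := 1 + P.time τ ^ (-P.mu) * r

/-- The scale of the energy `I⋆ (1 + t^(-μ) r)^(2h)`. -/
def scaleOf (P : ChirpedSystem) (e : ℝ → ℝ) (r τ : ℝ) : ℝ :=
  P.etaTime (P.time τ) * e (P.etaTime (P.time τ)) / P.widthOf r τ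

theorem energy_eq {r τ : ℝ} :
    P.resonantEnergy e (P.time τ) * P.widthOf r τ ^ (2 * P.h) = (P.scaleOf e r τ ^ (2 * P.h))⁻¹ := by
  unfold resonantEnergy scaleOf
  rw [div_pow, inv_div, div_eq_mul_inv, mul_comm]

theorem eventually_smallScale_mul (hP : P.Standing) (hr : P.Resonance) {ρ : ℝ} (hρ : 0 < ρ)
    (r₀ : ℝ) : ∃ τ', ∀ τ, τ' ≤ τ → 0 < τ ∧ ∀ r : ℝ, |r| ≤ r₀ → |P.smallScale τ ^ P.M * r| ≤ ρ := by
  have h1 : Tendsto (fun τ => P.smallScale τ ^ P.M * |r₀|) atTop (𝓝 0) := by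
    have := ((tendsto_smallScale hP).pow P.M).mul_const |r₀|
    rwa [zero_pow (P.M_eq hP hr).1.ne', zero_mul] at this
  obtain ⟨τ', h⟩ := eventually_atTop.1 ((h1.eventually (ge_mem_nhds hρ)).and (eventually_gt_atTop 0))
  refine ⟨τ', fun τ hτ => ⟨(h τ hτ).2, fun r hr => ?_⟩⟩
  rw [abs_mul, abs_of_nonneg (pow_nonneg (smallScale_pos hP (h τ hτ).2).le _)]
  exact (mul_le_mul_of_nonneg_left (hr.trans (le_abs_self _))
    (pow_nonneg (smallScale_pos hP (h τ hτ).2).le P.M)).trans (h τ hτ).1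

theorem tendsto_etaOf (hP : P.Standing) : Tendsto (fun τ => P.etaOf (P.epsOf τ)) atTop (𝓝 0) := by
  have := (tendsto_smallScale hP).pow (2 * P.b)
  rwa [zero_pow (by have := hP.one_le_b; omega)] at this

theorem paramPeriodic_amplitude : ParamPeriodic ϰ fun z => (P.kappa * z.1) ^ P.M * z.2.1 :=
  ParamPeriodic.of_fst_snd (f := fun ε r => (P.kappa * ε) ^ P.M * r) (by fun_prop)

/-- Globally defined smooth functions of `ε` and `t^(-μ) r` that agree with the factor
`1 + t^(-μ) r` and the scale for large `τ`. -/
structure ScaleExtension (W : WellFamily P.V (P.scale E₀)) (e : ℝ → ℝ) (w : ℝ → ℝ)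
    (d : ℝ × ℝ → ℝ) : Prop where
  smooth_w : ContDiff ℝ ∞ w
  smooth_d : ContDiff ℝ ∞ d
  w_pos : ∀ v, 0 < w v
  d_lt : ∀ z, |d z| < P.scale E₀
  eventually_eq : ∀ r₀ : ℝ, ∃ τ', ∀ τ, τ' ≤ τ → 0 < τ ∧ ∀ r, |r| ≤ r₀ →
    w (P.smallScale τ ^ P.M * r) = P.widthOf r τ ∧ 0 < P.widthOf r τ ∧
    d (P.epsOf τ, P.smallScale τ ^ P.M * r) = P.scaleOf e r τ ∧ 0 < P.scaleOf e r τ ∧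
    P.scaleOf e r τ < P.scale E₀

/-- For small τ the factor 1 + t^(-μ) r may vanish and the scale may leave the domain of the well
family. Cut-offs of both give functions defined for all ε and r; on |r| ≤ r₀ both are inactive once
τ is large. -/
theorem exists_scaleExtension (hP : P.Standing) (hr : P.Resonance) (hE₀ : 0 < E₀)
    (h : ResonantScale W ϰ e ρ) : ∃ w d, ScaleExtension W e w d := by
  obtain ⟨χ, hχ, hχd, ρ₁, hρ₁, hχρ⟩ := exists_cutoff 0 (scale_pos (P := P) hE₀)
  obtain ⟨χ₁, hχ₁, hχ₁d, ρ₂, hρ₂, hχ₁ρ⟩ := exists_cutoff 0 (R := 1) one_pos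
  simp only [sub_zero] at hχd hχρ hχ₁d hχ₁ρ
  have hw0 : ∀ v, 0 < 1 + χ₁ v := fun v => by
    have := abs_lt.1 (hχ₁d v)
    linarith
  have hη : ContDiff ℝ ∞ P.etaOf := by
    unfold etaOf
    fun_prop
  refine ⟨fun v => 1 + χ₁ v, fun z => χ (P.etaOf z.1 * e (P.etaOf z.1) / (1 + χ₁ z.2)),
    contDiff_const.add hχ₁, ?_, hw0, fun z => hχd _, fun r₀ => ?_⟩
  · have h1 : ContDiff ℝ ∞ fun z : ℝ × ℝ => P.etaOf z.1 := hη.comp contDiff_fst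
    exact hχ.comp ((h1.mul (h.smooth.comp h1)).div (contDiff_const.add (hχ₁.comp contDiff_snd))
      fun z => (hw0 z.2).ne')
  -- The bound 1/2 keeps the factor 1 + t^(-μ) r above 1/2, so dividing the scale by it at most
  -- doubles it; hence the factor 2 in the limit below.
  obtain ⟨τ₁, h1⟩ := eventually_smallScale_mul hP hr (lt_min hρ₂ one_half_pos) r₀
  have h2 : Tendsto (fun τ => P.etaOf (P.epsOf τ) * e (P.etaOf (P.epsOf τ)) * 2) atTop (𝓝 0) := by
    have h3 : ContinuousAt (fun η => η * e η * 2) 0 :=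
      ((continuous_id.mul h.smooth.continuous).mul continuous_const).continuousAt
    have h4 := h3.tendsto.comp (tendsto_etaOf hP)
    rw [zero_mul, zero_mul] at h4
    exact h4
  obtain ⟨τ₂, h5⟩ := eventually_atTop.1 (h2.eventually (gt_mem_nhds (lt_min hρ₁ (scale_pos hE₀))))
  refine ⟨max τ₁ τ₂, fun τ hτ => ?_⟩
  obtain ⟨hτ0, h6⟩ := h1 τ (le_of_max_le_left hτ)
  have h7 := h5 τ (le_of_max_le_right hτ)
  have hη := etaTime_time hP hτ0
  refine ⟨hτ0, fun r hr' => ?_⟩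
  have h9 := h6 r hr'
  have hw1 : 1 + χ₁ (P.smallScale τ ^ P.M * r) = P.widthOf r τ := by
    rw [widthOf, time_rpow_neg_mu hP hr hτ0, hχ₁ρ _ (h9.trans (min_le_left _ _))]
  have hw2 : 1 / 2 ≤ P.widthOf r τ := by
    rw [widthOf, time_rpow_neg_mu hP hr hτ0]
    have := abs_le.1 (h9.trans (min_le_right _ _))
    linarith
  have hw3 : 0 < P.widthOf r τ := by linarith
  have hη0 := mul_pos (etaOf_pos hP hτ0) (h.pos (P.etaOf (P.epsOf τ)))
  have hs0 : 0 < P.scaleOf e r τ := by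
    rw [scaleOf, hη]
    exact div_pos hη0 hw3
  have hs1 : P.scaleOf e r τ < min ρ₁ (P.scale E₀) := by
    refine lt_of_le_of_lt ?_ h7
    rw [scaleOf, hη, div_le_iff₀ hw3]
    nlinarith
  refine ⟨hw1, hw3, ?_, hs0, hs1.trans_le (min_le_right _ _)⟩
  have hs2 : P.etaOf (P.epsOf τ) * e (P.etaOf (P.epsOf τ)) / (1 + χ₁ (P.smallScale τ ^ P.M * r)) =
      P.scaleOf e r τ := by rw [hw1, scaleOf, hη]
  dsimp only
  rw [hs2]
  exact hχρ _ (by rw [abs_of_pos hs0]; exact (hs1.trans_le (min_le_left _ _)).le)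

variable {w : ℝ → ℝ} {d : ℝ × ℝ → ℝ}

namespace ScaleExtension

/-- For f, with e = 1, the available exponent is (l-1)(h-1) + p; for g, with e = h, it is l(h-1) +
p. Both dominate i + hj = (i+j) + (h-1)j under the respective degree bounds, which is exactly what σ
is designed for. -/
theorem hasSeries_forcing (hx : ScaleExtension W e w d) (h : ResonantScale W ϰ e ρ)
    (hP : P.Standing) (hfg : P.PowerLaw) (hϰ : 0 < ϰ) {a b : ℝ → ℝ → ℝ}
    (ha : AngleFunction (P.scale E₀) a) (hb : AngleFunction (P.scale E₀) b) :
    P.HasSeries ϰ fun r θ τ => P.etaTime (P.time τ) ^ P.etaExponent *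
      forcing W a b (P.scaleOf e r τ) (θ + P.zeta τ / ϰ) (P.zeta τ) (P.time τ) := by
  have hd : ParamPeriodic ϰ fun z => d (z.1, (P.kappa * z.1) ^ P.M * z.2.1) :=
    ParamPeriodic.of_fst_snd (f := fun ε r => d (ε, (P.kappa * ε) ^ P.M * r))
      (hx.smooth_d.comp (by fun_prop : ContDiff ℝ ∞ fun z : ℝ × ℝ =>
        (z.1, (P.kappa * z.1) ^ P.M * z.2)))
  have hd0 : ∀ z : ℝ × ℝ × ℝ × ℝ, |d (z.1, (P.kappa * z.1) ^ P.M * z.2.1)| < P.scale E₀ :=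
    fun z => hx.d_lt _
  have hu : ParamPeriodic ϰ fun z => e (P.etaOf z.1) * (w ((P.kappa * z.1) ^ P.M * z.2.1))⁻¹ :=
    (paramPeriodic_etaOf.comp h.smooth).mul
      ((paramPeriodic_amplitude.comp hx.smooth_w).inv fun z => (hx.w_pos _).ne')
  have hu0 : ∀ z : ℝ × ℝ × ℝ × ℝ,
      0 < e (P.etaOf z.1) * (w ((P.kappa * z.1) ^ P.M * z.2.1))⁻¹ := fun z =>
    mul_pos (h.pos _) (inv_pos.2 (hx.w_pos _))
  obtain ⟨m, hm⟩ := hfg.expansion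
  have hh := hP.two_le_h
  have hX := (angleFunction_X W).paramPeriodic hϰ hd hd0
  have hY := (angleFunction_Y W).paramPeriodic hϰ hd hd0
  have hf := hasSeries_perturbation (L := P.etaExponent) (e := 1) (m := m) hP hϰ hfg.A_smooth
    hfg.A_periodic hfg.A_zero (fun n => by
      obtain ⟨C, t', ht', h⟩ := hm n
      exact ⟨C, t', ht', fun t ht x y σ => (h t ht x y σ).1⟩)
    (fun i j hij hj => by
      unfold etaExponent
      obtain ⟨k, hk⟩ : ∃ k, P.l = j + 1 + k := ⟨P.l - (j + 1), by omega⟩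
      obtain ⟨n, hn⟩ : ∃ n, P.h = n + 2 := ⟨P.h - 2, by omega⟩
      obtain ⟨o, ho⟩ : ∃ o, P.p = i + j + o := ⟨P.p - (i + j), by omega⟩
      rw [hk, hn, ho]
      push_cast
      nlinarith)
    hu hu0 hX hY (ha.paramPeriodic hϰ hd hd0)
  have hg := hasSeries_perturbation (L := P.etaExponent) (e := P.h) (m := m) hP hϰ hfg.B_smooth
    hfg.B_periodic hfg.B_zero (fun n => by
      obtain ⟨C, t', ht', h⟩ := hm n
      exact ⟨C, t', ht', fun t ht x y σ => (h t ht x y σ).2⟩)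
    (fun i j hij hj => by
      unfold etaExponent
      obtain ⟨k, hk⟩ : ∃ k, P.l = j + k := ⟨P.l - j, by omega⟩
      obtain ⟨n, hn⟩ : ∃ n, P.h = n + 2 := ⟨P.h - 2, by omega⟩
      obtain ⟨o, ho⟩ : ∃ o, P.p = i + j + o := ⟨P.p - (i + j), by omega⟩
      rw [hk, hn, ho]
      push_cast
      nlinarith)
    hu hu0 hX hY (hb.paramPeriodic hϰ hd hd0)
  refine (hf.add hg).congr fun r₀ => ?_
  obtain ⟨τ', h1⟩ := hx.eventually_eq r₀
  refine ⟨τ', fun τ hτ r θ hr₀ => ?_⟩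
  obtain ⟨hτ0, h2⟩ := h1 τ hτ
  obtain ⟨h3, -, h4, -, -⟩ := h2 r hr₀
  have h5 : P.etaOf (P.epsOf τ) * (e (P.etaOf (P.epsOf τ)) *
      (w ((P.kappa * P.epsOf τ) ^ P.M * r))⁻¹) = P.scaleOf e r τ := by
    change _ * (_ * (w (P.smallScale τ ^ P.M * r))⁻¹) = _
    rw [h3, scaleOf, etaTime_time hP hτ0, div_eq_mul_inv, mul_assoc]
  change d (P.epsOf τ, (P.kappa * P.epsOf τ) ^ P.M * r) = _ at h4
  simp only [paramPoint]
  rw [h4, h5, etaTime_time hP hτ0, forcing]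
  ring

/-- The frequency is t^(b/q) times a smooth function of ε and t^(-μ) r, so the difference contains a
factor t^(-μ) r. The powers of t cancel because 2μ = b/q - σ. -/
theorem exists_frequency_difference (hx : ScaleExtension W e w d) (h : ResonantScale W ϰ e ρ)
    (hP : P.Standing) (hr : P.Resonance) (hE₀ : 0 < E₀) :
    ∃ k : ℝ × ℝ × ℝ × ℝ → ℝ, ParamPeriodic ϰ k ∧ ∀ r₀ : ℝ, ∃ τ', ∀ τ, τ' ≤ τ → ∀ r θ, |r| ≤ r₀ →
      P.time τ ^ (-P.mu - P.sigma) *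
        (P.omega (P.resonantEnergy e (P.time τ) * P.widthOf r τ ^ (2 * P.h)) -
          P.omega (P.resonantEnergy e (P.time τ))) = r * k (P.paramPoint r θ τ) := by
  have hh := hP.two_le_h
  let Φ : ℝ × ℝ → ℝ := fun z =>
    (e (P.etaOf z.1))⁻¹ ^ (P.h - 1) * w z.2 ^ (P.h - 1) * W.freq (d z)
  have hη : ContDiff ℝ ∞ P.etaOf := by
    unfold etaOf
    fun_prop
  have hΦ : ContDiff ℝ ∞ Φ := by
    have h1 : ContDiff ℝ ∞ fun z : ℝ × ℝ => e (P.etaOf z.1) := h.smooth.comp (hη.comp contDiff_fst)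
    refine (((h1.inv fun z => (h.pos _).ne').pow _).mul ((hx.smooth_w.comp contDiff_snd).pow _)).mul ?_
    exact contDiff_iff_contDiffAt.2 fun z =>
      (WellFamily.smooth_freq (hx.d_lt z)).comp z hx.smooth_d.contDiffAt
  obtain ⟨K, hK, hKΦ⟩ := exists_contDiff_dividedDifference (E := ℝ) hΦ
  refine ⟨fun z => K (z.1, (P.kappa * z.1) ^ P.M * z.2.1, 0),
    ParamPeriodic.of_fst_snd (f := fun ε r => K (ε, (P.kappa * ε) ^ P.M * r, 0))
      (hK.comp (by fun_prop : ContDiff ℝ ∞ fun z : ℝ × ℝ =>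
        (z.1, (P.kappa * z.1) ^ P.M * z.2, (0 : ℝ)))), fun r₀ => ?_⟩
  -- The absolute value makes r = 0 admissible whatever the sign of r₀; the frequency at r = 0 is
  -- that of I⋆.
  obtain ⟨τ', h1⟩ := hx.eventually_eq |r₀|
  refine ⟨τ', fun τ hτ r θ hr₀ => ?_⟩
  obtain ⟨hτ0, h2⟩ := h1 τ hτ
  have ht := time_pos hP hτ0
  have hfreq : ∀ r, |r| ≤ |r₀| →
      P.omega (P.resonantEnergy e (P.time τ) * P.widthOf r τ ^ (2 * P.h)) =
        P.time τ ^ ((P.b : ℝ) / P.q) * Φ (P.epsOf τ, P.smallScale τ ^ P.M * r) := by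
    intro r hr₀
    obtain ⟨h3, h4, h5, h6, h7⟩ := h2 r hr₀
    have hE := lt_inv_of_abs_lt_scale hh hE₀ (by rwa [abs_of_pos h6]) h6.ne'
    simp only [Φ]
    rw [energy_eq, omega_eq W hh hE₀ hE, scale_pow_inv hh h6, h3, h5]
    conv_lhs => rw [scaleOf, div_pow, mul_pow, etaTime_pow hP ht, ← scaleOf]
    rw [etaTime_time hP hτ0, inv_pow]
    have := pow_pos (h.pos (P.etaOf (P.epsOf τ))) (P.h - 1)
    have := pow_pos h4 (P.h - 1)
    have := Real.rpow_pos_of_pos ht ((P.b : ℝ) / P.q)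
    field_simp
  have h0 := hfreq 0 (by rw [abs_zero]; exact abs_nonneg _)
  rw [show P.widthOf 0 τ = 1 by simp [widthOf], one_pow, mul_one, mul_zero] at h0
  rw [hfreq r (hr₀.trans (le_abs_self _)), h0, ← mul_sub, hKΦ, sub_zero, ← time_rpow_neg_mu hP hr hτ0]
  simp only [paramPoint]
  change _ = r * K (P.epsOf τ, P.smallScale τ ^ P.M * r, 0)
  rw [time_rpow_neg_mu hP hr hτ0]
  have h8 : P.time τ ^ (-P.mu - P.sigma) * P.time τ ^ ((P.b : ℝ) / P.q) * P.smallScale τ ^ P.M = 1 := by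
    rw [← time_rpow_neg_mu hP hr hτ0, ← Real.rpow_add ht, ← Real.rpow_add ht]
    convert Real.rpow_zero _ using 2
    unfold mu
    ring
  linear_combination r * K (P.epsOf τ, P.smallScale τ ^ P.M * r, 0) * h8

end ScaleExtension

end Series

end ChirpedSystem

/-! ### Expansions of 𝒜 and ℬ -/

namespace ChirpedSystem

variable {P : ChirpedSystem} {ϰ : ℕ} {E₀ : ℝ} {W : WellFamily P.V (P.scale E₀)} {e : ℝ → ℝ} {ρ : ℝ}
  {w : ℝ → ℝ} {d : ℝ × ℝ → ℝ}

namespace ScaleExtension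

/-- Three contributions: the forcing, of size t^(-σ-a/q) before scaling; the drift of I⋆, of size
t^(-1-σ); and the derivative of t^(-μ), of size t^(-1-μ-σ). After scaling each is smooth in ε. -/
theorem hasSeries_calA (hx : ScaleExtension W e w d) (h : ResonantScale W ϰ e ρ)
    (hP : P.Standing) (hr : P.Resonance) (hfg : P.PowerLaw) (hϰ : 0 < ϰ) :
    P.HasSeries ϰ (P.calA ϰ (eaX W) (eaY W) (P.resonantEnergy e)) := by
  have hh := hP.two_le_h
  have hw : ParamPeriodic ϰ fun z => w ((P.kappa * z.1) ^ P.M * z.2.1) :=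
    paramPeriodic_amplitude.comp hx.smooth_w
  have hs : ∀ n, ParamPeriodic ϰ fun z => (P.kappa * z.1) ^ n := fun n =>
    ((ParamPeriodic.const P.kappa).mul ParamPeriodic.epsilon).pow n
  have he : ParamPeriodic ϰ fun z => (e (P.etaOf z.1))⁻¹ :=
    (paramPeriodic_etaOf.comp h.smooth).inv fun z => (h.pos _).ne'
  have he' : ParamPeriodic ϰ fun z => deriv e (P.etaOf z.1) :=
    paramPeriodic_etaOf.comp (contDiff_infty_iff_deriv.1 h.smooth).2
  have hforce := hx.hasSeries_forcing h hP hfg hϰ (angleFunction_force W) (angleFunction_Y W)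
  have h1 := hforce.param_mul hϰ ((ParamPeriodic.const (P.kappa ^ P.M / (2 * P.h))).mul hw)
  have hrest : ParamPeriodic ϰ fun z => P.kappa ^ P.M *
      (P.mu * z.2.1 * (P.kappa * z.1) ^ (P.N - P.M) - w ((P.kappa * z.1) ^ P.M * z.2.1) *
        (P.b / (P.q * ((P.h : ℝ) - 1))) * (P.kappa * z.1) ^ (P.N - 2 * P.M) *
        (1 + P.etaOf z.1 * deriv e (P.etaOf z.1) * (e (P.etaOf z.1))⁻¹)) :=
    (ParamPeriodic.const _).mul ((((ParamPeriodic.const P.mu).mul (ParamPeriodic.of_fst_snd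
      (f := fun _ r => r) contDiff_snd)).mul (hs _)).sub (((hw.mul (ParamPeriodic.const _)).mul
      (hs _)).mul ((ParamPeriodic.const 1).add ((paramPeriodic_etaOf.mul he').mul he))))
  refine (h1.add (HasSeries.of_param hrest)).congr fun r₀ => ?_
  obtain ⟨τ', h2⟩ := hx.eventually_eq r₀
  refine ⟨τ', fun τ hτ r θ hr₀ => ?_⟩
  obtain ⟨hτ0, h3⟩ := h2 τ hτ
  obtain ⟨h4, h5, -, h6, -⟩ := h3 r hr₀
  have ht := time_pos hP hτ0
  have hF := F_div_eq (W := W) hh h6 (θ + P.zeta τ / ϰ) (P.time τ)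
  rw [← energy_eq] at hF
  change P.F (eaX W) (eaY W) _ _ _ / _ = forcing W _ _ _ _ (P.zeta τ) _ at hF
  simp only [paramPoint]
  change _ = P.kappa ^ P.M / (2 * P.h) * w (P.smallScale τ ^ P.M * r) * _ +
    P.kappa ^ P.M * (P.mu * r * P.smallScale τ ^ (P.N - P.M) - w (P.smallScale τ ^ P.M * r) *
    _ * P.smallScale τ ^ (P.N - 2 * P.M) * _)
  rw [← hF, h4, ← etaTime_time hP hτ0]
  unfold calA
  dsimp only
  rw [h.deriv_energy hP ht, prefactor_eq hP hr hτ0, ← time_rpow_sub_sigma_a hP ht]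
  change _ * (_ * (P.widthOf r τ / _) * (_ * P.F _ _ (_ * P.widthOf r τ ^ _) _ _ /
    (_ * P.widthOf r τ ^ _) - _) + _) = _
  rw [mul_div_assoc (P.time τ ^ (-(P.a : ℝ) / P.q))]
  have e1 : P.time τ ^ (-P.mu - P.sigma) * P.time τ ^ P.mu * P.time τ ^ (-(P.a : ℝ) / P.q) =
      P.time τ ^ (-P.sigma - (P.a : ℝ) / P.q) := by
    rw [← Real.rpow_add ht, ← Real.rpow_add ht]
    congr 1
    ring
  have e2 : P.time τ ^ (-P.mu - P.sigma) * P.time τ ^ P.mu * (P.time τ)⁻¹ =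
      P.smallScale τ ^ (P.N - 2 * P.M) := by
    rw [← time_rpow_sub_sigma hP hr hτ0, ← Real.rpow_neg_one, ← Real.rpow_add ht,
      ← Real.rpow_add ht]
    congr 1
    ring
  have e3 : P.time τ ^ (-P.mu - P.sigma) * (P.time τ)⁻¹ = P.smallScale τ ^ (P.N - P.M) := by
    rw [← time_rpow_sub_mu_sigma hP hr hτ0, ← Real.rpow_neg_one, ← Real.rpow_add ht]
    congr 1
    ring
  rw [← e1, ← e2, ← e3]
  have hh' : (P.h : ℝ) ≠ 0 := by
    have := hP.two_le
    positivity
  generalize P.F (eaX W) (eaY W) _ _ _ / _ = Φ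
  generalize P.etaTime (P.time τ) * deriv e (P.etaTime (P.time τ)) * (e (P.etaTime (P.time τ)))⁻¹ = D
  generalize (P.b : ℝ) / (P.q * ((P.h : ℝ) - 1)) = c
  field_simp
  ring

/-- The frequency difference gives the leading part; the forcing enters with an additional factor
t^(-μ) = (κε)^M. -/
theorem hasSeries_calB (hx : ScaleExtension W e w d) (h : ResonantScale W ϰ e ρ)
    (hP : P.Standing) (hr : P.Resonance) (hfg : P.PowerLaw) (hϰ : 0 < ϰ) (hE₀ : 0 < E₀) :
    P.HasSeries ϰ (P.calB ϰ (eaX W) (eaY W) (P.resonantEnergy e)) := by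
  have hh := hP.two_le_h
  obtain ⟨k, hk, hkr⟩ := hx.exists_frequency_difference h hP hr hE₀
  have hs : ∀ n, ParamPeriodic ϰ fun z => (P.kappa * z.1) ^ n := fun n =>
    ((ParamPeriodic.const P.kappa).mul ParamPeriodic.epsilon).pow n
  have hforce := hx.hasSeries_forcing h hP hfg hϰ (angleFunction_phaseY W) (angleFunction_phaseX W)
  have h1 := hforce.param_mul hϰ ((ParamPeriodic.const (P.kappa ^ P.M)).mul (hs P.M))
  have hrest : ParamPeriodic ϰ fun z => P.kappa ^ P.M * (z.2.1 * k z) :=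
    (ParamPeriodic.const _).mul ((ParamPeriodic.of_fst_snd (f := fun _ r => r) contDiff_snd).mul hk)
  refine (h1.add (HasSeries.of_param hrest)).congr fun r₀ => ?_
  obtain ⟨τ', h2⟩ := hx.eventually_eq r₀
  obtain ⟨τ'', h2'⟩ := hkr r₀
  refine ⟨max τ' τ'', fun τ hτ r θ hr₀ => ?_⟩
  obtain ⟨hτ0, h3⟩ := h2 τ (le_of_max_le_left hτ)
  have hω := h2' τ (le_of_max_le_right hτ) r θ hr₀
  obtain ⟨-, -, -, h6, h7⟩ := h3 r hr₀
  have ht := time_pos hP hτ0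
  have hG := G_eq (W := W) hh hE₀ h6 h7 (θ + P.zeta τ / ϰ) (P.time τ)
  rw [← energy_eq] at hG
  change P.G (eaX W) (eaY W) _ _ _ = forcing W _ _ _ _ (P.zeta τ) _ at hG
  rw [← hG]
  change _ = P.kappa ^ P.M * P.smallScale τ ^ P.M * _ + P.kappa ^ P.M * (r * _)
  rw [← hω, ← time_rpow_sub_sigma_a hP ht, ← time_rpow_neg_mu hP hr hτ0]
  unfold calB
  dsimp only
  rw [prefactor_eq hP hr hτ0]
  change _ * (P.omega (_ * P.widthOf r τ ^ _) - _ + _ * P.G _ _ (_ * P.widthOf r τ ^ _) _ _) = _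
  have e1 : P.time τ ^ (-P.mu - P.sigma) * P.time τ ^ (-(P.a : ℝ) / P.q) =
      P.time τ ^ (-P.mu) * P.time τ ^ (-P.sigma - (P.a : ℝ) / P.q) := by
    rw [← Real.rpow_add ht, ← Real.rpow_add ht]
    congr 1
    ring
  generalize P.G (eaX W) (eaY W) _ _ _ = Φ
  linear_combination P.kappa ^ P.M * Φ * e1

end ScaleExtension

end ChirpedSystem

/-- Hadamard's lemma for a function of two variables. -/
theorem exists_contDiff_shift {Γ : ℝ → ℝ → ℝ} (hΓ : ContDiff ℝ ∞ fun z : ℝ × ℝ => Γ z.1 z.2)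
    {a b p q : ℝ → ℝ} (ha : ContDiff ℝ ∞ a) (hb : ContDiff ℝ ∞ b) (hp : ContDiff ℝ ∞ p)
    (hq : ContDiff ℝ ∞ q) (m : ℕ) : ∃ R : ℝ → ℝ, ContDiff ℝ ∞ R ∧ ∀ ε,
      Γ (a ε + ε ^ m * p ε) (b ε + ε ^ m * q ε) = Γ (a ε) (b ε) + ε ^ m * R ε := by
  obtain ⟨K₁, hK₁, h1⟩ := exists_contDiff_dividedDifference (E := ℝ)
    (F := fun z : ℝ × ℝ => Γ z.2 z.1) (hΓ.comp (by fun_prop : ContDiff ℝ ∞ fun z : ℝ × ℝ => (z.2, z.1)))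
  obtain ⟨K₂, hK₂, h2⟩ := exists_contDiff_dividedDifference (E := ℝ) hΓ
  refine ⟨fun ε => p ε * K₁ (b ε + ε ^ m * q ε, a ε + ε ^ m * p ε, a ε) +
    q ε * K₂ (a ε, b ε + ε ^ m * q ε, b ε), ?_, fun ε => ?_⟩
  · have e1 : ContDiff ℝ ∞ fun ε => b ε + ε ^ m * q ε := by fun_prop
    have e2 : ContDiff ℝ ∞ fun ε => a ε + ε ^ m * p ε := by fun_prop
    exact (hp.mul (hK₁.comp (e1.prodMk (e2.prodMk ha)))).add
      (hq.mul (hK₂.comp (ha.prodMk (e1.prodMk hb))))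
  · have e1 := h1 (b ε + ε ^ m * q ε) (a ε + ε ^ m * p ε) (a ε)
    have e2 := h2 (a ε) (b ε + ε ^ m * q ε) (b ε)
    dsimp only at e1 e2
    linear_combination e1 + e2

/-- Isolates the one new unknown of order K, namely Γ_K(r, θ). Everything else uses indices below K,
because a displacement with k ≥ K carries ε^(M+k) with M > 0 and cannot affect order K. -/
theorem taylorCoeff_composition {Γ : ℕ → ℝ → ℝ → ℝ}
    (hΓ : ∀ j, ContDiff ℝ ∞ fun z : ℝ × ℝ => Γ j z.1 z.2) {M K n : ℕ} (hM : 0 < M) (hK : K ≤ n)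
    (r θ : ℝ) (ρ ψ : ℕ → ℝ) :
    taylorCoeff K (fun ε => ∑ j ∈ Finset.range (n + 1), ε ^ j *
        Γ j (r + ∑ k ∈ Finset.range (n + 1), ε ^ (M + k) * ρ k)
          (θ + ∑ k ∈ Finset.range (n + 1), ε ^ (M + k) * ψ k)) =
      Γ K r θ + taylorCoeff K (fun ε => ∑ j ∈ Finset.range K, ε ^ j *
        Γ j (r + ∑ k ∈ Finset.range K, ε ^ (M + k) * ρ k)
          (θ + ∑ k ∈ Finset.range K, ε ^ (M + k) * ψ k)) := by
  have hs : ∀ (m : ℕ) (σ : ℕ → ℝ) (v : ℝ),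
      ContDiff ℝ ∞ fun ε : ℝ => v + ∑ k ∈ Finset.range m, ε ^ (M + k) * σ k := fun m σ v =>
    contDiff_const.add (ContDiff.sum fun k _ => by fun_prop)
  have hG : ∀ m j, ContDiff ℝ ∞ fun ε : ℝ =>
      Γ j (r + ∑ k ∈ Finset.range m, ε ^ (M + k) * ρ k)
          (θ + ∑ k ∈ Finset.range m, ε ^ (M + k) * ψ k) := fun m j =>
    (hΓ j).comp ((hs m ρ r).prodMk (hs m ψ θ))
  have hterm : ∀ m j, ContDiff ℝ ∞ fun ε : ℝ => ε ^ j *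
      Γ j (r + ∑ k ∈ Finset.range m, ε ^ (M + k) * ρ k)
          (θ + ∑ k ∈ Finset.range m, ε ^ (M + k) * ψ k) := fun m j =>
    (contDiff_id.pow j).mul (hG m j)
  rw [taylorCoeff_sum fun j _ => hterm _ j, taylorCoeff_sum fun j _ => hterm _ j]
  obtain ⟨m, rfl⟩ : ∃ m, n = K + m := ⟨n - K, by omega⟩
  -- Splitting off one from M lets the omitted displacements show the factor ε^(K+1).
  obtain ⟨M, rfl⟩ : ∃ M', M = M' + 1 := ⟨M - 1, by omega⟩
  rw [show K + m + 1 = K + (1 + m) by ring, Finset.sum_range_add, Finset.sum_range_add _ 1 m,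
    Finset.sum_range_one, add_zero, taylorCoeff_pow_mul_self (hG _ _),
    Finset.sum_eq_zero (s := Finset.range m) fun j _ =>
      taylorCoeff_pow_mul_of_lt (by omega) (hG _ _), add_zero, add_comm]
  congr 1
  · simp
  refine Finset.sum_congr rfl fun j _ => ?_
  have hsplit : ∀ (σ : ℕ → ℝ) (ε : ℝ), ∑ k ∈ Finset.range (K + (1 + m)), ε ^ (M + 1 + k) * σ k =
      (∑ k ∈ Finset.range K, ε ^ (M + 1 + k) * σ k) +
        ε ^ (K + 1) * ∑ k ∈ Finset.range (1 + m), ε ^ (M + k) * σ (K + k) := fun σ ε => by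
    rw [Finset.sum_range_add, Finset.mul_sum]
    congr 1
    refine Finset.sum_congr rfl fun k _ => by ring
  obtain ⟨R, hR, h⟩ := exists_contDiff_shift (hΓ j) (hs K ρ r) (hs K ψ θ)
    (p := fun ε => ∑ k ∈ Finset.range (1 + m), ε ^ (M + k) * ρ (K + k))
    (q := fun ε => ∑ k ∈ Finset.range (1 + m), ε ^ (M + k) * ψ (K + k))
    (ContDiff.sum fun k _ => by fun_prop) (ContDiff.sum fun k _ => by fun_prop) (K + 1)
  refine taylorCoeff_congr_pow (n := K + 1) (R := fun ε => ε ^ j * R ε) (by omega) (hterm K j)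
    ((contDiff_id.pow j).mul hR) fun ε => ?_
  rw [hsplit ρ, hsplit ψ, ← add_assoc, ← add_assoc, h ε]
  ring

/-! ### The defect of the averaging transformation -/

namespace ChirpedSystem

variable {P : ChirpedSystem} {ϰ : ℕ}

/-- What remains, divided by `ε^M`, when the derivative of the near-identity transformation along
the truncated system is compared with the averaged right-hand side. -/
def defect (P : ChirpedSystem) (n : ℕ) (cA cB ρ ψ c γ : ℕ → ℝ → ℝ → ℝ → ℝ) (Γ : ℕ → ℝ → ℝ → ℝ)
    (ε r θ ζ : ℝ) : ℝ :=
  (∑ i ∈ Finset.range (n + 1), ε ^ i * c i r θ ζ)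
  + (∑ i ∈ Finset.range (n + 1), ∑ j ∈ Finset.range (n + 1), ε ^ (i + j + P.M) *
      (cA i r θ ζ * deriv (fun r' => γ j r' θ ζ) r + cB i r θ ζ * deriv (fun θ' => γ j r θ' ζ) θ))
  + (∑ j ∈ Finset.range (n + 1), ε ^ j * (P.vartheta * deriv (fun ζ' => γ j r θ ζ') ζ))
  - (∑ j ∈ Finset.range (n + 1), ε ^ (j + P.N) * (((P.M : ℝ) + j) / P.N * γ j r θ ζ))
  - ∑ j ∈ Finset.range (n + 1), ε ^ j *
      Γ j (r + ∑ k ∈ Finset.range (n + 1), ε ^ (P.M + k) * ρ k r θ ζ)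
        (θ + ∑ k ∈ Finset.range (n + 1), ε ^ (P.M + k) * ψ k r θ ζ)

section Defect

variable {cA cB ρ ψ c γ : ℕ → ℝ → ℝ → ℝ → ℝ} {Γ : ℕ → ℝ → ℝ → ℝ}

/-- Collecting the coefficient of ε^K reproduces the K-th equation of the chain: the convolution,
the shift by N and the composition give precisely `correction`. -/
theorem taylorCoeff_defect (hM : 0 < P.M) (h : P.AveragingChain ϰ cA cB ρ ψ c γ Γ) {K n : ℕ}
    (hK : K ≤ n) (r θ ζ : ℝ) :
    taylorCoeff K (fun ε => P.defect n cA cB ρ ψ c γ Γ ε r θ ζ) = 0 := by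
  have hmon : ∀ (m : ℕ) (a : ℝ), ContDiff ℝ ∞ fun ε : ℝ => ε ^ m * a := fun m a => by fun_prop
  have hs1 : ∀ (f : ℕ → ℕ) (a : ℕ → ℝ), ContDiff ℝ ∞ fun ε : ℝ =>
      ∑ j ∈ Finset.range (n + 1), ε ^ f j * a j := fun f a => ContDiff.sum fun j _ => hmon _ _
  have hs2 : ∀ (f : ℕ → ℕ → ℕ) (a : ℕ → ℕ → ℝ), ContDiff ℝ ∞ fun ε : ℝ =>
      ∑ i ∈ Finset.range (n + 1), ∑ j ∈ Finset.range (n + 1), ε ^ f i j * a i j := fun f a =>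
    ContDiff.sum fun i _ => ContDiff.sum fun j _ => hmon _ _
  have hs3 : ContDiff ℝ ∞ fun ε : ℝ => ∑ j ∈ Finset.range (n + 1), ε ^ j *
      Γ j (r + ∑ k ∈ Finset.range (n + 1), ε ^ (P.M + k) * ρ k r θ ζ)
        (θ + ∑ k ∈ Finset.range (n + 1), ε ^ (P.M + k) * ψ k r θ ζ) :=
    ContDiff.sum fun j _ => (contDiff_id.pow j).mul ((h.smooth_avg j).comp
      ((contDiff_const.add (hs1 (fun k => P.M + k) fun k => ρ k r θ ζ)).prodMk
        (contDiff_const.add (hs1 (fun k => P.M + k) fun k => ψ k r θ ζ))))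
  have ht1 : ∀ (f : ℕ → ℕ) (a : ℕ → ℝ), taylorCoeff K (fun ε : ℝ =>
      ∑ j ∈ Finset.range (n + 1), ε ^ f j * a j) =
      ∑ j ∈ Finset.range (n + 1), if f j = K then a j else 0 := fun f a => by
    rw [taylorCoeff_sum fun j _ => hmon _ _]
    exact Finset.sum_congr rfl fun j _ => taylorCoeff_monomial _ _ _
  have ht2 : ∀ (f : ℕ → ℕ → ℕ) (a : ℕ → ℕ → ℝ), taylorCoeff K (fun ε : ℝ =>
      ∑ i ∈ Finset.range (n + 1), ∑ j ∈ Finset.range (n + 1), ε ^ f i j * a i j) =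
      ∑ i ∈ Finset.range (n + 1), ∑ j ∈ Finset.range (n + 1), if f i j = K then a i j else 0 :=
    fun f a => by
    rw [taylorCoeff_sum fun i _ => hs1 (f i) (a i)]
    exact Finset.sum_congr rfl fun i _ => ht1 (f i) (a i)
  have hd : ∀ a : ℕ → ℝ, (∑ j ∈ Finset.range (n + 1), if j = K then a j else 0) = a K := fun a => by
    rw [Finset.sum_ite_eq' (Finset.range (n + 1)) K a, if_pos (by simpa using hK)]
  have hconv : ∀ a : ℕ → ℕ → ℝ, (∑ i ∈ Finset.range (n + 1), ∑ j ∈ Finset.range (n + 1),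
      if i + j + P.M = K then a i j else 0) = ∑ i ∈ Finset.range (K + 1),
      ∑ j ∈ Finset.range (K + 1), if i + j + P.M = K then a i j else 0 := fun a => by
    have hsub : Finset.range (K + 1) ⊆ Finset.range (n + 1) := Finset.range_mono (by omega)
    rw [← Finset.sum_subset hsub fun i _ hi => Finset.sum_eq_zero fun j _ => if_neg (by
      rw [Finset.mem_range] at hi
      omega)]
    refine Finset.sum_congr rfl fun i _ => (Finset.sum_subset hsub fun j _ hj => if_neg (by
      rw [Finset.mem_range] at hj
      omega)).symm
  have hpow : (∑ j ∈ Finset.range (n + 1), if j + P.N = K then ((P.M : ℝ) + j) / P.N * γ j r θ ζ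
      else 0) = if P.N ≤ K then ((P.M : ℝ) + K - P.N) / P.N * γ (K - P.N) r θ ζ else 0 := by
    by_cases hN : P.N ≤ K
    · rw [if_pos hN, Finset.sum_eq_single_of_mem (K - P.N) (by rw [Finset.mem_range]; omega)
        fun j _ hj => if_neg (by omega), if_pos (by omega), Nat.cast_sub hN, add_sub_assoc]
    · rw [if_neg hN]
      exact Finset.sum_eq_zero fun j _ => if_neg (by omega)
  unfold defect
  rw [taylorCoeff_sub ((((hs1 _ _).add (hs2 _ _)).add (hs1 _ _)).sub (hs1 _ _)) hs3,
    taylorCoeff_sub (((hs1 _ _).add (hs2 _ _)).add (hs1 _ _)) (hs1 _ _),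
    taylorCoeff_add ((hs1 _ _).add (hs2 _ _)) (hs1 _ _), taylorCoeff_add (hs1 _ _) (hs2 _ _),
    taylorCoeff_composition h.smooth_avg hM hK, ht1, ht1, ht1, ht2, hd, hd, hconv, hpow,
    h.equation K r θ ζ, correction]
  unfold taylorCoeff
  ring

theorem paramPeriodic_defect (hA : ∀ j, SmoothPeriodic ϰ (cA j)) (hB : ∀ j, SmoothPeriodic ϰ (cB j))
    (hc : ∀ j, SmoothPeriodic ϰ (c j)) (hρ : ∀ j, SmoothPeriodic ϰ (ρ j))
    (hψ : ∀ j, SmoothPeriodic ϰ (ψ j)) (h : P.AveragingChain ϰ cA cB ρ ψ c γ Γ) (n : ℕ) :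
    ParamPeriodic ϰ fun z => P.defect n cA cB ρ ψ c γ Γ z.1 z.2.1 z.2.2.1 z.2.2.2 := by
  have hγ := h.smoothPeriodic
  have hε : ∀ m : ℕ, ParamPeriodic ϰ fun z => z.1 ^ m := fun m => ParamPeriodic.epsilon.pow m
  have hsum : ∀ {σ : ℕ → ℝ → ℝ → ℝ → ℝ}, (∀ j, SmoothPeriodic ϰ (σ j)) → ∀ f : ℕ → ℕ,
      ParamPeriodic ϰ fun z => ∑ j ∈ Finset.range (n + 1),
        z.1 ^ f j * σ j z.2.1 z.2.2.1 z.2.2.2 := fun hσ f =>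
    ParamPeriodic.sum fun j _ => (hε _).mul (ParamPeriodic.of_smoothPeriodic (hσ j))
  have h2 : ParamPeriodic ϰ fun z => ∑ i ∈ Finset.range (n + 1), ∑ j ∈ Finset.range (n + 1),
      z.1 ^ (i + j + P.M) * (cA i z.2.1 z.2.2.1 z.2.2.2 *
        deriv (fun r' => γ j r' z.2.2.1 z.2.2.2) z.2.1 + cB i z.2.1 z.2.2.1 z.2.2.2 *
        deriv (fun θ' => γ j z.2.1 θ' z.2.2.2) z.2.2.1) :=
    ParamPeriodic.sum fun i _ => ParamPeriodic.sum fun j _ => (hε _).mul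
      (ParamPeriodic.of_smoothPeriodic
        (((hA i).mul (hγ j).deriv_one).add ((hB i).mul (hγ j).deriv_two)))
  have h5 : ParamPeriodic ϰ fun z => ∑ j ∈ Finset.range (n + 1), z.1 ^ j *
      Γ j (z.2.1 + ∑ k ∈ Finset.range (n + 1), z.1 ^ (P.M + k) * ρ k z.2.1 z.2.2.1 z.2.2.2)
        (z.2.2.1 + ∑ k ∈ Finset.range (n + 1), z.1 ^ (P.M + k) * ψ k z.2.1 z.2.2.1 z.2.2.2) := by
    refine ParamPeriodic.sum fun j _ => (hε _).mul ?_
    have e1 := hsum hρ fun k => P.M + k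
    have e2 := hsum hψ fun k => P.M + k
    refine ⟨(h.smooth_avg j).comp (((by fun_prop : ContDiff ℝ ∞ fun z : ℝ × ℝ × ℝ × ℝ => z.2.1).add
      e1.1).prodMk ((by fun_prop : ContDiff ℝ ∞ fun z : ℝ × ℝ × ℝ × ℝ => z.2.2.1).add e2.1)),
      fun ε r θ ζ => ⟨?_, ?_⟩⟩
    · have p1 := (e1.2 ε r θ ζ).1
      have p2 := (e2.2 ε r θ ζ).1
      dsimp only at p1 p2 ⊢
      rw [p1, p2, add_right_comm, h.periodic_avg]
    · have p1 := (e1.2 ε r θ ζ).2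
      have p2 := (e2.2 ε r θ ζ).2
      dsimp only at p1 p2 ⊢
      rw [p1, p2]
  exact ((((hsum hc fun j => j).add h2).add (hsum (fun j => (smoothPeriodic_const _).mul
    (hγ j).deriv_three) fun j => j)).sub (hsum (fun j => (smoothPeriodic_const _).mul (hγ j))
    fun j => j + P.N)).sub h5

/-- All Taylor coefficients up to order n vanish, so only the Taylor remainder is left, and it is
uniform by periodicity. -/
theorem exists_defect_bound (hM : 0 < P.M) (hϰ : 0 < ϰ) (hA : ∀ j, SmoothPeriodic ϰ (cA j))
    (hB : ∀ j, SmoothPeriodic ϰ (cB j)) (hc : ∀ j, SmoothPeriodic ϰ (c j))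
    (hρ : ∀ j, SmoothPeriodic ϰ (ρ j)) (hψ : ∀ j, SmoothPeriodic ϰ (ψ j))
    (h : P.AveragingChain ϰ cA cB ρ ψ c γ Γ) (n : ℕ) (r₀ : ℝ) :
    ∃ C, 0 < C ∧ ∀ ε r θ ζ, |ε| ≤ 1 → |r| ≤ r₀ →
      |P.defect n cA cB ρ ψ c γ Γ ε r θ ζ| ≤ C * |ε| ^ (n + 1) := by
  obtain ⟨C, hC, h1⟩ := (paramPeriodic_defect hA hB hc hρ hψ h n).taylor_bound hϰ (n + 1) r₀
  refine ⟨C, hC, fun ε r θ ζ hε hr => ?_⟩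
  have h2 := h1 ε r θ ζ hε hr
  rwa [Finset.sum_eq_zero fun K hK => by
    rw [taylorCoeff_defect hM h (Nat.lt_succ_iff.1 (Finset.mem_range.1 hK)), mul_zero],
    sub_zero] at h2

end Defect

end ChirpedSystem

theorem hasDerivAt_comp_three {c : ℝ → ℝ → ℝ → ℝ}
    (hc : ContDiff ℝ ∞ fun z : ℝ × ℝ × ℝ => c z.1 z.2.1 z.2.2) {r θ ζ : ℝ → ℝ} {r' θ' ζ' t : ℝ}
    (hr : HasDerivAt r r' t) (hθ : HasDerivAt θ θ' t) (hζ : HasDerivAt ζ ζ' t) :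
    HasDerivAt (fun t => c (r t) (θ t) (ζ t))
      (r' * deriv (fun x => c x (θ t) (ζ t)) (r t) + θ' * deriv (fun x => c (r t) x (ζ t)) (θ t) +
        ζ' * deriv (fun x => c (r t) (θ t) x) (ζ t)) t := by
  have hf := (hc.differentiable (by norm_num) (r t, θ t, ζ t)).hasFDerivAt
  have h1 := hf.comp_hasDerivAt t (hr.prodMk (hθ.prodMk hζ))
  have h2 := (hf.comp_hasDerivAt (r t) (f := fun x => (x, θ t, ζ t))
    ((hasDerivAt_id _).prodMk ((hasDerivAt_const _ _).prodMk (hasDerivAt_const _ _)))).deriv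
  have h3 := (hf.comp_hasDerivAt (θ t) (f := fun x => (r t, x, ζ t))
    ((hasDerivAt_const _ _).prodMk ((hasDerivAt_id _).prodMk (hasDerivAt_const _ _)))).deriv
  have h4 := (hf.comp_hasDerivAt (ζ t) (f := fun x => (r t, θ t, x))
    ((hasDerivAt_const _ _).prodMk ((hasDerivAt_const _ _).prodMk (hasDerivAt_id _)))).deriv
  have h5 : ((r', θ', ζ') : ℝ × ℝ × ℝ) = r' • ((1, 0, 0) : ℝ × ℝ × ℝ) + θ' • ((0, 1, 0) : ℝ × ℝ × ℝ) +
      ζ' • ((0, 0, 1) : ℝ × ℝ × ℝ) := by simp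
  rw [h5, map_add, map_add, map_smul, map_smul, map_smul, smul_eq_mul, smul_eq_mul, smul_eq_mul] at h1
  simp only [Function.comp_def] at h1 h2 h3 h4
  rw [h2, h3, h4]
  exact h1

/-! ### Perturbations of the identity on a strip -/

section Strip

variable {g k : ℝ → ℝ → ℝ} {r₀ α : ℝ}

/-- The two points are joined by a path with one leg in r and one in θ, which stays in the strip. -/
theorem lipschitz_strip (h1 : ∀ r θ, |r| ≤ r₀ → DifferentiableAt ℝ (fun r' => g r' θ) r ∧
      |deriv (fun r' => g r' θ) r| ≤ α)
    (h2 : ∀ r θ, |r| ≤ r₀ → DifferentiableAt ℝ (fun θ' => g r θ') θ ∧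
      |deriv (fun θ' => g r θ') θ| ≤ α) {r r' : ℝ} (hr : |r| ≤ r₀) (hr' : |r'| ≤ r₀) (θ θ' : ℝ) :
    |g r θ - g r' θ'| ≤ α * |r - r'| + α * |θ - θ'| := by
  have e1 := (convex_Icc (-r₀) r₀).norm_image_sub_le_of_norm_deriv_le (f := fun r => g r θ)
    (fun x hx => (h1 x θ (abs_le.2 hx)).1) (fun x hx => (h1 x θ (abs_le.2 hx)).2)
    (abs_le.1 hr') (abs_le.1 hr)
  have e2 := convex_univ.norm_image_sub_le_of_norm_deriv_le (f := fun θ => g r' θ)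
    (fun x _ => (h2 r' x hr').1) (fun x _ => (h2 r' x hr').2) (Set.mem_univ θ') (Set.mem_univ θ)
  simp only [Real.norm_eq_abs] at e1 e2
  exact (abs_sub_le _ (g r' θ) _).trans (add_le_add e1 e2)

/-- For two points with equal images, adding the estimates gives |Δr| + |Δθ| ≤ 2α(|Δr| + |Δθ|) with
2α < 1. -/
theorem injOn_strip (hα : α < 1 / 2)
    (hg : ∀ r r' θ θ', |r| ≤ r₀ → |r'| ≤ r₀ → |g r θ - g r' θ'| ≤ α * |r - r'| + α * |θ - θ'|)
    (hk : ∀ r r' θ θ', |r| ≤ r₀ → |r'| ≤ r₀ → |k r θ - k r' θ'| ≤ α * |r - r'| + α * |θ - θ'|) :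
    Set.InjOn (fun z : ℝ × ℝ => (z.1 + g z.1 z.2, z.2 + k z.1 z.2)) {z | |z.1| ≤ r₀} := by
  rintro ⟨r, θ⟩ hr ⟨r', θ'⟩ hr' heq
  simp only [Prod.mk.injEq] at heq
  have h1 := hg r r' θ θ' hr hr'
  have h2 := hk r r' θ θ' hr hr'
  rw [show g r θ - g r' θ' = -(r - r') by linarith [heq.1], abs_neg] at h1
  rw [show k r θ - k r' θ' = -(θ - θ') by linarith [heq.2], abs_neg] at h2
  have h3 := abs_nonneg (r - r')
  have h4 := abs_nonneg (θ - θ')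
  have h5 : |r - r'| + |θ - θ'| = 0 := by nlinarith
  have h6 : r - r' = 0 := abs_eq_zero.1 (by linarith)
  have h7 : θ - θ' = 0 := abs_eq_zero.1 (by linarith)
  exact Prod.ext (by dsimp only; linarith) (by dsimp only; linarith)

/-- A preimage is a fixed point of (r, θ) ↦ (R - g, Ψ - k). The margin ε in the bound on R makes
this map preserve the strip, and in the maximum norm it contracts by 2α. -/
theorem exists_preimage_strip (hα0 : 0 ≤ α) (hα : α < 1 / 2) {ε : ℝ}
    (hg : ∀ r r' θ θ', |r| ≤ r₀ → |r'| ≤ r₀ → |g r θ - g r' θ'| ≤ α * |r - r'| + α * |θ - θ'|)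
    (hk : ∀ r r' θ θ', |r| ≤ r₀ → |r'| ≤ r₀ → |k r θ - k r' θ'| ≤ α * |r - r'| + α * |θ - θ'|)
    (hgε : ∀ r θ, |r| ≤ r₀ → |g r θ| ≤ ε) {R Ψ : ℝ} (hR : |R| ≤ r₀ - ε) (hr₀ : 0 ≤ r₀) :
    ∃ r θ, |r| ≤ r₀ ∧ r + g r θ = R ∧ θ + k r θ = Ψ := by
  let s : Set (ℝ × ℝ) := {z | |z.1| ≤ r₀}
  let F : ℝ × ℝ → ℝ × ℝ := fun z => (R - g z.1 z.2, Ψ - k z.1 z.2)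
  have hs : IsComplete s := (isClosed_le (by fun_prop) continuous_const).isComplete
  have hF : Set.MapsTo F s s := fun z hz => by
    have h1 := hgε z.1 z.2 hz
    change |R - g z.1 z.2| ≤ r₀
    exact (abs_sub _ _).trans (by linarith)
  have hc : ContractingWith (2 * α).toNNReal (hF.restrict F s s) := by
    refine ⟨Real.toNNReal_lt_one.2 (by linarith), ?_⟩
    refine LipschitzWith.of_dist_le_mul fun z z' => ?_
    have h1 := hg z.1.1 z'.1.1 z.1.2 z'.1.2 z.2 z'.2
    have h2 := hk z.1.1 z'.1.1 z.1.2 z'.1.2 z.2 z'.2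
    rw [Real.coe_toNNReal _ (by positivity)]
    change max (dist (R - g z.1.1 z.1.2) (R - g z'.1.1 z'.1.2))
      (dist (Ψ - k z.1.1 z.1.2) (Ψ - k z'.1.1 z'.1.2)) ≤
      2 * α * max (dist z.1.1 z'.1.1) (dist z.1.2 z'.1.2)
    simp only [Real.dist_eq, sub_sub_sub_cancel_left]
    rw [abs_sub_comm (g _ _), abs_sub_comm (k _ _)]
    have h3 := mul_le_mul_of_nonneg_left (le_max_left |z.1.1 - z'.1.1| |z.1.2 - z'.1.2|) hα0
    have h4 := mul_le_mul_of_nonneg_left (le_max_right |z.1.1 - z'.1.1| |z.1.2 - z'.1.2|) hα0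
    exact max_le (by linarith) (by linarith)
  obtain ⟨z, hz, hfix, -, -⟩ := hc.exists_fixedPoint' hs hF (x := (0, 0))
    (show |(0 : ℝ)| ≤ r₀ by rwa [abs_zero]) (edist_ne_top _ _)
  have h1 : R - g z.1 z.2 = z.1 := congrArg Prod.fst hfix
  have h2 : Ψ - k z.1 z.2 = z.2 := congrArg Prod.snd hfix
  exact ⟨z.1, z.2, hz, by linarith, by linarith⟩

end Strip

namespace ChirpedSystem

variable {P : ChirpedSystem} {ϰ : ℕ}

/-! ### The near-identity transformation -/

/-- The displacement of the near-identity transformation. -/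
def shift (P : ChirpedSystem) (n : ℕ) (γ : ℕ → ℝ → ℝ → ℝ → ℝ) (r θ τ : ℝ) : ℝ :=
  ∑ K ∈ Finset.range (n + 1), P.epsOf τ ^ (P.M + K) * γ K r θ (P.zeta τ)

theorem rpow_M_add {τ : ℝ} (hτ : 0 < τ) (K : ℕ) :
    τ ^ (-((P.M : ℝ) + K) / P.N) = P.epsOf τ ^ (P.M + K) := by
  rw [epsOf_pow hτ]
  push_cast
  rfl

theorem nearId_eq {τ : ℝ} (hτ : 0 < τ) (n : ℕ) (γ : ℕ → ℝ → ℝ → ℝ → ℝ) (v r θ : ℝ) :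
    P.nearId n γ v r θ τ = v + P.shift n γ r θ τ := by
  unfold nearId shift
  simp only [rpow_M_add hτ]

section Shift

variable {γ : ℕ → ℝ → ℝ → ℝ → ℝ}

/-- The displacement has a common factor ε^M with M > 0, the other factor being bounded. Applied to
the derivatives of the coefficients, it also makes the transformation C¹-close to the identity. -/
theorem eventually_shift_le (hP : P.Standing) (hr : P.Resonance) (hϰ : 0 < ϰ)
    (hγ : ∀ K, SmoothPeriodic ϰ (γ K)) (n : ℕ) (r₀ : ℝ) {α : ℝ} (hα : 0 < α) :
    ∃ τ', ∀ τ, τ' ≤ τ → ∀ r θ, |r| ≤ r₀ → |P.shift n γ r θ τ| ≤ α := by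
  have h1 : ParamPeriodic ϰ fun z => ∑ K ∈ Finset.range (n + 1),
      z.1 ^ K * γ K z.2.1 z.2.2.1 z.2.2.2 := ParamPeriodic.sum fun K _ =>
    (ParamPeriodic.epsilon.pow K).mul (ParamPeriodic.of_smoothPeriodic (hγ K))
  obtain ⟨C, hC, h2⟩ := h1.bound hϰ r₀
  have h3 : Tendsto (fun τ => P.epsOf τ ^ P.M * C) atTop (𝓝 0) := by
    have := ((tendsto_epsOf hP).pow P.M).mul_const C
    rwa [zero_pow (P.M_eq hP hr).1.ne', zero_mul] at this
  obtain ⟨τ', h4⟩ := eventually_atTop.1 ((h3.eventually (ge_mem_nhds hα)).and (eventually_ge_atTop 1))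
  refine ⟨τ', fun τ hτ r θ hr => ?_⟩
  obtain ⟨h5, h6⟩ := h4 τ hτ
  have hε := epsOf_pos (P := P) (by linarith : 0 < τ)
  have h7 := h2 (P.epsOf τ) r θ (P.zeta τ) (by rw [abs_of_pos hε]; exact epsOf_le_one h6) hr
  have h8 : P.shift n γ r θ τ = P.epsOf τ ^ P.M * ∑ K ∈ Finset.range (n + 1),
      P.epsOf τ ^ K * γ K r θ (P.zeta τ) := by
    rw [shift, Finset.mul_sum]
    exact Finset.sum_congr rfl fun K _ => by rw [pow_add, mul_assoc]
  rw [h8, abs_mul, abs_of_pos (pow_pos hε _)]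
  exact (mul_le_mul_of_nonneg_left h7 (pow_pos hε _).le).trans h5

theorem hasDerivAt_shift_fst (hγ : ∀ K, SmoothPeriodic ϰ (γ K)) (n : ℕ) (r θ τ : ℝ) :
    HasDerivAt (fun r' => P.shift n γ r' θ τ)
      (P.shift n (fun K r θ ζ => deriv (fun r' => γ K r' θ ζ) r) r θ τ) r :=
  HasDerivAt.fun_sum fun K _ => HasDerivAt.const_mul _
    ((((hγ K).contDiff_comp contDiff_id contDiff_const contDiff_const).differentiable
      (by norm_num) r).hasDerivAt)

theorem hasDerivAt_shift_snd (hγ : ∀ K, SmoothPeriodic ϰ (γ K)) (n : ℕ) (r θ τ : ℝ) :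
    HasDerivAt (fun θ' => P.shift n γ r θ' τ)
      (P.shift n (fun K r θ ζ => deriv (fun θ' => γ K r θ' ζ) θ) r θ τ) θ :=
  HasDerivAt.fun_sum fun K _ => HasDerivAt.const_mul _
    ((((hγ K).contDiff_comp contDiff_const contDiff_id contDiff_const).differentiable
      (by norm_num) θ).hasDerivAt)

theorem hasDerivAt_zeta (hP : P.Standing) {τ : ℝ} (hτ : 0 < τ) : HasDerivAt P.zeta P.vartheta τ := by
  have h : HasDerivAt (fun τ => P.vartheta * τ) P.vartheta τ := by
    simpa using (hasDerivAt_id τ).const_mul P.vartheta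
  refine h.congr_of_eventuallyEq ?_
  filter_upwards [eventually_gt_nhds hτ] with τ' hτ'
  exact zeta_eq hP hτ'

/-- Since ε^N = 1/τ, a derivative in τ costs N powers of ε; this is the origin of the term with
index K - N in the chain. -/
theorem hasDerivAt_epsOf_pow (hP : P.Standing) {τ : ℝ} (hτ : 0 < τ) (m : ℕ) :
    HasDerivAt (fun τ => P.epsOf τ ^ m) (-(m / P.N * P.epsOf τ ^ (m + P.N))) τ := by
  have hN : (P.N : ℝ) ≠ 0 := by exact_mod_cast (P.N_eq hP).1.ne'
  have h := Real.hasDerivAt_rpow_const (x := τ) (p := -(m : ℝ) / P.N) (Or.inl hτ.ne')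
  rw [show -(m : ℝ) / P.N - 1 = -((m + P.N : ℕ) : ℝ) / P.N by push_cast; field_simp; ring,
    ← epsOf_pow hτ, neg_div, neg_mul] at h
  refine h.congr_of_eventuallyEq ?_
  filter_upwards [eventually_gt_nhds hτ] with τ' hτ'
  rw [epsOf_pow hτ', neg_div]

/-- The rate of change of the displacement when `r`, `θ` have the rates `r'`, `θ'`. -/
def shiftRate (P : ChirpedSystem) (n : ℕ) (γ : ℕ → ℝ → ℝ → ℝ → ℝ) (r' θ' r θ τ : ℝ) : ℝ :=
  r' * P.shift n (fun K r θ ζ => deriv (fun r' => γ K r' θ ζ) r) r θ τ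
  + θ' * P.shift n (fun K r θ ζ => deriv (fun θ' => γ K r θ' ζ) θ) r θ τ
  + P.shift n (fun K r θ ζ => P.vartheta * deriv (fun ζ' => γ K r θ ζ') ζ) r θ τ
  - P.epsOf τ ^ P.N * P.shift n (fun K r θ ζ => ((P.M : ℝ) + K) / P.N * γ K r θ ζ) r θ τ

theorem hasDerivAt_nearId (hP : P.Standing) (hγ : ∀ K, SmoothPeriodic ϰ (γ K)) (n : ℕ)
    {v r θ : ℝ → ℝ} {v' r' θ' τ : ℝ} (hτ : 0 < τ) (hv : HasDerivAt v v' τ) (hr : HasDerivAt r r' τ)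
    (hθ : HasDerivAt θ θ' τ) :
    HasDerivAt (fun τ => P.nearId n γ (v τ) (r τ) (θ τ) τ)
      (v' + P.shiftRate n γ r' θ' (r τ) (θ τ) τ) τ := by
  have h1 : HasDerivAt (fun τ => P.shift n γ (r τ) (θ τ) τ)
      (P.shiftRate n γ r' θ' (r τ) (θ τ) τ) τ := by
    have h2 : HasDerivAt (fun τ => P.shift n γ (r τ) (θ τ) τ) _ τ :=
      HasDerivAt.fun_sum fun K (_ : K ∈ Finset.range (n + 1)) =>
        (hasDerivAt_epsOf_pow hP hτ (P.M + K)).fun_mul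
          (hasDerivAt_comp_three (hγ K).1 hr hθ (hasDerivAt_zeta hP hτ))
    convert h2 using 1
    unfold shiftRate shift
    simp only [Finset.mul_sum]
    rw [← Finset.sum_add_distrib, ← Finset.sum_add_distrib, ← Finset.sum_sub_distrib]
    refine Finset.sum_congr rfl fun K _ => ?_
    push_cast
    ring
  refine (hv.add h1).congr_of_eventuallyEq ?_
  filter_upwards [eventually_gt_nhds hτ] with τ' hτ'
  exact nearId_eq hτ' n γ _ _ _

end Shift

section NearIdentity

variable {ρ ψ : ℕ → ℝ → ℝ → ℝ → ℝ}

theorem exists_nearIdentity (hP : P.Standing) (hr : P.Resonance) (hϰ : 0 < ϰ)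
    (hρ : ∀ K, SmoothPeriodic ϰ (ρ K)) (hψ : ∀ K, SmoothPeriodic ϰ (ψ K)) (n : ℕ) {r₀ ε : ℝ}
    (hε : 0 < ε) (hr₀ : ε < r₀) :
    ∃ τ', 0 < τ' ∧ ∀ τ₀, τ' ≤ τ₀ → P.NearIdentity n ρ ψ r₀ ε τ₀ := by
  -- The bound 1/4 keeps 2α below 1 for injectivity and contraction, and the Jacobian at least
  -- (3/4)² - (1/4)² > 0.
  have hα : 0 < min ε (1 / 4) := lt_min hε (by norm_num)
  have hρ1 := fun K => (hρ K).deriv_one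
  have hρ2 := fun K => (hρ K).deriv_two
  have hψ1 := fun K => (hψ K).deriv_one
  have hψ2 := fun K => (hψ K).deriv_two
  obtain ⟨τ₁, h1⟩ := eventually_shift_le hP hr hϰ hρ n r₀ hα
  obtain ⟨τ₂, h2⟩ := eventually_shift_le hP hr hϰ hψ n r₀ hα
  obtain ⟨τ₃, h3⟩ := eventually_shift_le hP hr hϰ hρ1 n r₀ hα
  obtain ⟨τ₄, h4⟩ := eventually_shift_le hP hr hϰ hρ2 n r₀ hα
  obtain ⟨τ₅, h5⟩ := eventually_shift_le hP hr hϰ hψ1 n r₀ hα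
  obtain ⟨τ₆, h6⟩ := eventually_shift_le hP hr hϰ hψ2 n r₀ hα
  obtain ⟨τ', hτ'⟩ := eventually_atTop.1 ((((((eventually_ge_atTop τ₁).and (eventually_ge_atTop τ₂)).and
    (eventually_ge_atTop τ₃)).and (eventually_ge_atTop τ₄)).and (eventually_ge_atTop τ₅)).and
    (eventually_ge_atTop τ₆))
  have hle1 : min ε (1 / 4) ≤ ε := min_le_left _ _
  have hle2 : min ε (1 / 4) ≤ 1 / 4 := min_le_right _ _
  refine ⟨max τ' 1, lt_max_of_lt_right one_pos, fun τ₀ hτ₀ => ?_⟩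
  have key : ∀ τ, τ₀ < τ → 0 < τ ∧ (∀ v r θ, P.nearId n ρ v r θ τ = v + P.shift n ρ r θ τ) ∧
      (∀ v r θ, P.nearId n ψ v r θ τ = v + P.shift n ψ r θ τ) ∧ ∀ r θ, |r| ≤ r₀ →
      |P.shift n ρ r θ τ| ≤ min ε (1 / 4) ∧ |P.shift n ψ r θ τ| ≤ min ε (1 / 4) ∧
      |deriv (fun r' => P.shift n ρ r' θ τ) r| ≤ min ε (1 / 4) ∧
      |deriv (fun θ' => P.shift n ρ r θ' τ) θ| ≤ min ε (1 / 4) ∧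
      |deriv (fun r' => P.shift n ψ r' θ τ) r| ≤ min ε (1 / 4) ∧
      |deriv (fun θ' => P.shift n ψ r θ' τ) θ| ≤ min ε (1 / 4) := by
    intro τ hτ
    have hτ1 : max τ' 1 ≤ τ := hτ₀.trans hτ.le
    have hτ0 : 0 < τ := one_pos.trans_le (le_of_max_le_right hτ1)
    obtain ⟨⟨⟨⟨⟨a1, a2⟩, a3⟩, a4⟩, a5⟩, a6⟩ := hτ' τ (le_of_max_le_left hτ1)
    refine ⟨hτ0, fun v r θ => nearId_eq hτ0 n ρ v r θ, fun v r θ => nearId_eq hτ0 n ψ v r θ,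
      fun r θ hr' => ?_⟩
    rw [(hasDerivAt_shift_fst hρ n r θ τ).deriv, (hasDerivAt_shift_snd hρ n r θ τ).deriv,
      (hasDerivAt_shift_fst hψ n r θ τ).deriv, (hasDerivAt_shift_snd hψ n r θ τ).deriv]
    exact ⟨h1 τ a1 r θ hr', h2 τ a2 r θ hr', h3 τ a3 r θ hr', h4 τ a4 r θ hr', h5 τ a5 r θ hr',
      h6 τ a6 r θ hr'⟩
  have hderiv : ∀ τ, τ₀ < τ → ∀ r θ,
      deriv (fun r' => P.Rn n ρ r' θ τ) r = 1 + deriv (fun r' => P.shift n ρ r' θ τ) r ∧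
      deriv (fun θ' => P.Rn n ρ r θ' τ) θ = deriv (fun θ' => P.shift n ρ r θ' τ) θ ∧
      deriv (fun r' => P.Psin n ψ r' θ τ) r = deriv (fun r' => P.shift n ψ r' θ τ) r ∧
      deriv (fun θ' => P.Psin n ψ r θ' τ) θ = 1 + deriv (fun θ' => P.shift n ψ r θ' τ) θ := by
    intro τ hτ r θ
    obtain ⟨-, e1, e2, -⟩ := key τ hτ
    unfold Rn Psin
    simp only [e1, e2]
    have d1 := (hasDerivAt_shift_fst (P := P) hρ n r θ τ).differentiableAt
    have d2 := (hasDerivAt_shift_snd (P := P) hψ n r θ τ).differentiableAt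
    refine ⟨?_, deriv_const_add _, deriv_const_add _, ?_⟩
    · exact (((hasDerivAt_id r).add d1.hasDerivAt).deriv)
    · exact (((hasDerivAt_id θ).add d2.hasDerivAt).deriv)
  have hlip : ∀ τ, τ₀ < τ → (∀ r r' θ θ', |r| ≤ r₀ → |r'| ≤ r₀ →
      |P.shift n ρ r θ τ - P.shift n ρ r' θ' τ| ≤
        min ε (1 / 4) * |r - r'| + min ε (1 / 4) * |θ - θ'|) ∧
      ∀ r r' θ θ', |r| ≤ r₀ → |r'| ≤ r₀ → |P.shift n ψ r θ τ - P.shift n ψ r' θ' τ| ≤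
        min ε (1 / 4) * |r - r'| + min ε (1 / 4) * |θ - θ'| := by
    intro τ hτ
    obtain ⟨-, -, -, e3⟩ := key τ hτ
    refine ⟨fun r r' θ θ' hr hr' => lipschitz_strip (g := fun r θ => P.shift n ρ r θ τ)
      (fun r θ h => ⟨(hasDerivAt_shift_fst hρ n r θ τ).differentiableAt, (e3 r θ h).2.2.1⟩)
      (fun r θ h => ⟨(hasDerivAt_shift_snd hρ n r θ τ).differentiableAt, (e3 r θ h).2.2.2.1⟩)
      hr hr' θ θ', fun r r' θ θ' hr hr' => lipschitz_strip (g := fun r θ => P.shift n ψ r θ τ)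
      (fun r θ h => ⟨(hasDerivAt_shift_fst hψ n r θ τ).differentiableAt, (e3 r θ h).2.2.2.2.1⟩)
      (fun r θ h => ⟨(hasDerivAt_shift_snd hψ n r θ τ).differentiableAt, (e3 r θ h).2.2.2.2.2⟩)
      hr hr' θ θ'⟩
  refine ⟨fun τ hτ r θ hr' => ?_, fun τ hτ r θ hr' => ?_, fun τ hτ => ?_, fun τ hτ R Ψ hR => ?_⟩
  · obtain ⟨-, e1, e2, e3⟩ := key τ hτ
    obtain ⟨d1, d2, d3, d4⟩ := hderiv τ hτ r θ
    obtain ⟨b1, b2, b3, b4, b5, b6⟩ := e3 r θ hr'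
    rw [d1, d2, d3, d4, Rn, Psin, e1, e2, add_sub_cancel_left, add_sub_cancel_left,
      add_sub_cancel_left, add_sub_cancel_left]
    exact ⟨b1.trans hle1, b2.trans hle1, b3.trans hle1, b4.trans hle1, b5.trans hle1, b6.trans hle1⟩
  · obtain ⟨-, -, -, e3⟩ := key τ hτ
    obtain ⟨d1, d2, d3, d4⟩ := hderiv τ hτ r θ
    obtain ⟨-, -, b3, b4, b5, b6⟩ := e3 r θ hr'
    rw [d1, d2, d3, d4]
    have b3 := abs_le.1 (b3.trans hle2)
    have b6 := abs_le.1 (b6.trans hle2)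
    have b45 := mul_le_mul (b4.trans hle2) (b5.trans hle2) (abs_nonneg _) (by norm_num)
    rw [← abs_mul] at b45
    have b45 := (abs_le.1 b45).2
    nlinarith [b3.1, b6.1]
  · obtain ⟨-, e1, e2, -⟩ := key τ hτ
    unfold Rn Psin
    simp only [e1, e2]
    exact injOn_strip (by linarith) (hlip τ hτ).1 (hlip τ hτ).2
  · obtain ⟨-, e1, e2, e3⟩ := key τ hτ
    unfold Rn Psin
    simp only [e1, e2]
    exact exists_preimage_strip (g := fun r θ => P.shift n ρ r θ τ) (k := fun r θ => P.shift n ψ r θ τ)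
      hα.le (by linarith) (hlip τ hτ).1 (hlip τ hτ).2
      (fun r θ h => (e3 r θ h).1.trans hle1) hR (by linarith)

end NearIdentity

end ChirpedSystem

namespace ChirpedSystem

variable {P : ChirpedSystem} {ϰ : ℕ}

/-! ### The averaged system -/

section Remainder

variable {cA cB ρ ψ c γ : ℕ → ℝ → ℝ → ℝ → ℝ} {Γ : ℕ → ℝ → ℝ → ℝ} {a b f : ℝ → ℝ → ℝ → ℝ}

/-- The averaged right-hand side without remainder. -/
def averagedRate (P : ChirpedSystem) (n : ℕ) (Γ : ℕ → ℝ → ℝ → ℝ) (R Ψ τ : ℝ) : ℝ :=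
  ∑ K ∈ Finset.range (n + 1), τ ^ (-((P.M : ℝ) + K) / P.N) * Γ K R Ψ

/-- The remainder of the averaged system as a function of `(r, θ, τ)`: `f` is the right-hand side of
the equation that is averaged, `a` and `b` are those of the equations for `r` and `θ`. -/
def averagedRemainder (P : ChirpedSystem) (n : ℕ) (ρ ψ γ : ℕ → ℝ → ℝ → ℝ → ℝ)
    (Γ : ℕ → ℝ → ℝ → ℝ) (a b f : ℝ → ℝ → ℝ → ℝ) (r θ τ : ℝ) : ℝ :=
  P.epsOf τ ^ P.M * f r θ τ
  + P.shiftRate n γ (P.epsOf τ ^ P.M * a r θ τ) (P.epsOf τ ^ P.M * b r θ τ) r θ τ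
  - P.averagedRate n Γ (P.Rn n ρ r θ τ) (P.Psin n ψ r θ τ) τ

/-- Replacing 𝒜 and ℬ by their truncated expansions turns the remainder into the defect; what is
left are the truncation errors, those of r' and θ' being multiplied by derivatives of the
displacement. -/
theorem averagedRemainder_eq {τ : ℝ} (hτ : 0 < τ) (n : ℕ) (r θ : ℝ) :
    P.averagedRemainder n ρ ψ γ Γ a b f r θ τ = P.epsOf τ ^ P.M *
      (P.defect n cA cB ρ ψ c γ Γ (P.epsOf τ) r θ (P.zeta τ) +
      (f r θ τ - ∑ i ∈ Finset.range (n + 1), P.epsOf τ ^ i * c i r θ (P.zeta τ)) +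
      ((a r θ τ - ∑ i ∈ Finset.range (n + 1), P.epsOf τ ^ i * cA i r θ (P.zeta τ)) *
        P.shift n (fun K r θ ζ => deriv (fun r' => γ K r' θ ζ) r) r θ τ +
      (b r θ τ - ∑ i ∈ Finset.range (n + 1), P.epsOf τ ^ i * cB i r θ (P.zeta τ)) *
        P.shift n (fun K r θ ζ => deriv (fun θ' => γ K r θ' ζ) θ) r θ τ)) := by
  have h1 : ∀ σ : ℕ → ℝ → ℝ → ℝ → ℝ, P.shift n σ r θ τ = P.epsOf τ ^ P.M *
      ∑ K ∈ Finset.range (n + 1), P.epsOf τ ^ K * σ K r θ (P.zeta τ) := fun σ => by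
    rw [shift, Finset.mul_sum]
    exact Finset.sum_congr rfl fun K _ => by rw [pow_add, mul_assoc]
  have h2 : P.averagedRate n Γ (P.Rn n ρ r θ τ) (P.Psin n ψ r θ τ) τ = P.epsOf τ ^ P.M *
      ∑ j ∈ Finset.range (n + 1), P.epsOf τ ^ j * Γ j
        (r + ∑ k ∈ Finset.range (n + 1), P.epsOf τ ^ (P.M + k) * ρ k r θ (P.zeta τ))
        (θ + ∑ k ∈ Finset.range (n + 1), P.epsOf τ ^ (P.M + k) * ψ k r θ (P.zeta τ)) := by
    rw [averagedRate, Rn, Psin, nearId_eq hτ, nearId_eq hτ, Finset.mul_sum]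
    exact Finset.sum_congr rfl fun K _ => by rw [rpow_M_add hτ, pow_add, mul_assoc]; rfl
  have h3 : (∑ i ∈ Finset.range (n + 1), ∑ j ∈ Finset.range (n + 1), P.epsOf τ ^ (i + j + P.M) *
      (cA i r θ (P.zeta τ) * deriv (fun r' => γ j r' θ (P.zeta τ)) r +
        cB i r θ (P.zeta τ) * deriv (fun θ' => γ j r θ' (P.zeta τ)) θ)) =
      (∑ i ∈ Finset.range (n + 1), P.epsOf τ ^ i * cA i r θ (P.zeta τ)) *
        P.shift n (fun K r θ ζ => deriv (fun r' => γ K r' θ ζ) r) r θ τ +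
      (∑ i ∈ Finset.range (n + 1), P.epsOf τ ^ i * cB i r θ (P.zeta τ)) *
        P.shift n (fun K r θ ζ => deriv (fun θ' => γ K r θ' ζ) θ) r θ τ := by
    unfold shift
    rw [Finset.sum_mul_sum, Finset.sum_mul_sum, ← Finset.sum_add_distrib]
    refine Finset.sum_congr rfl fun i _ => ?_
    rw [← Finset.sum_add_distrib]
    refine Finset.sum_congr rfl fun j _ => by ring
  have h4 : (∑ j ∈ Finset.range (n + 1), P.epsOf τ ^ (j + P.N) *
      (((P.M : ℝ) + j) / P.N * γ j r θ (P.zeta τ))) = P.epsOf τ ^ P.N *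
      ∑ j ∈ Finset.range (n + 1), P.epsOf τ ^ j * (((P.M : ℝ) + j) / P.N * γ j r θ (P.zeta τ)) := by
    rw [Finset.mul_sum]
    exact Finset.sum_congr rfl fun K _ => by ring
  unfold averagedRemainder defect shiftRate
  rw [h2, h3, h4, h1 fun K r θ ζ => P.vartheta * deriv (fun ζ' => γ K r θ ζ') ζ,
    h1 fun K r θ ζ => ((P.M : ℝ) + K) / P.N * γ K r θ ζ]
  ring

theorem Expands.exists_bound (h : P.Expands f c) (n : ℕ) {r₀ : ℝ} (hr₀ : 0 < r₀) :
    ∃ C τ' : ℝ, 0 ≤ C ∧ 0 < τ' ∧ ∀ τ, τ' ≤ τ → ∀ r θ, |r| ≤ r₀ →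
      |f r θ τ - ∑ i ∈ Finset.range (n + 1), P.epsOf τ ^ i * c i r θ (P.zeta τ)|
        ≤ C * P.epsOf τ ^ (n + 1) := by
  obtain ⟨C, τ', hτ', h1⟩ := h n r₀ hr₀
  refine ⟨|C|, τ', abs_nonneg _, hτ', fun τ hτ r θ hr => ?_⟩
  have hτ0 := hτ'.trans_le hτ
  have h2 := h1 τ hτ r θ hr
  have h3 : τ ^ (-((n : ℝ) + 1) / P.N) = P.epsOf τ ^ (n + 1) := by
    rw [epsOf_pow hτ0]
    push_cast
    rfl
  rw [h3] at h2
  simp only [epsOf_pow hτ0 (_ : ℕ)] at h2 ⊢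
  exact h2.trans (mul_le_mul_of_nonneg_right (le_abs_self C) (Real.rpow_nonneg hτ0.le _))

/-- The defect and the truncation errors are O(ε^(n+1)), the derivatives of the displacement are
eventually at most 1, and the common factor ε^M gives the stated power of τ. -/
theorem exists_averagedRemainder_bound (hP : P.Standing) (hr : P.Resonance) (hϰ : 0 < ϰ)
    (hA : ∀ j, SmoothPeriodic ϰ (cA j)) (hB : ∀ j, SmoothPeriodic ϰ (cB j))
    (hc : ∀ j, SmoothPeriodic ϰ (c j)) (hρ : ∀ j, SmoothPeriodic ϰ (ρ j))
    (hψ : ∀ j, SmoothPeriodic ϰ (ψ j)) (h : P.AveragingChain ϰ cA cB ρ ψ c γ Γ)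
    (ha : P.Expands a cA) (hb : P.Expands b cB) (hf : P.Expands f c) (n : ℕ) {r₀ : ℝ}
    (hr₀ : 0 < r₀) :
    ∃ C τ' : ℝ, 0 ≤ C ∧ 0 < τ' ∧ ∀ τ, τ' ≤ τ → ∀ r θ, |r| ≤ r₀ →
      |P.averagedRemainder n ρ ψ γ Γ a b f r θ τ| ≤ C * τ ^ (-((P.M : ℝ) + n + 1) / P.N) := by
  obtain ⟨C, hC, h1⟩ := exists_defect_bound (P.M_eq hP hr).1 hϰ hA hB hc hρ hψ h n r₀
  obtain ⟨Ca, τa, hCa, -, h2⟩ := ha.exists_bound n hr₀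
  obtain ⟨Cb, τb, hCb, -, h3⟩ := hb.exists_bound n hr₀
  obtain ⟨Cf, τf, hCf, -, h4⟩ := hf.exists_bound n hr₀
  obtain ⟨τ₁, h5⟩ := eventually_shift_le hP hr hϰ (fun K => (h.smoothPeriodic K).deriv_one) n r₀
    one_pos
  obtain ⟨τ₂, h6⟩ := eventually_shift_le hP hr hϰ (fun K => (h.smoothPeriodic K).deriv_two) n r₀
    one_pos
  obtain ⟨τ', hτ'⟩ := eventually_atTop.1 (((((eventually_ge_atTop τ₁).and (eventually_ge_atTop τ₂)).and
    (eventually_ge_atTop τa)).and (eventually_ge_atTop τb)).and (eventually_ge_atTop τf))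
  refine ⟨C + Cf + (Ca + Cb), max τ' 1, by positivity, lt_max_of_lt_right one_pos,
    fun τ hτ r θ hr' => ?_⟩
  obtain ⟨⟨⟨⟨e1, e2⟩, e3⟩, e4⟩, e5⟩ := hτ' τ (le_of_max_le_left hτ)
  have hτ1 := le_of_max_le_right hτ
  have hτ0 : 0 < τ := by linarith
  have hε := epsOf_pos (P := P) hτ0
  have b1 := h1 (P.epsOf τ) r θ (P.zeta τ) (by rw [abs_of_pos hε]; exact epsOf_le_one hτ1) hr'
  rw [abs_of_pos hε] at b1
  have b2 := h2 τ e3 r θ hr'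
  have b3 := h3 τ e4 r θ hr'
  have b4 := h4 τ e5 r θ hr'
  have b5 := h5 τ e1 r θ hr'
  have b6 := h6 τ e2 r θ hr'
  have hpow : τ ^ (-((P.M : ℝ) + n + 1) / P.N) = P.epsOf τ ^ P.M * P.epsOf τ ^ (n + 1) := by
    rw [← pow_add, epsOf_pow hτ0]
    push_cast
    rw [add_assoc]
  rw [averagedRemainder_eq (cA := cA) (cB := cB) (c := c) hτ0, hpow, abs_mul,
    abs_of_pos (pow_pos hε _), mul_left_comm]
  refine mul_le_mul_of_nonneg_left ?_ (pow_pos hε _).le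
  have b7 := mul_le_mul b2 b5 (abs_nonneg _) ((abs_nonneg _).trans b2)
  have b8 := mul_le_mul b3 b6 (abs_nonneg _) ((abs_nonneg _).trans b3)
  rw [← abs_mul, mul_one] at b7 b8
  refine (abs_add_le _ _).trans ((add_le_add ((abs_add_le _ _).trans (add_le_add b1 b4))
    ((abs_add_le _ _).trans (add_le_add b7 b8))).trans (le_of_eq ?_))
  ring

end Remainder

/-- The value at the preimage under the near-identity transformation. -/
def transport (P : ChirpedSystem) (n : ℕ) (ρ ψ : ℕ → ℝ → ℝ → ℝ → ℝ) (r₀ : ℝ) (f : ℝ → ℝ → ℝ → ℝ)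
    (R Ψ τ : ℝ) : ℝ :=
  let z := Function.invFunOn
    (fun z : ℝ × ℝ => (P.Rn n ρ z.1 z.2 τ, P.Psin n ψ z.1 z.2 τ)) {z | |z.1| ≤ r₀} (R, Ψ)
  f z.1 z.2 τ

theorem transport_eq {n : ℕ} {ρ ψ : ℕ → ℝ → ℝ → ℝ → ℝ} {r₀ τ : ℝ} (f : ℝ → ℝ → ℝ → ℝ)
    (h : Set.InjOn (fun z : ℝ × ℝ => (P.Rn n ρ z.1 z.2 τ, P.Psin n ψ z.1 z.2 τ)) {z | |z.1| ≤ r₀})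
    {r θ : ℝ} (hr : |r| ≤ r₀) :
    P.transport n ρ ψ r₀ f (P.Rn n ρ r θ τ) (P.Psin n ψ r θ τ) τ = f r θ τ := by
  have h1 := h.leftInvOn_invFunOn (show (r, θ) ∈ {z : ℝ × ℝ | |z.1| ≤ r₀} from hr)
  unfold transport
  dsimp only at h1 ⊢
  rw [h1]

/-- The remainder is defined as whatever makes the chain rule an identity, so one direction is
immediate. Conversely the equations for R' and Ψ' are linear in (r', θ') with the positive Jacobian
as determinant, so they determine the rates. -/
theorem solvesAmplitude_iff_solvesAveraged (hP : P.Standing) {ρ ψ : ℕ → ℝ → ℝ → ℝ → ℝ}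
    (hρ : ∀ K, SmoothPeriodic ϰ (ρ K)) (hψ : ∀ K, SmoothPeriodic ϰ (ψ K)) {n : ℕ} {r₀ ε τ₀ τ : ℝ}
    (h : P.NearIdentity n ρ ψ r₀ ε τ₀) (hτ : τ₀ < τ) (hτ0 : 0 < τ) {X Y : ℝ → ℝ → ℝ} {Istar : ℝ → ℝ}
    (Λ Ω : ℕ → ℝ → ℝ → ℝ) {r θ : ℝ → ℝ} (hr₀ : |r τ| ≤ r₀) (hr : DifferentiableAt ℝ r τ)
    (hθ : DifferentiableAt ℝ θ τ) :
    P.SolvesAmplitude ϰ X Y Istar r θ τ ↔ P.SolvesAveraged n Λ Ω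
      (P.transport n ρ ψ r₀ (P.averagedRemainder n ρ ψ ρ Λ (P.calA ϰ X Y Istar)
        (P.calB ϰ X Y Istar) (P.calA ϰ X Y Istar)))
      (P.transport n ρ ψ r₀ (P.averagedRemainder n ρ ψ ψ Ω (P.calA ϰ X Y Istar)
        (P.calB ϰ X Y Istar) (P.calB ϰ X Y Istar)))
      (fun τ => P.Rn n ρ (r τ) (θ τ) τ) (fun τ => P.Psin n ψ (r τ) (θ τ) τ) τ := by
  have hpow : τ ^ (-(P.M : ℝ) / P.N) = P.epsOf τ ^ P.M := (epsOf_pow hτ0 _).symm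
  have h1 := hasDerivAt_nearId hP hρ n hτ0 hr.hasDerivAt hr.hasDerivAt hθ.hasDerivAt
  have h2 := hasDerivAt_nearId hP hψ n hτ0 hθ.hasDerivAt hr.hasDerivAt hθ.hasDerivAt
  have hinj := h.inj τ hτ
  have hjac := h.jacobian τ hτ (r τ) (θ τ) hr₀
  have d1 : deriv (fun r' => P.Rn n ρ r' (θ τ) τ) (r τ) =
      1 + P.shift n (fun K r θ ζ => deriv (fun r' => ρ K r' θ ζ) r) (r τ) (θ τ) τ := by
    unfold Rn
    simp only [nearId_eq hτ0]
    exact ((hasDerivAt_id _).add (hasDerivAt_shift_fst hρ n _ _ τ)).deriv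
  have d2 : deriv (fun θ' => P.Rn n ρ (r τ) θ' τ) (θ τ) =
      P.shift n (fun K r θ ζ => deriv (fun θ' => ρ K r θ' ζ) θ) (r τ) (θ τ) τ := by
    unfold Rn
    simp only [nearId_eq hτ0]
    exact ((hasDerivAt_shift_snd hρ n _ _ τ).const_add _).deriv
  have d3 : deriv (fun r' => P.Psin n ψ r' (θ τ) τ) (r τ) =
      P.shift n (fun K r θ ζ => deriv (fun r' => ψ K r' θ ζ) r) (r τ) (θ τ) τ := by
    unfold Psin
    simp only [nearId_eq hτ0]
    exact ((hasDerivAt_shift_fst hψ n _ _ τ).const_add _).deriv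
  have d4 : deriv (fun θ' => P.Psin n ψ (r τ) θ' τ) (θ τ) =
      1 + P.shift n (fun K r θ ζ => deriv (fun θ' => ψ K r θ' ζ) θ) (r τ) (θ τ) τ := by
    unfold Psin
    simp only [nearId_eq hτ0]
    exact ((hasDerivAt_id _).add (hasDerivAt_shift_snd hψ n _ _ τ)).deriv
  rw [d1, d2, d3, d4] at hjac
  unfold SolvesAveraged SolvesAmplitude
  dsimp only
  rw [transport_eq _ hinj hr₀, transport_eq _ hinj hr₀, hpow]
  change _ ↔ HasDerivAt (fun τ => P.nearId n ρ (r τ) (r τ) (θ τ) τ)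
      (P.averagedRate n Λ (P.Rn n ρ (r τ) (θ τ) τ) (P.Psin n ψ (r τ) (θ τ) τ) τ + _) τ ∧
    HasDerivAt (fun τ => P.nearId n ψ (θ τ) (r τ) (θ τ) τ)
      (P.averagedRate n Ω (P.Rn n ρ (r τ) (θ τ) τ) (P.Psin n ψ (r τ) (θ τ) τ) τ + _) τ
  unfold averagedRemainder
  rw [add_sub_cancel, add_sub_cancel]
  generalize P.calA ϰ X Y Istar (r τ) (θ τ) τ = a
  generalize P.calB ϰ X Y Istar (r τ) (θ τ) τ = b
  constructor
  · rintro ⟨h3, h4⟩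
    rw [h3.deriv, h4.deriv] at h1 h2
    exact ⟨h1, h2⟩
  · rintro ⟨h3, h4⟩
    have e1 := h1.unique h3
    have e2 := h2.unique h4
    unfold shiftRate at e1 e2
    set r' := deriv r τ
    set θ' := deriv θ τ
    set j1 := P.shift n (fun K r θ ζ => deriv (fun r' => ρ K r' θ ζ) r) (r τ) (θ τ) τ
    set j2 := P.shift n (fun K r θ ζ => deriv (fun θ' => ρ K r θ' ζ) θ) (r τ) (θ τ) τ
    set j3 := P.shift n (fun K r θ ζ => deriv (fun r' => ψ K r' θ ζ) r) (r τ) (θ τ) τ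
    set j4 := P.shift n (fun K r θ ζ => deriv (fun θ' => ψ K r θ' ζ) θ) (r τ) (θ τ) τ
    -- Cramer's rule for the deviations of r' and θ' from their prescribed values.
    have e3 : (r' - P.epsOf τ ^ P.M * a) * ((1 + j1) * (1 + j4) - j2 * j3) = 0 := by
      linear_combination (1 + j4) * e1 - j2 * e2
    have e4 : (θ' - P.epsOf τ ^ P.M * b) * ((1 + j1) * (1 + j4) - j2 * j3) = 0 := by
      linear_combination (1 + j1) * e2 - j3 * e1
    have e5 := (mul_eq_zero.1 e3).resolve_right hjac.ne'
    have e6 := (mul_eq_zero.1 e4).resolve_right hjac.ne'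
    rw [sub_eq_zero] at e5 e6
    rw [← e5, ← e6]
    exact ⟨hr.hasDerivAt, hθ.hasDerivAt⟩

end ChirpedSystem

/-! ### Assembly of the averaged form -/

namespace ChirpedSystem

variable {P : ChirpedSystem} {ϰ : ℕ}

theorem exists_energy_gt (hr : P.Resonance) {Istar : ℝ → ℝ} (hI : Tendsto Istar atTop atTop)
    {E₁ : ℝ} (hE₁ : 0 < E₁) (r₀ : ℝ) : ∃ T : ℝ, ∀ t, T ≤ t → ∀ r, |r| ≤ r₀ →
      0 < 1 + t ^ (-P.mu) * r ∧ E₁ < Istar t * (1 + t ^ (-P.mu) * r) ^ (2 * P.h) := by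
  have h1 : Tendsto (fun t : ℝ => t ^ (-P.mu) * |r₀|) atTop (𝓝 0) := by
    have := (tendsto_rpow_neg_atTop hr.mu_pos).mul_const |r₀|
    rwa [zero_mul] at this
  -- Once |t^(-μ) r| ≤ 1/2, the factor (1 + t^(-μ) r)^(2h) can reduce I⋆ by at most 2^(2h), so I⋆ is
  -- required to exceed E₁ by that factor.
  obtain ⟨T, hT⟩ := eventually_atTop.1 (((h1.eventually (ge_mem_nhds one_half_pos)).and
    (hI.eventually_gt_atTop (E₁ * 2 ^ (2 * P.h)))).and (eventually_gt_atTop 0))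
  refine ⟨T, fun t ht r hr => ?_⟩
  obtain ⟨⟨h2, h3⟩, h4⟩ := hT t ht
  have h5 : |t ^ (-P.mu) * r| ≤ 1 / 2 := by
    rw [abs_mul, abs_of_nonneg (Real.rpow_nonneg h4.le _)]
    exact (mul_le_mul_of_nonneg_left (hr.trans (le_abs_self _)) (Real.rpow_nonneg h4.le _)).trans h2
  have h6 : 1 / 2 ≤ 1 + t ^ (-P.mu) * r := by linarith [(abs_le.1 h5).1]
  refine ⟨by linarith, ?_⟩
  have h7 := pow_le_pow_left₀ (by norm_num : (0 : ℝ) ≤ 1 / 2) h6 (2 * P.h)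
  have h8 : 0 < Istar t := lt_trans (by positivity) h3
  calc E₁ = E₁ * 2 ^ (2 * P.h) * (1 / 2) ^ (2 * P.h) := by
        rw [mul_assoc, ← mul_pow]
        norm_num
    _ < Istar t * (1 / 2) ^ (2 * P.h) := mul_lt_mul_of_pos_right h3 (by positivity)
    _ ≤ _ := mul_le_mul_of_nonneg_left h7 h8.le

theorem le_tau (hP : P.Standing) {τ t : ℝ} (hτ : 0 < τ) (h : P.time τ ≤ t) : τ ≤ P.tau t := by
  rw [← tau_time hP hτ]
  exact div_le_div_of_nonneg_right
    (Real.rpow_le_rpow (time_pos hP hτ).le h hP.nu_pos.le) hP.nu_pos.le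

theorem exists_averaged_form (hP : P.Standing) (hr : P.Resonance) (hϰ : 0 < ϰ) {E₀ E₁ t₁ : ℝ}
    {X Y : ℝ → ℝ → ℝ} {Istar : ℝ → ℝ} (hX : P.IsEnergyAngle E₀ X Y)
    (hXY : P.EnergyAngleChange E₀ X Y) (hE₀ : 0 < E₀) (hE : E₀ ≤ E₁) (ht₁ : 0 < t₁)
    (hI : P.IsResonantEnergy ϰ E₁ t₁ Istar) (hItop : Tendsto Istar atTop atTop)
    {cA cB ρ ψ : ℕ → ℝ → ℝ → ℝ → ℝ} {Λ Ω : ℕ → ℝ → ℝ → ℝ}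
    (hA : ∀ K, SmoothPeriodic ϰ (cA K)) (hB : ∀ K, SmoothPeriodic ϰ (cB K))
    (hAe : P.Expands (P.calA ϰ X Y Istar) cA) (hBe : P.Expands (P.calB ϰ X Y Istar) cB)
    (hAc : P.AveragingChain ϰ cA cB ρ ψ cA ρ Λ) (hBc : P.AveragingChain ϰ cA cB ρ ψ cB ψ Ω)
    (n : ℕ) {r₀ ε : ℝ} (hε : 0 < ε) (hr₀ : ε < r₀) :
    ∃ (t₀ C : ℝ) (Λt Ωt : ℝ → ℝ → ℝ → ℝ), t₁ ≤ t₀ ∧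
      P.NearIdentity n ρ ψ r₀ ε (P.tau t₀) ∧
      (∀ τ, P.tau t₀ < τ → ∀ r θ : ℝ, |r| ≤ r₀ →
        |Λt (P.Rn n ρ r θ τ) (P.Psin n ψ r θ τ) τ| ≤ C * τ ^ (-((P.M : ℝ) + n + 1) / P.N) ∧
        |Ωt (P.Rn n ρ r θ τ) (P.Psin n ψ r θ τ) τ| ≤ C * τ ^ (-((P.M : ℝ) + n + 1) / P.N)) ∧
      ∀ (r θ : ℝ → ℝ) (t : ℝ), t₀ < t → |r (P.tau t)| ≤ r₀ →
        DifferentiableAt ℝ r (P.tau t) → DifferentiableAt ℝ θ (P.tau t) →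
        (P.original ϰ X Istar r θ t, P.original ϰ Y Istar r θ t) ∈ P.D E₁ ∧
        (P.SolvesFull (P.original ϰ X Istar r θ) (P.original ϰ Y Istar r θ) t ↔
          P.SolvesAveraged n Λ Ω Λt Ωt
            (fun τ => P.Rn n ρ (r τ) (θ τ) τ) (fun τ => P.Psin n ψ (r τ) (θ τ) τ) (P.tau t)) := by
  have hr₀' : 0 < r₀ := hε.trans hr₀
  have hρ := hAc.smoothPeriodic
  have hψ := hBc.smoothPeriodic
  obtain ⟨τ₁, hτ₁, hnear⟩ := exists_nearIdentity hP hr hϰ hρ hψ n hε hr₀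
  obtain ⟨C₁, τ₂, hC₁, -, h1⟩ :=
    exists_averagedRemainder_bound hP hr hϰ hA hB hA hρ hψ hAc hAe hBe hAe n hr₀'
  obtain ⟨C₂, τ₃, hC₂, -, h2⟩ :=
    exists_averagedRemainder_bound hP hr hϰ hA hB hB hρ hψ hBc hAe hBe hBe n hr₀'
  obtain ⟨T, hT⟩ := exists_energy_gt hr hItop (hE₀.trans_le hE) r₀
  have hτ' : 0 < max τ₁ (max τ₂ τ₃) := lt_max_of_lt_left hτ₁
  -- One time after which the energy bound, the near-identity property and both remainder estimates
  -- hold on |r| ≤ r₀.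
  let t₀ := max t₁ (max T (P.time (max τ₁ (max τ₂ τ₃))))
  have ht₀ : t₁ ≤ t₀ := le_max_left _ _
  have hTt₀ : T ≤ t₀ := (le_max_left _ _).trans (le_max_right _ _)
  have hτt₀ : max τ₁ (max τ₂ τ₃) ≤ P.tau t₀ :=
    le_tau hP hτ' ((le_max_right _ _).trans (le_max_right _ _))
  have hnear' := hnear _ ((le_max_left _ _).trans hτt₀)
  refine ⟨t₀, C₁ + C₂, P.transport n ρ ψ r₀ (P.averagedRemainder n ρ ψ ρ Λ (P.calA ϰ X Y Istar)
        (P.calB ϰ X Y Istar) (P.calA ϰ X Y Istar)),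
      P.transport n ρ ψ r₀ (P.averagedRemainder n ρ ψ ψ Ω (P.calA ϰ X Y Istar)
        (P.calB ϰ X Y Istar) (P.calB ϰ X Y Istar)), ht₀, hnear', fun τ hτ r θ hr' => ?_,
      fun r θ t ht hr' hrd hθd => ?_⟩
  · have hτ2 := hτt₀.trans hτ.le
    have hτ0 := hτ'.trans_le hτ2
    have e1 := h1 τ (((le_max_left _ _).trans (le_max_right _ _)).trans hτ2) r θ hr'
    have e2 := h2 τ (((le_max_right _ _).trans (le_max_right _ _)).trans hτ2) r θ hr'
    have e3 := Real.rpow_nonneg hτ0.le (-((P.M : ℝ) + n + 1) / P.N)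
    rw [transport_eq _ (hnear'.inj τ hτ) hr', transport_eq _ (hnear'.inj τ hτ) hr', add_mul]
    have := mul_nonneg hC₁ e3
    have := mul_nonneg hC₂ e3
    exact ⟨by linarith, by linarith⟩
  · have ht₁' := ht₀.trans_lt ht
    have ht0 := ht₁.trans ht₁'
    obtain ⟨hw, hen⟩ := hT t (hTt₀.trans ht.le) _ hr'
    have hen' : E₁ < P.energyOf Istar r t := hen
    refine ⟨?_, ?_⟩
    · change E₁ < P.H (X _ _) (Y _ _)
      rwa [hXY.energy _ _ (hE.trans_lt hen')]
    · rw [solvesFull_iff_solvesAmplitude hP hX hXY hE₀ hE ht₁ hI r θ t ht₁' hw hen' hrd hθd]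
      exact solvesAmplitude_iff_solvesAveraged hP hρ hψ hnear'
        (tau_lt_tau hP (ht₁.le.trans ht₀) ht) (tau_pos hP ht0) Λ Ω hr' hrd hθd

end ChirpedSystem

end

theorem mainTheorem2 (P : ChirpedSystem) (hP : P.Standing) (hfg : P.PowerLaw)
    (hrc : P.Resonance) (ϰ : ℕ) (hϰ : 0 < ϰ) :
    (∃ E₀ E₁ : ℝ, P.EnergyLevels E₀ E₁) ∧
    ∀ E₀ E₁ : ℝ, P.EnergyLevels E₀ E₁ →
    -- the energy-angle variables, and the system in these variables
    ∃ X Y : ℝ → ℝ → ℝ, P.IsEnergyAngle E₀ X Y ∧ P.EnergyAngleChange E₀ X Y ∧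
      (∀ (I φ : ℝ → ℝ) (t : ℝ), 0 < t → E₀ < I t → DifferentiableAt ℝ I t →
        DifferentiableAt ℝ φ t →
        (P.SolvesFull (fun t' => X (φ t') (I t')) (fun t' => Y (φ t') (I t')) t ↔
          P.SolvesEnergyAngle X Y I φ t)) ∧
    -- the amplitude and the phase difference, and the system in these variables
    ∃ (t₁ : ℝ) (Istar : ℝ → ℝ), 0 < t₁ ∧ P.IsResonantEnergy ϰ E₁ t₁ Istar ∧
      (∀ J : Set ℝ, IsOpen J → J.OrdConnected → J ⊆ Set.Ioi t₁ → ∀ x y : ℝ → ℝ,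
        (∀ t ∈ J, P.SolvesFull x y t ∧ (x t, y t) ∈ P.D E₁) →
        ∃ r θ : ℝ → ℝ, ∀ t ∈ J, 0 < 1 + t ^ (-P.mu) * r (P.tau t) ∧
          DifferentiableAt ℝ r (P.tau t) ∧ DifferentiableAt ℝ θ (P.tau t) ∧
          x t = P.original ϰ X Istar r θ t ∧ y t = P.original ϰ Y Istar r θ t) ∧
      (∀ (r θ : ℝ → ℝ) (t : ℝ), t₁ < t → 0 < 1 + t ^ (-P.mu) * r (P.tau t) →
        E₁ < P.energyOf Istar r t →
        DifferentiableAt ℝ r (P.tau t) → DifferentiableAt ℝ θ (P.tau t) →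
        (P.SolvesFull (P.original ϰ X Istar r θ) (P.original ϰ Y Istar r θ) t ↔
          P.SolvesAmplitude ϰ X Y Istar r θ (P.tau t))) ∧
    -- the coefficients of the averaging transformation and of the averaged system
    ∃ cA cB ρ ψ : ℕ → ℝ → ℝ → ℝ → ℝ, ∃ Λ Ω : ℕ → ℝ → ℝ → ℝ,
      (∀ K, ChirpedSystem.SmoothPeriodic ϰ (cA K) ∧ ChirpedSystem.SmoothPeriodic ϰ (cB K)) ∧
      P.Expands (P.calA ϰ X Y Istar) cA ∧ P.Expands (P.calB ϰ X Y Istar) cB ∧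
      P.AveragingChain ϰ cA cB ρ ψ cA ρ Λ ∧ P.AveragingChain ϰ cA cB ρ ψ cB ψ Ω ∧
    -- the averaged form
    ∀ (n : ℕ) (r₀ ε : ℝ), 0 < ε → ε < r₀ →
    ∃ (t₀ C : ℝ) (Λt Ωt : ℝ → ℝ → ℝ → ℝ), t₁ ≤ t₀ ∧
      P.NearIdentity n ρ ψ r₀ ε (P.tau t₀) ∧
      (∀ τ, P.tau t₀ < τ → ∀ r θ : ℝ, |r| ≤ r₀ →
        |Λt (P.Rn n ρ r θ τ) (P.Psin n ψ r θ τ) τ| ≤ C * τ ^ (-((P.M : ℝ) + n + 1) / P.N) ∧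
        |Ωt (P.Rn n ρ r θ τ) (P.Psin n ψ r θ τ) τ| ≤ C * τ ^ (-((P.M : ℝ) + n + 1) / P.N)) ∧
      ∀ (r θ : ℝ → ℝ) (t : ℝ), t₀ < t → |r (P.tau t)| ≤ r₀ →
        DifferentiableAt ℝ r (P.tau t) → DifferentiableAt ℝ θ (P.tau t) →
        (P.original ϰ X Istar r θ t, P.original ϰ Y Istar r θ t) ∈ P.D E₁ ∧
        (P.SolvesFull (P.original ϰ X Istar r θ) (P.original ϰ Y Istar r θ) t ↔
          P.SolvesAveraged n Λ Ω Λt Ωt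
            (fun τ => P.Rn n ρ (r τ) (θ τ) τ) (fun τ => P.Psin n ψ (r τ) (θ τ) τ) (P.tau t)) := by
  have hh := hP.two_le_h
  refine ⟨ChirpedSystem.exists_energyLevels hh, fun E₀ E₁ hE => ?_⟩
  obtain ⟨hreg, hE₁, -⟩ := hE
  have hE₀ := hreg.1
  -- A critical point of U above E₀ would be an equilibrium on its level line with y = 0, so
  -- regularity of the level lines supplies the hypothesis of the well construction.
  obtain ⟨W⟩ := ChirpedSystem.nonempty_wellFamily hh hE₀ fun x hx => hreg.deriv_U_ne hx
  have hX := ChirpedSystem.isEnergyAngle_ea W hh hE₀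
  have hXY := ChirpedSystem.energyAngleChange_ea W hh hE₀
  obtain ⟨e, δ, he⟩ := ChirpedSystem.exists_resonantScale hP W hE₀ hϰ
  obtain ⟨t₁, ht₁, hI⟩ := he.exists_isResonantEnergy hP hE₀ E₁
  obtain ⟨w, d, hx⟩ := ChirpedSystem.exists_scaleExtension hP hrc hE₀ he
  obtain ⟨cA, hA, hAe⟩ := (hx.hasSeries_calA he hP hrc hfg hϰ).exists_expands hϰ
  obtain ⟨cB, hB, hBe⟩ := (hx.hasSeries_calB he hP hrc hfg hϰ hE₀).exists_expands hϰ
  obtain ⟨ρ, ψ, Λ, Ω, hAc, hBc⟩ := ChirpedSystem.exists_averagingChain hP hrc hϰ hA hB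
  refine ⟨ChirpedSystem.eaX W, ChirpedSystem.eaY W, hX, hXY, fun I φ t _ hIt hId hφd =>
    ChirpedSystem.solvesFull_iff_solvesEnergyAngle hX hXY I φ t hIt hId hφd,
    t₁, P.resonantEnergy e, ht₁, hI, fun J hJ hJc hJt x y h =>
      ChirpedSystem.exists_amplitude W hP hE₀ hE₁ ht₁ hI hJ hJc hJt h,
    fun r θ t ht hw hen hr hθ => ChirpedSystem.solvesFull_iff_solvesAmplitude hP hX hXY hE₀ hE₁ ht₁
      hI r θ t ht hw hen hr hθ,
    cA, cB, ρ, ψ, Λ, Ω, fun K => ⟨hA K, hB K⟩, hAe, hBe, hAc, hBc, fun n r₀ ε hε hr₀ =>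
      ChirpedSystem.exists_averaged_form hP hrc hϰ hX hXY hE₀ hE₁ ht₁ hI (he.tendsto_energy hP)
        hA hB hAe hBe hAc hBc n hε hr₀⟩
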